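/- **Setting.** Let $n>2$, let $\mathfrak g_{YM}$ be a finite-dimensional real Lie algebra (for instance a reductive one), $\mathfrak g=\mathfrak g_{YM}\oplus so(1,n-1)$ with basis $\delta_I$ and structure constants $f_{IJ}{}^K$ (the Lorentz part being spanned by $l_{ab}$, $a>b$), and let the bosonic and fermionic matter fields $y^m$ form bases of finite-dimensional real $\mathfrak g$-modules. The fields $\Phi^A$ are the vielbein $e_\mu{}^a$ (with $\det e>0$), the Yang–Mills fields $A_\mu{}^i$, the $y^m$, and the ghosts $\xi^\mu$, $C^I$; each has an antifield $\Phi^*_A$ of opposite parity and ghost number $-\mathrm{gh}(\Phi^A)-1$. Let $\mathcal A$ be the algebra of local functions, i.e. of (graded commutative) polynomials in all $\partial_{\mu_1\ldots\mu_k}\Phi^A,\ \partial_{\mu_1\ldots\mu_k}\Phi^*_A$ except the undifferentiated vielbein, with coefficients in $C^\infty(GL^+(n))$, the smooth functions of the undifferentiated vielbein. Let $\mathcal E=\Omega(\mathbb R^n)\otimes\mathcal A$ be the algebra of local forms, bigraded by ghost number $g$ and form degree $p$, with exterior derivative $d$. Let $L_0\in\mathcal A$ be a bosonic function of $e,A,y$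 and their derivatives whose integral is invariant under diffeomorphisms, local Lorentz and Yang–Mills transformations (its gauge variation is a total divergence). The BRST differential $s$ is the odd derivation with $s\partial_\mu=\partial_\mu s$, $s x^\mu=s\,dx^\mu=0$, $s\Phi^A=-\delta^RS/\delta\Phi^*_A$, $s\Phi^*_A=\delta^RS/\delta\Phi^A$, where $S=\int (L_0-(s\Phi^A)\Phi^*_A)$ and $$se_\mu{}^a=\xi^\nu\partial_\nu e_\mu{}^a+\partial_\mu\xi^\nu e_\nu{}^a+e_\mu{}^bC_b{}^a,\quad sA_\mu{}^i=\xi^\nu\partial_\nu A_\mu{}^i+\partial_\mu\xi^\nu A_\nu{}^i+\partial_\mu C^i+C^jA_\mu{}^kf_{kj}{}^i,$$ $$sy^m=\xi^\nu\partial_\nu y^m+C^I\delta_Iy^m,\quad s\xi^\mu=\xi^\nu\partial_\nu\xi^\mu,\quad sC^K=\xi^\nu\partial_\nu C^K-\tfrac12C^IC^Jf_{IJ}{}^K .$$ A *Wess–Zumino solution* of bidegree $(g,p)$ is $a\in\mathcal E^{g,p}$ with $sa+da'=0$ for some $a'\in\mathcal E^{g+1,p-1}$. It is *trivial* if $a=sb+dc$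 with $b\in\mathcal E^{g-1,p}$, $c\in\mathcal E^{g,p-1}$. It *generates a trivial descent* if some $a_0\in\mathcal E^{g,p}$ with $a-a_0$ trivial satisfies $sa_0=0$, and a *non-trivial descent* otherwise. Let $\{\alpha_m\}$ be homogeneous closed forms of degrees $k_m$ on $GL^+(n)$ representing a basis of $H^*_{DR}(GL^+(n))$, and let $\alpha_m^{k_m,0}(e,se)\in\mathcal A$ be obtained from $\alpha_m$ by replacing $e$ by $e_\mu{}^a$ and the differentials of the coordinates by $se_\mu{}^a$. Let $\mathcal A_2\subset\mathcal A$ be the subalgebra generated by $\hat\xi^a=\xi^\mu e_\mu{}^a$, by $\hat C^I=C^I+\xi^\mu A_\mu{}^I$ (for Lorentz indices $A_\mu{}^I$ is the spin connection $\omega_\mu{}^{ab}$ of the vielbein), and by all iterated covariant derivatives $D_{a_1}\cdots D_{a_r}$, $D_a=E_a{}^\mu(\partial_\mu-A_\mu{}^I\delta_I)$ with $E_a{}^\mu$ the inverse vielbein, of the matter fields $y^m$, the curvatures $F_{ab}{}^I=E_a{}^\mu E_b{}^\nu F_{\mu\nu}{}^I$ (Yang–Mills and Riemann), and the tensorial antifields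 $y^*_m/e$, $e_\mu{}^be^{*\mu}_a/e$, $e_\mu{}^aA^{*\mu}_i/e$, $C^*_I/e$, $E_a{}^\mu(\xi^*_\mu-A_\mu{}^IC^*_I)/e$, where here $e=\det(e_\mu{}^a)$. Let $\{P_A\}$ be elements of $\mathcal A_2$ of definite ghost numbers $g_A$ representing a basis of $H^*(s,\mathcal A_2)$. **Theorem.** Let $a\in\mathcal E^{g,p}$ be a non-trivial Wess–Zumino solution generating a trivial descent. 1. Every $a_0\in\mathcal E^{g,p}$ with $sa_0=0$ and $a-a_0$ trivial (in particular $a$ itself if $sa=0$) is of the form $$a_0=\sum_{m,A}\omega_{m,A}(x,dx)\,\alpha_m^{k_m,0}(e,se)\,P_A+sb,\qquad b\in\mathcal E^{g-1,p},$$ a finite sum over pairs with $k_m+g_A=g$, where the $\omega_{m,A}$ are $p$-forms on $\mathbb R^n$. 2. Up to a trivial solution the coefficient forms can all be taken non-exact: there are a non-empty finite set of pairs $(m,A)$ with $k_m+g_A=g$, non-exact $p$-forms $\omega_{m,A}$ on $\mathbb R^n$, and $b\in\mathcal E^{g-1,p}$, $c\in\mathcal E^{g,p-1}$ with $$a=\sum_{m,A}\omega_{m,A}\,\alpha_m^{k_m,0}\,P_A+sb+dc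 .$$ In particular, every non-trivial Wess–Zumino solution of form degree $p=n$ (volume form) generates a non-trivial descent. -/

import Mathlib

open scoped TensorProduct ContDiff

noncomputable section

namespace EYM

/-! ## Grassmann algebras -/

section GrassmannAlgebra

/-- The real Grassmann algebra on anticommuting generators `θ_i`, `i ∈ σ`. -/
def Grassmann (σ : Type*) : Type _ := ExteriorAlgebra ℝ (σ →₀ ℝ)

variable {σ : Type*}

instance : Ring (Grassmann σ) := inferInstanceAs (Ring (ExteriorAlgebra ℝ (σ →₀ ℝ)))
instance : Algebra ℝ (Grassmann σ) := inferInstanceAs (Algebra ℝ (ExteriorAlgebra ℝ (σ →₀ ℝ)))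

/-- The embedding of the span of the generators. -/
def Grassmann.lin : (σ →₀ ℝ) →ₗ[ℝ] Grassmann σ := ExteriorAlgebra.ι ℝ

/-- The generator `θ_i`. -/
def Grassmann.gen (i : σ) : Grassmann σ := Grassmann.lin (Finsupp.single i 1)

/-- The left derivative `∂^L/∂θ_i`. -/
def Grassmann.dL (i : σ) : Grassmann σ →ₗ[ℝ] Grassmann σ :=
  CliffordAlgebra.contractLeft (Q := (0 : QuadraticForm ℝ (σ →₀ ℝ))) (Finsupp.lapply i)

/-- The right derivative `∂^R/∂θ_i`. -/
def Grassmann.dR (i : σ) : Grassmann σ →ₗ[ℝ] Grassmann σ :=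
  CliffordAlgebra.contractRight (Q := (0 : QuadraticForm ℝ (σ →₀ ℝ))).flip (Finsupp.lapply i)

/-- The parity automorphism `θ_i ↦ -θ_i`. -/
def Grassmann.parity : Grassmann σ →ₐ[ℝ] Grassmann σ :=
  CliffordAlgebra.involute (Q := (0 : QuadraticForm ℝ (σ →₀ ℝ)))

/-- The homogeneous part of degree `k`. -/
def Grassmann.deg (σ : Type*) (k : ℕ) : Submodule ℝ (Grassmann σ) := ⋀[ℝ]^k (σ →₀ ℝ)

/-- The universal property: a linear map with `T(v)² = 0` extends to an algebra homomorphism. -/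
def Grassmann.lift {B : Type*} [Ring B] [Algebra ℝ B] (T : (σ →₀ ℝ) →ₗ[ℝ] B)
    (hT : ∀ v, T v * T v = 0) : Grassmann σ →ₐ[ℝ] B :=
  ExteriorAlgebra.lift ℝ ⟨T, hT⟩

theorem Grassmann.lin_add_mul_swap (v w : σ →₀ ℝ) :
    (Grassmann.lin v * Grassmann.lin w + Grassmann.lin w * Grassmann.lin v : Grassmann σ) = 0 :=
  ExteriorAlgebra.ι_add_mul_swap v w

theorem Grassmann.dL_finite (x : Grassmann σ) : {i : σ | Grassmann.dL i x ≠ 0}.Finite := by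
  change ExteriorAlgebra ℝ (σ →₀ ℝ) at x
  change {i : σ | CliffordAlgebra.contractLeft (Q := (0 : QuadraticForm ℝ (σ →₀ ℝ)))
    (Finsupp.lapply i) x ≠ 0}.Finite
  induction x using CliffordAlgebra.left_induction with
  | algebraMap r => simp [CliffordAlgebra.contractLeft_algebraMap]
  | add x y hx hy =>
    refine (hx.union hy).subset fun z hz => ?_
    by_contra h
    simp only [Set.mem_union, Set.mem_ofPred_eq, not_or, not_not] at h
    exact hz (by rw [map_add, h.1, h.2, add_zero])
  | ι_mul x m hx =>
    refine (hx.union m.support.finite_toSet).subset fun z hz => ?_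
    by_contra h
    simp only [Set.mem_union, Set.mem_ofPred_eq, not_or, not_not, Finset.mem_coe,
      Finsupp.notMem_support_iff] at h
    refine hz ?_
    rw [CliffordAlgebra.contractLeft_ι_mul, h.1]
    simp [h.2]

end GrassmannAlgebra

/-! ## Smooth functions and differential forms on an open subset of a coordinate space -/

section Forms

variable {κ : Type*}

/-- Extension by zero of a function on an open set, used only to differentiate it inside. -/
def extendZero {U : TopologicalSpace.Opens (κ → ℝ)} (f : U → ℝ) : (κ → ℝ) → ℝ :=
  Function.extend Subtype.val f 0

theorem extendZero_apply {U : TopologicalSpace.Opens (κ → ℝ)} (f : U → ℝ) (x : U) :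
    extendZero f x = f x :=
  Subtype.val_injective.extend_apply f 0 x

variable [Fintype κ]

/-- The algebra `C^∞(U)` of smooth real functions on an open set `U` of `ℝ^κ`. -/
def SmoothFun (U : TopologicalSpace.Opens (κ → ℝ)) : Subalgebra ℝ (U → ℝ) where
  carrier := {f | ∃ F : (κ → ℝ) → ℝ, ContDiffOn ℝ ∞ F U ∧ ∀ x : U, f x = F x}
  mul_mem' := by
    rintro f g ⟨F, hF, hf⟩ ⟨G, hG, hg⟩
    exact ⟨fun x => F x * G x, hF.mul hG, fun x => by simp [hf, hg]⟩
  add_mem' := by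
    rintro f g ⟨F, hF, hf⟩ ⟨G, hG, hg⟩
    exact ⟨fun x => F x + G x, hF.add hG, fun x => by simp [hf, hg]⟩
  algebraMap_mem' := by
    intro r
    exact ⟨fun _ => r, contDiffOn_const, fun x => rfl⟩

variable {U : TopologicalSpace.Opens (κ → ℝ)}

instance : CommRing (SmoothFun U) := inferInstance
instance : Algebra ℝ (SmoothFun U) := inferInstance

theorem smoothFun_contDiffOn (f : SmoothFun U) : ContDiffOn ℝ ∞ (extendZero f.1) U := by
  obtain ⟨F, hF, hf⟩ := f.2
  refine hF.congr fun x hx => ?_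
  rw [← hf ⟨x, hx⟩]
  exact extendZero_apply f.1 ⟨x, hx⟩

theorem smoothFun_differentiableAt (f : SmoothFun U) (x : U) :
    DifferentiableAt ℝ (extendZero f.1) x :=
  ((smoothFun_contDiffOn f).contDiffAt (U.isOpen.mem_nhds x.2)).differentiableAt (by simp)

variable [DecidableEq κ]

/-- The partial derivative `∂/∂x^i` on `C^∞(U)`. -/
def pd (i : κ) : SmoothFun U →ₗ[ℝ] SmoothFun U where
  toFun f := ⟨fun x => fderiv ℝ (extendZero f.1) x (Pi.single i 1),
    ⟨fun x => fderiv ℝ (extendZero f.1) x (Pi.single i 1),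
      ((smoothFun_contDiffOn f).fderiv_of_isOpen U.isOpen (m := ∞) (by simp)).clm_apply contDiffOn_const,
      fun _ => rfl⟩⟩
  map_add' f g := by
    ext x
    have h : extendZero (f + g).1 =ᶠ[nhds (x : κ → ℝ)] extendZero f.1 + extendZero g.1 := by
      filter_upwards [U.isOpen.mem_nhds x.2] with y hy
      have := extendZero_apply (f + g).1 ⟨y, hy⟩
      have h1 := extendZero_apply f.1 ⟨y, hy⟩
      have h2 := extendZero_apply g.1 ⟨y, hy⟩
      simp only [Pi.add_apply] at *
      rw [this, h1, h2]
      rfl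
    have h3 := h.fderiv_eq (𝕜 := ℝ)
    rw [fderiv_add (smoothFun_differentiableAt f x) (smoothFun_differentiableAt g x)] at h3
    exact (congrArg (fun T => T (Pi.single i 1)) h3)
  map_smul' r f := by
    ext x
    have h : extendZero (r • f).1 =ᶠ[nhds (x : κ → ℝ)] r • extendZero f.1 := by
      filter_upwards [U.isOpen.mem_nhds x.2] with y hy
      have := extendZero_apply (r • f).1 ⟨y, hy⟩
      have h1 := extendZero_apply f.1 ⟨y, hy⟩
      simp only [Pi.smul_apply] at *
      rw [this, h1]
      rfl
    have h3 := h.fderiv_eq (𝕜 := ℝ)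
    rw [fderiv_const_smul (smoothFun_differentiableAt f x)] at h3
    exact (congrArg (fun T => T (Pi.single i 1)) h3)

/-- The algebra `Ω(U) = C^∞(U) ⊗ Λ(dx^i)` of smooth differential forms on `U`. -/
abbrev Form (U : TopologicalSpace.Opens (κ → ℝ)) : Type _ :=
  SmoothFun U ⊗[ℝ] Grassmann κ

instance : Ring (Form U) := Algebra.TensorProduct.instRing
instance : Algebra ℝ (Form U) := Algebra.TensorProduct.leftAlgebra
instance : AddCommGroup (Form U) := Ring.toAddCommGroup

/-- The exterior derivative `d = ∑ᵢ dx^i ∂/∂x^i`. -/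
def extD : Form U →ₗ[ℝ] Form U :=
  ∑ i : κ, TensorProduct.map (pd i)
    (LinearMap.mulLeft ℝ (Grassmann.gen i))

/-- The forms of degree `p` (only `0` if `p < 0`). -/
def formDeg (U : TopologicalSpace.Opens (κ → ℝ)) (p : ℤ) : Submodule ℝ (Form U) :=
  Submodule.span ℝ {w | ∃ (f : SmoothFun U) (k : ℕ), (k : ℤ) = p ∧
    ∃ v ∈ Grassmann.deg κ k, w = f ⊗ₜ[ℝ] v}

/-- The sign operator `ω ↦ (-1)^p ω` on `p`-forms. -/
def formSign : Form U →ₗ[ℝ] Form U :=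
  TensorProduct.map LinearMap.id Grassmann.parity.toLinearMap

/-- A form is exact if it is `d` of a form; for homogeneous forms of degree `p` the primitive
can equivalently be taken of degree `p - 1` (so in degree `0` only `0` is exact). -/
def IsExact (w : Form U) : Prop := ∃ v : Form U, extD v = w

end Forms

/-- The family `c` lies in the subspace `W`, consists of `δ`-cocycles, and represents a basis of
the cohomology (cocycles in `W` modulo `δ(W)`) of the differential `δ` on `W`. -/
def IsCohomologyBasis {V : Type*} [AddCommGroup V] [Module ℝ V] (δ : V →ₗ[ℝ] V)
    (W : Submodule ℝ V) {J : Type*} (c : J → V) : Prop :=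
  (∀ j, c j ∈ W ∧ δ (c j) = 0) ∧
  (∀ z ∈ W, δ z = 0 → ∃ r : J →₀ ℝ, ∃ b ∈ W, z = Finsupp.linearCombination ℝ c r + δ b) ∧
  (∀ r : J →₀ ℝ, (∃ b ∈ W, Finsupp.linearCombination ℝ c r = δ b) → r = 0)

/-! ## The Lorentz algebra -/

section LorentzAlgebra

attribute [local instance 100] LieRing.ofAssociativeRing

/-- The Minkowski metric `η = diag(1, -1, …, -1)`. -/
def eta (n : ℕ) (a b : Fin n) : ℝ := if a = b then (if a.val = 0 then 1 else -1) else 0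

/-- The Lorentz algebra `so(1, n-1)`: real matrices `X` with `Xᵀ η + η X = 0`. -/
abbrev Lorentz (n : ℕ) : Type :=
  skewAdjointMatricesLieSubalgebra (Matrix.of (eta n))

/-- Index pairs `(a, b)` with `a > b`. -/
abbrev LPair (n : ℕ) : Type := {p : Fin n × Fin n // p.2 < p.1}


end LorentzAlgebra


theorem eta_sq {n : ℕ} (a : Fin n) : eta n a a * eta n a a = 1 := by
  by_cases h : a.val = 0 <;> simp [eta, h]

theorem eta_ne {n : ℕ} {a b : Fin n} (h : a ≠ b) : eta n a b = 0 := by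
  simp [eta, h]

theorem mem_lorentz {n : ℕ} (X : Matrix (Fin n) (Fin n) ℝ) :
    X ∈ skewAdjointMatricesLieSubalgebra (Matrix.of (eta n)) ↔
      ∀ a b, eta n a a * X a b = - (eta n b b * X b a) := by
  rw [mem_skewAdjointMatricesLieSubalgebra, mem_skewAdjointMatricesSubmodule,
    Matrix.IsSkewAdjoint, Matrix.IsAdjointPair, ← Matrix.ext_iff]
  have h1 : ∀ a b, (X.transpose * Matrix.of (eta n)) a b = X b a * eta n b b := by
    intro a b
    rw [Matrix.mul_apply, Finset.sum_eq_single b]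
    · rfl
    · intro c _ hc; simp [eta_ne hc]
    · simp
  have h2 : ∀ a b, (Matrix.of (eta n) * -X) a b = - (eta n a a * X a b) := by
    intro a b
    rw [Matrix.mul_apply, Finset.sum_eq_single a]
    · simp
    · intro c _ hc; simp [eta_ne hc.symm]
    · simp
  constructor
  · intro h a b
    have := h a b
    rw [h1, h2] at this
    linarith
  · intro h a b
    rw [h1, h2]
    linarith [h a b]

/-- The coordinates of a Lorentz matrix `X = ∑_{a>b} w_{ab} l_{ab}`, where
`l_{ab} = η (E_{ab} - E_{ba})`: thus `w_{ab} = η_{aa} X_{ab}`. -/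
def lorentzCoord (n : ℕ) : Lorentz n ≃ₗ[ℝ] (LPair n → ℝ) where
  toFun X p := eta n p.1.1 p.1.1 * X.1 p.1.1 p.1.2
  map_add' X Y := by ext p; simp [mul_add]
  map_smul' r X := by ext p; simp; ring
  invFun w := ⟨Matrix.of fun a b => eta n a a *
      (if h : b < a then w ⟨(a, b), h⟩ else if h : a < b then - w ⟨(b, a), h⟩ else 0), by
    rw [mem_lorentz]
    intro a b
    simp only [Matrix.of_apply, ← mul_assoc, eta_sq, one_mul]
    rcases lt_trichotomy a b with h | h | h
    · simp [h, h.not_gt]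
    · subst h; simp
    · simp [h, h.not_gt]⟩
  left_inv X := by
    apply Subtype.ext
    ext a b
    have hX := (mem_lorentz X.1).1 X.2
    simp only [Matrix.of_apply]
    rcases lt_trichotomy a b with h | h | h
    · simp only [h, h.not_gt, dite_true, dite_false]
      rw [← hX a b, ← mul_assoc, eta_sq, one_mul]
    · subst h
      have := hX a a
      have h0 : eta n a a * X.1 a a = 0 := by linarith
      have h1 : X.1 a a = 0 := by
        calc X.1 a a = eta n a a * (eta n a a * X.1 a a) := by
              rw [← mul_assoc, eta_sq, one_mul]
          _ = 0 := by rw [h0, mul_zero]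
      simp [h1]
    · simp only [h, dite_true]
      rw [← mul_assoc, eta_sq, one_mul]
  right_inv w := by
    ext p
    obtain ⟨⟨a, b⟩, h⟩ := p
    have h' : b < a := h
    simp only [Matrix.of_apply, h', dite_true]
    rw [← mul_assoc, eta_sq, one_mul]

/-- The basis `l_{ab}` (`a > b`) of the Lorentz algebra; it satisfies
`[l_{ab}, l_{cd}] = η_{ac} l_{db} - η_{ad} l_{cb} - η_{bc} l_{da} + η_{bd} l_{ca}`. -/
def lorentzBasis (n : ℕ) : Module.Basis (LPair n) ℝ (Lorentz n) :=
  Module.Basis.ofEquivFun (lorentzCoord n)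

/-! ## Gauge data -/

/-- The numerical data entering the BRST transformations, in coordinates: structure constants
`f_{IJ}^K` of the gauge algebra `𝔤_YM + so(1, n-1)` and the matrices of the action of its basis
elements `δ_I` on a Lorentz vector, on bosonic matter and on fermionic matter. Here
`δ_I V^a = ∑_b vec I a b V^b` and `δ_I y^m = ∑_k rep I m k y^k`. -/
structure GaugeData (n : ℕ) (ι β φ : Type*) where
  /-- structure constants, `[δ_I, δ_J] = ∑_K f I J K δ_K` -/
  f : ι ⊕ LPair n → ι ⊕ LPair n → ι ⊕ LPair n → ℝ
  /-- action on a Lorentz vector -/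
  vec : ι ⊕ LPair n → Fin n → Fin n → ℝ
  /-- action on the bosonic matter fields -/
  repB : ι ⊕ LPair n → β → β → ℝ
  /-- action on the fermionic matter fields -/
  repF : ι ⊕ LPair n → φ → φ → ℝ

/-- The basis `δ_I` of `𝔤_YM × so(1, n-1)`. -/
def gaugeBasis (n : ℕ) {ι 𝔤 : Type*} [LieRing 𝔤] [LieAlgebra ℝ 𝔤] (X : Module.Basis ι ℝ 𝔤) :
    Module.Basis (ι ⊕ LPair n) ℝ (𝔤 × Lorentz n) :=
  X.prod (lorentzBasis n)

/-- The gauge data determined by a basis of the Yang–Mills algebra `𝔤` and by the bosonic and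
fermionic matter multiplets. The matter fields `y^m` form bases of modules of
`𝔤 × so(1, n-1)`, whose elements act on the span of the `y^m`. -/
def GaugeData.ofLie (n : ℕ) {ι β φ 𝔤 WB WF : Type*} [LieRing 𝔤] [LieAlgebra ℝ 𝔤]
    (X : Module.Basis ι ℝ 𝔤)
    [AddCommGroup WB] [Module ℝ WB] [LieRingModule (𝔤 × Lorentz n) WB]
    (yB : Module.Basis β ℝ WB)
    [AddCommGroup WF] [Module ℝ WF] [LieRingModule (𝔤 × Lorentz n) WF]
    (yF : Module.Basis φ ℝ WF) : GaugeData n ι β φ where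
  f I J K := (gaugeBasis n X).repr ⁅gaugeBasis n X I, gaugeBasis n X J⁆ K
  vec I a b := (gaugeBasis n X I).2.1 b a
  repB I m k := yB.repr ⁅gaugeBasis n X I, yB m⁆ k
  repF I m k := yF.repr ⁅gaugeBasis n X I, yF m⁆ k

/-! ## Fields, antifields and the jet space -/

section Jets

/-- The fields `Φ^A`: vielbein `e_μ^a`, Yang–Mills fields `A_μ^i`, bosonic and fermionic matter,
diffeomorphism ghosts `ξ^μ`, and ghosts `C^I` of Yang–Mills and local Lorentz symmetry. -/
inductive Fld (n : ℕ) (ι β φ : Type*)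
  | e (μ a : Fin n)
  | A (μ : Fin n) (i : ι)
  | yB (m : β)
  | yF (m : φ)
  | xi (μ : Fin n)
  | C (I : ι ⊕ LPair n)
  deriving DecidableEq, Fintype

/-- The fields `Φ^A` and the antifields `Φ*_A`. -/
inductive Var (n : ℕ) (ι β φ : Type*)
  | fld (Φ : Fld n ι β φ)
  | anti (Φ : Fld n ι β φ)
  deriving DecidableEq, Fintype

variable {n : ℕ} {ι β φ : Type*}

/-- Grassmann parity of the fields. -/
def Fld.isOdd : Fld n ι β φ → Bool
  | .e _ _ => false
  | .A _ _ => false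
  | .yB _ => false
  | .yF _ => true
  | .xi _ => true
  | .C _ => true

/-- Grassmann parity; an antifield has the parity opposite to that of its field. -/
def Var.isOdd : Var n ι β φ → Bool
  | .fld Φ => Φ.isOdd
  | .anti Φ => !Φ.isOdd

/-- Ghost number of the fields. -/
def Fld.gh : Fld n ι β φ → ℤ
  | .xi _ => 1
  | .C _ => 1
  | _ => 0

/-- Ghost number: `-1` for the antifields of `e, A, y` and `-2` for those of the ghosts. -/
def Var.gh : Var n ι β φ → ℤ
  | .fld Φ => Φ.gh
  | .anti Φ => - Φ.gh - 1

/-- Jet coordinates: `(Z, α)` stands for the partial derivative `∂^α Z`. -/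
abbrev Jet (n : ℕ) (ι β φ : Type*) : Type _ := Var n ι β φ × (Fin n →₀ ℕ)

/-- `frameIdx z = some (μ, a)` iff `z` is the undifferentiated vielbein `e_μ^a`. -/
def frameIdx : Jet n ι β φ → Option (Fin n × Fin n)
  | (.fld (.e μ a), α) => if α = 0 then some (μ, a) else none
  | _ => none

/-- The odd jet coordinates. -/
abbrev OddJet (n : ℕ) (ι β φ : Type*) : Type _ := {z : Jet n ι β φ // z.1.isOdd = true}

/-- The even jet coordinates other than the undifferentiated vielbein. -/
abbrev EvenJet (n : ℕ) (ι β φ : Type*) : Type _ :=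
  {z : Jet n ι β φ // z.1.isOdd = false ∧ frameIdx z = none}

/-- The matrix `e_μ^a` (rows `μ`, columns `a`) with given entries. -/
def frameMatrix (n : ℕ) (x : Fin n × Fin n → ℝ) : Matrix (Fin n) (Fin n) ℝ :=
  Matrix.of fun μ a => x (μ, a)

theorem contDiff_det {n : ℕ} {E : Type*} [NormedAddCommGroup E] [NormedSpace ℝ E]
    (M : E → Matrix (Fin n) (Fin n) ℝ) (hM : ∀ i j, ContDiff ℝ ∞ fun x => M x i j) :
    ContDiff ℝ ∞ fun x => (M x).det := by
  simp only [Matrix.det_apply]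
  refine ContDiff.sum fun σ _ => ?_
  refine ContDiff.const_smul _ ?_
  exact contDiff_prod fun i _ => hM _ _

theorem contDiff_frameMatrix (n : ℕ) (μ a : Fin n) :
    ContDiff ℝ ∞ fun x => frameMatrix n x μ a := by
  simp only [frameMatrix, Matrix.of_apply]
  fun_prop

/-- The manifold `GL⁺(n)` of vielbeins of positive determinant. -/
def GLp (n : ℕ) : TopologicalSpace.Opens (Fin n × Fin n → ℝ) :=
  ⟨{x | 0 < (frameMatrix n x).det},
    isOpen_lt continuous_const (contDiff_det _ (contDiff_frameMatrix n)).continuous⟩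

/-- Polynomials in the even jet coordinates with smooth coefficients on `GL⁺(n)`. -/
def EvenFun (n : ℕ) (ι β φ : Type*) : Type _ :=
  SmoothFun (GLp n) ⊗[ℝ] MvPolynomial (EvenJet n ι β φ) ℝ

instance : CommRing (EvenFun n ι β φ) :=
  inferInstanceAs (CommRing (SmoothFun (GLp n) ⊗[ℝ] MvPolynomial (EvenJet n ι β φ) ℝ))
instance : Algebra ℝ (EvenFun n ι β φ) :=
  inferInstanceAs (Algebra ℝ (SmoothFun (GLp n) ⊗[ℝ] MvPolynomial (EvenJet n ι β φ) ℝ))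

/-- The product of a function of the vielbein and a polynomial. -/
def EvenFun.mk (f : SmoothFun (GLp n)) (p : MvPolynomial (EvenJet n ι β φ) ℝ) :
    EvenFun n ι β φ := f ⊗ₜ[ℝ] p

/-- The operator `S ⊗ T` on `EvenFun`. -/
def EvenFun.map (S : SmoothFun (GLp n) →ₗ[ℝ] SmoothFun (GLp n))
    (T : MvPolynomial (EvenJet n ι β φ) ℝ →ₗ[ℝ] MvPolynomial (EvenJet n ι β φ) ℝ) :
    EvenFun n ι β φ →ₗ[ℝ] EvenFun n ι β φ :=
  TensorProduct.map S T

/-- A function of the vielbein as an element of `EvenFun`. -/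
def EvenFun.ofFrame : SmoothFun (GLp n) →ₐ[ℝ] EvenFun n ι β φ :=
  Algebra.TensorProduct.includeLeft

theorem EvenFun.map_mk (S : SmoothFun (GLp n) →ₗ[ℝ] SmoothFun (GLp n))
    (T : MvPolynomial (EvenJet n ι β φ) ℝ →ₗ[ℝ] MvPolynomial (EvenJet n ι β φ) ℝ)
    (f : SmoothFun (GLp n)) (p : MvPolynomial (EvenJet n ι β φ) ℝ) :
    EvenFun.map S T (EvenFun.mk f p) = EvenFun.mk (S f) (T p) := rfl

theorem EvenFun.induction {P : EvenFun n ι β φ → Prop} (h0 : P 0)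
    (h1 : ∀ f p, P (EvenFun.mk f p)) (h2 : ∀ x y, P x → P y → P (x + y))
    (x : EvenFun n ι β φ) : P x :=
  TensorProduct.induction_on (motive := P) x h0 h1 h2

/-- The algebra `𝒜` of local functions: polynomials in all jet coordinates other than the
undifferentiated vielbein (commuting in the even, anticommuting in the odd ones), whose
coefficients are smooth functions of the undifferentiated vielbein on `GL⁺(n)`. -/
abbrev LocalFun (n : ℕ) (ι β φ : Type*) : Type _ :=
  EvenFun n ι β φ ⊗[ℝ] Grassmann (OddJet n ι β φ)

/-- A smooth function of the vielbein as a local function. -/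
def frameFun : SmoothFun (GLp n) →ₐ[ℝ] LocalFun n ι β φ :=
  Algebra.TensorProduct.includeLeft.comp EvenFun.ofFrame

/-- The coordinate function `e_μ^a` on `GL⁺(n)`. -/
def frameCoord (p : Fin n × Fin n) : SmoothFun (GLp n) :=
  ⟨fun x => x.1 p, fun x => x p, (contDiff_apply ℝ ℝ p).contDiffOn, fun _ => rfl⟩

/-- The jet coordinate `∂^α Z` as a local function. -/
def gen (z : Jet n ι β φ) : LocalFun n ι β φ :=
  if h : z.1.isOdd = true then 1 ⊗ₜ Grassmann.gen ⟨z, h⟩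
  else match h' : frameIdx z with
    | some p => frameFun (frameCoord p)
    | none => EvenFun.mk 1 (MvPolynomial.X ⟨z, by simpa using h, h'⟩) ⊗ₜ 1

/-- Left partial derivative `∂^L/∂z` with respect to a jet coordinate. -/
def dL (z : Jet n ι β φ) : LocalFun n ι β φ →ₗ[ℝ] LocalFun n ι β φ :=
  if h : z.1.isOdd = true then
    TensorProduct.map LinearMap.id (Grassmann.dL ⟨z, h⟩)
  else match h' : frameIdx z with
    | some p => TensorProduct.map (EvenFun.map (pd p) LinearMap.id) LinearMap.id
    | none => TensorProduct.map (EvenFun.map LinearMap.id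
        (MvPolynomial.pderiv ⟨z, by simpa using h, h'⟩).toLinearMap) LinearMap.id

/-- Right partial derivative `∂^R/∂z` with respect to a jet coordinate. -/
def dR (z : Jet n ι β φ) : LocalFun n ι β φ →ₗ[ℝ] LocalFun n ι β φ :=
  if h : z.1.isOdd = true then
    TensorProduct.map LinearMap.id (Grassmann.dR ⟨z, h⟩)
  else dL z

/-- The parity automorphism: `+1` on even and `-1` on odd local functions. -/
def parity : LocalFun n ι β φ →ₗ[ℝ] LocalFun n ι β φ :=
  TensorProduct.map LinearMap.id Grassmann.parity.toLinearMap

/-- The local functions of ghost number `g`. -/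
def ghostDeg (n : ℕ) (ι β φ : Type*) (g : ℤ) : Submodule ℝ (LocalFun n ι β φ) :=
  Submodule.span ℝ {a | ∃ (f : SmoothFun (GLp n)) (l : List (Jet n ι β φ)),
    (l.map fun z => z.1.gh).sum = g ∧ a = frameFun f * (l.map gen).prod}

theorem dL_finite (a : LocalFun n ι β φ) : {z | dL z a ≠ 0}.Finite := by
  induction a using TensorProduct.induction_on with
  | zero => simp
  | add x y hx hy =>
    refine (hx.union hy).subset fun z hz => ?_
    by_contra h
    simp only [Set.mem_union, Set.mem_ofPred_eq, not_or, not_not] at h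
    exact hz (by rw [map_add, h.1, h.2, add_zero])
  | tmul k v =>
    induction k using EvenFun.induction with
    | h0 => simp
    | h2 x y hx hy =>
      refine (hx.union hy).subset fun z hz => ?_
      by_contra h
      simp only [Set.mem_union, Set.mem_ofPred_eq, not_or, not_not] at h
      exact hz (by rw [TensorProduct.add_tmul, map_add, h.1, h.2, add_zero])
    | h1 f p =>
      have h1 := (Grassmann.dL_finite v).image (Subtype.val : OddJet n ι β φ → Jet n ι β φ)
      have h2 : (Subtype.val '' (p.vars : Set (EvenJet n ι β φ))).Finite :=
        p.vars.finite_toSet.image _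
      have h3 : (Set.range fun p : Fin n × Fin n =>
          ((Var.fld (Fld.e p.1 p.2), 0) : Jet n ι β φ)).Finite := Set.finite_range _
      refine ((h1.union h2).union h3).subset fun z hz => ?_
      by_contra hn
      simp only [Set.mem_union, not_or] at hn
      obtain ⟨⟨n1, n2⟩, n3⟩ := hn
      apply hz
      unfold dL
      split_ifs with h
      · have : Grassmann.dL (⟨z, h⟩ : OddJet n ι β φ) v = 0 := by
          by_contra hne
          exact n1 ⟨⟨z, h⟩, hne, rfl⟩
        rw [TensorProduct.map_tmul, this, TensorProduct.tmul_zero]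
      · split
        · rename_i q hq
          exfalso
          apply n3
          obtain ⟨Z, α⟩ := z
          cases Z with
          | anti Φ => simp [frameIdx] at hq
          | fld Φ =>
            cases Φ <;> simp [frameIdx] at hq
            obtain ⟨rfl, rfl⟩ := hq
            exact ⟨(_, _), rfl⟩
        · rename_i hq
          have h0 : z.1.isOdd = false := by simpa using h
          have : MvPolynomial.pderiv (⟨z, h0, hq⟩ : EvenJet n ι β φ) p = 0 := by
            apply MvPolynomial.pderiv_eq_zero_of_notMem_vars
            intro hm
            exact n2 ⟨⟨z, h0, hq⟩, hm, rfl⟩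
          have h4 : EvenFun.mk (n := n) f (0 : MvPolynomial (EvenJet n ι β φ) ℝ) = 0 :=
            TensorProduct.tmul_zero _ _
          rw [TensorProduct.map_tmul, EvenFun.map_mk]
          change EvenFun.mk f (MvPolynomial.pderiv _ p) ⊗ₜ[ℝ] _ = 0
          rw [this, h4, TensorProduct.zero_tmul]

/-- The (super)derivation `∑_z Q_z ∂^L/∂z` of local functions with characteristic `Q`; on a given
local function only finitely many terms are nonzero. -/
def evol (Q : Jet n ι β φ → LocalFun n ι β φ) : LocalFun n ι β φ →ₗ[ℝ] LocalFun n ι β φ where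
  toFun a := ∑ᶠ z, Q z * dL z a
  map_add' a b := by
    have h : ∀ z, Q z * dL z (a + b) = Q z * dL z a + Q z * dL z b := fun z => by
      rw [map_add, mul_add]
    rw [finsum_congr h]
    refine finsum_add_distrib ?_ ?_
    · exact (dL_finite a).subset fun z hz h => hz (by dsimp only; rw [h, mul_zero])
    · exact (dL_finite b).subset fun z hz h => hz (by dsimp only; rw [h, mul_zero])
  map_smul' r a := by
    have h : ∀ z, Q z * dL z (r • a) = r • (Q z * dL z a) := fun z => by
      rw [map_smul, mul_smul_comm]
    rw [finsum_congr h, RingHom.id_apply]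
    refine (smul_finsum' r ?_).symm
    exact (dL_finite a).subset fun z hz h => hz (by dsimp only; rw [h, mul_zero])

/-- The total derivative `∂_μ`, `∂_μ (∂^α Z) = ∂^{α + μ} Z`. -/
def totalD (μ : Fin n) : LocalFun n ι β φ →ₗ[ℝ] LocalFun n ι β φ :=
  evol fun z => gen (z.1, z.2 + Finsupp.single μ 1)

/-- The iterated total derivative `∂^α`. -/
def iterD (α : Fin n →₀ ℕ) : Module.End ℝ (LocalFun n ι β φ) :=
  ((List.finRange n).map fun μ => (totalD μ : Module.End ℝ (LocalFun n ι β φ)) ^ α μ).prod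

/-- The Euler–Lagrange right derivative
`δ^R L/δZ = ∑_α (-1)^{|α|} ∂^α (∂^R L/∂(∂^α Z))` (a finite sum). -/
def euler (Z : Var n ι β φ) (L : LocalFun n ι β φ) : LocalFun n ι β φ :=
  ∑ᶠ α : Fin n →₀ ℕ, (-1 : ℝ) ^ α.degree • iterD α (dR (Z, α) L)

/-- Local functions linear in the odd jet coordinates. -/
def oddLin (n : ℕ) (ι β φ : Type*) : Submodule ℝ (LocalFun n ι β φ) :=
  Submodule.span ℝ {x | ∃ (k : EvenFun n ι β φ)
    (v : OddJet n ι β φ →₀ ℝ), x = k ⊗ₜ Grassmann.lin v}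

theorem oddLin_anticomm {x y : LocalFun n ι β φ} (hx : x ∈ oddLin n ι β φ)
    (hy : y ∈ oddLin n ι β φ) : x * y + y * x = 0 := by
  induction hx using Submodule.span_induction with
  | zero => simp
  | add a b _ _ ha hb =>
    have : (a + b) * y + y * (a + b) = (a * y + y * a) + (b * y + y * b) := by
      rw [add_mul, mul_add]; abel
    rw [this, ha, hb, add_zero]
  | smul r a _ ha => rw [smul_mul_assoc, mul_smul_comm, ← smul_add, ha, smul_zero]
  | mem a ha =>
    induction hy using Submodule.span_induction with
    | zero => simp
    | add c d _ _ hc hd =>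
      have : a * (c + d) + (c + d) * a = (a * c + c * a) + (a * d + d * a) := by
        rw [add_mul, mul_add]; abel
      rw [this, hc, hd, add_zero]
    | smul r c _ hc => rw [smul_mul_assoc, mul_smul_comm, ← smul_add, hc, smul_zero]
    | mem c hc =>
      obtain ⟨k, v, rfl⟩ := ha
      obtain ⟨l, w, rfl⟩ := hc
      rw [Algebra.TensorProduct.tmul_mul_tmul, Algebra.TensorProduct.tmul_mul_tmul,
        mul_comm l k, ← TensorProduct.tmul_add, Grassmann.lin_add_mul_swap,
        TensorProduct.tmul_zero]

theorem oddLin_sq {x : LocalFun n ι β φ} (hx : x ∈ oddLin n ι β φ) : x * x = 0 := by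
  have h := oddLin_anticomm hx hx
  have h2 : (2 : ℝ) • (x * x) = 0 := by rw [two_smul]; exact h
  exact (smul_eq_zero.1 h2).resolve_left two_ne_zero

theorem gen_odd_mul_even {z w : Jet n ι β φ} (hz : z.1.isOdd = true) (hw : w.1.isOdd = false) :
    gen z * gen w ∈ oddLin n ι β φ := by
  apply Submodule.subset_span
  have h1 : gen z = (1 : EvenFun n ι β φ) ⊗ₜ[ℝ]
      Grassmann.lin (Finsupp.single (⟨z, hz⟩ : OddJet n ι β φ) (1 : ℝ)) := by
    simp [gen, hz, Grassmann.gen]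
  have h2 : ∃ k : EvenFun n ι β φ,
      gen w = k ⊗ₜ[ℝ] (1 : Grassmann (OddJet n ι β φ)) := by
    unfold gen
    rw [dif_neg (by simp [hw])]
    split
    · exact ⟨_, rfl⟩
    · exact ⟨_, rfl⟩
  obtain ⟨k, hk⟩ := h2
  refine ⟨k, Finsupp.single ⟨z, hz⟩ 1, ?_⟩
  rw [h1, hk, Algebra.TensorProduct.tmul_mul_tmul, one_mul, mul_one]

end Jets

/-! ## The BRST differential -/

section BRST

variable {n : ℕ} {ι β φ : Type*} [Fintype ι] [Fintype β] [Fintype φ]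

/-- Undifferentiated field or antifield. -/
abbrev fld (Φ : Fld n ι β φ) : LocalFun n ι β φ := gen (.fld Φ, 0)

/-- First derivative `∂_μ Φ` of a field. -/
abbrev dfld (μ : Fin n) (Φ : Fld n ι β φ) : LocalFun n ι β φ :=
  gen (.fld Φ, Finsupp.single μ 1)

/-- Undifferentiated antifield `Φ*`. -/
abbrev anti (Φ : Fld n ι β φ) : LocalFun n ι β φ := gen (.anti Φ, 0)

/-- The BRST transformations `s Φ^A` of the fields:
* `s e_μ^a = ξ^ν ∂_ν e_μ^a + ∂_μ ξ^ν e_ν^a + C^I δ_I e_μ^a` (only the Lorentz ghosts contribute to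
  the last term, which is `e_μ^b C_b^a`),
* `s A_μ^i = ξ^ν ∂_ν A_μ^i + ∂_μ ξ^ν A_ν^i + ∂_μ C^i + f_{kj}^i C^j A_μ^k`,
* `s y^m = ξ^ν ∂_ν y^m + C^I δ_I y^m`,
* `s ξ^μ = ξ^ν ∂_ν ξ^μ`,
* `s C^K = ξ^ν ∂_ν C^K - (1/2) f_{IJ}^K C^I C^J`. -/
def brstField (D : GaugeData n ι β φ) (Φ : Fld n ι β φ) : LocalFun n ι β φ :=
  (∑ ν, fld (.xi ν) * dfld ν Φ) +
  match Φ with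
  | .e μ a => (∑ ν, dfld μ (.xi ν) * fld (.e ν a)) +
      ∑ I, ∑ b, D.vec I a b • (fld (.C I) * fld (.e μ b))
  | .A μ i => (∑ ν, dfld μ (.xi ν) * fld (.A ν i)) + dfld μ (.C (.inl i)) +
      ∑ j, ∑ k, D.f (.inl k) (.inl j) (.inl i) • (fld (.C (.inl j)) * fld (.A μ k))
  | .yB m => ∑ I, ∑ k, D.repB I m k • (fld (.C I) * fld (.yB k))
  | .yF m => ∑ I, ∑ k, D.repF I m k • (fld (.C I) * fld (.yF k))
  | .xi _ => 0
  | .C K => -((1 / 2 : ℝ) • ∑ I, ∑ J, D.f I J K • (fld (.C I) * fld (.C J)))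

/-- The density of the solution `S = ∫ (L₀ - (s Φ^A) Φ*_A)` of the master equation.
Written out, `-(s Φ^A) Φ*_A` is
`-ξ^μ Φ*_A ∂_μ Φ^A - C^I y*_m δ_I y^m + e*_a^μ (e_ν^a ∂_μ ξ^ν + e_μ^b C_b^a)
  + A*_i^μ (∂_μ C^i + C^j A_μ^k f_{kj}^i + A_ν^i ∂_μ ξ^ν) + (1/2) C*_K C^I C^J f_{IJ}^K`. -/
def masterDensity (D : GaugeData n ι β φ) (L₀ : LocalFun n ι β φ) : LocalFun n ι β φ :=
  L₀ - ∑ Φ, brstField D Φ * anti Φ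

/-- BRST transformation of fields and antifields, `s Φ^A = -δ^R S/δΦ*_A` (which is `brstField`)
and `s Φ*_A = δ^R S/δΦ^A`. -/
def brstVar (D : GaugeData n ι β φ) (L₀ : LocalFun n ι β φ) : Var n ι β φ → LocalFun n ι β φ
  | .fld Φ => brstField D Φ
  | .anti Φ => euler (.fld Φ) (masterDensity D L₀)

/-- The BRST differential on local functions: the odd derivation commuting with the total
derivatives that has the prescribed values on fields and antifields. -/
def brst (D : GaugeData n ι β φ) (L₀ : LocalFun n ι β φ) :
    LocalFun n ι β φ →ₗ[ℝ] LocalFun n ι β φ :=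
  evol fun z => iterD z.2 (brstVar D L₀ z.1)

/-- The classical fields are `e, A, y`. -/
def Fld.IsClassical : Fld n ι β φ → Prop
  | .xi _ => False
  | .C _ => False
  | _ => True

/-- `L₀` is a (bosonic) local function of the classical fields `e, A, y` and their derivatives
whose integral is invariant under diffeomorphisms, local Lorentz and Yang–Mills transformations:
its gauge variation, with the ghosts as parameters, is a total divergence. -/
def IsInvariantLagrangian (D : GaugeData n ι β φ) (L₀ : LocalFun n ι β φ) : Prop :=
  L₀ ∈ Algebra.adjoin ℝ (Set.range (frameFun (n := n) (ι := ι) (β := β) (φ := φ)) ∪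
      {x | ∃ (Φ : Fld n ι β φ) (α : Fin n →₀ ℕ), Φ.IsClassical ∧ x = gen (.fld Φ, α)}) ∧
  parity L₀ = L₀ ∧
  ∃ k : Fin n → LocalFun n ι β φ,
    evol (fun z => match z with
      | (.fld Φ, α) => iterD α (brstField D Φ)
      | (.anti _, _) => 0) L₀ = ∑ μ, totalD μ (k μ)

/-! ## The subalgebra of tensor fields and undifferentiated ghosts -/

/-- The matrix of the action of `δ_I` on the fields, `δ_I Φ^A = ∑_B (rot I A B) Φ^B`, with world
indices inert: vector on `e`, coadjoint on `A` and `C`, and the given one on matter. -/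
def rot (D : GaugeData n ι β φ) (I : ι ⊕ LPair n) : Fld n ι β φ → Fld n ι β φ → ℝ
  | .e μ a, .e ν b => if μ = ν then D.vec I a b else 0
  | .A μ i, .A ν j => if μ = ν then - D.f I (.inl j) (.inl i) else 0
  | .yB m, .yB k => D.repB I m k
  | .yF m, .yF k => D.repF I m k
  | .C J, .C K => - D.f I K J
  | _, _ => 0

/-- The derivation `δ_I` of local functions (dual action on the antifields), commuting with the
total derivatives. -/
def gaugeAct (D : GaugeData n ι β φ) (I : ι ⊕ LPair n) :
    LocalFun n ι β φ →ₗ[ℝ] LocalFun n ι β φ :=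
  evol fun z => match z with
    | (.fld Φ, α) => ∑ Ψ, rot D I Φ Ψ • gen (.fld Ψ, α)
    | (.anti Φ, α) => - ∑ Ψ, rot D I Ψ Φ • gen (.anti Ψ, α)

/-- The inverse determinant `1/e` of the vielbein as a function on `GL⁺(n)`. -/
def invDetFun (n : ℕ) : SmoothFun (GLp n) :=
  ⟨fun x => ((frameMatrix n x).det)⁻¹, fun x => ((frameMatrix n x).det)⁻¹,
    (contDiff_det _ (contDiff_frameMatrix n)).contDiffOn.inv fun _ hx => ne_of_gt hx,
    fun _ => rfl⟩

/-- The inverse vielbein `E_a^μ` as a function on `GL⁺(n)`. -/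
def invFrameFun (a μ : Fin n) : SmoothFun (GLp n) :=
  ⟨fun x => (frameMatrix n x)⁻¹ a μ, fun x => (frameMatrix n x)⁻¹ a μ, by
    simp only [Matrix.inv_def, Matrix.smul_apply, Ring.inverse_eq_inv', smul_eq_mul,
      Matrix.adjugate_apply]
    refine ((contDiff_det _ (contDiff_frameMatrix n)).contDiffOn.inv
      fun _ hx => ne_of_gt hx).mul (ContDiff.contDiffOn ?_)
    refine contDiff_det _ fun i j => ?_
    by_cases h : i = μ
    · subst h
      simp only [Matrix.updateRow_self]
      exact contDiff_const
    · simp only [Matrix.updateRow_ne h]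
      exact contDiff_frameMatrix n i j,
    fun _ => rfl⟩

/-- `1/e` as a local function. -/
abbrev invDet : LocalFun n ι β φ := frameFun (invDetFun n)

/-- `E_a^μ` as a local function. -/
abbrev invFrame (a μ : Fin n) : LocalFun n ι β φ := frameFun (invFrameFun a μ)

/-- `Ω_{[μν]ρ} = e_{ρa} ∂_{[μ} e_{ν]}^a`. -/
def anholonomy (n : ℕ) (ι β φ : Type*) (μ ν ρ : Fin n) : LocalFun n ι β φ :=
  ∑ a, ∑ b, eta n a b • (fld (.e ρ b) *
    ((1 / 2 : ℝ) • ((dfld μ (.e ν a) : LocalFun n ι β φ) - dfld ν (.e μ a))))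

/-- The spin connection
`ω_μ^{ab} = E^{aν} E^{bρ} (Ω_{[μν]ρ} - Ω_{[νρ]μ} + Ω_{[ρμ]ν})`. -/
def spinConn (μ a b : Fin n) : LocalFun n ι β φ :=
  ∑ ν, ∑ ρ, (∑ c, eta n a c • invFrame c ν) * (∑ d, eta n b d • invFrame d ρ) *
    (anholonomy n ι β φ μ ν ρ - anholonomy n ι β φ ν ρ μ + anholonomy n ι β φ ρ μ ν)

/-- The connection `A_μ^I`: Yang–Mills fields and spin connection. -/
def conn (μ : Fin n) : ι ⊕ LPair n → LocalFun n ι β φ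
  | .inl i => fld (.A μ i)
  | .inr p => spinConn μ p.1.1 p.1.2

/-- The curvatures `F_{μν}^I = ∂_μ A_ν^I - ∂_ν A_μ^I + f_{JK}^I A_μ^J A_ν^K`, i.e. the Yang–Mills
field strengths and the Riemann tensor. -/
def curv (D : GaugeData n ι β φ) (μ ν : Fin n) (I : ι ⊕ LPair n) : LocalFun n ι β φ :=
  totalD μ (conn ν I : LocalFun n ι β φ) - totalD ν (conn μ I) + ∑ J, ∑ K, D.f J K I • (conn μ J * conn ν K : LocalFun n ι β φ)

/-- The covariant derivative `D_a = E_a^μ (∂_μ - A_μ^I δ_I)`. -/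
def covD (D : GaugeData n ι β φ) (a : Fin n) (x : LocalFun n ι β φ) : LocalFun n ι β φ :=
  ∑ μ, invFrame a μ * (totalD μ x - ∑ I, conn μ I * gaugeAct D I x)

/-- The undifferentiated tensor fields: matter fields, curvatures `F_{ab}^I = E_a^μ E_b^ν F_{μν}^I`,
and the antifields converted to tensors. -/
inductive IsTensorSeed (D : GaugeData n ι β φ) : LocalFun n ι β φ → Prop
  | matterB (m : β) : IsTensorSeed D (fld (.yB m))
  | matterF (m : φ) : IsTensorSeed D (fld (.yF m))
  | curvature (a b : Fin n) (I : ι ⊕ LPair n) :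
      IsTensorSeed D (∑ μ, ∑ ν, invFrame a μ * invFrame b ν * curv D μ ν I)
  | antiB (m : β) : IsTensorSeed D (invDet * anti (.yB m))
  | antiF (m : φ) : IsTensorSeed D (invDet * anti (.yF m))
  | antiE (a b : Fin n) : IsTensorSeed D (invDet * ∑ μ, fld (.e μ b) * anti (.e μ a))
  | antiA (i : ι) (a : Fin n) : IsTensorSeed D (invDet * ∑ μ, fld (.e μ a) * anti (.A μ i))
  | antiC (I : ι ⊕ LPair n) : IsTensorSeed D (invDet * anti (.C I))
  | antiXi (a : Fin n) : IsTensorSeed D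
      (invDet * ∑ μ, invFrame a μ * ((anti (.xi μ) : LocalFun n ι β φ) - ∑ I, conn μ I * anti (.C I)))

/-- The subalgebra `𝒜₂` of local functions generated by the tensor fields (all iterated covariant
derivatives of the undifferentiated ones) and by the undifferentiated ghosts
`ξ̂^a = ξ^μ e_μ^a` and `Ĉ^I = C^I + ξ^μ A_μ^I`. -/
def tensorAlg (D : GaugeData n ι β φ) : Subalgebra ℝ (LocalFun n ι β φ) :=
  Algebra.adjoin ℝ
    ({x | ∃ (l : List (Fin n)) (t : LocalFun n ι β φ),
        IsTensorSeed D t ∧ x = l.foldr (covD D) t} ∪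
      Set.range (fun a : Fin n => ∑ μ, fld (.xi μ) * fld (.e μ a)) ∪
      Set.range (fun I : ι ⊕ LPair n => fld (.C I) + ∑ μ, fld (.xi μ) * conn μ I))

/-! ## Substitution of `s e` for `d e` in forms on `GL⁺(n)` -/

theorem brstField_e_mem (D : GaugeData n ι β φ) (μ a : Fin n) :
    brstField D (.e μ a) ∈ oddLin n ι β φ := by
  unfold brstField
  refine add_mem (sum_mem fun ν _ => gen_odd_mul_even rfl rfl) (add_mem (sum_mem fun ν _ =>
    gen_odd_mul_even rfl rfl) (sum_mem fun I _ => sum_mem fun b _ =>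
      Submodule.smul_mem _ _ (gen_odd_mul_even rfl rfl)))

/-- The linear map `d e_μ^a ↦ s e_μ^a`. -/
def brstFrame (D : GaugeData n ι β φ) : (Fin n × Fin n →₀ ℝ) →ₗ[ℝ] LocalFun n ι β φ :=
  Finsupp.linearCombination ℝ fun p : Fin n × Fin n => brstField D (.e p.1 p.2)

theorem brstFrame_sq (D : GaugeData n ι β φ) (v : Fin n × Fin n →₀ ℝ) :
    brstFrame D v * brstFrame D v = 0 := by
  apply oddLin_sq
  rw [brstFrame, Finsupp.linearCombination_apply]
  exact sum_mem fun p _ => Submodule.smul_mem _ _ (brstField_e_mem D _ _)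

/-- The algebra homomorphism `Ω(GL⁺(n)) → 𝒜`, `α(e, de) ↦ α(e, s e)`. -/
def substFrame (D : GaugeData n ι β φ) : Form (GLp n) →ₐ[ℝ] LocalFun n ι β φ :=
  Algebra.TensorProduct.lift frameFun
    (Grassmann.lift (brstFrame D) (brstFrame_sq D)) (fun f w => by
      change frameFun f * _ = _ * frameFun f
      generalize Grassmann.lift (brstFrame D) (brstFrame_sq D) w = x
      induction x using TensorProduct.induction_on with
      | zero => rw [mul_zero, zero_mul]
      | add x y hx hy => rw [mul_add, add_mul, hx, hy]
      | tmul k v =>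
        change (EvenFun.ofFrame f ⊗ₜ[ℝ] (1 : Grassmann (OddJet n ι β φ))) *
          (k ⊗ₜ[ℝ] v) = (k ⊗ₜ[ℝ] v) *
          (EvenFun.ofFrame f ⊗ₜ[ℝ] (1 : Grassmann (OddJet n ι β φ)))
        rw [Algebra.TensorProduct.tmul_mul_tmul, Algebra.TensorProduct.tmul_mul_tmul, one_mul,
          mul_one, mul_comm])

/-! ## Local forms and the Wess–Zumino consistency condition -/

/-- Spacetime `ℝⁿ`. -/
abbrev spacetime (n : ℕ) : TopologicalSpace.Opens (Fin n → ℝ) := ⊤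

/-- The local forms `ℰ = Ω(ℝⁿ) ⊗ 𝒜`. -/
abbrev LocalForm (n : ℕ) (ι β φ : Type*) : Type _ :=
  Form (spacetime n) ⊗[ℝ] LocalFun n ι β φ

/-- The local forms of ghost number `g` and form degree `p`. -/
def bideg (n : ℕ) (ι β φ : Type*) (g p : ℤ) : Submodule ℝ (LocalForm n ι β φ) :=
  Submodule.map₂ (TensorProduct.mk ℝ _ _) (formDeg (spacetime n) p) (ghostDeg n ι β φ g)

instance : AddCommGroup (LocalForm n ι β φ) := TensorProduct.addCommGroup

/-- The BRST differential on local forms, `s(ω α) = (-1)^p ω (s α)` for a `p`-form `ω`. -/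
def sForm (D : GaugeData n ι β φ) (L₀ : LocalFun n ι β φ) :
    LocalForm n ι β φ →ₗ[ℝ] LocalForm n ι β φ :=
  TensorProduct.map formSign (brst D L₀)

/-- The spacetime exterior derivative on local forms,
`d(ω α) = (dω) α + ∑_μ dx^μ ω (∂_μ α)`. -/
def dForm : LocalForm n ι β φ →ₗ[ℝ] LocalForm n ι β φ :=
  TensorProduct.map (extD (U := spacetime n)) LinearMap.id +
    ∑ μ : Fin n, TensorProduct.map
      (LinearMap.mulLeft ℝ ((1 : SmoothFun (spacetime n)) ⊗ₜ[ℝ] Grassmann.gen μ)) (totalD μ)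

/-- `a` is a solution `a^{g,p}` of the Wess–Zumino condition `s a^{g,p} + d a^{g+1,p-1} = 0`. -/
def IsWZSolution (D : GaugeData n ι β φ) (L₀ : LocalFun n ι β φ) (g p : ℤ)
    (a : LocalForm n ι β φ) : Prop :=
  a ∈ bideg n ι β φ g p ∧
    ∃ a' ∈ bideg n ι β φ (g + 1) (p - 1), sForm D L₀ a + dForm a' = 0

/-- `a` is a trivial solution, `a = s b^{g-1,p} + d c^{g,p-1}`. -/
def IsTrivialSolution (D : GaugeData n ι β φ) (L₀ : LocalFun n ι β φ) (g p : ℤ)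
    (a : LocalForm n ι β φ) : Prop :=
  ∃ b ∈ bideg n ι β φ (g - 1) p, ∃ c ∈ bideg n ι β φ g (p - 1), a = sForm D L₀ b + dForm c

/-- `a^{g,p}` generates a trivial descent: by adding a trivial solution it can be turned into a
form `a₀` with `s a₀ = 0`. Otherwise it generates a non-trivial descent. -/
def HasTrivialDescent (D : GaugeData n ι β φ) (L₀ : LocalFun n ι β φ) (g p : ℤ)
    (a : LocalForm n ι β φ) : Prop :=
  ∃ a₀ ∈ bideg n ι β φ g p, sForm D L₀ a₀ = 0 ∧ IsTrivialSolution D L₀ g p (a - a₀)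

end BRST

end EYM

open EYM

namespace EYM
open scoped Classical
variable {n : ℕ} {ι β φ : Type*}

local notation "𝓐" => LocalFun n ι β φ
local notation "𝓜" => Fin n →₀ ℕ
local notation "𝓕" => Fld n ι β φ
local notation "𝓙" => Jet n ι β φ
local notation "𝓥" => Var n ι β φ
local notation "𝓘" => ι ⊕ LPair n
local notation "𝓒" => SmoothFun (GLp n)
open Finset (sum_comm sum_add_distrib mul_sum smul_sum sum_neg_distrib sum_sub_distrib
  sum_eq_zero sum_mul sum_ite_irrel sum_eq_single sum_const_zero sum_smul univ mem_univ
  sum_insert mem_union_left mem_image sum_ite_eq mem_insert_self mem_union_right mem_biUnion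
  sum_subset sum_map sum_ite_eq' sum_image sum_const card_univ sum_empty mem_filter)
open Finsupp (single linearCombination single_left_inj single_apply linearCombination_apply
  degree_eq_zero_iff induction_linear degree_single finsetSum_apply ext single_le_iff degree lsum
  lsum_single lsum_apply)
open TensorProduct (map_tmul induction_on map tmul_add zero_tmul add_tmul tmul_smul tmul_zero
  smul_tmul' tmul_neg)
open Submodule (smul_mem subset_span span span_induction span_le mul_mem_mul mem_iSup_of_mem
  mem_sup_right mem_sup mem_sup_left mul_le map₂ ker_subtype span_mono fg_span mem_comap
  one_eq_span map_span_le map₂_le apply_mem_map₂)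
open EYM.Grassmann (lin)
open LinearMap (range mulLeft mulLeft_apply id_apply comp_apply ker)
open Module (Basis End finrank)
open Algebra (subset_adjoin algebraMap_eq_smul_one smul_def adjoin_induction adjoin adjoin_mono)
open Subalgebra (toSubmodule)
open Matrix (transvection diagonal)
open Function (update Injective Embedding support update_self update_eq_self)
open Set (Icc Ioc)
open LinearMap renaming add_apply → add_app, sub_apply → sub_app, smul_apply → smul_app,
  sum_apply → sum_app, zero_apply → zero_app
open EYM.Grassmann renaming dL → gdL, gen → ggen, parity → gpar
open EYM.Grassmann (lin_add_mul_swap)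
attribute [-simp] Fintype.sum_sum_type
local notation "𝓛" => LocalFun n ι β φ →ₗ[ℝ] LocalFun n ι β φ
open Algebra.TensorProduct (tmul_mul_tmul)
local notation "𝓙₀" => EvenJet n ι β φ
local notation "𝓙₁" => OddJet n ι β φ
variable {x y : LocalFun n ι β φ}

lemma eq_zero_of_eq_neg {M : Type*} [AddCommGroup M] [Module ℝ M] {x : M} (h : x = -x) : x = 0 :=
  (smul_eq_zero.1 ((two_smul ℝ x).trans (eq_neg_iff_add_eq_zero.1 h))).resolve_left two_ne_zero

lemma map_mem_of_span {V W : Type*} [AddCommGroup V] [Module ℝ V] [AddCommGroup W] [Module ℝ W]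
    (E : V →ₗ[ℝ] W) {s : Set V} {S : Submodule ℝ W} (h : ∀ x ∈ s, E x ∈ S) {x : V}
    (hx : x ∈ span ℝ s) : E x ∈ S := (map_span_le E s S).2 h ⟨x, hx, rfl⟩

lemma sum_ext {I M : Type*} [AddCommMonoid M] {s : Finset I} {f g : I → M}
    (h : ∀ i ∈ s, f i = g i) : ∑ i ∈ s, f i = ∑ i ∈ s, g i := Finset.sum_congr rfl h

/-! ## Derivatives of smooth functions -/

section Smooth

variable {κ : Type*} [Fintype κ] [DecidableEq κ] {U : TopologicalSpace.Opens (κ → ℝ)}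

lemma pd_apply (i : κ) (f : SmoothFun U) (x : U) :
    (pd i f).1 x = fderiv ℝ (extendZero f.1) x (Pi.single i 1) := rfl

lemma pd_apply_of_eqOn (i : κ) (f : SmoothFun U) (F : (κ → ℝ) → ℝ) (hF : ∀ x : U, f.1 x = F x)
    (x : U) : (pd i f).1 x = fderiv ℝ F x (Pi.single i 1) := by
  rw [pd_apply]
  congr 1
  apply Filter.EventuallyEq.fderiv_eq
  filter_upwards [U.isOpen.mem_nhds x.2] with y hy
  rw [← hF ⟨y, hy⟩]
  exact extendZero_apply f.1 ⟨y, hy⟩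

lemma pd_mul (i : κ) (f g : SmoothFun U) : pd i (f * g) = pd i f * g + f * pd i g := by
  ext x
  rw [pd_apply_of_eqOn i (f * g) (fun y => extendZero f.1 y * extendZero g.1 y)
    (fun y => by rw [extendZero_apply, extendZero_apply]; rfl) x]
  rw [fderiv_fun_mul (smoothFun_differentiableAt f x) (smoothFun_differentiableAt g x)]
  change _ = (pd i f).1 x * g.1 x + f.1 x * (pd i g).1 x
  rw [pd_apply, pd_apply]
  simp only [add_apply, smul_apply, smul_eq_mul, extendZero_apply]
  ring

lemma pd_algebraMap (i : κ) (r : ℝ) : pd i (algebraMap ℝ (SmoothFun U) r) = 0 := by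
  ext x
  rw [pd_apply_of_eqOn i _ (fun _ => r) (fun y => rfl) x]
  simp

lemma pd_one (i : κ) : pd i (1 : SmoothFun U) = 0 := by
  have h := pd_algebraMap (U := U) i 1
  rwa [map_one] at h

lemma pd_comm (i j : κ) (f : SmoothFun U) : pd i (pd j f) = pd j (pd i f) := by
  have key : ∀ (i j : κ) (x : U), (pd i (pd j f)).1 x =
      fderiv ℝ (fderiv ℝ (extendZero f.1)) x (Pi.single i 1) (Pi.single j 1) := fun i j x => by
    rw [pd_apply_of_eqOn i (pd j f) (fun y => fderiv ℝ (extendZero f.1) y (Pi.single j 1))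
      (fun y => rfl) x]
    have hd : DifferentiableAt ℝ (fderiv ℝ (extendZero f.1)) (x : κ → ℝ) :=
      (((smoothFun_contDiffOn f).fderiv_of_isOpen U.isOpen (m := ∞) (by simp)).contDiffAt
        (U.isOpen.mem_nhds x.2)).differentiableAt (by simp)
    rw [fderiv_clm_apply hd (by fun_prop)]
    simp
  ext x
  rw [key, key]
  have hs : IsSymmSndFDerivAt ℝ (extendZero f.1) (x : κ → ℝ) :=
    ((smoothFun_contDiffOn f).contDiffAt (U.isOpen.mem_nhds x.2)).isSymmSndFDerivAt (by
      rw [minSmoothness_of_isRCLikeNormedField]; exact WithTop.coe_le_coe.2 le_top)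
  exact hs _ _

end Smooth

/-! ## Derivatives on Grassmann algebras -/

section GrassmannDer

variable {σ : Type*}

lemma Grassmann.induction {p : Grassmann σ → Prop} (h0 : ∀ r, p (algebraMap ℝ _ r))
    (hadd : ∀ x y, p x → p y → p (x + y))
    (hmul : ∀ x (v : σ →₀ ℝ), p x → p (lin v * x)) (x : Grassmann σ) : p x :=
  CliffordAlgebra.left_induction (Q := (0 : QuadraticForm ℝ (σ →₀ ℝ))) (P := p) h0 hadd
    (fun x m hx => hmul x m hx) x

lemma Grassmann.parity_lin (v : σ →₀ ℝ) : gpar (lin v) = -lin v := CliffordAlgebra.involute_ι v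

lemma Grassmann.dL_lin_mul (i : σ) (v : σ →₀ ℝ) (x : Grassmann σ) :
    gdL i (lin v * x) = v i • x - lin v * gdL i x :=
  CliffordAlgebra.contractLeft_ι_mul (Q := (0 : QuadraticForm ℝ (σ →₀ ℝ))) _ v x

lemma Grassmann.dL_algebraMap (i : σ) (r : ℝ) : gdL i (algebraMap ℝ (Grassmann σ) r) = 0 :=
  CliffordAlgebra.contractLeft_algebraMap (Q := (0 : QuadraticForm ℝ (σ →₀ ℝ))) _ r

lemma Grassmann.dL_lin (i : σ) (v : σ →₀ ℝ) : gdL i (lin v) = algebraMap ℝ _ (v i) :=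
  CliffordAlgebra.contractLeft_ι (Q := (0 : QuadraticForm ℝ (σ →₀ ℝ))) _ v

lemma Grassmann.dL_mul (i : σ) (x y : Grassmann σ) :
    gdL i (x * y) = gdL i x * y + gpar x * gdL i y := by
  induction x using Grassmann.induction with
  | h0 r =>
    rw [Grassmann.dL_algebraMap, ← smul_def, map_smul, AlgHom.commutes, ← smul_def]
    simp
  | hadd a b ha hb => rw [add_mul, map_add, ha, hb, map_add, map_add]; noncomm_ring
  | hmul a v ha =>
    rw [mul_assoc, Grassmann.dL_lin_mul, ha, Grassmann.dL_lin_mul, map_mul, Grassmann.parity_lin,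
      sub_mul, smul_mul_assoc]
    noncomm_ring

lemma Grassmann.dL_comm (i j : σ) (x : Grassmann σ) : gdL i (gdL j x) = -gdL j (gdL i x) :=
  CliffordAlgebra.contractLeft_comm _ _ _

lemma Grassmann.parity_parity (x : Grassmann σ) : gpar (gpar x) = x :=
  CliffordAlgebra.involute_involute x

lemma Grassmann.parity_dL (i : σ) (x : Grassmann σ) : gpar (gdL i x) = -gdL i (gpar x) := by
  induction x using Grassmann.induction with
  | h0 r => rw [Grassmann.dL_algebraMap, AlgHom.commutes, Grassmann.dL_algebraMap]; simp
  | hadd a b ha hb => rw [map_add, map_add, ha, hb, map_add, map_add]; abel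
  | hmul a v ha =>
    rw [Grassmann.dL_lin_mul, map_mul, map_sub, map_mul, ha, map_smul, Grassmann.parity_lin,
      ← map_neg, Grassmann.dL_lin_mul, map_neg, Finsupp.neg_apply]
    simp only [neg_smul, neg_mul, mul_neg]
    abel

lemma Grassmann.dR_eq (i : σ) (x : Grassmann σ) : Grassmann.dR i x = gpar (gdL i x) := by
  have hmul : ∀ (x : Grassmann σ) (v : σ →₀ ℝ), Grassmann.dR i (x * lin v) =
      v i • x - Grassmann.dR i x * lin v := fun x v =>
    CliffordAlgebra.contractRight_mul_ι (Q := (0 : QuadraticForm ℝ (σ →₀ ℝ))) _ v x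
  have key : ∀ x : Grassmann σ, (fun x => Grassmann.dR i x = gpar (gdL i x)) x := fun x => by
    refine CliffordAlgebra.right_induction (Q := (0 : QuadraticForm ℝ (σ →₀ ℝ))) ?_ ?_ ?_ x
    · intro r
      change Grassmann.dR i (algebraMap ℝ (Grassmann σ) r) =
        gpar (gdL i (algebraMap ℝ (Grassmann σ) r))
      rw [Grassmann.dL_algebraMap, map_zero]
      exact CliffordAlgebra.contractRight_algebraMap (Q := (0 : QuadraticForm ℝ (σ →₀ ℝ))) _ r
    · intro x y hx hy
      change Grassmann σ at x y
      change Grassmann.dR i (x + y) = gpar (gdL i (x + y))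
      rw [map_add, map_add, map_add, hx, hy]
    · intro v x hx
      change Grassmann σ at x
      change Grassmann.dR i (x * lin v) = gpar (gdL i (x * lin v))
      rw [hmul, Grassmann.dL_mul, map_add, map_mul, map_mul, Grassmann.parity_lin, hx,
        Grassmann.dL_lin, AlgHom.commutes, Grassmann.parity_parity, algebraMap_eq_smul_one]
      simp only [mul_smul_comm, mul_one, mul_neg]
      abel
  exact key x

end GrassmannDer

/-! ## Jet coordinates -/

section JetCoord

/-- The undifferentiated vielbein as a jet coordinate. -/
abbrev frameJet (p : Fin n × Fin n) : 𝓙 := (.fld (.e p.1 p.2), 0)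

lemma eq_frameJet {z : 𝓙} {p : Fin n × Fin n} (h : frameIdx z = some p) : z = frameJet p := by
  obtain ⟨Z, α⟩ := z
  cases Z with
  | anti Φ => simp [frameIdx] at h
  | fld Φ =>
    cases Φ <;> simp [frameIdx] at h
    obtain ⟨rfl, rfl⟩ := h
    rfl

lemma frameIdx_frameJet (p : Fin n × Fin n) : frameIdx (frameJet p : 𝓙) = some p := by
  simp [frameIdx]

lemma jet_cases (z : 𝓙) :
    z.1.isOdd = true ∨ (∃ p, z = frameJet p) ∨ (z.1.isOdd = false ∧ frameIdx z = none) := by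
  by_cases h : z.1.isOdd = true
  · exact Or.inl h
  · right
    rcases h' : frameIdx z with _ | p
    · exact Or.inr ⟨by simpa using h, rfl⟩
    · exact Or.inl ⟨p, eq_frameJet h'⟩

lemma gen_odd {z : 𝓙} (h : z.1.isOdd = true) :
    gen z = (1 : EvenFun n ι β φ) ⊗ₜ[ℝ] ggen (⟨z, h⟩ : 𝓙₁) := by
  simp [gen, h]

lemma gen_frame (p : Fin n × Fin n) : gen (frameJet p : 𝓙) = frameFun (frameCoord p) := by
  unfold gen
  rw [dif_neg (by simp [Var.isOdd, Fld.isOdd])]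
  split
  · rename_i q hq
    rw [frameIdx_frameJet] at hq
    simp only [Option.some.injEq] at hq
    rw [hq]
  · rename_i hq
    rw [frameIdx_frameJet] at hq
    simp at hq

lemma gen_even {z : 𝓙} (h : z.1.isOdd = false ∧ frameIdx z = none) :
    gen z = EvenFun.mk 1 (MvPolynomial.X (⟨z, h⟩ : 𝓙₀)) ⊗ₜ[ℝ]
      (1 : Grassmann 𝓙₁) := by
  unfold gen
  rw [dif_neg (by simp [h.1])]
  split
  · rename_i q hq
    rw [h.2] at hq
    simp at hq
  · rfl

lemma dL_odd {z : 𝓙} (h : z.1.isOdd = true) :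
    dL z = map LinearMap.id (gdL (⟨z, h⟩ : 𝓙₁)) := by
  unfold dL
  rw [dif_pos h]

lemma dL_frame (p : Fin n × Fin n) : dL (frameJet p : 𝓙) =
      map (EvenFun.map (pd p) LinearMap.id) LinearMap.id := by
  unfold dL
  rw [dif_neg (by simp [Var.isOdd, Fld.isOdd])]
  split
  · rename_i q hq
    rw [frameIdx_frameJet] at hq
    simp only [Option.some.injEq] at hq
    rw [hq]
  · rename_i hq
    rw [frameIdx_frameJet] at hq
    simp at hq

lemma dL_even {z : 𝓙} (h : z.1.isOdd = false ∧ frameIdx z = none) :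
    dL z = map (EvenFun.map LinearMap.id
        (MvPolynomial.pderiv (⟨z, h⟩ : 𝓙₀)).toLinearMap) LinearMap.id := by
  unfold dL
  rw [dif_neg (by simp [h.1])]
  split
  · rename_i q hq
    rw [h.2] at hq
    simp at hq
  · rfl

lemma frameFun_tmul (f : 𝓒) : (frameFun f : 𝓐) = EvenFun.mk f 1 ⊗ₜ[ℝ] 1 := rfl

lemma EvenFun.mk_mul (f g : 𝓒) (p q : MvPolynomial 𝓙₀ ℝ) :
    EvenFun.mk f p * EvenFun.mk g q = EvenFun.mk (f * g) (p * q) :=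
  tmul_mul_tmul _ _ _ _

lemma EvenFun.one_def : (1 : EvenFun n ι β φ) = EvenFun.mk 1 1 := rfl

lemma EvenFun.mk_add_right (f : 𝓒) (p q : MvPolynomial 𝓙₀ ℝ) :
    EvenFun.mk f (p + q) = EvenFun.mk f p + EvenFun.mk f q := tmul_add _ _ _

lemma EvenFun.mk_add_left (f g : 𝓒) (p : MvPolynomial 𝓙₀ ℝ) :
    EvenFun.mk (f + g) p = EvenFun.mk f p + EvenFun.mk g p := add_tmul _ _ _

lemma EvenFun.mk_smul (r : ℝ) (f : 𝓒) (p : MvPolynomial 𝓙₀ ℝ) :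
    EvenFun.mk f (r • p) = r • EvenFun.mk f p := tmul_smul _ _ _

lemma EvenFun.mk_zero (f : 𝓒) :
    EvenFun.mk f (0 : MvPolynomial 𝓙₀ ℝ) = 0 := tmul_zero _ _

lemma EvenFun.zero_mk (p : MvPolynomial 𝓙₀ ℝ) :
    EvenFun.mk (0 : 𝓒) p = 0 := zero_tmul _ _

/-- Elements of the even part are central. -/
lemma tmul_one_comm (k : EvenFun n ι β φ) (x : 𝓐) :
    (k ⊗ₜ[ℝ] (1 : Grassmann 𝓙₁)) * x = x * (k ⊗ₜ[ℝ] 1) := by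
  induction x using induction_on with
  | zero => rw [mul_zero, zero_mul]
  | add x y hx hy => rw [mul_add, add_mul, hx, hy]
  | tmul l v =>
    rw [tmul_mul_tmul, tmul_mul_tmul, one_mul,
      mul_one, mul_comm]

lemma frameFun_comm (f : 𝓒) (x : 𝓐) : frameFun f * x = x * frameFun f := tmul_one_comm _ x

/-- The products of a function of the vielbein and jet coordinates span the local functions. -/
lemma span_monomials : span ℝ {a : 𝓐 |
    ∃ (f : 𝓒) (l : List 𝓙), a = frameFun f * (l.map gen).prod} = ⊤ := by
  set W := span ℝ {a : 𝓐 |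
    ∃ (f : 𝓒) (l : List 𝓙), a = frameFun f * (l.map gen).prod} with hW
  have hgen (z : 𝓙) : ∀ x ∈ W, gen z * x ∈ W := fun x hx => by
    refine map_mem_of_span (mulLeft ℝ (gen z)) ?_ hx
    rintro _ ⟨f, l, rfl⟩
    refine subset_span ⟨f, z :: l, ?_⟩
    rw [mulLeft_apply, List.map_cons, List.prod_cons, ← mul_assoc, ← mul_assoc, frameFun_comm f]
  have hframe (g : 𝓒) : ∀ x ∈ W, frameFun g * x ∈ W := fun x hx => by
    refine map_mem_of_span (mulLeft ℝ (frameFun g)) ?_ hx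
    rintro _ ⟨f, l, rfl⟩
    exact subset_span ⟨g * f, l, by rw [mulLeft_apply, map_mul, mul_assoc]⟩
  have h1 : (1 : 𝓐) ∈ W := subset_span ⟨1, [], by simp⟩
  have hodd : ∀ v : Grassmann 𝓙₁, (1 : EvenFun n ι β φ) ⊗ₜ[ℝ] v ∈ W := fun v => by
    induction v using Grassmann.induction with
    | h0 r =>
      rw [algebraMap_eq_smul_one, tmul_smul]
      exact smul_mem _ _ h1
    | hadd x y hx hy => rw [tmul_add]; exact add_mem hx hy
    | hmul x v hx =>
      induction v using induction_linear with
      | zero => simp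
      | add a b ha hb =>
        rw [map_add, add_mul, tmul_add]
        exact add_mem ha hb
      | single i r =>
        have e1 : (1 : EvenFun n ι β φ) ⊗ₜ[ℝ] (lin (single i r) * x) =
            r • (gen i.1 * ((1 : EvenFun n ι β φ) ⊗ₜ[ℝ] x)) := by
          rw [gen_odd i.2, ggen, tmul_mul_tmul, one_mul,
            ← tmul_smul, ← smul_mul_assoc, ← map_smul]
          simp
        rw [e1]
        exact smul_mem _ _ (hgen _ _ hx)
  have hpoly : ∀ (p : MvPolynomial 𝓙₀ ℝ), ∀ x ∈ W,
      (EvenFun.mk 1 p ⊗ₜ[ℝ] (1 : Grassmann 𝓙₁)) * x ∈ W := fun p => by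
    induction p using MvPolynomial.induction_on with
    | C a =>
      intro x hx
      have : EvenFun.mk 1 (MvPolynomial.C a) ⊗ₜ[ℝ] (1 : Grassmann 𝓙₁) =
          a • (1 : 𝓐) := by
        rw [MvPolynomial.C_eq_smul_one, EvenFun.mk_smul, ← smul_tmul']
        rfl
      rw [this, smul_mul_assoc, one_mul]
      exact smul_mem _ _ hx
    | add p q hp hq =>
      intro x hx
      rw [EvenFun.mk_add_right, add_tmul, add_mul]
      exact add_mem (hp x hx) (hq x hx)
    | mul_X p i hp =>
      intro x hx
      have : EvenFun.mk 1 (p * MvPolynomial.X i) ⊗ₜ[ℝ] (1 : Grassmann 𝓙₁) =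
          (EvenFun.mk 1 p ⊗ₜ[ℝ] 1) * gen i.1 := by
        rw [gen_even i.2, tmul_mul_tmul, EvenFun.mk_mul, one_mul, one_mul]
      rw [this, mul_assoc]
      exact hp _ (hgen _ _ hx)
  rw [eq_top_iff]
  rintro x -
  induction x using induction_on with
  | zero => exact zero_mem _
  | add x y hx hy => exact add_mem hx hy
  | tmul k v =>
    induction k using EvenFun.induction with
    | h0 => rw [zero_tmul]; exact zero_mem _
    | h2 x y hx hy => rw [add_tmul]; exact add_mem hx hy
    | h1 f p =>
      have : EvenFun.mk f p ⊗ₜ[ℝ] v = frameFun f * ((EvenFun.mk 1 p ⊗ₜ[ℝ] 1) * (1 ⊗ₜ[ℝ] v)) := by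
        rw [frameFun_tmul, tmul_mul_tmul,
          tmul_mul_tmul, mul_one, EvenFun.mk_mul, one_mul, one_mul, one_mul,
          mul_one]
      rw [this]
      exact hframe _ _ (hpoly _ _ (hodd v))

end JetCoord

open EYM.Grassmann (parity_lin dL_algebraMap dL_lin_mul dL_lin dL_comm parity_dL)

/-! ## Superderivations of local functions -/

section SuperDer

instance ringLocalFun : Ring 𝓐 := Algebra.TensorProduct.instRing
instance algebraLocalFun : Algebra ℝ 𝓐 := Algebra.TensorProduct.leftAlgebra
instance addCommGroupLocalFun : AddCommGroup 𝓐 := Ring.toAddCommGroup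
instance moduleLocalFun : Module ℝ 𝓐 := Algebra.toModule
instance semiringLocalFun : Semiring 𝓐 := Ring.toSemiring
instance addCommMonoidLocalFun : AddCommMonoid 𝓐 := AddCommGroup.toAddCommMonoid
instance nonAssocRingLocalFun : NonUnitalNonAssocRing 𝓐 := NonAssocRing.toNonUnitalNonAssocRing
instance nonAssocSemiringLocalFun : NonUnitalNonAssocSemiring 𝓐 := NonAssocSemiring.toNonUnitalNonAssocSemiring

/-- The sign `(-1)^ε`. -/
def sgn (ε : Bool) : ℝ := if ε then -1 else 1

@[simp] theorem sgn_true : sgn true = -1 := rfl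
@[simp] theorem sgn_false : sgn false = 1 := rfl

lemma sgn_mul_self (ε : Bool) : sgn ε * sgn ε = 1 := by cases ε <;> simp

lemma sgn_xor (ε δ : Bool) : sgn (ε ^^ δ) = sgn ε * sgn δ := by cases ε <;> cases δ <;> simp

/-- The `ε`-th power of the parity automorphism. -/
def par (ε : Bool) : 𝓛 := if ε then parity else LinearMap.id

@[simp] theorem par_true (x : 𝓐) : par true x = parity x := rfl
@[simp] theorem par_false (x : 𝓐) : par false x = x := rfl

lemma parity_tmul (k : EvenFun n ι β φ) (v : Grassmann 𝓙₁) :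
    parity (k ⊗ₜ[ℝ] v) = k ⊗ₜ[ℝ] gpar v := rfl

lemma parity_mul (x y : 𝓐) : parity (x * y) = parity x * parity y := by
  induction x using induction_on with
  | zero => simp
  | add a b ha hb => rw [add_mul, map_add, ha, hb, map_add, add_mul]
  | tmul k v =>
    induction y using induction_on with
    | zero => simp
    | add a b ha hb => rw [mul_add, map_add, ha, hb, map_add, mul_add]
    | tmul l w =>
      rw [tmul_mul_tmul, parity_tmul, parity_tmul, parity_tmul, map_mul,
        tmul_mul_tmul]

@[simp] theorem parity_parity (x : 𝓐) : parity (parity x) = x := by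
  induction x using induction_on with
  | zero => simp
  | add a b ha hb => rw [map_add, map_add, ha, hb]
  | tmul k v => rw [parity_tmul, parity_tmul, Grassmann.parity_parity]

@[simp] theorem parity_frameFun (f : 𝓒) : parity (frameFun f : 𝓐) = frameFun f := by
  rw [frameFun_tmul, parity_tmul, map_one]

@[simp] theorem parity_one : parity (1 : 𝓐) = 1 := by
  rw [Algebra.TensorProduct.one_def, parity_tmul, map_one]

lemma par_mul (ε : Bool) (x y : 𝓐) : par ε (x * y) = par ε x * par ε y := by
  cases ε
  · rfl
  · exact parity_mul x y

lemma par_par (ε δ : Bool) (x : 𝓐) : par ε (par δ x) = par (ε ^^ δ) x := by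
  cases ε <;> cases δ <;> simp

@[simp] theorem par_frameFun (ε : Bool) (f : 𝓒) : par ε (frameFun f : 𝓐) = frameFun f := by
  cases ε <;> simp

@[simp] theorem par_one (ε : Bool) : par ε (1 : 𝓐) = 1 := by
  cases ε <;> simp

/-- Local functions of definite parity. -/
def IsHom (η : Bool) (q : 𝓐) : Prop := parity q = sgn η • q

lemma IsHom.par {η : Bool} {q : 𝓐} (h : IsHom η q) (ε : Bool) : par ε q = sgn (ε && η) • q := by
  cases ε
  · simp
  · exact h

lemma isHom_gen (z : 𝓙) : IsHom z.1.isOdd (gen z) := by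
  unfold IsHom
  rcases jet_cases z with h | ⟨p, rfl⟩ | h
  · rw [gen_odd h, parity_tmul, ggen, parity_lin, h]
    simp [tmul_neg]
  · rw [gen_frame, parity_frameFun]; simp [Var.isOdd, Fld.isOdd]
  · rw [gen_even h, parity_tmul, map_one, h.1]; simp

lemma isHom_frameFun (f : 𝓒) : IsHom false (frameFun f : 𝓐) := by
  simp [IsHom]

lemma isHom_one : IsHom false (1 : 𝓐) := by
  simp [IsHom]

lemma isHom_zero (η : Bool) : IsHom η (0 : 𝓐) := by
  simp [IsHom]

lemma IsHom.add {η : Bool} (hx : IsHom η x) (hy : IsHom η y) : IsHom η (x + y) := by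
  unfold IsHom at *
  rw [map_add, hx, hy, smul_add]

lemma IsHom.smul {η : Bool} (hx : IsHom η x) (r : ℝ) : IsHom η (r • x) := by
  unfold IsHom at *
  rw [map_smul, hx, smul_comm]

lemma IsHom.neg {η : Bool} (hx : IsHom η x) : IsHom η (-x) := by
  unfold IsHom at *
  rw [map_neg, hx, smul_neg]

lemma IsHom.sub {η : Bool} (hx : IsHom η x) (hy : IsHom η y) : IsHom η (x - y) := by
  rw [sub_eq_add_neg]; exact hx.add hy.neg

lemma IsHom.sum {η : Bool} {I : Type*} {s : Finset I} {x : I → 𝓐}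
    (hx : ∀ i ∈ s, IsHom η (x i)) : IsHom η (∑ i ∈ s, x i) := by
  unfold IsHom at *
  rw [map_sum, smul_sum]
  exact sum_ext hx

lemma IsHom.mul {η η' ζ : Bool} (hx : IsHom η x) (hy : IsHom η' y)
    (h : (η ^^ η') = ζ := by rfl) : IsHom ζ (x * y) := by
  subst h
  unfold IsHom at *
  rw [parity_mul, hx, hy, smul_mul_smul_comm, sgn_xor]

lemma IsHom.parity {η : Bool} (hx : IsHom η x) : IsHom η (parity x) := by
  unfold IsHom at *
  rw [hx, map_smul, hx]

lemma IsHom.par' {η : Bool} (hx : IsHom η x) (ε : Bool) : IsHom η (EYM.par ε x) := by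
  cases ε
  · exact hx
  · exact hx.parity

/-- Induction on local functions along monomials. -/
lemma LocalFun.induction {p : 𝓐 → Prop}
    (hf : ∀ f, p (frameFun f)) (hg : ∀ z x, p x → p (gen z * x))
    (hadd : ∀ x y, p x → p y → p (x + y)) (x : 𝓐) : p x := by
  have hx : x ∈ span ℝ {a : 𝓐 |
    ∃ (f : 𝓒) (l : List 𝓙), a = frameFun f * (l.map gen).prod} := by
    rw [span_monomials]; trivial
  have hm : ∀ (f : 𝓒) (l : List 𝓙), p (frameFun f * (l.map gen).prod) := fun f l => by
    induction l with
    | nil => simpa using hf f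
    | cons z l ih =>
      rw [List.map_cons, List.prod_cons, ← mul_assoc, frameFun_comm, mul_assoc]
      exact hg _ _ ih
  have hsm : ∀ (r : ℝ), ∀ a ∈ {a : 𝓐 | ∃ (f : 𝓒)
      (l : List 𝓙), a = frameFun f * (l.map gen).prod}, p (r • a) := by
    rintro r a ⟨f, l, rfl⟩
    rw [← smul_mul_assoc, ← map_smul]
    exact hm _ _
  induction hx using Submodule.closure_induction with
  | zero => simpa using hf 0
  | add x y _ _ hx hy => exact hadd _ _ hx hy
  | smul_mem r x hx => exact hsm r x hx

/-- Homogeneous elements supercommute with everything. -/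
lemma IsHom.comm {η : Bool} {q : 𝓐} (hq : IsHom η q) (w : 𝓐) : q * w = EYM.par η w * q := by
  have key : ∀ q : 𝓐, ∃ a b, q = a + b ∧ IsHom false a ∧ IsHom true b ∧
      (∀ w, a * w = w * a) ∧ (∀ w, b * w = EYM.parity w * b) := fun q => by
    induction q using LocalFun.induction with
    | hf f =>
      exact ⟨frameFun f, 0, by simp, isHom_frameFun f, isHom_zero _, frameFun_comm f, by simp⟩
    | hadd x y hx hy =>
      obtain ⟨a, b, rfl, h1, h2, h3, h4⟩ := hx
      obtain ⟨c, d, rfl, k1, k2, k3, k4⟩ := hy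
      refine ⟨a + c, b + d, by abel, h1.add k1, h2.add k2, fun w => ?_, fun w => ?_⟩
      · rw [add_mul, mul_add, h3, k3]
      · rw [add_mul, mul_add, h4, k4]
    | hg z x hx =>
      obtain ⟨a, b, rfl, h1, h2, h3, h4⟩ := hx
      by_cases hz : z.1.isOdd = true
      · have hzc : ∀ w : 𝓐, gen z * w = EYM.parity w * gen z := fun w => by
          rw [gen_odd hz]
          induction w using induction_on with
          | zero => simp
          | add x y hx hy => rw [mul_add, hx, hy, map_add, add_mul]
          | tmul k v =>
            rw [parity_tmul, tmul_mul_tmul,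
              tmul_mul_tmul, one_mul, mul_one]
            congr 1
            induction v using Grassmann.induction with
            | h0 r => rw [AlgHom.commutes, Algebra.commutes]
            | hadd x y hx hy => rw [mul_add, hx, hy, map_add, add_mul]
            | hmul x v hx =>
              rw [map_mul, parity_lin, ← mul_assoc, mul_assoc (-_), ← hx, ← mul_assoc]
              congr 1
              have := lin_add_mul_swap (single (⟨z, hz⟩ : 𝓙₁) 1) v
              rw [neg_mul]
              exact eq_neg_of_add_eq_zero_left this
        have hzg : IsHom true (gen z : 𝓐) := by
          have := isHom_gen z (ι := ι) (β := β) (φ := φ)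
          rwa [hz] at this
        refine ⟨gen z * b, gen z * a, by rw [mul_add, add_comm], hzg.mul h2, hzg.mul h1,
          fun w => ?_, fun w => ?_⟩
        · rw [mul_assoc, h4, ← mul_assoc, hzc, parity_parity, mul_assoc]
        · rw [mul_assoc, h3, ← mul_assoc, hzc, mul_assoc]
      · have hz' : z.1.isOdd = false := by simpa using hz
        have hzc : ∀ w : 𝓐, gen z * w = w * gen z := by
          rcases jet_cases z with h | ⟨p, rfl⟩ | h
          · exact absurd h hz
          · rw [gen_frame]; exact frameFun_comm _
          · rw [gen_even h]; exact tmul_one_comm _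
        have hzg : IsHom false (gen z : 𝓐) := by
          have := isHom_gen z (ι := ι) (β := β) (φ := φ)
          rwa [hz'] at this
        refine ⟨gen z * a, gen z * b, by rw [mul_add], hzg.mul h1, hzg.mul h2,
          fun w => ?_, fun w => ?_⟩
        · rw [mul_assoc, h3, ← mul_assoc, hzc, mul_assoc]
        · rw [mul_assoc, h4, ← mul_assoc, hzc, mul_assoc]
  obtain ⟨a, b, rfl, h1, h2, h3, h4⟩ := key q
  unfold IsHom at hq h1 h2
  rw [map_add, h1, h2] at hq
  cases η
  · have hb : b = 0 := by
      simp only [sgn_true, sgn_false, one_smul, neg_smul] at hq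
      exact eq_zero_of_eq_neg (add_left_cancel hq).symm
    subst hb
    simpa using h3 w
  · have ha : a = 0 := by
      simp only [sgn_true, sgn_false, one_smul, neg_smul, neg_add] at hq
      exact eq_zero_of_eq_neg (add_right_cancel hq)
    subst ha
    simpa using h4 w

lemma IsHom.even_comm (hx : IsHom false x) (w : 𝓐) : x * w = w * x := hx.comm w

lemma IsHom.odd_comm (hx : IsHom true x) (hy : IsHom true y) : x * y = -(y * x) := by
  rw [hx.comm y, par_true, hy]; simp

/-- `D` is a superderivation of parity `ε`, acting on functions of the vielbein by the chain
rule. -/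
structure IsSDer (ε : Bool) (D : 𝓛) : Prop where
  mul : ∀ x y, D (x * y) = D x * y + par ε x * D y
  frame : ∀ f, D (frameFun f) = ∑ p, D (gen (frameJet p)) * frameFun (pd p f)
  map_parity : ∀ x, parity (D x) = sgn ε • D (parity x)

lemma IsSDer.ext {ε : Bool} {D D' : 𝓛}
    (hD : IsSDer ε D) (hD' : IsSDer ε D') (h : ∀ z, D (gen z) = D' (gen z)) : D = D' := by
  refine LinearMap.ext fun x => ?_
  induction x using LocalFun.induction with
  | hf f => rw [hD.frame, hD'.frame]; simp only [h]
  | hg z x hx => rw [hD.mul, hD'.mul, h, hx]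
  | hadd x y hx hy => rw [map_add, map_add, hx, hy]

lemma IsSDer.map_one {ε : Bool} {D : 𝓛} (hD : IsSDer ε D) : D 1 = 0 := by
  have := hD.mul 1 1
  rw [mul_one, par_one, mul_one, one_mul] at this
  exact left_eq_add.1 this

lemma IsSDer.par {ε : Bool} {D : 𝓛} (hD : IsSDer ε D) (δ : Bool) (x : 𝓐) :
    par δ (D x) = sgn (ε && δ) • D (par δ x) := by
  cases δ
  · simp
  · rw [par_true, hD.map_parity]; simp

lemma IsSDer.isHom {ε η ζ : Bool} {D : 𝓛}
    (hD : IsSDer ε D) (hx : IsHom η x) (h : (ε ^^ η) = ζ := by rfl) : IsHom ζ (D x) := by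
  subst h
  unfold IsHom at *
  rw [hD.map_parity, hx, map_smul, smul_smul, sgn_xor]

lemma IsSDer.add {ε : Bool} {D D' : 𝓛}
    (hD : IsSDer ε D) (hD' : IsSDer ε D') : IsSDer ε (D + D') where
  mul x y := by
    simp only [add_app, hD.mul, hD'.mul, add_mul, mul_add]; abel
  frame f := by
    simp only [add_app, hD.frame, hD'.frame, add_mul, sum_add_distrib]
  map_parity x := by
    simp only [add_app, map_add, hD.map_parity, hD'.map_parity, smul_add]

lemma IsSDer.smul {ε : Bool} {D : 𝓛} (hD : IsSDer ε D) (r : ℝ) : IsSDer ε (r • D) where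
  mul x y := by
    simp only [smul_app, hD.mul, smul_add, smul_mul_assoc, mul_smul_comm]
  frame f := by
    simp only [smul_app, hD.frame, smul_sum, smul_mul_assoc]
  map_parity x := by
    simp only [smul_app, map_smul, hD.map_parity]
    rw [smul_comm]

lemma IsSDer.zero (ε : Bool) : IsSDer ε (0 : 𝓛) where
  mul x y := by simp
  frame f := by simp
  map_parity x := by simp

lemma IsSDer.sub {ε : Bool} {D D' : 𝓛}
    (hD : IsSDer ε D) (hD' : IsSDer ε D') : IsSDer ε (D - D') := by
  have h : D - D' = D + (-1 : ℝ) • D' := by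
    refine LinearMap.ext fun x => ?_
    rw [sub_app, add_app, smul_app, sub_eq_add_neg, neg_one_smul]
  rw [h]
  exact hD.add (hD'.smul (-1))

lemma IsSDer.sum {ε : Bool} {I : Type*} (s : Finset I) {D : I → 𝓛}
    (hD : ∀ i ∈ s, IsSDer ε (D i)) : IsSDer ε (∑ i ∈ s, D i) := by
  induction s using Finset.induction_on with
  | empty => simpa using IsSDer.zero ε
  | insert i s hi ih =>
    rw [sum_insert hi]
    exact (hD i (mem_insert_self _ _)).add (ih fun j hj => hD j (Finset.mem_insert_of_mem hj))

/-- Left multiples of superderivations. -/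
lemma IsSDer.lmul {ε η ζ : Bool} {D : 𝓛}
    (hD : IsSDer ε D) {q : 𝓐} (hq : IsHom η q) (h : (η ^^ ε) = ζ := by rfl) :
    IsSDer ζ (mulLeft ℝ q ∘ₗ D) where
  mul x y := by
    subst h
    simp only [comp_apply, mulLeft_apply, hD.mul, mul_add]
    rw [← mul_assoc, ← mul_assoc, hq.comm (EYM.par ε x), par_par, mul_assoc (EYM.par _ x)]
  frame f := by
    simp only [comp_apply, mulLeft_apply, hD.frame f, mul_sum, mul_assoc]
  map_parity x := by
    subst h
    simp only [comp_apply, mulLeft_apply, parity_mul, hD.map_parity, sgn_xor]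
    rw [hq, smul_mul_smul_comm]

/-- The supercommutator of operators of parities `ε` and `δ`. -/
def scomm (ε δ : Bool) (D D' : 𝓛) : 𝓛 := D ∘ₗ D' - sgn (ε && δ) • (D' ∘ₗ D)

lemma scomm_apply (ε δ : Bool) (D D' : 𝓛)
    (x : 𝓐) : scomm ε δ D D' x = D (D' x) - sgn (ε && δ) • D' (D x) := rfl

lemma IsSDer.scomm {ε δ ζ : Bool} {D D' : 𝓛}
    (hD : IsSDer ε D) (hD' : IsSDer δ D') (h : (ε ^^ δ) = ζ := by rfl) :
    IsSDer ζ (scomm ε δ D D') where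
  mul x y := by
    subst h
    simp only [scomm_apply, hD'.mul, map_add, hD.mul, hD.par δ x, hD'.par ε x, par_par,
      sub_mul, mul_sub, smul_add, smul_mul_assoc, mul_smul_comm]
    rw [Bool.xor_comm δ ε, Bool.and_comm δ ε, smul_smul, sgn_mul_self, one_smul]
    abel
  frame f := by
    have key : ∀ {ε δ : Bool} {D D' : 𝓛}, IsSDer ε D →
        IsSDer δ D' → D (D' (frameFun f)) = ∑ p, D (D' (gen (frameJet p))) * frameFun (pd p f) +
        ∑ p, ∑ q, sgn (ε && δ) •
          (D' (gen (frameJet p)) * D (gen (frameJet q)) * frameFun (pd q (pd p f))) := by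
      intro ε δ D D' hD hD'
      rw [hD'.frame, map_sum, ← sum_add_distrib]
      refine sum_ext fun p _ => ?_
      rw [hD.mul, hD'.par, gen_frame, par_frameFun, hD.frame (pd p f), mul_sum]
      congr 1
      refine sum_ext fun q _ => ?_
      rw [smul_mul_assoc, ← mul_assoc, Bool.and_comm]
    rw [scomm_apply, key hD hD', key hD' hD, smul_add, smul_sum, smul_sum,
      sum_comm (γ := Fin n × Fin n)
        (f := fun p q => sgn (ε && δ) • (D' (gen (frameJet p)) * D (gen (frameJet q)) *
          frameFun (pd q (pd p f))))]
    have h2 : ∀ p q, sgn (ε && δ) • (D' (gen (frameJet p)) * D (gen (frameJet q)) *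
        frameFun (pd q (pd p f))) = D (gen (frameJet q)) * D' (gen (frameJet p)) *
        frameFun (pd p (pd q f)) := fun p q => by
      have hp : IsHom δ (D' (gen (frameJet p))) :=
        hD'.isHom (isHom_gen (frameJet p)) (by simp [Var.isOdd, Fld.isOdd])
      have hq : IsHom ε (D (gen (frameJet q))) :=
        hD.isHom (isHom_gen (frameJet q)) (by simp [Var.isOdd, Fld.isOdd])
      rw [hq.comm, hp.par, pd_comm, smul_mul_assoc, smul_mul_assoc]
    simp only [h2, smul_sum, smul_smul]
    rw [Bool.and_comm δ ε, sgn_mul_self]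
    simp only [one_smul]
    rw [add_sub_add_right_eq_sub, ← sum_sub_distrib]
    refine sum_ext fun p _ => ?_
    rw [scomm_apply, sub_mul, smul_mul_assoc]
  map_parity x := by
    subst h
    simp only [scomm_apply, map_sub, map_smul, hD.map_parity, hD'.map_parity, smul_smul, smul_sub]
    rw [sgn_xor]
    congr 2; ring

/-! ## Partial derivatives and evolutionary derivations -/

lemma EvenFun.map_pd_mul (p : Fin n × Fin n) (k l : EvenFun n ι β φ) :
    EvenFun.map (pd p) LinearMap.id (k * l) =
      EvenFun.map (pd p) LinearMap.id k * l + k * EvenFun.map (pd p) LinearMap.id l := by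
  induction k using EvenFun.induction with
  | h0 => simp
  | h2 a b ha hb => rw [add_mul, map_add, ha, hb, map_add, add_mul, add_mul]; abel
  | h1 f P =>
    induction l using EvenFun.induction with
    | h0 => simp
    | h2 a b ha hb => rw [mul_add, map_add, ha, hb, map_add, mul_add, mul_add]; abel
    | h1 g Q =>
      rw [EvenFun.mk_mul, EvenFun.map_mk, EvenFun.map_mk, EvenFun.map_mk, EvenFun.mk_mul,
        EvenFun.mk_mul, pd_mul, EvenFun.mk_add_left]
      rfl

lemma EvenFun.map_pderiv_mul (i : 𝓙₀) (k l : EvenFun n ι β φ) :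
    EvenFun.map LinearMap.id (MvPolynomial.pderiv i).toLinearMap (k * l) =
      EvenFun.map LinearMap.id (MvPolynomial.pderiv i).toLinearMap k * l +
        k * EvenFun.map LinearMap.id (MvPolynomial.pderiv i).toLinearMap l := by
  induction k using EvenFun.induction with
  | h0 => simp
  | h2 a b ha hb => rw [add_mul, map_add, ha, hb, map_add, add_mul, add_mul]; abel
  | h1 f P =>
    induction l using EvenFun.induction with
    | h0 => simp
    | h2 a b ha hb => rw [mul_add, map_add, ha, hb, map_add, mul_add, mul_add]; abel
    | h1 g Q =>
      rw [EvenFun.mk_mul, EvenFun.map_mk, EvenFun.map_mk, EvenFun.map_mk, EvenFun.mk_mul,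
        EvenFun.mk_mul]
      simp only [LinearMap.id_coe, id_eq]
      rw [← EvenFun.mk_add_right]
      congr 1
      change MvPolynomial.pderiv i (P * Q) = MvPolynomial.pderiv i P * Q + P * MvPolynomial.pderiv i Q
      rw [Derivation.leibniz, smul_eq_mul, smul_eq_mul]
      ring

lemma dL_mul (z : 𝓙) (x y : 𝓐) : dL z (x * y) = dL z x * y + par z.1.isOdd x * dL z y := by
  induction x using induction_on with
  | zero => simp
  | add a b ha hb => rw [add_mul, map_add, ha, hb, map_add, map_add, add_mul, add_mul]; abel
  | tmul k v =>
    induction y using induction_on with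
    | zero => simp
    | add a b ha hb => rw [mul_add, map_add, ha, hb, map_add, mul_add, mul_add]; abel
    | tmul l w =>
      rcases jet_cases z with h | ⟨p, rfl⟩ | h
      · rw [dL_odd h, h, par_true, parity_tmul, tmul_mul_tmul,
          map_tmul, map_tmul, map_tmul,
          tmul_mul_tmul, tmul_mul_tmul,
          Grassmann.dL_mul, tmul_add]
        rfl
      · rw [dL_frame, show Var.isOdd (frameJet p : 𝓙).1 = false from rfl, par_false,
          tmul_mul_tmul, map_tmul, map_tmul,
          map_tmul, tmul_mul_tmul,
          tmul_mul_tmul, EvenFun.map_pd_mul, add_tmul]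
        rfl
      · rw [dL_even h, h.1, par_false, tmul_mul_tmul,
          map_tmul, map_tmul, map_tmul,
          tmul_mul_tmul, tmul_mul_tmul,
          EvenFun.map_pderiv_mul, add_tmul]
        rfl

lemma pd_frameCoord (p q : Fin n × Fin n) : pd p (frameCoord q) = if p = q then 1 else 0 := by
  ext x
  rw [pd_apply_of_eqOn p (frameCoord q) (fun y => y q) (fun y => rfl) x]
  have : HasFDerivAt (fun y : Fin n × Fin n → ℝ => y q)
      (ContinuousLinearMap.proj (R := ℝ) (φ := fun _ : Fin n × Fin n => ℝ) q) (x : Fin n × Fin n → ℝ) :=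
    (ContinuousLinearMap.proj (R := ℝ) (φ := fun _ : Fin n × Fin n => ℝ) q).hasFDerivAt
  rw [this.fderiv]
  by_cases h : p = q
  · subst h; simp
  · simp [h, Ne.symm h]

lemma dL_frameFun_frame (p : Fin n × Fin n) (f : 𝓒) :
    dL (frameJet p : 𝓙) (frameFun f) = frameFun (pd p f) := by
  rw [dL_frame]; rfl

lemma dL_frameFun_of_ne {z : 𝓙} (hz : ∀ p, z ≠ frameJet p) (f : 𝓒) :
    dL z (frameFun f : 𝓐) = 0 := by
  rcases jet_cases z with h | ⟨p, rfl⟩ | h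
  · rw [dL_odd h, frameFun_tmul, map_tmul]
    have := dL_algebraMap (⟨z, h⟩ : 𝓙₁) 1
    rw [map_one] at this
    rw [this, tmul_zero]
  · exact absurd rfl (hz p)
  · rw [dL_even h, frameFun_tmul, map_tmul, EvenFun.map_mk]
    have : ((MvPolynomial.pderiv (⟨z, h⟩ : 𝓙₀)).toLinearMap
        (1 : MvPolynomial 𝓙₀ ℝ)) = 0 :=
      (MvPolynomial.pderiv (⟨z, h⟩ : 𝓙₀)).map_one_eq_zero
    rw [this, EvenFun.mk_zero, zero_tmul]

lemma dL_gen (z w : 𝓙) : dL z (gen w : 𝓐) = if z = w then 1 else 0 := by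
  by_cases hzw : z = w
  · subst hzw
    rw [if_pos rfl]
    rcases jet_cases z with h | ⟨p, rfl⟩ | h
    · rw [dL_odd h, gen_odd h, map_tmul, ggen, dL_lin]
      simp [Algebra.TensorProduct.one_def]
    · rw [gen_frame, dL_frameFun_frame, pd_frameCoord, if_pos rfl, map_one]
    · rw [dL_even h, gen_even h, map_tmul, EvenFun.map_mk]
      have : ((MvPolynomial.pderiv (⟨z, h⟩ : 𝓙₀)).toLinearMap
        (MvPolynomial.X (⟨z, h⟩ : 𝓙₀) : MvPolynomial 𝓙₀ ℝ)) = 1 :=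
        MvPolynomial.pderiv_X_self _
      rw [this]
      rfl
  · rw [if_neg hzw]
    rcases jet_cases w with hw | ⟨q, rfl⟩ | hw
    · rcases jet_cases z with h | ⟨p, rfl⟩ | h
      · rw [dL_odd h, gen_odd hw, map_tmul, ggen, dL_lin,
          single_apply, if_neg (by simpa using Ne.symm hzw)]
        simp
      · rw [dL_frame, gen_odd hw, map_tmul]
        have : EvenFun.map (pd p) LinearMap.id (1 : EvenFun n ι β φ) = 0 := by
          rw [EvenFun.one_def, EvenFun.map_mk, pd_one, EvenFun.zero_mk]
        rw [this, zero_tmul]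
      · rw [dL_even h, gen_odd hw, map_tmul]
        have : EvenFun.map LinearMap.id (MvPolynomial.pderiv (⟨z, h⟩ : 𝓙₀)).toLinearMap
            (1 : EvenFun n ι β φ) = 0 := by
          rw [EvenFun.one_def, EvenFun.map_mk]
          have : ((MvPolynomial.pderiv (⟨z, h⟩ : 𝓙₀)).toLinearMap
              (1 : MvPolynomial 𝓙₀ ℝ)) = 0 :=
            (MvPolynomial.pderiv (⟨z, h⟩ : 𝓙₀)).map_one_eq_zero
          rw [this, EvenFun.mk_zero]
        rw [this, zero_tmul]
    · by_cases hz : ∃ p, z = frameJet p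
      · obtain ⟨p, rfl⟩ := hz
        rw [gen_frame, dL_frameFun_frame, pd_frameCoord, if_neg, map_zero]
        rintro rfl
        exact hzw rfl
      · push Not at hz
        rw [gen_frame, dL_frameFun_of_ne hz]
    · rcases jet_cases z with h | ⟨p, rfl⟩ | h
      · rw [dL_odd h, gen_even hw, map_tmul]
        have := dL_algebraMap (⟨z, h⟩ : 𝓙₁) 1
        rw [map_one] at this
        rw [this, tmul_zero]
      · rw [dL_frame, gen_even hw, map_tmul, EvenFun.map_mk, pd_one, EvenFun.zero_mk, zero_tmul]
      · rw [dL_even h, gen_even hw, map_tmul, EvenFun.map_mk]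
        have : ((MvPolynomial.pderiv (⟨z, h⟩ : 𝓙₀)).toLinearMap
            (MvPolynomial.X (⟨w, hw⟩ : 𝓙₀) : MvPolynomial 𝓙₀ ℝ)) = 0 :=
          MvPolynomial.pderiv_X_of_ne (by simpa using Ne.symm hzw)
        rw [this, EvenFun.mk_zero, zero_tmul]

lemma dL_gen_self (z : 𝓙) : dL z (gen z : 𝓐) = 1 := by
  rw [dL_gen, if_pos rfl]

lemma dL_gen_of_ne {z w : 𝓙} (h : z ≠ w) : dL z (gen w : 𝓐) = 0 := by
  rw [dL_gen, if_neg h]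

lemma isSDer_dL (z : 𝓙) : IsSDer z.1.isOdd (dL z) where
  mul := dL_mul z
  frame f := by
    by_cases hz : ∃ p, z = frameJet p
    · obtain ⟨p, rfl⟩ := hz
      rw [dL_frameFun_frame, sum_eq_single p, dL_gen_self, one_mul]
      · intro q _ hq
        rw [dL_gen_of_ne, zero_mul]
        intro h
        simp only [Prod.mk.injEq, Var.fld.injEq, Fld.e.injEq, and_true] at h
        exact hq (Prod.ext h.1.symm h.2.symm)
      · simp
    · push Not at hz
      rw [dL_frameFun_of_ne hz]
      refine (sum_eq_zero fun p _ => ?_).symm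
      rw [dL_gen_of_ne (hz p), zero_mul]
  map_parity x := by
    induction x using induction_on with
    | zero => simp
    | add a b ha hb => rw [map_add, map_add, ha, hb, map_add, map_add, smul_add]
    | tmul k v =>
      rcases jet_cases z with h | ⟨p, rfl⟩ | h
      · rw [dL_odd h, parity_tmul, map_tmul, map_tmul, parity_tmul, parity_dL, h, tmul_neg]
        simp
      · rw [dL_frame, parity_tmul, map_tmul, map_tmul, parity_tmul]
        simp [Var.isOdd, Fld.isOdd]
      · rw [dL_even h, parity_tmul, map_tmul, map_tmul, parity_tmul, h.1]
        simp

lemma dR_eq (z : 𝓙) (x : 𝓐) : dR z x = par z.1.isOdd (dL z x) := by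
  unfold dR
  split_ifs with h
  · rw [dL_odd h, h, par_true]
    induction x using induction_on with
    | zero => simp
    | add a b ha hb => rw [map_add, map_add, ha, hb, map_add]
    | tmul k v =>
      rw [map_tmul, map_tmul, parity_tmul, Grassmann.dR_eq]
  · rw [show z.1.isOdd = false by simpa using h, par_false]

lemma evol_apply (Q : 𝓙 → 𝓐) (x : 𝓐) : evol Q x = ∑ᶠ z, Q z * dL z x := rfl

/-- `evol` as a finite sum over any finite set containing the relevant coordinates. -/
lemma evol_eq_sum (Q : 𝓙 → 𝓐) (x : 𝓐) (s : Finset 𝓙) (hs : ∀ z, z ∉ s → Q z * dL z x = 0) :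
    evol Q x = ∑ z ∈ s, Q z * dL z x := finsum_eq_sum_of_support_subset _ fun z hz => by
    by_contra h
    exact hz (hs z h)

lemma evol_gen (Q : 𝓙 → 𝓐) (z : 𝓙) : evol Q (gen z) = Q z := by
  rw [evol_eq_sum Q (gen z) {z}, Finset.sum_singleton, dL_gen_self, mul_one]
  intro w hw
  rw [dL_gen_of_ne (by simpa using hw), mul_zero]

lemma isSDer_evol {ε : Bool} {Q : 𝓙 → 𝓐}
    (hQ : ∀ z, IsHom (ε ^^ z.1.isOdd) (Q z)) : IsSDer ε (evol Q) := by
  have hd : ∀ z, IsSDer ε (mulLeft ℝ (Q z) ∘ₗ dL z) := fun z =>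
    (isSDer_dL z).lmul (hQ z) (by cases ε <;> cases z.1.isOdd <;> rfl)
  have key : ∀ s : Finset 𝓐, ∃ D : 𝓛, IsSDer ε D ∧ ∀ x ∈ s, evol Q x = D x := fun s => by
    refine ⟨∑ z ∈ s.biUnion fun x => (dL_finite x).toFinset, mulLeft ℝ (Q z) ∘ₗ dL z,
      IsSDer.sum _ fun z _ => hd z, fun x hx => ?_⟩
    rw [sum_app]
    refine evol_eq_sum Q x _ fun z hz => ?_
    have : dL z x = 0 := by
      by_contra h
      exact hz (Finset.mem_biUnion.2 ⟨x, hx, by simpa using h⟩)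
    rw [this, mul_zero]
  constructor
  · intro x y
    obtain ⟨D, hD, h⟩ := key {x, y, x * y}
    rw [h _ (by simp), h x (by simp), h y (by simp), hD.mul]
  · intro f
    obtain ⟨D, hD, h⟩ := key (insert (frameFun f) (Finset.univ.image fun p => gen (frameJet p)))
    rw [h _ (by simp), hD.frame]
    refine sum_ext fun p _ => ?_
    rw [h _ (by simp)]
  · intro x
    obtain ⟨D, hD, h⟩ := key {x, parity x}
    rw [h x (by simp), h (parity x) (by simp), hD.map_parity]

end SuperDer

/-! ## Total derivatives -/

section TotalD

lemma isSDer_totalD (μ : Fin n) : IsSDer false (totalD μ : 𝓐 →ₗ[ℝ] _) := isSDer_evol fun z => by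
    rw [Bool.false_xor]
    exact isHom_gen (z.1, z.2 + single μ 1)

lemma totalD_gen (μ : Fin n) (z : 𝓙) :
    totalD μ (gen z) = gen (z.1, z.2 + single μ 1) := evol_gen _ z

lemma totalD_mul (μ : Fin n) (x y : 𝓐) :
    totalD μ (x * y) = totalD μ x * y + x * totalD μ y := (isSDer_totalD μ).mul x y

lemma totalD_one (μ : Fin n) : totalD μ (1 : 𝓐) = 0 := (isSDer_totalD μ).map_one

/-- Even derivations agreeing up to commutators on the generators commute. -/
lemma IsSDer.comp_comm {ε δ : Bool} {D D' : 𝓛} (hD : IsSDer ε D) (hD' : IsSDer δ D')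
    (h : ∀ z, D (D' (gen z)) = sgn (ε && δ) • D' (D (gen z))) (x : 𝓐) :
    D (D' x) = sgn (ε && δ) • D' (D x) := by
  have := (hD.scomm hD' rfl).ext (IsSDer.zero _) fun z => by
    rw [scomm_apply, h, sub_self, zero_app]
  have h2 := LinearMap.congr_fun this x
  rw [scomm_apply, zero_app] at h2
  exact sub_eq_zero.1 h2

lemma totalD_comm (μ ν : Fin n) (x : 𝓐) : totalD μ (totalD ν x) = totalD ν (totalD μ x) := by
  have := (isSDer_totalD μ).comp_comm (isSDer_totalD ν) (ι := ι) (β := β) (φ := φ) (fun z => by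
      simp only [totalD_gen, Bool.and_false, sgn_false, one_smul]
      rw [add_right_comm]) x
  simpa using this

lemma iterD_zero (x : 𝓐) : iterD 0 x = x := by
  have : (iterD 0 : End ℝ 𝓐) = 1 := by
    unfold iterD
    apply List.prod_eq_one
    intro T hT
    rw [List.mem_map] at hT
    obtain ⟨μ, _, rfl⟩ := hT
    simp
  rw [this]; rfl

lemma iterD_add_single (α : 𝓜) (μ : Fin n) (x : 𝓐) :
    iterD (α + single μ 1) x = totalD μ (iterD α x) := by
  have hc : ∀ μ ν : Fin n, Commute (totalD μ : End ℝ 𝓐) (totalD ν) :=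
    fun μ ν => LinearMap.ext fun x => totalD_comm μ ν x
  have key : ∀ l : List (Fin n), l.Nodup →
      (l.map fun ν => (totalD ν : End ℝ 𝓐) ^ ((α + single μ 1 : 𝓜) ν)).prod =
      (if μ ∈ l then (totalD μ : End ℝ 𝓐) else 1) *
      (l.map fun ν => (totalD ν : End ℝ 𝓐) ^ α ν).prod := fun l => by
    induction l with
    | nil => simp
    | cons a l ih =>
      intro hl
      rw [List.nodup_cons] at hl
      rw [List.map_cons, List.prod_cons, List.map_cons, List.prod_cons, ih hl.2]
      by_cases ha : μ = a
      · subst ha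
        rw [if_neg hl.1, if_pos (by simp), one_mul, Finsupp.add_apply, Finsupp.single_eq_same,
          pow_succ', mul_assoc]
      · have : (α + single μ 1 : 𝓜) a = α a := by
          rw [Finsupp.add_apply, Finsupp.single_eq_of_ne (Ne.symm ha), add_zero]
        rw [this]
        by_cases hm : μ ∈ l
        · rw [if_pos hm, if_pos (by simp [hm]), ← mul_assoc, ← mul_assoc,
            ((hc μ a).pow_right (α a)).eq]
        · rw [if_neg hm, if_neg (by simp [hm, ha]), one_mul, one_mul]
  have := key (List.finRange n) (List.nodup_finRange n)
  rw [if_pos (List.mem_finRange μ)] at this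
  exact LinearMap.congr_fun this x

/-- Induction on multi-indices, one derivative at a time. -/
lemma multiIndex_induction {p : 𝓜 → Prop} (h0 : p 0)
    (h1 : ∀ α μ, p α → p (α + single μ 1)) (α : 𝓜) : p α := by
  have key : ∀ β, p β → p (β + α) := by
    induction α using induction_linear with
    | zero => intro β hβ; rwa [add_zero]
    | add f g hf hg => intro β hβ; rw [← add_assoc]; exact hg _ (hf _ hβ)
    | single a b =>
      induction b with
      | zero => intro β hβ; rwa [Finsupp.single_zero, add_zero]
      | succ b ih => intro β hβ; rw [Finsupp.single_add, ← add_assoc]; exact h1 _ _ (ih β hβ)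
  simpa using key 0 h0

lemma iterD_comm_of_comm {T : 𝓛}
    (hT : ∀ μ x, T (totalD μ x) = totalD μ (T x)) (α : 𝓜) (x : 𝓐) :
    T (iterD α x) = iterD α (T x) := by
  induction α using multiIndex_induction with
  | h0 => rw [iterD_zero, iterD_zero]
  | h1 α μ ih => rw [iterD_add_single, iterD_add_single, hT, ih]

lemma iterD_totalD (α : 𝓜) (μ : Fin n) (x : 𝓐) : iterD α (totalD μ x) = totalD μ (iterD α x) :=
  (iterD_comm_of_comm (fun ν y => totalD_comm μ ν y) α x).symm

lemma iterD_gen (α : 𝓜) (z : 𝓙) : iterD α (gen z) = gen (z.1, z.2 + α) := by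
  induction α using multiIndex_induction with
  | h0 => rw [iterD_zero, add_zero]
  | h1 α μ ih => rw [iterD_add_single, ih, totalD_gen, add_assoc]

lemma par_totalD (ε : Bool) (μ : Fin n) (x : 𝓐) : par ε (totalD μ x) = totalD μ (par ε x) := by
  rw [(isSDer_totalD μ).par]; simp

lemma par_iterD (ε : Bool) (α : 𝓜) (x : 𝓐) : par ε (iterD α x) = iterD α (par ε x) :=
  iterD_comm_of_comm (fun μ x => par_totalD ε μ x) α x

lemma IsHom.totalD {η : Bool} (hx : IsHom η x) (μ : Fin n) :
    IsHom η (totalD μ x) := (isSDer_totalD μ).isHom hx (by simp)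

lemma IsHom.iterD {η : Bool} (hx : IsHom η x) (α : 𝓜) : IsHom η (iterD α x) := by
  induction α using multiIndex_induction with
  | h0 => rwa [iterD_zero]
  | h1 α μ ih => rw [iterD_add_single]; exact ih.totalD μ

lemma dL_totalD_succ (Z : 𝓥) (γ : 𝓜) (μ : Fin n) (x : 𝓐) : dL (Z, γ + single μ 1) (totalD μ x) =
      totalD μ (dL (Z, γ + single μ 1) x) + dL (Z, γ) x := by
  have h1 := (isSDer_dL (Z, γ + single μ 1)).scomm
    (isSDer_totalD μ (ι := ι) (β := β) (φ := φ)) (by rw [Bool.xor_false])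
  have := h1.ext (isSDer_dL (Z, γ)) fun w => by
    rw [scomm_apply, totalD_gen]
    by_cases h : (Z, γ) = w
    · subst h
      rw [dL_gen_self, dL_gen_self, dL_gen_of_ne, map_zero, smul_zero, sub_zero]
      intro h
      have := congrArg (fun z => z.2 μ) h
      simp at this
    · rw [dL_gen_of_ne h, dL_gen_of_ne]
      · have : totalD μ (dL (Z, γ + single μ 1) (gen w : 𝓐)) = 0 := by
          by_cases h' : (Z, γ + single μ 1) = w
          · rw [← h', dL_gen_self, totalD_one]
          · rw [dL_gen_of_ne h', map_zero]
        rw [this, smul_zero, sub_zero]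
      · intro h'
        apply h
        simp only [Prod.mk.injEq, add_left_inj] at h'
        exact Prod.ext h'.1 h'.2
  have := LinearMap.congr_fun this x
  rw [scomm_apply] at this
  simp only [Bool.and_false, sgn_false, one_smul] at this
  rw [← this]; abel

lemma dL_totalD_zero (Z : 𝓥) (γ : 𝓜) (μ : Fin n) (hγ : γ μ = 0)
    (x : 𝓐) : dL (Z, γ) (totalD μ x) = totalD μ (dL (Z, γ) x) := by
  have := (isSDer_dL (Z, γ)).comp_comm (isSDer_totalD μ (ι := ι) (β := β) (φ := φ)) (fun w => by
    have : totalD μ (dL (Z, γ) (gen w : 𝓐)) = 0 := by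
      by_cases h' : (Z, γ) = w
      · rw [← h', dL_gen_self, totalD_one]
      · rw [dL_gen_of_ne h', map_zero]
    rw [this, smul_zero, totalD_gen, dL_gen_of_ne]
    intro h
    have := congrArg (fun z => z.2 μ) h
    simp [hγ] at this) x
  simpa using this

lemma exists_eq_add_single {γ : 𝓜} {μ : Fin n} (h : γ μ ≠ 0) : ∃ γ', γ = γ' + single μ 1 :=
  ⟨γ - single μ 1, by
    ext ν
    by_cases hν : ν = μ
    · subst hν; simp; omega
    · simp [Finsupp.single_eq_of_ne hν]⟩

end TotalD

/-! ## Euler–Lagrange derivatives -/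

section Euler

/-- `∑_α (-1)^{|α|} ∂^α ((∂^L q/∂(∂^α Z)) h)`. -/
def adj (Z : 𝓥) (q h : 𝓐) : 𝓐 := ∑ᶠ α : 𝓜, (-1 : ℝ) ^ α.degree • iterD α (dL (Z, α) q * h)

lemma adj_finite (Z : 𝓥) (q : 𝓐) : {α : 𝓜 | dL (Z, α) q ≠ 0}.Finite :=
  (dL_finite q).preimage fun _ _ _ _ h => (Prod.mk.inj h).2

lemma adj_eq_sum (Z : 𝓥) (q h : 𝓐) (s : Finset 𝓜) (hs : ∀ α, α ∉ s → dL (Z, α) q = 0) :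
    adj Z q h = ∑ α ∈ s, (-1 : ℝ) ^ α.degree • iterD α (dL (Z, α) q * h) :=
  finsum_eq_sum_of_support_subset _ fun α hα => by
    by_contra h'
    refine hα ?_
    dsimp only
    rw [hs α h', zero_mul, map_zero, smul_zero]

lemma adj_add_left (Z : 𝓥) (q q' h : 𝓐) : adj Z (q + q') h = adj Z q h + adj Z q' h := by
  set s := (adj_finite Z q).toFinset ∪ (adj_finite Z q').toFinset
  have h1 : ∀ α ∉ s, dL (Z, α) q = 0 := by
    intro α hα; by_contra h; exact hα (mem_union_left _ (by simpa using h))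
  have h2 : ∀ α ∉ s, dL (Z, α) q' = 0 := by
    intro α hα; by_contra h; exact hα (mem_union_right _ (by simpa using h))
  rw [adj_eq_sum Z q h s h1, adj_eq_sum Z q' h s h2,
    adj_eq_sum Z (q + q') h s fun α hα => by rw [map_add, h1 α hα, h2 α hα, add_zero],
    ← sum_add_distrib]
  refine sum_ext fun α _ => ?_
  rw [map_add, add_mul, map_add, smul_add]

lemma adj_smul_left (Z : 𝓥) (r : ℝ) (q h : 𝓐) : adj Z (r • q) h = r • adj Z q h := by
  have h1 : ∀ α ∉ (adj_finite Z q).toFinset, dL (Z, α) q = 0 := by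
    intro α hα; by_contra h; exact hα (by simpa using h)
  rw [adj_eq_sum Z q h _ h1, adj_eq_sum Z (r • q) h _ fun α hα => by rw [map_smul, h1 α hα, smul_zero],
    smul_sum]
  refine sum_ext fun α _ => ?_
  rw [map_smul, smul_mul_assoc, map_smul, smul_comm]

lemma adj_add_right (Z : 𝓥) (q h h' : 𝓐) : adj Z q (h + h') = adj Z q h + adj Z q h' := by
  have h1 : ∀ α ∉ (adj_finite Z q).toFinset, dL (Z, α) q = 0 := by
    intro α hα; by_contra h; exact hα (by simpa using h)
  rw [adj_eq_sum Z q h _ h1, adj_eq_sum Z q h' _ h1, adj_eq_sum Z q _ _ h1, ← sum_add_distrib]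
  refine sum_ext fun α _ => ?_
  rw [mul_add, map_add, smul_add]

lemma adj_smul_right (Z : 𝓥) (r : ℝ) (q h : 𝓐) : adj Z q (r • h) = r • adj Z q h := by
  have h1 : ∀ α ∉ (adj_finite Z q).toFinset, dL (Z, α) q = 0 := by
    intro α hα; by_contra h; exact hα (by simpa using h)
  rw [adj_eq_sum Z q h _ h1, adj_eq_sum Z q _ _ h1, smul_sum]
  refine sum_ext fun α _ => ?_
  rw [mul_smul_comm, map_smul, smul_comm]

/-- The bilinear map `(q, h) ↦ adj Z q h`. -/
def adjL (Z : 𝓥) : 𝓐 →ₗ[ℝ] 𝓛 :=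
  LinearMap.mk₂ ℝ (adj Z) (adj_add_left Z) (adj_smul_left Z) (adj_add_right Z)
    (fun r q h => adj_smul_right Z r q h)

lemma adjL_apply (Z : 𝓥) (q h : 𝓐) : adjL Z q h = adj Z q h := rfl

/-- Integration by parts. -/
lemma adj_totalD (Z : 𝓥) (μ : Fin n) (q h : 𝓐) :
    adj Z (totalD μ q) h = -adj Z q (totalD μ h) := by
  set s := (adj_finite Z q).toFinset with hs
  have h1 : ∀ α ∉ s, dL (Z, α) q = 0 := by
    intro α hα; by_contra h; exact hα (by simpa [hs] using h)
  set e : 𝓜 ↪ 𝓜 := addRightEmbedding (single μ 1) with he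
  set t := s ∪ s.map e with ht
  have h3 : ∀ α ∉ t, dL (Z, α) (totalD μ q) = 0 := fun α hα => by
    rw [ht, Finset.mem_union, not_or] at hα
    by_cases hμ : α μ = 0
    · rw [dL_totalD_zero Z α μ hμ, h1 α hα.1, map_zero]
    · obtain ⟨γ, rfl⟩ := exists_eq_add_single hμ
      rw [dL_totalD_succ, h1 _ hα.1, map_zero, zero_add]
      apply h1
      intro hγ
      exact hα.2 (Finset.mem_map_of_mem e hγ)
  have h4 : ∀ α, dL (Z, α) (totalD μ q) = totalD μ (dL (Z, α) q) +
      (if α μ = 0 then 0 else dL (Z, α - single μ 1) q) := fun α => by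
    split_ifs with hμ
    · rw [dL_totalD_zero Z α μ hμ, add_zero]
    · obtain ⟨γ, rfl⟩ := exists_eq_add_single hμ
      rw [dL_totalD_succ, add_tsub_cancel_right]
  rw [adj_eq_sum Z _ h t h3]
  have h5 : ∑ α ∈ t, (-1 : ℝ) ^ α.degree • iterD α ((if α μ = 0 then 0 else
      dL (Z, α - single μ 1) q) * h) =
      ∑ α ∈ s, (-1 : ℝ) ^ (α.degree + 1) • totalD μ (iterD α (dL (Z, α) q * h)) := by
    rw [← sum_subset (Finset.subset_union_right : s.map e ⊆ t), sum_map]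
    · refine sum_ext fun α _ => ?_
      simp only [he, addRightEmbedding_apply]
      rw [if_neg (by simp), add_tsub_cancel_right, iterD_add_single, map_add, degree_single]
    · intro α _ hα
      split_ifs with hμ
      · rw [zero_mul, map_zero, smul_zero]
      · obtain ⟨γ, rfl⟩ := exists_eq_add_single hμ
        rw [add_tsub_cancel_right, h1, zero_mul, map_zero, smul_zero]
        intro hγ
        exact hα (Finset.mem_map_of_mem e hγ)
  simp only [h4, add_mul, map_add, smul_add]
  rw [sum_add_distrib, h5, adj_eq_sum Z q _ s h1,
    ← sum_subset (Finset.subset_union_left : s ⊆ t), ← sum_add_distrib, ← sum_neg_distrib]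
  · refine sum_ext fun α _ => ?_
    rw [← iterD_totalD, totalD_mul, map_add, pow_succ, mul_neg_one, neg_smul, smul_add]
    abel
  · intro α _ hα
    rw [h1 α hα, map_zero, zero_mul, map_zero, smul_zero]

lemma adj_iterD (Z : 𝓥) (α : 𝓜) (q h : 𝓐) :
    adj Z (iterD α q) h = (-1 : ℝ) ^ α.degree • adj Z q (iterD α h) := by
  induction α using multiIndex_induction generalizing h with
  | h0 => simp [iterD_zero]
  | h1 α μ ih =>
    rw [iterD_add_single, adj_totalD, ih, iterD_totalD, ← iterD_add_single,
      map_add, degree_single, pow_succ, mul_neg_one, neg_smul]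

/-- The left Euler–Lagrange derivative. -/
def eulerL (Z : 𝓥) (f : 𝓐) : 𝓐 := adj Z f 1

lemma eulerL_totalD (Z : 𝓥) (μ : Fin n) (k : 𝓐) : eulerL Z (totalD μ k) = 0 := by
  rw [eulerL, adj_totalD, totalD_one, ← adjL_apply, map_zero, neg_zero]

lemma euler_eq (Z : 𝓥) (f : 𝓐) : euler Z f = par Z.isOdd (eulerL Z f) := by
  rw [eulerL, adj_eq_sum Z f 1 (adj_finite Z f).toFinset (fun α hα => by
    by_contra h; exact hα (by simpa using h)), map_sum]
  unfold euler
  rw [finsum_eq_sum_of_support_subset (s := (adj_finite Z f).toFinset)]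
  · refine sum_ext fun α _ => ?_
    rw [map_smul, par_iterD, mul_one, dR_eq]
  · intro α hα
    by_contra h
    apply hα
    have : dL (Z, α) f = 0 := by simpa using h
    dsimp only
    rw [dR_eq, this, map_zero, map_zero, smul_zero]

lemma adj_isHom {Z : 𝓥} {η η' ζ : Bool} {q h : 𝓐} (hq : IsHom η q)
    (hh : IsHom η' h) (e : ((Z.isOdd ^^ η) ^^ η') = ζ) : IsHom ζ (adj Z q h) := by
  rw [adj_eq_sum Z q h (adj_finite Z q).toFinset (fun α hα => by
    by_contra h; exact hα (by simpa using h))]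
  exact IsHom.sum fun α _ => ((((isSDer_dL (Z, α)).isHom hq rfl).mul hh e).iterD α).smul _

lemma eulerL_isHom {Z : 𝓥} {η ζ : Bool} {f : 𝓐} (hf : IsHom η f)
    (e : (Z.isOdd ^^ η) = ζ) : IsHom ζ (eulerL Z f) :=
  adj_isHom hf isHom_one (by rw [e, Bool.xor_false])

/-- The Euler–Lagrange derivatives of an evolutionary variation. -/
lemma eulerL_evol [Fintype ι] [Fintype β] [Fintype φ] {Q : 𝓥 → 𝓐}
    (hQ : ∀ Z, IsHom (!Z.isOdd) (Q Z)) (Z : 𝓥) (f : 𝓐) :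
    eulerL Z (evol (fun z => iterD z.2 (Q z.1)) f) =
      sgn Z.isOdd • evol (fun z => iterD z.2 (Q z.1)) (eulerL Z f) +
        ∑ W, adj Z (Q W) (eulerL W f) := by
  set γ : 𝓛 := evol (fun z => iterD z.2 (Q z.1)) with hγdef
  have hγ : IsSDer true γ := isSDer_evol fun z => by
    rw [Bool.true_xor]; exact (hQ z.1).iterD z.2
  have hγg : ∀ z, γ (gen z) = iterD z.2 (Q z.1) := fun z => evol_gen _ z
  have hγD : ∀ μ x, γ (totalD μ x) = totalD μ (γ x) := fun μ x => by
    have := hγ.comp_comm (isSDer_totalD μ (ι := ι) (β := β) (φ := φ)) (fun z => by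
      rw [totalD_gen, hγg, hγg, iterD_add_single]; simp) x
    simpa using this
  set t := (dL_finite f).toFinset.image Prod.snd with ht
  have ht1 : ∀ W α, α ∉ t → dL (W, α) f = 0 := fun W α hα => by
    by_contra h
    exact hα (Finset.mem_image.2 ⟨(W, α), by simpa using h, rfl⟩)
  set S : Finset 𝓙 := univ ×ˢ t with hS
  have hev : ∀ q : 𝓙 → 𝓐, evol q f = ∑ w ∈ S, q w * dL w f :=
    fun q => evol_eq_sum q f S fun w hw => by
      rw [ht1 w.1 w.2 fun h => hw (Finset.mem_product.2 ⟨mem_univ _, h⟩), mul_zero]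
  have hc : ∀ α, dL (Z, α) (γ f) = sgn Z.isOdd • γ (dL (Z, α) f) +
      ∑ w ∈ S, dL (Z, α) (iterD w.2 (Q w.1)) * dL w f := fun α => by
    rw [← hev fun w => dL (Z, α) (iterD w.2 (Q w.1))]
    have h2 := ((isSDer_dL (Z, α)).scomm hγ (ζ := !Z.isOdd) (by rw [Bool.xor_true])).ext
      (isSDer_evol (ε := !Z.isOdd) (Q := fun w => dL (Z, α) (iterD w.2 (Q w.1))) fun w =>
        (isSDer_dL (Z, α)).isHom ((hQ w.1).iterD w.2) (by
          cases Z.isOdd <;> cases w.1.isOdd <;> rfl)) fun w => by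
      rw [evol_gen, scomm_apply, hγg]
      have : γ (dL (Z, α) (gen w : 𝓐)) = 0 := by
        by_cases h' : (Z, α) = w
        · rw [← h', dL_gen_self, hγ.map_one]
        · rw [dL_gen_of_ne h', map_zero]
      rw [this, smul_zero, sub_zero]
    have h3 := LinearMap.congr_fun h2 f
    rw [scomm_apply, Bool.and_true] at h3
    rw [← h3]; abel
  set s := (adj_finite Z f).toFinset ∪ (adj_finite Z (γ f)).toFinset ∪
    S.biUnion fun w => (adj_finite Z (iterD w.2 (Q w.1))).toFinset with hs
  have hs1 : ∀ α ∉ s, dL (Z, α) f = 0 := fun α hα => by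
    by_contra h
    exact hα (mem_union_left _ (mem_union_left _ (by simpa using h)))
  have hs2 : ∀ α ∉ s, dL (Z, α) (γ f) = 0 := fun α hα => by
    by_contra h
    exact hα (mem_union_left _ (mem_union_right _ (by simpa using h)))
  have hs3 : ∀ w ∈ S, ∀ α ∉ s, dL (Z, α) (iterD w.2 (Q w.1)) = 0 := fun w hw α hα => by
    by_contra h
    exact hα (mem_union_right _ (Finset.mem_biUnion.2 ⟨w, hw, by simpa using h⟩))
  have e1 : ∑ W, adj Z (Q W) (eulerL W f) = ∑ w ∈ S, adj Z (iterD w.2 (Q w.1)) (dL w f) := by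
    rw [hS, Finset.sum_product]
    refine sum_ext fun W _ => ?_
    rw [eulerL, adj_eq_sum W f 1 t (ht1 W), ← adjL_apply, map_sum]
    refine sum_ext fun α _ => ?_
    rw [adj_iterD, map_smul, adjL_apply, mul_one]
  have e2 : ∀ w ∈ S, adj Z (iterD w.2 (Q w.1)) (dL w f) = ∑ α ∈ s, (-1 : ℝ) ^ α.degree •
      iterD α (dL (Z, α) (iterD w.2 (Q w.1)) * dL w f) := fun w hw =>
    adj_eq_sum Z _ _ s (hs3 w hw)
  rw [e1, sum_ext e2, sum_comm, eulerL, eulerL, adj_eq_sum Z _ _ s hs2,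
    adj_eq_sum Z f 1 s hs1, map_sum, smul_sum, ← sum_add_distrib]
  refine sum_ext fun α _ => ?_
  rw [hc, mul_one, mul_one, map_add, smul_add, map_smul, map_smul, map_sum, smul_sum,
    iterD_comm_of_comm hγD, smul_comm]

end Euler

/-! ## Relations between the structure constants -/

variable [Fintype ι] [Fintype β] [Fintype φ] {D : GaugeData n ι β φ} {L₀ : LocalFun n ι β φ}

local notation "𝓢" => brst D L₀
local notation "𝓣" => gaugeAct D

section LieRelations

/-- The relations satisfied by the matrices of a representation, in terms of its action on the
coordinates. -/
def IsRep (f : 𝓘 → 𝓘 → 𝓘 → ℝ) {T : Type*} [Fintype T] (ρ : 𝓘 → T → T → ℝ) : Prop :=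
  ∀ I J t u, ∑ K, f I J K * ρ K t u = ∑ v, (ρ J t v * ρ I v u - ρ I t v * ρ J v u)

/-- The relations satisfied by gauge data coming from Lie algebras and their modules. -/
structure GaugeData.IsLie (D : GaugeData n ι β φ) : Prop where
  antisymm : ∀ I J K, D.f I J K = -D.f J I K
  jacobi : ∀ I J K L, ∑ M, (D.f I J M * D.f M K L + D.f J K M * D.f M I L +
    D.f K I M * D.f M J L) = 0
  vec_rep : IsRep D.f D.vec
  repB_rep : IsRep D.f D.repB
  repF_rep : IsRep D.f D.repF
  vec_inl : ∀ i a b, D.vec (.inl i) a b = 0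
  vec_inr : ∀ (p : LPair n) a b, D.vec (.inr p) a b = eta n b b *
    (if b = p.1.1 ∧ a = p.1.2 then 1 else if b = p.1.2 ∧ a = p.1.1 then -1 else 0)
  f_inl_inr : ∀ i p K, D.f (.inl i) (.inr p) K = 0
  f_inl_inl_inr : ∀ i j p, D.f (.inl i) (.inl j) (.inr p) = 0
  f_inr_inr_inl : ∀ p q i, D.f (.inr p) (.inr q) (.inl i) = 0

lemma lorentzBasis_apply (p : LPair n) (a b : Fin n) : (lorentzBasis n p).1 a b = eta n a a *
    (if a = p.1.1 ∧ b = p.1.2 then 1 else if a = p.1.2 ∧ b = p.1.1 then -1 else 0) := by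
  obtain ⟨⟨c, d⟩, hcd⟩ := p
  have hcd' : d < c := hcd
  have h1 : (lorentzBasis n ⟨(c, d), hcd⟩).1 a b = eta n a a *
      (if h : b < a then (Pi.single (⟨(c, d), hcd⟩ : LPair n) (1 : ℝ) : LPair n → ℝ) ⟨(a, b), h⟩
        else if h : a < b then -(Pi.single (⟨(c, d), hcd⟩ : LPair n) (1 : ℝ) : LPair n → ℝ) ⟨(b, a), h⟩ else 0) := by
    have : lorentzBasis n ⟨(c, d), hcd⟩ =
        (lorentzCoord n).symm (Pi.single (⟨(c, d), hcd⟩ : LPair n) (1 : ℝ)) := by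
      rw [lorentzBasis]
      simp [Module.Basis.coe_ofEquivFun]
    rw [this]
    rfl
  rw [h1]
  congr 1
  simp only [Pi.single_apply, Subtype.mk.injEq, Prod.mk.injEq]
  by_cases k1 : a = c ∧ b = d
  · obtain ⟨rfl, rfl⟩ := k1
    simp [hcd']
  by_cases k2 : a = d ∧ b = c
  · obtain ⟨rfl, rfl⟩ := k2
    simp [hcd'.not_gt, hcd', hcd'.ne]
  rw [if_neg k1, if_neg k2, if_neg k1, if_neg (by rwa [and_comm])]
  simp

variable {𝔤 : Type*} [LieRing 𝔤] [LieAlgebra ℝ 𝔤] (X : Basis ι ℝ 𝔤)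

lemma isRep_module {T W : Type*} [Fintype T] [AddCommGroup W] [Module ℝ W]
    [LieRingModule (𝔤 × Lorentz n) W] [LieModule ℝ (𝔤 × Lorentz n) W] (y : Basis T ℝ W) :
    IsRep (fun I J K => (gaugeBasis n X).repr ⁅gaugeBasis n X I, gaugeBasis n X J⁆ K)
      (fun I t u => y.repr ⁅gaugeBasis n X I, y t⁆ u) := by
  intro I J t u
  set b := gaugeBasis n X
  have h2 : ∀ (J : 𝓘) (t : T), ⁅b J, y t⁆ = ∑ v, y.repr ⁅b J, y t⁆ v • y v := fun J t =>
    (y.sum_repr _).symm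
  have h3 : ∀ I J t, y.repr ⁅b I, ⁅b J, y t⁆⁆ u =
      ∑ v, y.repr ⁅b J, y t⁆ v * y.repr ⁅b I, y v⁆ u := fun I J t => by
    conv_lhs => rw [h2 J t]
    rw [lie_sum, map_sum, finsetSum_apply]
    refine sum_ext fun v _ => ?_
    rw [lie_smul, map_smul, Finsupp.smul_apply, smul_eq_mul]
  have h4 : y.repr ⁅⁅b I, b J⁆, y t⁆ u = ∑ K, b.repr ⁅b I, b J⁆ K * y.repr ⁅b K, y t⁆ u := by
    conv_lhs => rw [← b.sum_repr ⁅b I, b J⁆]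
    rw [sum_lie, map_sum, finsetSum_apply]
    refine sum_ext fun v _ => ?_
    rw [smul_lie, map_smul, Finsupp.smul_apply, smul_eq_mul]
  rw [← h4, lie_lie, map_sub, Finsupp.sub_apply, h3, h3, sum_sub_distrib]

lemma isLie_ofLie {WB : Type*} [AddCommGroup WB] [Module ℝ WB] [LieRingModule (𝔤 × Lorentz n) WB]
    [LieModule ℝ (𝔤 × Lorentz n) WB] (yB : Basis β ℝ WB)
    {WF : Type*} [AddCommGroup WF] [Module ℝ WF] [LieRingModule (𝔤 × Lorentz n) WF]
    [LieModule ℝ (𝔤 × Lorentz n) WF] (yF : Basis φ ℝ WF) : (GaugeData.ofLie n X yB yF).IsLie where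
  antisymm I J K := by
    change (gaugeBasis n X).repr _ K = -(gaugeBasis n X).repr _ K
    rw [← lie_skew, map_neg, Finsupp.neg_apply]
  jacobi I J K L := by
    change ∑ M, ((gaugeBasis n X).repr _ M * (gaugeBasis n X).repr _ L +
      (gaugeBasis n X).repr _ M * (gaugeBasis n X).repr _ L +
      (gaugeBasis n X).repr _ M * (gaugeBasis n X).repr _ L) = 0
    set b := gaugeBasis n X
    have h4 : ∀ I J K, b.repr ⁅⁅b I, b J⁆, b K⁆ L = ∑ M, b.repr ⁅b I, b J⁆ M * b.repr ⁅b M, b K⁆ L := fun I J K => by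
      conv_lhs => rw [← b.sum_repr ⁅b I, b J⁆]
      rw [sum_lie, map_sum, finsetSum_apply]
      refine sum_ext fun v _ => ?_
      rw [smul_lie, map_smul, Finsupp.smul_apply, smul_eq_mul]
    rw [sum_add_distrib, sum_add_distrib, ← h4, ← h4, ← h4, ← Finsupp.add_apply,
      ← Finsupp.add_apply, ← map_add, ← map_add]
    have : ⁅⁅b I, b J⁆, b K⁆ + ⁅⁅b J, b K⁆, b I⁆ + ⁅⁅b K, b I⁆, b J⁆ = 0 := by
      have := lie_jacobi (b K) (b I) (b J)
      rw [← lie_skew ⁅b I, b J⁆ (b K), ← lie_skew ⁅b J, b K⁆ (b I), ← lie_skew ⁅b K, b I⁆ (b J),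
        ← neg_add, ← neg_add, this, neg_zero]
    rw [this]; simp
  vec_rep := by
    intro I J t u
    change ∑ K, (gaugeBasis n X).repr _ K * (gaugeBasis n X K).2.1 u t = ∑ v,
      ((gaugeBasis n X J).2.1 v t * (gaugeBasis n X I).2.1 u v -
        (gaugeBasis n X I).2.1 v t * (gaugeBasis n X J).2.1 u v)
    set b := gaugeBasis n X
    have h : ⁅b I, b J⁆.2.1 u t = ∑ K, b.repr ⁅b I, b J⁆ K * (b K).2.1 u t := by
      conv_lhs => rw [← b.sum_repr ⁅b I, b J⁆]
      rw [Prod.snd_sum, AddSubmonoidClass.coe_finsetSum, Matrix.sum_apply]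
      refine sum_ext fun v _ => ?_
      rfl
    rw [← h]
    change ((b I).2.1 * (b J).2.1 - (b J).2.1 * (b I).2.1) u t = _
    rw [Matrix.sub_apply, Matrix.mul_apply, Matrix.mul_apply, ← sum_sub_distrib]
    refine sum_ext fun v _ => ?_
    ring
  repB_rep := isRep_module X yB
  repF_rep := isRep_module X yF
  vec_inl i a b := by
    change (gaugeBasis n X (Sum.inl i)).2.1 b a = 0
    simp [gaugeBasis]
  vec_inr p a b := by
    change (gaugeBasis n X (Sum.inr p)).2.1 b a = _
    rw [← lorentzBasis_apply]
    simp [gaugeBasis]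
  f_inl_inr i p K := by
    change (gaugeBasis n X).repr ⁅gaugeBasis n X (Sum.inl i), gaugeBasis n X (Sum.inr p)⁆ K = 0
    have : ⁅gaugeBasis n X (Sum.inl i), gaugeBasis n X (Sum.inr p)⁆ = 0 := by
      simp [gaugeBasis]
    rw [this]; simp
  f_inl_inl_inr i j p := by
    change (gaugeBasis n X).repr ⁅gaugeBasis n X (Sum.inl i), gaugeBasis n X (Sum.inl j)⁆ (Sum.inr p) = 0
    simp [gaugeBasis]
  f_inr_inr_inl p q i := by
    change (gaugeBasis n X).repr ⁅gaugeBasis n X (Sum.inr p), gaugeBasis n X (Sum.inr q)⁆ (Sum.inl i) = 0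
    simp [gaugeBasis]

end LieRelations

/-! ## The BRST differential as a superderivation -/

section BRSTDer

variable (D)

/-- The diffeomorphism ghost `ξ^μ`. -/
abbrev xi (μ : Fin n) : 𝓐 := fld (.xi μ)

/-- The ghost `C^I`. -/
abbrev gh (I : 𝓘) : 𝓐 := fld (.C I)

/-- The vielbein `e_μ^a`. -/
abbrev vb (μ a : Fin n) : 𝓐 := fld (.e μ a)

lemma isHom_xi (μ : Fin n) : IsHom true (xi μ : 𝓐) := isHom_gen (.fld (.xi μ), 0)
lemma isHom_gh (I : 𝓘) : IsHom true (gh I : 𝓐) := isHom_gen (.fld (.C I), 0)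
lemma isHom_vb (μ a : Fin n) : IsHom false (vb μ a : 𝓐) := isHom_gen (.fld (.e μ a), 0)
lemma isHom_fld (Φ : 𝓕) : IsHom Φ.isOdd (fld Φ) := isHom_gen (.fld Φ, 0)
lemma isHom_anti (Φ : 𝓕) : IsHom (!Φ.isOdd) (anti Φ) := isHom_gen (.anti Φ, 0)

lemma totalD_fld (μ : Fin n) (Φ : 𝓕) : totalD μ (fld Φ) = dfld μ Φ := by
  rw [totalD_gen, zero_add]

/-- The part of the BRST transformation of the fields that is not a translation. -/
def brstRot (Φ : 𝓕) : 𝓐 := match Φ with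
  | .e μ a => (∑ ν, dfld μ (.xi ν) * fld (.e ν a)) +
      ∑ I, ∑ b, D.vec I a b • (fld (.C I) * fld (.e μ b))
  | .A μ i => (∑ ν, dfld μ (.xi ν) * fld (.A ν i)) + dfld μ (.C (.inl i)) +
      ∑ j, ∑ k, D.f (.inl k) (.inl j) (.inl i) • (fld (.C (.inl j)) * fld (.A μ k))
  | .yB m => ∑ I, ∑ k, D.repB I m k • (fld (.C I) * fld (.yB k))
  | .yF m => ∑ I, ∑ k, D.repF I m k • (fld (.C I) * fld (.yF k))
  | .xi _ => 0
  | .C K => -((1 / 2 : ℝ) • ∑ I, ∑ J, D.f I J K • (fld (.C I) * fld (.C J)))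

lemma brstField_eq (Φ : 𝓕) : brstField D Φ = (∑ ν, xi ν * dfld ν Φ) + brstRot D Φ := rfl

lemma isHom_brstRot (Φ : 𝓕) : IsHom (!Φ.isOdd) (brstRot D Φ) := by
  have hd : ∀ μ (Ψ : 𝓕), IsHom Ψ.isOdd (dfld μ Ψ) := fun μ Ψ =>
    isHom_gen (.fld Ψ, single μ 1)
  cases Φ with
  | e μ a =>
    exact (IsHom.sum fun ν _ => (hd μ (.xi ν)).mul (isHom_fld (.e ν a)) rfl).add
      (IsHom.sum fun I _ => IsHom.sum fun b _ => ((isHom_gh I).mul (isHom_fld (.e μ b)) rfl).smul _)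
  | A μ i =>
    exact ((IsHom.sum fun ν _ => (hd μ (.xi ν)).mul (isHom_fld (.A ν i)) rfl).add
      (hd μ (.C (.inl i)))).add (IsHom.sum fun j _ => IsHom.sum fun k _ =>
        ((isHom_gh (.inl j)).mul (isHom_fld (.A μ k)) rfl).smul _)
  | yB m =>
    exact IsHom.sum fun I _ => IsHom.sum fun k _ => ((isHom_gh I).mul (isHom_fld (.yB k)) rfl).smul _
  | yF m =>
    exact IsHom.sum fun I _ => IsHom.sum fun k _ => ((isHom_gh I).mul (isHom_fld (.yF k)) rfl).smul _
  | xi μ => exact isHom_zero _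
  | C K =>
    exact (IsHom.smul (IsHom.sum fun I _ => IsHom.sum fun k _ =>
      ((isHom_gh I).mul (isHom_gh k) rfl).smul _) _).neg

lemma isHom_brstField (Φ : 𝓕) : IsHom (!Φ.isOdd) (brstField D Φ) := by
  rw [brstField_eq]
  exact (IsHom.sum fun ν _ => (isHom_xi ν).mul
    (isHom_gen (.fld Φ, single ν 1)) (by rw [Bool.true_xor]; rfl)).add (isHom_brstRot D Φ)

/-- The BRST transformations of the fields, extended by zero to the antifields. -/
def fieldVar : 𝓥 → 𝓐
  | .fld Φ => brstField D Φ
  | .anti _ => 0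

lemma isHom_fieldVar (Z : 𝓥) : IsHom (!Z.isOdd) (fieldVar D Z) := by
  cases Z with
  | fld Φ => exact isHom_brstField D Φ
  | anti Φ => exact isHom_zero _

/-- The BRST transformation of the fields as a derivation annihilating the antifields. -/
def fieldBrst : 𝓛 := evol fun z => iterD z.2 (fieldVar D z.1)

lemma isSDer_evolutionary {Q : 𝓥 → 𝓐}
    (hQ : ∀ Z, IsHom (!Z.isOdd) (Q Z)) : IsSDer true (evol fun z => iterD z.2 (Q z.1)) :=
  isSDer_evol fun z => by rw [Bool.true_xor]; exact (hQ z.1).iterD z.2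

lemma evolutionary_totalD {Q : 𝓥 → 𝓐} (hQ : ∀ Z, IsHom (!Z.isOdd) (Q Z)) (μ : Fin n) (x : 𝓐) :
    evol (fun z => iterD z.2 (Q z.1)) (totalD μ x) =
      totalD μ (evol (fun z => iterD z.2 (Q z.1)) x) := by
  have := (isSDer_evolutionary hQ).comp_comm (isSDer_totalD μ) (fun z => by
    rw [totalD_gen, evol_gen, evol_gen, iterD_add_single]; simp) x
  simpa using this

lemma isSDer_fieldBrst : IsSDer true (fieldBrst D) := isSDer_evolutionary (isHom_fieldVar D)

lemma fieldBrst_totalD (μ : Fin n) (x : 𝓐) :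
    fieldBrst D (totalD μ x) = totalD μ (fieldBrst D x) := evolutionary_totalD (isHom_fieldVar D) μ x

lemma fieldBrst_fld (Φ : 𝓕) : fieldBrst D (fld Φ) = brstField D Φ := by
  rw [fieldBrst, evol_gen, iterD_zero]; rfl

lemma fieldBrst_anti (Φ : 𝓕) (α : 𝓜) : fieldBrst D (gen (.anti Φ, α)) = 0 := by
  rw [fieldBrst, evol_gen]
  exact map_zero _

/-- `ξ^ν ∂_ν`. -/
def transl : 𝓛 := ∑ ν, mulLeft ℝ (xi ν) ∘ₗ totalD ν

lemma transl_apply (x : 𝓐) : transl x = ∑ ν, xi ν * totalD ν x := by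
  simp [transl]

lemma isSDer_transl : IsSDer true (transl : 𝓛) :=
  IsSDer.sum _ fun ν _ => (isSDer_totalD ν).lmul (isHom_xi ν) rfl

/-- The BRST transformation without the translation part. -/
def rotBrst : 𝓛 := fieldBrst D - transl

lemma isSDer_rotBrst : IsSDer true (rotBrst D) := (isSDer_fieldBrst D).sub isSDer_transl

lemma rotBrst_apply (x : 𝓐) : rotBrst D x = fieldBrst D x - ∑ ν, xi ν * totalD ν x := by
  rw [rotBrst, sub_app, transl_apply]

lemma fieldBrst_apply (x : 𝓐) : fieldBrst D x = rotBrst D x + ∑ ν, xi ν * totalD ν x := by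
  rw [rotBrst_apply]; abel

lemma rotBrst_fld (Φ : 𝓕) : rotBrst D (fld Φ) = brstRot D Φ := by
  rw [rotBrst_apply, fieldBrst_fld, brstField_eq]
  simp only [totalD_fld]; abel

lemma rotBrst_totalD (μ : Fin n) (x : 𝓐) :
    rotBrst D (totalD μ x) = totalD μ (rotBrst D x) + ∑ ν, dfld μ (.xi ν) * totalD ν x := by
  rw [rotBrst_apply, rotBrst_apply, map_sub, fieldBrst_totalD, map_sum]
  have : ∀ ν, totalD μ (xi ν * totalD ν x) = dfld μ (.xi ν) * totalD ν x + xi ν * totalD ν (totalD μ x) := by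
    intro ν; rw [totalD_mul, totalD_comm, totalD_fld]
  simp only [this, sum_add_distrib]; abel

lemma IsSDer.odd_mul {D : 𝓛} (hD : IsSDer true D) (hx : IsHom true x) (y : 𝓐) :
    D (x * y) = D x * y - x * D y := by
  rw [hD.mul, par_true, hx]; simp [sub_eq_add_neg]

lemma sum_antisymm_zero {M I : Type*} [AddCommGroup M] [Module ℝ M] [Fintype I]
    (f : I → I → M) (h : ∀ i j, f i j = -f j i) : ∑ i, ∑ j, f i j = 0 := by
  have h1 : ∑ i, ∑ j, f i j = -∑ i, ∑ j, f i j := by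
    conv_lhs => rw [sum_comm]
    simp only [← sum_neg_distrib]
    exact sum_ext fun i _ => sum_ext fun j _ => h j i
  exact eq_zero_of_eq_neg h1

/-- The square of `s` only involves its non-translational part. -/
lemma fieldBrst_sq (x : 𝓐) : fieldBrst D (fieldBrst D x) = rotBrst D (rotBrst D x) := by
  have hxi : ∀ ν, rotBrst D (xi ν) = 0 := fun ν => rotBrst_fld D (.xi ν)
  have h1 : rotBrst D (∑ ν, xi ν * totalD ν x) =
      -∑ ν, xi ν * totalD ν (rotBrst D x) - ∑ ν, ∑ μ, xi ν * (dfld ν (.xi μ) * totalD μ x) := by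
    rw [map_sum]
    simp only [(isSDer_rotBrst D).odd_mul (isHom_xi _), hxi, zero_mul, rotBrst_totalD, mul_add,
      mul_sum, zero_sub, neg_add, sum_add_distrib, sum_neg_distrib]
    abel
  have h2 : ∑ ν, xi ν * totalD ν (∑ μ, xi μ * totalD μ x) =
      ∑ ν, ∑ μ, xi ν * (dfld ν (.xi μ) * totalD μ x) := by
    simp only [map_sum, totalD_mul, totalD_fld, mul_sum, mul_add, sum_add_distrib]
    rw [add_eq_left]
    refine sum_antisymm_zero _ fun i j => ?_
    rw [← mul_assoc, ← mul_assoc, (isHom_xi i).odd_comm (isHom_xi j), totalD_comm, neg_mul]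
  rw [fieldBrst_apply D (fieldBrst D x), fieldBrst_apply D x, map_add, h1]
  simp only [map_add, mul_add, sum_add_distrib]
  rw [h2]; abel

lemma rotBrst_gh (K : 𝓘) : rotBrst D (gh K) =
    -((1 / 2 : ℝ) • ∑ I, ∑ J, D.f I J K • (gh I * gh J)) := rotBrst_fld D (.C K)

variable {D}

/-- The ghosts act on the coordinates of a representation compatibly with `s² = 0`. -/
lemma rotBrst_rep {T : Type*} [Fintype T] {ρ : 𝓘 → T → T → ℝ} (hρ : IsRep D.f ρ) {y w : T → 𝓐}
    (hy : ∀ t, rotBrst D (y t) = w t + ∑ I, ∑ u, ρ I t u • (gh I * y u)) (t : T) :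
    rotBrst D (∑ I, ∑ u, ρ I t u • (gh I * y u)) = -∑ I, ∑ u, ρ I t u • (gh I * w u) := by
  have h1 : ∑ I, ∑ u, ρ I t u • (rotBrst D (gh I) * y u) =
      -((1 / 2 : ℝ) • ∑ J, ∑ K, ∑ u, (∑ I, D.f J K I * ρ I t u) • (gh J * gh K * y u)) := by
    simp only [rotBrst_gh, neg_mul, smul_mul_assoc, sum_mul, smul_neg, smul_sum,
      sum_neg_distrib, sum_smul, smul_smul]
    congr 1
    calc _ = ∑ I, ∑ J, ∑ K, ∑ u, (ρ I t u * (1 / 2 * D.f J K I)) • (gh J * gh K * y u) := by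
          refine sum_ext fun I _ => ?_
          rw [sum_comm]
          refine sum_ext fun J _ => ?_
          rw [sum_comm]
      _ = _ := by
          rw [sum_comm]
          refine sum_ext fun J _ => ?_
          rw [sum_comm]
          refine sum_ext fun K _ => ?_
          rw [sum_comm]
          refine sum_ext fun u _ => sum_ext fun I _ => ?_
          congr 1; ring
  have h2 : ∑ I, ∑ u, ρ I t u • (gh I * ∑ J, ∑ v, ρ J u v • (gh J * y v)) =
      ∑ J, ∑ K, ∑ u, (∑ v, ρ J t v * ρ K v u) • (gh J * gh K * y u) := by
    simp only [mul_sum, smul_sum, sum_smul, mul_smul_comm, smul_smul, ← mul_assoc]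
    refine sum_ext fun J _ => ?_
    rw [sum_comm]
    refine sum_ext fun K _ => ?_
    rw [sum_comm]
  have h3 : (1 / 2 : ℝ) • ∑ J, ∑ K, ∑ u, (∑ I, D.f J K I * ρ I t u) • (gh J * gh K * y u) =
      - ∑ J, ∑ K, ∑ u, (∑ v, ρ J t v * ρ K v u) • (gh J * gh K * y u) := by
    have h4 : ∑ J, ∑ K, ((∑ u, (∑ I, D.f J K I * ρ I t u) • (gh J * gh K * y u)) +
        (2 : ℝ) • ∑ u, (∑ v, ρ J t v * ρ K v u) • (gh J * gh K * y u)) = 0 := by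
      refine sum_antisymm_zero _ fun J K => ?_
      rw [eq_neg_iff_add_eq_zero]
      have h5 : ∀ u, gh K * gh J * y u = -(gh J * gh K * y u) := fun u => by
        rw [(isHom_gh K).odd_comm (isHom_gh J), neg_mul]
      simp only [h5, smul_sum, ← sum_add_distrib, smul_neg, smul_smul]
      refine sum_eq_zero fun u _ => ?_
      rw [hρ, hρ, ← neg_smul, ← neg_smul, ← add_smul, ← add_smul, ← add_smul]
      convert zero_smul ℝ _ using 2
      simp only [sum_sub_distrib]
      ring
    rw [eq_neg_iff_add_eq_zero]
    have h6 : (1 / 2 : ℝ) • ∑ J, ∑ K, ((∑ u, (∑ I, D.f J K I * ρ I t u) • (gh J * gh K * y u)) +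
        (2 : ℝ) • ∑ u, (∑ v, ρ J t v * ρ K v u) • (gh J * gh K * y u)) = 0 := by
      rw [h4, smul_zero]
    simpa only [sum_add_distrib, smul_add, ← smul_sum, smul_smul, one_div,
      inv_mul_cancel₀ (two_ne_zero' ℝ), one_smul] using h6
  have h7 : ∀ I u, rotBrst D (gh I * y u) = rotBrst D (gh I) * y u - gh I * w u -
      gh I * ∑ J, ∑ v, ρ J u v • (gh J * y v) := fun I u => by
    rw [(isSDer_rotBrst D).odd_mul (isHom_gh I), hy, mul_add]; abel
  simp only [map_sum, map_smul, h7, smul_sub, sum_sub_distrib]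
  rw [h1, h2, h3]; abel

lemma rotBrst_dxi (μ ν : Fin n) : rotBrst D (dfld μ (.xi ν)) =
    ∑ ρ, dfld μ (.xi ρ) * dfld ρ (.xi ν) := by
  have := rotBrst_totalD D μ (xi ν)
  rw [rotBrst_fld D (.xi ν), totalD_fld] at this
  rw [this, show brstRot D (.xi ν) = 0 from rfl, map_zero, zero_add]
  simp only [totalD_fld]

lemma isHom_dxi (μ ν : Fin n) : IsHom true (dfld μ (.xi ν) : 𝓐) :=
  isHom_gen (.fld (.xi ν), single μ 1)

/-- Lower world indices are compatible with `s² = 0`. -/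
lemma rotBrst_lower {y w : Fin n → 𝓐}
    (hy : ∀ μ, rotBrst D (y μ) = ∑ ν, dfld μ (.xi ν) * y ν + w μ) (μ : Fin n) :
    rotBrst D (∑ ν, dfld μ (.xi ν) * y ν) = -∑ ν, dfld μ (.xi ν) * w ν := by
  have h : ∀ ν, rotBrst D (dfld μ (.xi ν) * y ν) = (∑ ρ, dfld μ (.xi ρ) * dfld ρ (.xi ν) * y ν) -
      (∑ ρ, dfld μ (.xi ν) * (dfld ν (.xi ρ) * y ρ)) - dfld μ (.xi ν) * w ν := fun ν => by
    rw [(isSDer_rotBrst D).odd_mul (isHom_dxi μ ν), rotBrst_dxi, hy, mul_add, sum_mul, mul_sum]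
    abel
  rw [map_sum]
  simp only [h, sum_sub_distrib]
  rw [sum_comm]
  simp only [mul_assoc]
  abel

lemma sum_cyclic {M I : Type*} [AddCommMonoid M] [Fintype I] (f : I → I → I → M) :
    ∑ i, ∑ j, ∑ k, f i j k = ∑ i, ∑ j, ∑ k, f j k i := by
  symm
  rw [sum_comm]
  exact sum_ext fun j _ => sum_comm

lemma sum_cyclic_zero {M I : Type*} [AddCommGroup M] [Module ℝ M] [Fintype I]
    (c : I → I → I → ℝ) (x : I → I → I → M) (hx : ∀ i j k, x i j k = x j k i)
    (hc : ∀ i j k, c i j k + c j k i + c k i j = 0) : ∑ i, ∑ j, ∑ k, c i j k • x i j k = 0 := by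
  have key : ∀ c : I → I → I → ℝ, ∑ i, ∑ j, ∑ k, c i j k • x i j k =
      ∑ i, ∑ j, ∑ k, c j k i • x i j k := fun c =>
    (sum_cyclic fun i j k => c i j k • x i j k).trans (sum_ext fun i _ =>
      sum_ext fun j _ => sum_ext fun k _ => by rw [hx i j k])
  have h1 := key c
  have h2 := key fun i j k => c j k i
  have h3 : (3 : ℝ) • ∑ i, ∑ j, ∑ k, c i j k • x i j k =
      ∑ i, ∑ j, ∑ k, (c i j k + c j k i + c k i j) • x i j k := by
    simp only [add_smul, sum_add_distrib]
    rw [← h2, ← h1]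
    module
  simp only [hc, zero_smul, sum_const_zero] at h3
  exact (smul_eq_zero.1 h3).resolve_left three_ne_zero

/-- Rewriting of `∑ f_{IJ}^K (s C^I) C^J`-type sums as cubic sums. -/
lemma sum_quartic {M I J : Type*} [AddCommGroup M] [Module ℝ M] [Fintype I] [Fintype J]
    (g : I → J → ℝ) (h : I → I → I → ℝ) (x : I → I → J → M) :
    ∑ i, ∑ j, ∑ l, ∑ m, (g i j * h l m i) • x l m j =
      ∑ l, ∑ m, ∑ j, (∑ i, h l m i * g i j) • x l m j := by
  simp only [sum_smul]
  calc _ = ∑ i, ∑ l, ∑ m, ∑ j, (g i j * h l m i) • x l m j := by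
        refine sum_ext fun i _ => ?_
        rw [sum_comm]
        exact sum_ext fun l _ => sum_comm
    _ = _ := by
        rw [sum_comm]
        refine sum_ext fun l _ => ?_
        rw [sum_comm]
        refine sum_ext fun m _ => ?_
        rw [sum_comm]
        simp only [mul_comm]

lemma rotBrst_gh_mul (y : 𝓐) (I : 𝓘) : rotBrst D (gh I) * y =
      (-(1 / 2) : ℝ) • ∑ L, ∑ M, D.f L M I • (gh L * gh M * y) := by
  rw [rotBrst_gh, neg_mul, smul_mul_assoc, sum_mul, neg_smul]
  simp only [sum_mul, smul_mul_assoc]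

lemma rotBrst_sq_gh (hD : D.IsLie) (K : 𝓘) : rotBrst D (brstRot D (.C K)) = 0 := by
  change rotBrst D (-((1 / 2 : ℝ) • ∑ I, ∑ J, D.f I J K • (gh I * gh J))) = 0
  have h0 : ∀ I, IsHom false (rotBrst D (gh I)) := fun I =>
    (isSDer_rotBrst D).isHom (isHom_gh I) rfl
  have h1 : ∑ I, ∑ J, D.f I J K • (gh I * rotBrst D (gh J)) =
      -∑ I, ∑ J, D.f I J K • (rotBrst D (gh I) * gh J) := by
    conv_lhs => rw [sum_comm]
    simp only [← sum_neg_distrib]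
    refine sum_ext fun I _ => sum_ext fun J _ => ?_
    rw [hD.antisymm, (h0 I).even_comm, neg_smul]
  have h2 : ∑ I, ∑ J, D.f I J K • (rotBrst D (gh I) * gh J) = 0 := by
    simp only [rotBrst_gh_mul, smul_sum, smul_smul]
    have := sum_quartic (fun I J => D.f I J K * -(1 / 2)) D.f
      (fun L M J => (gh L * gh M * gh J : 𝓐))
    simp only [← mul_assoc]
    refine this.trans ?_
    refine sum_cyclic_zero _ _ (fun L M J => ?_) fun L M J => ?_
    · have : IsHom false (gh M * gh J : 𝓐) := (isHom_gh M).mul (isHom_gh J) rfl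
      rw [mul_assoc, this.even_comm]
    · have := hD.jacobi L M J K
      rw [← sum_add_distrib, ← sum_add_distrib]
      calc _ = ∑ N, (D.f L M N * D.f N J K + D.f M J N * D.f N L K + D.f J L N * D.f N M K) *
            -(1 / 2) := sum_ext fun N _ => by ring
        _ = 0 := by rw [← sum_mul, this, zero_mul]
  simp only [map_neg, map_smul, map_sum, (isSDer_rotBrst D).odd_mul (isHom_gh _), smul_sub,
    sum_sub_distrib]
  rw [h1, h2]; simp

lemma dxi_gh_swap {T : Type*} [Fintype T] (ρ : 𝓘 → T → T → ℝ)
    (y : Fin n → T → 𝓐) (μ : Fin n) (t : T) :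
    ∑ ν, dfld μ (.xi ν) * ∑ I, ∑ u, ρ I t u • (gh I * y ν u) =
      -∑ I, ∑ u, ρ I t u • (gh I * ∑ ν, dfld μ (.xi ν) * y ν u) := by
  simp only [mul_sum, mul_smul_comm, smul_sum]
  rw [sum_comm, ← sum_neg_distrib]
  refine sum_ext fun I _ => ?_
  rw [sum_comm, ← sum_neg_distrib]
  refine sum_ext fun b _ => ?_
  rw [← sum_neg_distrib]
  refine sum_ext fun ν _ => ?_
  rw [← smul_neg, ← mul_assoc, ← mul_assoc, (isHom_dxi μ ν).odd_comm (isHom_gh I), neg_mul]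

lemma GaugeData.IsLie.f_inl_inr_right (hD : D.IsLie) (J : 𝓘) (k : ι) (p : LPair n) :
    D.f J (.inl k) (.inr p) = 0 := by
  cases J with
  | inl j => exact hD.f_inl_inl_inr _ _ _
  | inr q => rw [hD.antisymm, hD.f_inl_inr, neg_zero]

lemma GaugeData.IsLie.f_inr_inl (hD : D.IsLie) (I : 𝓘) (p : LPair n) (i : ι) :
    D.f I (.inr p) (.inl i) = 0 := by
  cases I with
  | inl j => exact hD.f_inl_inr _ _ _
  | inr q => exact hD.f_inr_inr_inl _ _ _

/-- The coadjoint action on the coordinates. -/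
lemma GaugeData.IsLie.coadj_rep (hD : D.IsLie) : IsRep D.f fun I K J => -D.f I J K := by
  intro I J L K
  have := hD.jacobi I J K L
  rw [← sub_eq_zero, ← sum_sub_distrib, ← neg_eq_zero, ← this, ← sum_neg_distrib]
  refine sum_ext fun M _ => ?_
  beta_reduce
  rw [hD.antisymm J M L, hD.antisymm I M L, hD.antisymm K I M]
  ring

lemma GaugeData.IsLie.coadj_rep_inl (hD : D.IsLie) :
    IsRep D.f fun I (i k : ι) => -D.f I (.inl k) (.inl i) := by
  intro I J i k
  rw [hD.coadj_rep I J (.inl i) (.inl k), Fintype.sum_sum_type]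
  simp [hD.f_inl_inr_right]

lemma fieldBrst_sq_fld (hD : D.IsLie) (Φ : 𝓕) : fieldBrst D (brstField D Φ) = 0 := by
  rw [← fieldBrst_fld, fieldBrst_sq, rotBrst_fld]
  cases Φ with
  | e μ a =>
    change rotBrst D ((∑ ν, dfld μ (.xi ν) * vb ν a) + ∑ I, ∑ b, D.vec I a b • (gh I * vb μ b)) = 0
    have h1 : ∀ μ a, rotBrst D (vb μ a) = (∑ ν, dfld μ (.xi ν) * vb ν a) +
      ∑ I, ∑ b, D.vec I a b • (gh I * vb μ b) := fun μ a => rotBrst_fld D (.e μ a)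
    rw [map_add, rotBrst_lower (y := fun μ => vb μ a) (fun μ => h1 μ a),
      rotBrst_rep hD.vec_rep (y := fun a => vb μ a) (fun a => h1 μ a), ← neg_add, neg_eq_zero]
    rw [dxi_gh_swap, neg_add_cancel]
  | A μ i =>
    set w : ι → 𝓐 := fun i => (∑ ν, dfld μ (.xi ν) * fld (.A ν i)) + dfld μ (.C (.inl i)) with hw
    have hA : ∀ μ i, rotBrst D (fld (.A μ i)) = (∑ ν, dfld μ (.xi ν) * fld (.A ν i)) +
        (dfld μ (.C (.inl i)) + ∑ I, ∑ k, (-D.f I (.inl k) (.inl i)) • (gh I * fld (.A μ k))) := fun μ i => by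
      rw [rotBrst_fld, ← add_assoc]
      simp only [brstRot, Fintype.sum_sum_type]
      have : ∀ p k, D.f (.inr p) (.inl k) (.inl i) = 0 := fun p k => by
        rw [hD.antisymm, hD.f_inl_inr, neg_zero]
      simp only [this, neg_zero, zero_smul, sum_const_zero, add_zero]
      congr 1
      refine sum_ext fun j _ => sum_ext fun k _ => ?_
      rw [hD.antisymm]
    rw [← rotBrst_fld, hA, map_add, map_add, rotBrst_lower (fun μ => hA μ i),
      rotBrst_rep hD.coadj_rep_inl (y := fun k => fld (.A μ k)) (w := w) (fun t => by
        rw [hA, hw, add_assoc]) i]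
    have hdC : rotBrst D (dfld μ (.C (.inl i))) =
        (∑ I, ∑ k, D.f (.inl k) I (.inl i) • (gh I * dfld μ (.C (.inl k)))) +
        ∑ ν, dfld μ (.xi ν) * dfld ν (.C (.inl i)) := by
      rw [← totalD_fld, rotBrst_totalD, rotBrst_gh]
      simp only [totalD_fld]
      congr 1
      have h1 : ∑ I, ∑ J, D.f I J (.inl i) • (dfld μ (.C I) * gh J : 𝓐) =
          ∑ I, ∑ J, D.f I J (.inl i) • (gh I * dfld μ (.C J)) := by
        rw [sum_comm]
        refine sum_ext fun I _ => sum_ext fun J _ => ?_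
        have : IsHom true (dfld μ (.C J) : 𝓐) := isHom_gen (.fld (.C J), single μ 1)
        rw [hD.antisymm, this.odd_comm (isHom_gh I), smul_neg, neg_smul, neg_neg]
      simp only [map_neg, map_smul, map_sum, totalD_mul, totalD_fld, smul_add, sum_add_distrib]
      rw [h1, ← smul_add, ← two_smul ℝ, smul_smul, one_div, inv_mul_cancel₀ two_ne_zero, one_smul,
        ← sum_neg_distrib]
      refine sum_ext fun I _ => ?_
      rw [Fintype.sum_sum_type]
      simp only [hD.f_inr_inl, zero_smul, sum_const_zero, add_zero, ← sum_neg_distrib]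
      refine sum_ext fun k _ => ?_
      rw [hD.antisymm, neg_smul, neg_neg]
    rw [hdC]
    simp only [mul_add, sum_add_distrib, hw, smul_add]
    rw [dxi_gh_swap (fun I (i k : ι) => -D.f I (.inl k) (.inl i)) (fun ν k => fld (.A ν k))]
    have h2 : ∑ I, ∑ k, D.f (.inl k) I (.inl i) • (gh I * dfld μ (.C (.inl k)) : 𝓐) =
        ∑ I, ∑ k, -D.f I (.inl k) (.inl i) • (gh I * dfld μ (.C (.inl k))) :=
      sum_ext fun I _ => sum_ext fun k _ => by rw [hD.antisymm]
    rw [h2]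
    abel
  | yB m =>
    change rotBrst D (∑ I, ∑ k, D.repB I m k • (gh I * fld (.yB k))) = 0
    rw [rotBrst_rep hD.repB_rep (y := fun k => fld (.yB k)) (w := fun _ => 0)
      (fun m => (rotBrst_fld D (.yB m)).trans (zero_add _).symm)]
    simp
  | yF m =>
    change rotBrst D (∑ I, ∑ k, D.repF I m k • (gh I * fld (.yF k))) = 0
    rw [rotBrst_rep hD.repF_rep (y := fun k => fld (.yF k)) (w := fun _ => 0)
      (fun m => (rotBrst_fld D (.yF m)).trans (zero_add _).symm)]
    simp
  | xi μ => exact map_zero _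
  | C K => exact rotBrst_sq_gh hD K

/-! ## The full differential -/

lemma isHom_master (hL : IsHom false L₀) : IsHom false (masterDensity D L₀) :=
  hL.sub (IsHom.sum fun Φ _ => (isHom_brstField D Φ).mul (isHom_anti Φ) (by simp))

lemma isHom_brstVar (hL : IsHom false L₀) (Z : 𝓥) : IsHom (!Z.isOdd) (brstVar D L₀ Z) := by
  cases Z with
  | fld Φ => exact isHom_brstField D Φ
  | anti Φ =>
    change IsHom _ (euler (.fld Φ) (masterDensity D L₀))
    rw [euler_eq]
    exact (eulerL_isHom (isHom_master hL) (by simp [Var.isOdd])).par' _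

lemma isSDer_brst (hL : IsHom false L₀) : IsSDer true 𝓢 :=
  isSDer_evolutionary (isHom_brstVar hL)

lemma brst_totalD (hL : IsHom false L₀) (μ : Fin n) (x : 𝓐) :
    𝓢 (totalD μ x) = totalD μ (𝓢 x) := evolutionary_totalD (isHom_brstVar hL) μ x

lemma brst_gen (z : 𝓙) : 𝓢 (gen z) = iterD z.2 (brstVar D L₀ z.1) := evol_gen _ z

lemma brst_fld (Φ : 𝓕) : 𝓢 (fld Φ) = brstField D Φ := by
  rw [brst_gen, iterD_zero]; rfl

lemma brst_anti (Φ : 𝓕) : 𝓢 (anti Φ) = euler (.fld Φ) (masterDensity D L₀) := by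
  rw [brst_gen, iterD_zero]; rfl

/-! ## Nilpotency -/

/-- The local functions depending on the undifferentiated vielbein and the jet coordinates in
`J` only. -/
def jetAlg (J : Set 𝓙) : Subalgebra ℝ 𝓐 :=
  adjoin ℝ (Set.range (frameFun (n := n) (ι := ι) (β := β) (φ := φ)) ∪ gen '' J)

lemma frameFun_mem_jetAlg (J : Set 𝓙) (f : 𝓒) :
    frameFun f ∈ jetAlg J := subset_adjoin (Or.inl ⟨f, rfl⟩)

lemma gen_mem_jetAlg {J : Set 𝓙} {z : 𝓙} (hz : z ∈ J) :
    gen z ∈ jetAlg J := subset_adjoin (Or.inr ⟨z, hz, rfl⟩)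

lemma jetAlg_induction {J : Set 𝓙} {p : 𝓐 → Prop}
    (hf : ∀ f, p (frameFun f)) (hg : ∀ z ∈ J, p (gen z))
    (hadd : ∀ x y, x ∈ jetAlg J → y ∈ jetAlg J → p x → p y → p (x + y))
    (hmul : ∀ x y, x ∈ jetAlg J → y ∈ jetAlg J → p x → p y → p (x * y))
    (hx : x ∈ jetAlg J) : p x := by
  induction hx using adjoin_induction with
  | mem x hx =>
    rcases hx with ⟨f, rfl⟩ | ⟨z, hz, rfl⟩
    · exact hf f
    · exact hg z hz
  | algebraMap r =>
    have := hf (algebraMap ℝ _ r)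
    rwa [AlgHom.commutes] at this
  | add x y hx hy h h' => exact hadd x y hx hy h h'
  | mul x y hx hy h h' => exact hmul x y hx hy h h'

lemma par_mem_jetAlg {J : Set 𝓙} (ε : Bool) (hx : x ∈ jetAlg J) : par ε x ∈ jetAlg J := by
  refine jetAlg_induction (p := fun x => par ε x ∈ jetAlg J) (fun f => ?_) (fun z hz => ?_)
    (fun x y _ _ h h' => ?_) (fun x y _ _ h h' => ?_) hx
  · rw [par_frameFun]; exact frameFun_mem_jetAlg J f
  · rw [(isHom_gen z).par]; exact Subalgebra.smul_mem _ (gen_mem_jetAlg hz) _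
  · rw [map_add]; exact add_mem h h'
  · rw [par_mul]; exact mul_mem h h'

lemma IsSDer.mem_jetAlg {J : Set 𝓙} {ε : Bool} {E : 𝓛} (hE : IsSDer ε E)
    (hf : ∀ p, E (gen (frameJet p)) ∈ jetAlg J) (hg : ∀ z ∈ J, E (gen z) ∈ jetAlg J)
    (hx : x ∈ jetAlg J) : E x ∈ jetAlg J := by
  refine jetAlg_induction (p := fun x => E x ∈ jetAlg J) (fun f => ?_) hg
    (fun x y _ _ h h' => ?_) (fun x y hx hy h h' => ?_) hx
  · rw [hE.frame]
    exact sum_mem fun p _ => mul_mem (hf p) (frameFun_mem_jetAlg J _)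
  · rw [map_add]; exact add_mem h h'
  · rw [hE.mul]; exact add_mem (mul_mem h hy) (mul_mem (par_mem_jetAlg ε hx) h')

lemma IsSDer.eq_zero_of_jetAlg {J : Set 𝓙} {ε : Bool} {E : 𝓛} (hE : IsSDer ε E)
    (hf : ∀ p, E (gen (frameJet p)) = 0) (hg : ∀ z ∈ J, E (gen z) = 0)
    (hx : x ∈ jetAlg J) : E x = 0 := by
  refine jetAlg_induction (p := fun x => E x = 0) (fun f => ?_) hg
    (fun x y _ _ h h' => ?_) (fun x y _ _ h h' => ?_) hx
  · rw [hE.frame]; exact sum_eq_zero fun p _ => by rw [hf, zero_mul]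
  · rw [map_add, h, h', add_zero]
  · rw [hE.mul, h, h', zero_mul, mul_zero, add_zero]

lemma dL_mem_jetAlg {J : Set 𝓙} (z : 𝓙) (hx : x ∈ jetAlg J) : dL z x ∈ jetAlg J := by
  have h : ∀ w : 𝓙, dL z (gen w) ∈ jetAlg J := fun w => by
    rw [dL_gen]; split_ifs
    · exact one_mem _
    · exact zero_mem _
  exact (isSDer_dL z).mem_jetAlg (fun p => h _) (fun w _ => h w) hx

/-- The jet coordinates of the fields. -/
def fieldJets (n : ℕ) (ι β φ : Type*) : Set (Jet n ι β φ) := {z | ∃ Φ, z.1 = .fld Φ}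

local notation "𝓤" => jetAlg (fieldJets n ι β φ)

lemma totalD_mem_fieldJets (μ : Fin n)
    (hx : x ∈ 𝓤) : totalD μ x ∈ 𝓤 :=
  (isSDer_totalD μ).mem_jetAlg (fun p => by rw [totalD_gen]; exact gen_mem_jetAlg ⟨_, rfl⟩)
    (fun z hz => by rw [totalD_gen]; exact gen_mem_jetAlg hz) hx

lemma iterD_mem_fieldJets (α : 𝓜)
    (hx : x ∈ 𝓤) : iterD α x ∈ 𝓤 := by
  induction α using multiIndex_induction with
  | h0 => rwa [iterD_zero]
  | h1 α μ ih => rw [iterD_add_single]; exact totalD_mem_fieldJets μ ih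

lemma fld_mem_fieldJets (Φ : 𝓕) (α : 𝓜) :
    gen (.fld Φ, α) ∈ 𝓤 := gen_mem_jetAlg ⟨_, rfl⟩

lemma brstField_mem_fieldJets (Φ : 𝓕) : brstField D Φ ∈ 𝓤 := by
  have h := fld_mem_fieldJets (n := n) (ι := ι) (β := β) (φ := φ)
  refine add_mem (sum_mem fun ν _ => mul_mem (h _ _) (h _ _)) ?_
  cases Φ with
  | e μ a =>
    exact add_mem (sum_mem fun ν _ => mul_mem (h _ _) (h _ _))
      (sum_mem fun ν _ => sum_mem fun _ _ => Subalgebra.smul_mem _ (mul_mem (h _ _) (h _ _)) _)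
  | A μ i =>
    exact add_mem (add_mem (sum_mem fun ν _ => mul_mem (h _ _) (h _ _)) (h _ _))
      (sum_mem fun ν _ => sum_mem fun _ _ => Subalgebra.smul_mem _ (mul_mem (h _ _) (h _ _)) _)
  | yB m =>
    exact sum_mem fun ν _ => sum_mem fun _ _ => Subalgebra.smul_mem _ (mul_mem (h _ _) (h _ _)) _
  | yF m =>
    exact sum_mem fun ν _ => sum_mem fun _ _ => Subalgebra.smul_mem _ (mul_mem (h _ _) (h _ _)) _
  | xi μ => exact zero_mem _
  | C K =>
    exact neg_mem (Subalgebra.smul_mem _ (sum_mem fun ν _ => sum_mem fun _ _ =>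
      Subalgebra.smul_mem _ (mul_mem (h _ _) (h _ _)) _) _)

lemma IsInvariantLagrangian.isHom (hL : IsInvariantLagrangian D L₀) : IsHom false L₀ := by
  rw [IsHom, sgn_false, one_smul]; exact hL.2.1

lemma IsInvariantLagrangian.mem (hL : IsInvariantLagrangian D L₀) :
    L₀ ∈ 𝓤 := by
  refine adjoin_mono (Set.union_subset_union_right _ ?_) hL.1
  rintro x ⟨Φ, α, -, rfl⟩
  exact ⟨_, ⟨Φ, rfl⟩, rfl⟩

lemma IsInvariantLagrangian.exists_divergence (hL : IsInvariantLagrangian D L₀) :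
    ∃ k : Fin n → 𝓐, fieldBrst D L₀ = ∑ μ, totalD μ (k μ) := by
  obtain ⟨k, hk⟩ := hL.2.2
  refine ⟨k, hk ▸ ?_⟩
  unfold fieldBrst
  congr 2
  funext ⟨Z, α⟩
  cases Z
  · rfl
  · exact map_zero _

/-- The part of the BRST differential acting on the antifields only. -/
def antiBrst (D : GaugeData n ι β φ) (L₀ : 𝓐) : 𝓛 := brst D L₀ - fieldBrst D

lemma isSDer_antiBrst (hL : IsHom false L₀) : IsSDer true (antiBrst D L₀) :=
  (isSDer_brst hL).sub (isSDer_fieldBrst D)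

lemma antiBrst_totalD (hL : IsHom false L₀) (μ : Fin n) (x : 𝓐) :
    antiBrst D L₀ (totalD μ x) = totalD μ (antiBrst D L₀ x) := by
  simp only [antiBrst, sub_app, brst_totalD hL, fieldBrst_totalD, map_sub]

lemma antiBrst_gen_fld (Φ : 𝓕) (α : 𝓜) : antiBrst D L₀ (gen (.fld Φ, α)) = 0 := by
  rw [antiBrst, sub_app, brst_gen, fieldBrst, evol_gen]
  exact sub_self _

lemma antiBrst_eq_zero (hL : IsHom false L₀)
    (hx : x ∈ 𝓤) : antiBrst D L₀ x = 0 :=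
  (isSDer_antiBrst hL).eq_zero_of_jetAlg (fun p => antiBrst_gen_fld _ _) (fun z hz => by
      obtain ⟨Z, α⟩ := z
      obtain ⟨Φ, hΦ⟩ := hz
      change Z = _ at hΦ
      subst hΦ
      exact antiBrst_gen_fld _ _) hx

lemma antiBrst_anti (hL : IsHom false L₀) (Φ : 𝓕) : antiBrst D L₀ (anti Φ) =
    sgn Φ.isOdd • eulerL (.fld Φ) (masterDensity D L₀) := by
  have h : IsHom Φ.isOdd (eulerL (.fld Φ) (masterDensity D L₀)) :=
    eulerL_isHom (isHom_master hL) (by simp [Var.isOdd])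
  rw [antiBrst, sub_app, fieldBrst_anti, sub_zero, brst_anti, euler_eq, h.par]
  simp [Var.isOdd]

lemma eulerL_mul_anti (A Φ : 𝓕) (q : 𝓐) :
    eulerL (.fld A) (q * anti Φ) = adj (.fld A) q (anti Φ) := by
  unfold eulerL adj
  refine finsum_congr fun α => ?_
  rw [dL_mul, dL_gen_of_ne (fun h => by cases h), mul_zero, add_zero, mul_one]

lemma antiBrst_iterD (hL : IsHom false L₀) (α : 𝓜) (x : 𝓐) :
    antiBrst D L₀ (iterD α x) = iterD α (antiBrst D L₀ x) :=
  iterD_comm_of_comm (antiBrst_totalD hL) α x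

lemma eulerL_mem_fieldJets (Z : 𝓥)
    (hx : x ∈ 𝓤) : eulerL Z x ∈ 𝓤 := by
  rw [eulerL, adj_eq_sum Z x 1 (adj_finite Z x).toFinset fun α hα => by
    by_contra h; exact hα (by simpa using h)]
  refine sum_mem fun α _ => Subalgebra.smul_mem _ (iterD_mem_fieldJets _ ?_) _
  rw [mul_one]
  exact dL_mem_jetAlg _ hx

lemma antiBrst_adj (hL : IsHom false L₀) (A Φ : 𝓕) {η : Bool} {q : 𝓐}
    (hq : q ∈ 𝓤) (hη : IsHom η q) :
    antiBrst D L₀ (adj (.fld A) q (anti Φ)) =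
      sgn (A.isOdd ^^ η) • adj (.fld A) q (antiBrst D L₀ (anti Φ)) := by
  have hs : ∀ α, α ∉ (adj_finite (.fld A) q).toFinset → dL (.fld A, α) q = 0 := fun α hα => by
    by_contra h; exact hα (by simpa using h)
  rw [adj_eq_sum _ q _ _ hs, adj_eq_sum _ q _ _ hs, map_sum, smul_sum]
  refine sum_ext fun α _ => ?_
  have h1 : IsHom (A.isOdd ^^ η) (dL (.fld A, α) q) := (isSDer_dL (.fld A, α)).isHom hη rfl
  rw [map_smul, antiBrst_iterD hL, (isSDer_antiBrst hL).mul, antiBrst_eq_zero hL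
    (dL_mem_jetAlg _ hq), zero_mul, zero_add, par_true, h1, smul_mul_assoc, map_smul, smul_comm]

lemma fieldBrst_master (hD : D.IsLie) : fieldBrst D (masterDensity D L₀) = fieldBrst D L₀ := by
  rw [masterDensity, map_sub, map_sum, sub_eq_self]
  refine sum_eq_zero fun Φ _ => ?_
  rw [(isSDer_fieldBrst D).mul, fieldBrst_sq_fld hD, fieldBrst_anti, zero_mul, mul_zero, add_zero]

lemma brst_eulerL_master (hD : D.IsLie) (hL : IsInvariantLagrangian D L₀) (A : 𝓕) :
    𝓢 (eulerL (.fld A) (masterDensity D L₀)) = 0 := by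
  have hh := hL.isHom
  set K := masterDensity D L₀ with hK
  have h1 := eulerL_evol (isHom_fieldVar D) (.fld A) K
  change eulerL _ (fieldBrst D K) = _ • fieldBrst D _ + _ at h1
  obtain ⟨k, hk⟩ := hL.exists_divergence
  have h0 : eulerL (.fld A) (fieldBrst D K) = 0 := by
    rw [hK, fieldBrst_master hD, hk, ← mul_one (eulerL _ _)]
    change adj _ _ 1 * 1 = 0
    rw [mul_one, ← adjL_apply, map_sum, sum_app]
    exact sum_eq_zero fun μ _ => eulerL_totalD _ μ _
  have h2 : ∑ W, adj (.fld A) (fieldVar D W) (eulerL W K) =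
      ∑ Φ, adj (.fld A) (brstField D Φ) (eulerL (.fld Φ) K) := by
    refine (Fintype.sum_of_injective Var.fld (fun _ _ h => Var.fld.inj h) _ _ (fun W hW => ?_)
      fun Φ => rfl).symm
    cases W with
    | fld Φ => exact absurd ⟨Φ, rfl⟩ hW
    | anti Φ => exact (LinearMap.congr_fun (map_zero (adjL (.fld A))) _)
  have h3 : antiBrst D L₀ (eulerL (.fld A) K) =
      sgn A.isOdd • ∑ Φ, adj (.fld A) (brstField D Φ) (eulerL (.fld Φ) K) := by
    have e1 : eulerL (.fld A) K = eulerL (.fld A) L₀ -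
        ∑ Φ, adj (.fld A) (brstField D Φ) (anti Φ) := by
      simp only [← eulerL_mul_anti]
      simp only [eulerL, ← adjL_apply, hK, masterDensity, map_sub, map_sum, sub_app, sum_app]
    rw [e1, map_sub, antiBrst_eq_zero hh (eulerL_mem_fieldJets _ hL.mem), zero_sub, map_sum,
      smul_sum, ← sum_neg_distrib]
    refine sum_ext fun Φ _ => ?_
    rw [antiBrst_adj hh A Φ (brstField_mem_fieldJets Φ) (isHom_brstField D Φ), antiBrst_anti hh,
      adj_smul_right, smul_smul, ← neg_smul, ← hK]
    congr 1
    cases A.isOdd <;> cases Φ.isOdd <;> simp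
  have h4 : 𝓢 (eulerL (.fld A) K) =
      antiBrst D L₀ (eulerL (.fld A) K) + fieldBrst D (eulerL (.fld A) K) := by
    simp [antiBrst]
  rw [h4, h3, ← h2]
  rw [h0] at h1
  have h5 := congrArg (fun x => sgn A.isOdd • x) h1
  simp only [smul_add, smul_smul, smul_zero] at h5
  change 0 = (sgn A.isOdd * sgn A.isOdd) • _ + _ at h5
  rw [sgn_mul_self, one_smul] at h5
  rw [add_comm]; exact h5.symm

lemma brst_sq (hD : D.IsLie) (hL : IsInvariantLagrangian D L₀) (x : 𝓐) :
    𝓢 (𝓢 x) = 0 := by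
  have hh := hL.isHom
  have hs := isSDer_brst (D := D) hh
  have h := (hs.scomm hs (ζ := false)).ext (IsSDer.zero _) fun z => by
      have : 𝓢 (𝓢 (gen z)) = 0 := by
        obtain ⟨Z, α⟩ := z
        rw [brst_gen, iterD_comm_of_comm (brst_totalD hh)]
        cases Z with
        | anti Φ =>
          change iterD α (𝓢 (euler (.fld Φ) _)) = 0
          have h : IsHom Φ.isOdd (eulerL (.fld Φ) (masterDensity D L₀)) :=
            eulerL_isHom (isHom_master hh) (by simp [Var.isOdd])
          rw [euler_eq, h.par, map_smul, brst_eulerL_master hD hL, smul_zero, map_zero]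
        | fld Φ =>
          change iterD α (𝓢 (brstField D Φ)) = 0
          have h1 := antiBrst_eq_zero (D := D) hh (brstField_mem_fieldJets (D := D) Φ)
          rw [antiBrst, sub_app, fieldBrst_sq_fld hD, sub_zero] at h1
          rw [h1, map_zero]
      rw [scomm_apply, this, smul_zero, sub_zero, zero_app]
  have h2 := LinearMap.congr_fun h x
  rw [scomm_apply] at h2
  simp only [Bool.and_self, sgn_true, neg_smul, one_smul, sub_neg_eq_add, zero_app,
    ← two_smul ℝ] at h2
  exact (smul_eq_zero.1 h2).resolve_left two_ne_zero

end BRSTDer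

local notation "𝓤" => jetAlg (fieldJets n ι β φ)

section AntiBRST

/-! ## The action on the antifields -/

lemma adj_mul (Z : 𝓥) {η η' : Bool} {u w : 𝓐} (hu : IsHom η u) (hw : IsHom η' w) (h : 𝓐) :
    adj Z (u * w) h = adj Z u (w * h) + sgn (η && η') • adj Z w (u * h) := by
  set s := (adj_finite Z u).toFinset ∪ (adj_finite Z w).toFinset with hs
  have h1 : ∀ α, α ∉ s → dL (Z, α) u = 0 ∧ dL (Z, α) w = 0 := fun α hα => by
    simpa [hs, not_or] using hα
  rw [adj_eq_sum Z u _ s fun α hα => (h1 α hα).1, adj_eq_sum Z w _ s fun α hα => (h1 α hα).2,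
    adj_eq_sum Z (u * w) _ s fun α hα => by rw [dL_mul, (h1 α hα).1, (h1 α hα).2, zero_mul,
      mul_zero, add_zero], smul_sum, ← sum_add_distrib]
  refine sum_ext fun α _ => ?_
  have h2 : IsHom (Z.isOdd ^^ η') (dL (Z, α) w) := (isSDer_dL (Z, α)).isHom hw rfl
  rw [dL_mul, smul_comm (sgn (η && η')), ← smul_add, ← map_smul (iterD α) (sgn (η && η')), ← map_add]
  congr 2
  change (dL (Z, α) u * w + EYM.par Z.isOdd u * dL (Z, α) w) * h = _
  rw [add_mul, mul_assoc, hu.par, smul_mul_assoc, smul_mul_assoc, hu.comm (dL (Z, α) w), h2.par,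
    smul_mul_assoc, smul_mul_assoc, smul_smul, mul_assoc]
  congr 2
  cases Z.isOdd <;> cases η <;> cases η' <;> simp

lemma adj_gen (Z : 𝓥) (W : 𝓥) (α : 𝓜) (h : 𝓐) :
    adj Z (gen (W, α)) h = if W = Z then (-1 : ℝ) ^ α.degree • iterD α h else 0 := by
  rw [adj_eq_sum Z _ h {α} fun γ hγ => dL_gen_of_ne fun e => hγ (by
    rw [Finset.mem_singleton]; exact (Prod.mk.inj e).2), Finset.sum_singleton]
  split_ifs with hW
  · subst hW; rw [dL_gen_self, one_mul]
  · rw [dL_gen_of_ne fun e => hW (Prod.mk.inj e).1.symm]; simp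

lemma iterD_single (μ : Fin n) (x : 𝓐) : iterD (single μ 1) x = totalD μ x := by
  rw [← zero_add (single μ 1), iterD_add_single, iterD_zero]

lemma adj_fld (A Φ : 𝓕) (h : 𝓐) : adj (.fld A) (fld Φ) h = if Φ = A then h else 0 := by
  rw [adj_gen]; simp [iterD_zero]

lemma adj_dfld (μ : Fin n) (A Φ : 𝓕) (h : 𝓐) :
    adj (.fld A) (dfld μ Φ) h = if Φ = A then -totalD μ h else 0 := by
  rw [adj_gen]; simp [iterD_single]

lemma sum_fld {M : Type*} [AddCommMonoid M] (f : 𝓕 → M) :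
    ∑ Φ, f Φ = (∑ μ, ∑ a, f (.e μ a)) + ((∑ μ, ∑ i, f (.A μ i)) + ((∑ m, f (.yB m)) +
      ((∑ m, f (.yF m)) + ((∑ μ, f (.xi μ)) + ∑ I, f (.C I))))) := by
  let E : (Fin n × Fin n) ⊕ (Fin n × ι) ⊕ β ⊕ φ ⊕ Fin n ⊕ 𝓘 ≃ 𝓕 :=
    { toFun := fun x => match x with
        | .inl p => .e p.1 p.2
        | .inr (.inl p) => .A p.1 p.2
        | .inr (.inr (.inl m)) => .yB m
        | .inr (.inr (.inr (.inl m))) => .yF m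
        | .inr (.inr (.inr (.inr (.inl m)))) => .xi m
        | .inr (.inr (.inr (.inr (.inr m)))) => .C m
      invFun := fun Φ => match Φ with
        | .e μ a => .inl (μ, a)
        | .A μ a => .inr (.inl (μ, a))
        | .yB m => .inr (.inr (.inl m))
        | .yF m => .inr (.inr (.inr (.inl m)))
        | .xi m => .inr (.inr (.inr (.inr (.inl m))))
        | .C m => .inr (.inr (.inr (.inr (.inr m))))
      left_inv := fun x => by rcases x with x | x | x | x | x | x <;> rfl
      right_inv := fun x => by cases x <;> rfl }
  rw [← E.sum_comp]
  simp only [Fintype.sum_sum_type, Fintype.sum_prod_type]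
  rfl

/-- The jet coordinates other than those of the ghosts. -/
def ghostFree (n : ℕ) (ι β φ : Type*) : Set (Jet n ι β φ) := {z | ∀ Φ, z.1 = .fld Φ → Φ.IsClassical}

local notation "𝓖" => jetAlg (ghostFree n ι β φ)

lemma totalD_mem_ghostFree (μ : Fin n)
    (hx : x ∈ 𝓖) : totalD μ x ∈ 𝓖 :=
  (isSDer_totalD μ).mem_jetAlg (fun p => by
      rw [totalD_gen]
      refine gen_mem_jetAlg fun Φ h => ?_
      cases h; trivial)
    (fun z hz => by rw [totalD_gen]; exact gen_mem_jetAlg hz) hx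

lemma iterD_mem_ghostFree (α : 𝓜)
    (hx : x ∈ 𝓖) : iterD α x ∈ 𝓖 := by
  induction α using multiIndex_induction with
  | h0 => rwa [iterD_zero]
  | h1 α μ ih => rw [iterD_add_single]; exact totalD_mem_ghostFree μ ih

lemma fld_mem_ghostFree {Φ : 𝓕} (h : Φ.IsClassical) (α : 𝓜) :
    gen (.fld Φ, α) ∈ 𝓖 := gen_mem_jetAlg fun Ψ e => by cases e; exact h

lemma anti_mem_ghostFree (Φ : 𝓕) (α : 𝓜) : gen (.anti Φ, α) ∈ 𝓖 :=
  gen_mem_jetAlg fun Ψ e => by cases e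

lemma dL_ghostFree {Φ : 𝓕} (hΦ : ¬ Φ.IsClassical) (α : 𝓜)
    (hx : x ∈ 𝓖) : dL (.fld Φ, α) x = 0 := by
  refine (isSDer_dL _).eq_zero_of_jetAlg (fun p => dL_gen_of_ne fun e => hΦ ?_)
    (fun z hz => dL_gen_of_ne fun e => hΦ ?_) hx
  · cases e; trivial
  · subst e; exact hz Φ rfl

lemma eulerL_mem_ghostFree (Z : 𝓥)
    (hx : x ∈ 𝓖) : eulerL Z x ∈ 𝓖 := by
  rw [eulerL, adj_eq_sum Z x 1 (adj_finite Z x).toFinset fun α hα => by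
    by_contra h; exact hα (by simpa using h)]
  refine sum_mem fun α _ => Subalgebra.smul_mem _ (iterD_mem_ghostFree _ ?_) _
  rw [mul_one]
  exact dL_mem_jetAlg _ hx

lemma IsInvariantLagrangian.mem_ghostFree (hL : IsInvariantLagrangian D L₀) :
    L₀ ∈ 𝓖 := by
  refine adjoin_mono (Set.union_subset_union_right _ ?_) hL.1
  rintro x ⟨Φ, α, h, rfl⟩
  exact ⟨_, fun Ψ e => by cases e; exact h, rfl⟩

/-- The terms of `s Φ*` due to world indices and to inhomogeneous transformation laws. -/
def antiWorld : 𝓕 → 𝓐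
  | .e ν a => -∑ μ, dfld μ (.xi ν) * anti (.e μ a)
  | .A ν i => -∑ μ, dfld μ (.xi ν) * anti (.A μ i)
  | .xi σ => (∑ ρ, dfld σ (.xi ρ) * anti (.xi ρ)) + ∑ K, dfld σ (.C K) * anti (.C K)
  | _ => 0

lemma isHom_dfld (μ : Fin n) (Φ : 𝓕) : IsHom Φ.isOdd (dfld μ Φ) := isHom_gen (.fld Φ, single μ 1)

lemma gaugeAct_anti (I : 𝓘) (Φ : 𝓕) :
    𝓣 I (anti Φ) = -∑ Ψ, rot D I Ψ Φ • anti Ψ := evol_gen _ _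

lemma gaugeAct_fld (I : 𝓘) (Φ : 𝓕) :
    𝓣 I (fld Φ) = ∑ Ψ, rot D I Φ Ψ • fld Ψ := evol_gen _ _

lemma sum_adj_transl (Φ : 𝓕) : ∑ Ψ, adj (.fld Φ) (∑ ν, xi ν * dfld ν Ψ) (anti Ψ) =
      (∑ ν, if .xi ν = Φ then ∑ Ψ, dfld ν Ψ * anti Ψ else 0) -
        sgn Φ.isOdd • ∑ ν, totalD ν (xi ν * anti Φ) := by
  simp only [← adjL_apply, map_sum, sum_app]
  simp only [adjL_apply, adj_mul _ (isHom_xi _) (isHom_dfld _ _), adj_fld, adj_dfld,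
    sum_add_distrib, smul_ite, smul_zero, Bool.true_and, smul_neg]
  rw [sum_comm, sub_eq_add_neg]
  congr 1
  · refine sum_ext fun ν _ => ?_
    split_ifs <;> simp
  · rw [sum_comm]
    simp [smul_sum]

lemma gaugeAct_anti_e (I : 𝓘) (ν a : Fin n) :
    𝓣 I (anti (.e ν a)) = -∑ b, D.vec I b a • anti (.e ν b) := by
  rw [gaugeAct_anti, sum_fld]; simp [rot, sum_ite_irrel]

lemma gaugeAct_anti_A (I : 𝓘) (ν : Fin n) (i : ι) :
    𝓣 I (anti (.A ν i)) = ∑ k, D.f I (.inl i) (.inl k) • anti (.A ν k) := by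
  rw [gaugeAct_anti, sum_fld]; simp [rot, sum_ite_irrel]

lemma gaugeAct_anti_yB (I : 𝓘) (m : β) :
    𝓣 I (anti (.yB m)) = -∑ k, D.repB I k m • anti (.yB k) := by
  rw [gaugeAct_anti, sum_fld]; simp [rot]

lemma gaugeAct_anti_yF (I : 𝓘) (m : φ) :
    𝓣 I (anti (.yF m)) = -∑ k, D.repF I k m • anti (.yF k) := by
  rw [gaugeAct_anti, sum_fld]; simp [rot]

lemma gaugeAct_anti_xi (I : 𝓘) (μ : Fin n) : 𝓣 I (anti (.xi μ)) = 0 := by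
  rw [gaugeAct_anti, sum_fld]; simp [rot]

lemma gaugeAct_anti_C (I K : 𝓘) : 𝓣 I (anti (.C K)) = ∑ L, D.f I K L • anti (.C L) := by
  rw [gaugeAct_anti, sum_fld]; simp [rot]

lemma gaugeAct_fld_e (I : 𝓘) (ν a : Fin n) :
    𝓣 I (fld (.e ν a)) = ∑ b, D.vec I a b • fld (.e ν b) := by
  rw [gaugeAct_fld, sum_fld]; simp [rot, sum_ite_irrel]

lemma gaugeAct_fld_A (I : 𝓘) (ν : Fin n) (i : ι) :
    𝓣 I (fld (.A ν i)) = -∑ k, D.f I (.inl k) (.inl i) • fld (.A ν k) := by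
  rw [gaugeAct_fld, sum_fld]; simp [rot, sum_ite_irrel]

lemma gaugeAct_fld_yB (I : 𝓘) (m : β) :
    𝓣 I (fld (.yB m)) = ∑ k, D.repB I m k • fld (.yB k) := by
  rw [gaugeAct_fld, sum_fld]; simp [rot]

lemma gaugeAct_fld_yF (I : 𝓘) (m : φ) :
    𝓣 I (fld (.yF m)) = ∑ k, D.repF I m k • fld (.yF k) := by
  rw [gaugeAct_fld, sum_fld]; simp [rot]

lemma gaugeAct_fld_xi (I : 𝓘) (μ : Fin n) : 𝓣 I (fld (.xi μ)) = 0 := by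
  rw [gaugeAct_fld, sum_fld]; simp [rot]

lemma gaugeAct_fld_C (I K : 𝓘) : 𝓣 I (fld (.C K)) = -∑ L, D.f I L K • fld (.C L) := by
  rw [gaugeAct_fld, sum_fld]; simp [rot]

/-- The world index part of `antiWorld` coming from the classical fields. -/
def antiWorld' : 𝓕 → 𝓐
  | .e ν a => -∑ μ, dfld μ (.xi ν) * anti (.e μ a)
  | .A ν i => -∑ μ, dfld μ (.xi ν) * anti (.A μ i)
  | _ => 0

lemma sum_adj_brstRot (hD : D.IsLie) (Φ : 𝓕) : ∃ w ∈ 𝓖,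
    ∑ Ψ, adj (.fld Φ) (brstRot D Ψ) (anti Ψ) =
      w - sgn Φ.isOdd • ((∑ I, gh I * 𝓣 I (anti Φ)) + antiWorld' Φ) := by
  simp only [sum_fld]
  simp only [brstRot, ← adjL_apply, map_sum, map_add, sum_app, add_app,
    map_smul, smul_app, map_neg, map_zero, LinearMap.neg_apply, zero_app]
  simp only [adjL_apply, adj_mul _ (isHom_dxi _ _) (isHom_fld _),
    adj_mul _ (isHom_gh _) (isHom_fld _), adj_fld, adj_dfld]
  cases Φ with
  | e ν a =>
    refine ⟨0, zero_mem _, ?_⟩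
    simp only [gaugeAct_anti_e]
    simp [Fld.isOdd, antiWorld', ite_and, sum_add_distrib, mul_sum,
      sum_ite_irrel]
    rw [sum_comm]
  | A ν i =>
    refine ⟨0, zero_mem _, ?_⟩
    simp only [gaugeAct_anti_A, Fintype.sum_sum_type (fun I => gh I * _)]
    have : ∀ p i k, D.f (.inr p) (.inl i) (.inl k) = 0 := fun p i k => by
      rw [hD.antisymm, hD.f_inl_inr, neg_zero]
    simp [Fld.isOdd, antiWorld', ite_and, sum_add_distrib, mul_sum,
      sum_ite_irrel, this]
    rw [sum_comm, ← sum_neg_distrib]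
    refine sum_ext fun j _ => ?_
    rw [← sum_neg_distrib]
    refine sum_ext fun k _ => ?_
    rw [hD.antisymm, neg_smul]
  | yB m =>
    refine ⟨0, zero_mem _, ?_⟩
    simp only [gaugeAct_anti_yB]
    simp [Fld.isOdd, antiWorld', mul_sum]
    rw [sum_comm]
  | yF m =>
    refine ⟨0, zero_mem _, ?_⟩
    simp only [gaugeAct_anti_yF]
    simp [Fld.isOdd, antiWorld', mul_sum]
    rw [sum_comm]
  | xi m =>
    refine ⟨-(∑ x, ∑ x_1, (totalD x) (fld (Fld.e m x_1) * anti (Fld.e x x_1))) +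
      -∑ x, ∑ x_1, (totalD x) (fld (Fld.A m x_1) * anti (Fld.A x x_1)), ?_, ?_⟩
    · refine add_mem (neg_mem (sum_mem fun x _ => sum_mem fun y _ => ?_))
        (neg_mem (sum_mem fun x _ => sum_mem fun y _ => ?_)) <;>
      exact totalD_mem_ghostFree _ (mul_mem
        (fld_mem_ghostFree (by trivial) _) (anti_mem_ghostFree _ _))
    simp only [gaugeAct_anti_xi]
    simp [Fld.isOdd, antiWorld']
  | C K =>
    have key : ∀ w r, w ∈ 𝓖 →
        r = ∑ I, gh I * 𝓣 I (anti (.C K)) → ∃ w' ∈ 𝓖, w + r =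
      w' - sgn (Fld.C K : 𝓕).isOdd • ((∑ I, gh I * 𝓣 I (anti (.C K))) +
        antiWorld' (.C K)) := fun w r hw hr =>
      ⟨w, hw, by rw [hr]; simp [Fld.isOdd, antiWorld']⟩
    simp only [← add_assoc]
    simp only [reduceCtorEq, if_false, Fld.C.injEq, zero_add, smul_zero, sum_const_zero,
      add_zero]
    have hg : ∀ Φ : 𝓕, Φ.IsClassical → fld Φ ∈ 𝓖 := fun Φ h =>
      fld_mem_ghostFree h 0
    refine key _ _ ?_ ?_
    rotate_left
    · simp only [gaugeAct_anti_C, sum_neg_distrib, smul_add, sum_add_distrib, smul_ite, smul_zero]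
      simp [Fld.isOdd, sum_ite_irrel, mul_sum]
      simp only [smul_sum, smul_smul, ← sub_eq_add_neg, ← sum_sub_distrib]
      rw [sum_comm]
      refine sum_ext fun I _ => sum_ext fun L _ => ?_
      rw [hD.antisymm K I L, ← sub_smul]
      congr 1
      ring
    · have hi : ∀ (p : Prop) [Decidable p] (x : 𝓐),
          x ∈ 𝓖 → (if p then x else 0) ∈ 𝓖 := fun p _ x hx => by
        split_ifs
        · exact hx
        · exact zero_mem _
      refine add_mem (add_mem (add_mem ?_ ?_) ?_) ?_
      · exact sum_mem fun _ _ => sum_mem fun _ _ => sum_mem fun _ _ => sum_mem fun _ _ =>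
          Subalgebra.smul_mem _ (hi _ _ (mul_mem (hg _ (by trivial)) (anti_mem_ghostFree _ _))) _
      · exact sum_mem fun _ _ => sum_mem fun _ _ => add_mem
          (hi _ _ (neg_mem (totalD_mem_ghostFree _ (anti_mem_ghostFree _ _))))
          (sum_mem fun _ _ => sum_mem fun _ _ =>
            Subalgebra.smul_mem _ (hi _ _ (mul_mem (hg _ (by trivial)) (anti_mem_ghostFree _ _))) _)
      · exact sum_mem fun _ _ => sum_mem fun _ _ => sum_mem fun _ _ =>
          Subalgebra.smul_mem _ (hi _ _ (mul_mem (hg _ (by trivial)) (anti_mem_ghostFree _ _))) _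
      · exact sum_mem fun _ _ => sum_mem fun _ _ => sum_mem fun _ _ =>
          Subalgebra.smul_mem _ (hi _ _ (mul_mem (hg _ (by trivial)) (anti_mem_ghostFree _ _))) _

/-- The BRST transformation of the antifields. -/
lemma brst_anti_eq (hD : D.IsLie) (hL : IsInvariantLagrangian D L₀) (Φ : 𝓕) :
    ∃ w ∈ 𝓖, 𝓢 (anti Φ) =
      w + (∑ ν, totalD ν (xi ν * anti Φ)) + (∑ I, gh I * 𝓣 I (anti Φ)) + antiWorld Φ := by
  have hh := hL.isHom
  have h : IsHom Φ.isOdd (eulerL (.fld Φ) (masterDensity D L₀)) :=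
    eulerL_isHom (isHom_master hh) (by simp [Var.isOdd])
  have h1 : 𝓢 (anti Φ) = sgn Φ.isOdd • eulerL (.fld Φ) (masterDensity D L₀) := by
    rw [brst_anti, euler_eq, h.par]; simp [Var.isOdd]
  have e1 : eulerL (.fld Φ) (masterDensity D L₀) = eulerL (.fld Φ) L₀ -
      ((∑ Ψ, adj (.fld Φ) (∑ ν, xi ν * dfld ν Ψ) (anti Ψ)) +
        ∑ Ψ, adj (.fld Φ) (brstRot D Ψ) (anti Ψ)) := by
    rw [← sum_add_distrib]
    have h2 : ∀ Ψ, adj (.fld Φ) (∑ ν, xi ν * dfld ν Ψ) (anti Ψ) +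
        adj (.fld Φ) (brstRot D Ψ) (anti Ψ) = eulerL (.fld Φ) (brstField D Ψ * anti Ψ) :=
      fun Ψ => by rw [← adj_add_left, ← brstField_eq, eulerL_mul_anti]
    simp only [h2]
    simp only [eulerL, ← adjL_apply, masterDensity, map_sub, map_sum, sub_app, sum_app]
  obtain ⟨w, hw, h2⟩ := sum_adj_brstRot hD Φ
  rw [h1, e1, sum_adj_transl, h2]
  have hE := eulerL_mem_ghostFree (.fld Φ) hL.mem_ghostFree
  obtain ⟨v, hv, h3⟩ : ∃ v ∈ 𝓖,
      -(sgn Φ.isOdd • ∑ ν, if Fld.xi ν = Φ then ∑ Ψ, dfld ν Ψ * anti Ψ else 0) + antiWorld' Φ =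
        v + antiWorld Φ := by
    cases Φ with
    | xi σ =>
      refine ⟨(∑ μ, ∑ a, dfld σ (.e μ a) * anti (.e μ a)) +
        (∑ μ, ∑ i, dfld σ (.A μ i) * anti (.A μ i)) + (∑ m, dfld σ (.yB m) * anti (.yB m)) +
        ∑ m, dfld σ (.yF m) * anti (.yF m), ?_, ?_⟩
      rotate_left
      · simp only [Fld.xi.injEq, sum_ite_eq', mem_univ, if_true, sum_fld, antiWorld',
          antiWorld, add_zero, Fld.isOdd, sgn_true, neg_smul, one_smul, neg_neg]
        abel
      · have hg : ∀ Φ : 𝓕, Φ.IsClassical →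
            dfld σ Φ * anti Φ ∈ 𝓖 := fun Φ h =>
          mul_mem (fld_mem_ghostFree h _) (anti_mem_ghostFree _ _)
        exact add_mem (add_mem (add_mem (sum_mem fun _ _ => sum_mem fun _ _ => hg _ True.intro)
          (sum_mem fun _ _ => sum_mem fun _ _ => hg _ True.intro))
          (sum_mem fun _ _ => hg _ True.intro)) (sum_mem fun _ _ => hg _ True.intro)
    | e ν a => exact ⟨0, zero_mem _, by simp [antiWorld', antiWorld]⟩
    | A ν a => exact ⟨0, zero_mem _, by simp [antiWorld', antiWorld]⟩
    | yB m => exact ⟨0, zero_mem _, by simp [antiWorld', antiWorld]⟩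
    | yF m => exact ⟨0, zero_mem _, by simp [antiWorld', antiWorld]⟩
    | C K => exact ⟨0, zero_mem _, by simp [antiWorld', antiWorld]⟩
  refine ⟨sgn Φ.isOdd • eulerL (.fld Φ) L₀ - sgn Φ.isOdd • w + v,
    add_mem (sub_mem (Subalgebra.smul_mem _ hE _) (Subalgebra.smul_mem _ hw _)) hv, ?_⟩
  have h4 : ∀ y : 𝓐, sgn Φ.isOdd • sgn Φ.isOdd • y = y := fun y => by
    rw [smul_smul, sgn_mul_self, one_smul]
  simp only [smul_sub, smul_add, h4]
  rw [eq_sub_of_add_eq h3.symm]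
  abel

end AntiBRST

local notation "𝓖" => jetAlg (ghostFree n ι β φ)

section Lie

/-! ## Contractions and Lie derivatives with respect to the ghosts -/

/-- Index of a ghost: `ξ^σ` or `C^J`. -/
abbrev GhIdx (n : ℕ) (ι : Type*) : Type _ := Fin n ⊕ (ι ⊕ LPair n)

local notation "𝓗" => GhIdx n ι

/-- The ghost with a given index. -/
def ghFld : 𝓗 → 𝓕
  | .inl σ => .xi σ
  | .inr J => .C J

/-- The jet coordinate `∂^γ` of a ghost. -/
abbrev gJet (g : 𝓗) (γ : 𝓜) : 𝓙 := (.fld (ghFld g), γ)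

lemma ghFld_odd (g : 𝓗) : (ghFld g : 𝓕).isOdd = true := by cases g <;> rfl

lemma ghFld_not_classical (g : 𝓗) : ¬ (ghFld g : 𝓕).IsClassical := by
  cases g <;> exact id

lemma ghFld_injective : Injective (ghFld : 𝓗 → 𝓕) := by
  rintro (a | a) (b | b) h <;> cases h <;> rfl

lemma isSDer_dL_gJet (g : 𝓗) (γ : 𝓜) : IsSDer true (dL (gJet g γ : 𝓙)) := by
  have := isSDer_dL (gJet g γ : 𝓙)
  rwa [show (gJet g γ : 𝓙).1.isOdd = true from ghFld_odd g] at this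

lemma dL_gJet_mul (g : 𝓗) (γ : 𝓜) (x y : 𝓐) :
    dL (gJet g γ) (x * y) = dL (gJet g γ) x * y + parity x * dL (gJet g γ) y :=
  (isSDer_dL_gJet g γ).mul x y

lemma dL_totalD (Z : 𝓥) (γ : 𝓜) (μ : Fin n) (x : 𝓐) :
    dL (Z, γ) (totalD μ x) = totalD μ (dL (Z, γ) x) +
      if γ μ = 0 then 0 else dL (Z, γ - single μ 1) x := by
  split_ifs with h
  · rw [dL_totalD_zero Z γ μ h, add_zero]
  · obtain ⟨γ', rfl⟩ := exists_eq_add_single h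
    rw [dL_totalD_succ, add_tsub_cancel_right]

variable (D L₀)

/-- Gauge data satisfying the Lie algebra relations together with an invariant Lagrangian. -/
class Admissible : Prop where
  isLie : D.IsLie
  invariant : IsInvariantLagrangian D L₀

/-- The anticommutator of `s` with the derivative with respect to a ghost jet coordinate. -/
def lie (g : 𝓗) (γ : 𝓜) : 𝓛 := scomm true true 𝓢 (dL (gJet g γ))

local notation "𝓠" => lie D L₀

variable {D L₀}

lemma Admissible.even (adm : Admissible D L₀) : IsHom false L₀ := adm.invariant.isHom

variable [adm : Admissible D L₀]

lemma lie_apply (g : 𝓗) (γ : 𝓜) (x : 𝓐) :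
    𝓠 g γ x = 𝓢 (dL (gJet g γ) x) + dL (gJet g γ) (𝓢 x) := by
  rw [lie, scomm_apply]; simp

lemma lie_eq {g : 𝓗} {γ : 𝓜}
    (hx : dL (gJet g γ) x = 0) : 𝓠 g γ x = dL (gJet g γ) (𝓢 x) := by
  rw [lie_apply, hx, map_zero, zero_add]

lemma isSDer_lie (g : 𝓗) (γ : 𝓜) :
    IsSDer false (𝓠 g γ) := (isSDer_brst adm.even).scomm (isSDer_dL_gJet g γ)

lemma lie_mul (g : 𝓗) (γ : 𝓜) (x y : 𝓐) :
    𝓠 g γ (x * y) = 𝓠 g γ x * y + x * 𝓠 g γ y := (isSDer_lie g γ).mul x y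

lemma lie_gen (g : 𝓗) (γ : 𝓜) (z : 𝓙) :
    𝓠 g γ (gen z) = dL (gJet g γ) (𝓢 (gen z)) := by
  rw [lie_apply, dL_gen]
  split_ifs
  · rw [(isSDer_brst adm.even).map_one, zero_add]
  · rw [map_zero, zero_add]

lemma lie_brst (g : 𝓗) (γ : 𝓜) (x : 𝓐) :
    𝓠 g γ (𝓢 x) = 𝓢 (𝓠 g γ x) := by
  rw [lie_apply, lie_apply, brst_sq adm.isLie adm.invariant, map_zero, add_zero, map_add, brst_sq adm.isLie adm.invariant, zero_add]

lemma lie_totalD (g : 𝓗) (γ : 𝓜) (μ : Fin n)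
    (x : 𝓐) : 𝓠 g γ (totalD μ x) = totalD μ (𝓠 g γ x) +
      if γ μ = 0 then 0 else 𝓠 g (γ - single μ 1) x := by
  rw [lie_apply, dL_totalD, brst_totalD adm.even, dL_totalD, map_add, brst_totalD adm.even, lie_apply]
  split_ifs with h
  · simp
  · rw [lie_apply]; simp only [map_add]; abel

lemma lie_single_totalD (g : 𝓗) (ρ μ : Fin n) (x : 𝓐) :
    𝓠 g (single ρ 1) (totalD μ x) = totalD μ (𝓠 g (single ρ 1) x) +
      if ρ = μ then 𝓠 g 0 x else 0 := by
  rw [lie_totalD]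
  by_cases h : ρ = μ
  · subst h; simp
  · simp [h]

lemma lie_zero_totalD (g : 𝓗) (μ : Fin n) (x : 𝓐) :
    𝓠 g 0 (totalD μ x) = totalD μ (𝓠 g 0 x) := by
  rw [lie_totalD]; simp

lemma dL_gJet_fld (g : 𝓗) (γ α : 𝓜) (Φ : 𝓕) : dL (gJet g γ) (gen (.fld Φ, α) : 𝓐) =
      if ghFld g = Φ then (if γ = α then 1 else 0) else 0 := by
  rw [dL_gen, ← ite_and]
  simp [Prod.ext_iff]

lemma dL_gJet_anti (g : 𝓗) (γ α : 𝓜) (Φ : 𝓕) : dL (gJet g γ) (gen (.anti Φ, α) : 𝓐) = 0 :=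
  dL_gen_of_ne fun h => by cases h

lemma parity_xi (μ : Fin n) : parity (xi μ : 𝓐) = -xi μ := by
  rw [isHom_xi μ]; simp

lemma parity_gh (I : 𝓘) : parity (gh I : 𝓐) = -gh I := by
  rw [isHom_gh I]; simp

lemma lie_fld (g : 𝓗) (γ : 𝓜) (Φ : 𝓕) :
    𝓠 g γ (fld Φ) = dL (gJet g γ) (brstField D Φ) := by rw [lie_gen, brst_fld]

lemma dL_transl_fld (g : 𝓗) (γ : 𝓜) (Φ : 𝓕) : dL (gJet g γ) (∑ ν, xi ν * dfld ν Φ) =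
      (∑ ν, if ghFld g = (.xi ν : 𝓕) then (if γ = 0 then dfld ν Φ else 0) else 0) -
        ∑ ν, if ghFld g = Φ then (if γ = single ν 1 then xi ν else 0) else 0 := by
  rw [map_sum, ← sum_sub_distrib]
  refine sum_ext fun ν _ => ?_
  rw [dL_gJet_mul, dL_gJet_fld, dL_gJet_fld, parity_xi]
  split_ifs <;> simp [sub_eq_add_neg]

lemma lie_xi_e (σ : Fin n) (γ : 𝓜) (μ a : Fin n) : 𝓠 (.inl σ) γ (vb μ a) =
    (if γ = 0 then dfld σ (.e μ a) else 0) + if γ = single μ 1 then vb σ a else 0 := by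
  rw [lie_fld, brstField_eq, map_add, dL_transl_fld]
  simp [ghFld, brstRot, dL_gJet_mul, dL_gJet_fld]

lemma lie_xi_A (σ : Fin n) (γ : 𝓜) (μ : Fin n) (i : ι) : 𝓠 (.inl σ) γ (fld (.A μ i)) =
    (if γ = 0 then dfld σ (.A μ i) else 0) + if γ = single μ 1 then fld (.A σ i) else 0 := by
  rw [lie_fld, brstField_eq, map_add, dL_transl_fld]
  simp [ghFld, brstRot, dL_gJet_mul, dL_gJet_fld]

lemma lie_xi_yB (σ : Fin n) (γ : 𝓜) (m : β) :
    𝓠 (.inl σ) γ (fld (.yB m)) = if γ = 0 then dfld σ (.yB m) else 0 := by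
  rw [lie_fld, brstField_eq, map_add, dL_transl_fld]
  simp [ghFld, brstRot, dL_gJet_mul, dL_gJet_fld]

lemma lie_xi_yF (σ : Fin n) (γ : 𝓜) (m : φ) :
    𝓠 (.inl σ) γ (fld (.yF m)) = if γ = 0 then dfld σ (.yF m) else 0 := by
  rw [lie_fld, brstField_eq, map_add, dL_transl_fld]
  simp [ghFld, brstRot, dL_gJet_mul, dL_gJet_fld]

lemma lie_xi_xi (σ : Fin n) (γ : 𝓜) (μ : Fin n) :
    𝓠 (.inl σ) γ (xi μ) = (if γ = 0 then dfld σ (.xi μ) else 0) -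
      if σ = μ then ∑ ν, (if γ = single ν 1 then xi ν else 0) else 0 := by
  rw [lie_fld, brstField_eq, map_add, dL_transl_fld]
  simp [ghFld, brstRot, sum_ite_irrel]

lemma lie_xi_C (σ : Fin n) (γ : 𝓜) (I : 𝓘) :
    𝓠 (.inl σ) γ (gh I) = if γ = 0 then dfld σ (.C I) else 0 := by
  rw [lie_fld, brstField_eq, map_add, dL_transl_fld]
  simp [ghFld, brstRot, dL_gJet_mul, dL_gJet_fld]

lemma lie_C_e (J : 𝓘) (γ : 𝓜) (μ a : Fin n) : 𝓠 (.inr J) γ (vb μ a) =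
    if γ = 0 then 𝓣 J (vb μ a) else 0 := by
  rw [lie_fld, brstField_eq, map_add, dL_transl_fld, gaugeAct_fld_e]
  simp [ghFld, brstRot, dL_gJet_mul, dL_gJet_fld, sum_ite_irrel]

lemma lie_C_A (J : 𝓘) (γ : 𝓜) (μ : Fin n) (i : ι) : 𝓠 (.inr J) γ (fld (.A μ i)) =
    (if γ = 0 then 𝓣 J (fld (.A μ i)) else 0) +
      if γ = single μ 1 then (if J = .inl i then 1 else 0) else 0 := by
  rw [lie_fld, brstField_eq, map_add, dL_transl_fld, gaugeAct_fld_A]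
  have : ∀ p i k, D.f (.inr p) (.inl i) (.inl k) = 0 := fun p i k => by
    rw [adm.isLie.antisymm, adm.isLie.f_inl_inr, neg_zero]
  cases J with
  | inl j =>
    simp [ghFld, brstRot, dL_gJet_mul, dL_gJet_fld, sum_ite_irrel]
    rw [add_comm]
    congr 1
    · congr 1
      rw [← sum_neg_distrib]
      refine sum_ext fun k _ => ?_
      rw [adm.isLie.antisymm, neg_smul]
    · by_cases h : j = i <;> simp [h]
  | inr p => simp [ghFld, brstRot, dL_gJet_mul, dL_gJet_fld, this]

lemma lie_C_yB (J : 𝓘) (γ : 𝓜) (m : β) :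
    𝓠 (.inr J) γ (fld (.yB m)) = if γ = 0 then 𝓣 J (fld (.yB m)) else 0 := by
  rw [lie_fld, brstField_eq, map_add, dL_transl_fld, gaugeAct_fld_yB]
  simp [ghFld, brstRot, dL_gJet_mul, dL_gJet_fld, sum_ite_irrel]

lemma lie_C_yF (J : 𝓘) (γ : 𝓜) (m : φ) :
    𝓠 (.inr J) γ (fld (.yF m)) = if γ = 0 then 𝓣 J (fld (.yF m)) else 0 := by
  rw [lie_fld, brstField_eq, map_add, dL_transl_fld, gaugeAct_fld_yF]
  simp [ghFld, brstRot, dL_gJet_mul, dL_gJet_fld, sum_ite_irrel]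

lemma lie_C_xi (J : 𝓘) (γ : 𝓜) (μ : Fin n) : 𝓠 (.inr J) γ (xi μ) = 0 := by
  rw [lie_fld, brstField_eq, map_add, dL_transl_fld]
  simp [ghFld, brstRot]

lemma lie_C_C (J : 𝓘) (γ : 𝓜) (K : 𝓘) :
    𝓠 (.inr J) γ (gh K) = (if γ = 0 then 𝓣 J (gh K) else 0) -
      if J = K then ∑ ν, (if γ = single ν 1 then xi ν else 0) else 0 := by
  rw [lie_fld, brstField_eq, map_add, dL_transl_fld, gaugeAct_fld_C]
  simp [ghFld, brstRot, dL_gJet_mul, dL_gJet_fld, parity_gh, sum_ite_irrel,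
    sum_add_distrib]
  by_cases h : γ = 0
  · have h1 : ∀ ν, (0 : 𝓜) ≠ single ν 1 := by simp [eq_comm]
    subst h
    simp only [if_true, h1, if_false, sum_const_zero, ite_self, sub_zero,
      neg_zero, zero_add, ← sub_eq_add_neg]
    have h2 : ∀ L, D.f L J K • (gh L : 𝓐) = -(D.f J L K • gh L) := fun L => by
      rw [adm.isLie.antisymm, neg_smul]
    simp only [h2, sum_neg_distrib, smul_neg]
    module
  · simp [h]

lemma dL_div_anti (g : 𝓗) (γ : 𝓜) (Φ : 𝓕) :
    dL (gJet g γ) (∑ ν, totalD ν (xi ν * anti Φ)) = ∑ ν, if ghFld g = (.xi ν : 𝓕) then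
      (if γ = 0 then totalD ν (anti Φ) else 0) + (if γ = single ν 1 then anti Φ else 0)
      else 0 := by
  rw [map_sum]
  refine sum_ext fun ν _ => ?_
  have h : ∀ γ, dL (gJet g γ) (xi ν * anti Φ) =
      if ghFld g = (.xi ν : 𝓕) then (if γ = 0 then anti Φ else 0) else 0 := fun γ => by
    rw [dL_gJet_mul, dL_gJet_fld, dL_gJet_anti]
    split_ifs <;> simp
  rw [dL_totalD, h, h]
  have h2 : (γ ν ≠ 0 ∧ γ - single ν 1 = 0) ↔ γ = single ν 1 := by
    constructor
    · rintro ⟨h1, h2⟩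
      obtain ⟨γ', rfl⟩ := exists_eq_add_single h1
      rw [add_tsub_cancel_right] at h2
      rw [h2, zero_add]
    · rintro rfl; simp
  by_cases hg : ghFld g = (.xi ν : 𝓕)
  · simp only [hg, if_true]
    congr 1
    · split_ifs <;> simp
    · by_cases h3 : γ ν = 0
      · rw [if_pos h3, if_neg fun h4 => (h2.2 h4).1 h3]
      · rw [if_neg h3]
        by_cases h4 : γ - single ν 1 = 0
        · rw [if_pos h4, if_pos (h2.1 ⟨h3, h4⟩)]
        · rw [if_neg h4, if_neg fun h5 => h4 (h2.2 h5).2]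
  · simp [hg]

lemma lie_anti (g : 𝓗) (γ : 𝓜) (Φ : 𝓕) :
    𝓠 g γ (anti Φ) = (∑ ν, if ghFld g = (.xi ν : 𝓕) then
      (if γ = 0 then totalD ν (anti Φ) else 0) + (if γ = single ν 1 then anti Φ else 0)
      else 0) + (∑ I, if ghFld g = (.C I : 𝓕) then
        (if γ = 0 then 𝓣 I (anti Φ) else 0) else 0) + dL (gJet g γ) (antiWorld Φ) := by
  obtain ⟨w, hw, h⟩ := brst_anti_eq adm.isLie adm.invariant Φ
  rw [lie_gen, h, map_add, map_add, map_add, dL_ghostFree (ghFld_not_classical g) γ hw,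
    dL_div_anti, zero_add, map_sum]
  congr 2
  refine sum_ext fun I _ => ?_
  rw [dL_gJet_mul, gaugeAct_anti, map_neg, map_sum]
  simp only [map_smul, dL_gJet_anti, dL_gJet_fld, smul_zero, sum_const_zero, neg_zero, mul_zero,
    add_zero]
  split_ifs <;> simp

lemma sum_ite_ghFld_C {M : Type*} [AddCommMonoid M] (J : 𝓘)
    (f : 𝓘 → M) [∀ I, Decidable (ghFld (.inr J) = (.C I : 𝓕))] :
    ∑ I, (if ghFld (.inr J) = (.C I : 𝓕) then f I else 0) = f J := by
  rw [sum_eq_single J (fun I _ hI => if_neg fun h => hI (by cases h; rfl)) (by simp),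
      if_pos (show ghFld (.inr J) = Fld.C J from rfl)]

lemma lie_xi_anti (σ : Fin n) (γ : 𝓜) (Φ : 𝓕) :
    𝓠 (.inl σ) γ (anti Φ) = (if γ = 0 then totalD σ (anti Φ) else 0) +
      (if γ = single σ 1 then anti Φ else 0) + dL (gJet (.inl σ) γ) (antiWorld Φ) := by
  rw [lie_anti]; simp [ghFld]

lemma lie_C_anti (J : 𝓘) (γ : 𝓜) (Φ : 𝓕) :
    𝓠 (.inr J) γ (anti Φ) = (if γ = 0 then 𝓣 J (anti Φ) else 0) +
      dL (gJet (.inr J) γ) (antiWorld Φ) := by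
  rw [lie_anti, sum_ite_ghFld_C, sum_eq_zero fun ν _ => if_neg (fun h => by cases h), zero_add]

lemma lie_xi_zero (σ : Fin n) : 𝓠 (.inl σ) 0 = totalD σ := by
  refine (isSDer_lie _ _).ext (isSDer_totalD σ) fun z => ?_
  obtain ⟨Z, α⟩ := z
  have h0 : (0 : 𝓜) ≠ single σ 1 := by simp [eq_comm]
  have h0' : ∀ μ, (0 : 𝓜) ≠ single μ 1 := by simp [eq_comm]
  suffices h : 𝓠 (.inl σ) 0 (gen (Z, 0)) = totalD σ (gen (Z, 0)) by
    have h1 := iterD_comm_of_comm (lie_zero_totalD (D := D) (L₀ := L₀) (.inl σ)) α (gen (Z, 0))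
    rwa [h, iterD_totalD, iterD_gen, zero_add] at h1
  cases Z with
  | fld Φ =>
    rw [totalD_fld]
    cases Φ with
    | e μ a => rw [lie_xi_e]; simp [h0']
    | A μ a => rw [lie_xi_A]; simp [h0']
    | yB m => rw [lie_xi_yB]; simp
    | yF m => rw [lie_xi_yF]; simp
    | xi μ => rw [lie_xi_xi]; simp [h0']
    | C I => rw [lie_xi_C]; simp
  | anti Φ =>
    rw [lie_anti]
    have h2 : dL (gJet (.inl σ) 0) (antiWorld Φ : 𝓐) = 0 := by
      cases Φ <;> simp [antiWorld, dL_gJet_mul, dL_gJet_fld, dL_gJet_anti, h0', ghFld]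
    rw [h2]
    simp [ghFld, h0']

lemma isSDer_gaugeAct (J : 𝓘) : IsSDer false (𝓣 J) := by
  refine isSDer_evol fun z => ?_
  obtain ⟨Z, α⟩ := z
  cases Z with
  | fld Φ =>
    refine IsHom.sum fun Ψ _ => ?_
    have h : rot D J Φ Ψ ≠ 0 → Ψ.isOdd = Φ.isOdd := by
      cases Φ <;> cases Ψ <;> simp [rot, Fld.isOdd]
    by_cases h0 : rot D J Φ Ψ = 0
    · rw [h0, zero_smul]; exact isHom_zero _
    · refine IsHom.smul ?_ _
      have := isHom_gen (.fld Ψ, α)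
      rw [Bool.false_xor]
      change IsHom Φ.isOdd _
      rw [← h h0]; exact this
  | anti Φ =>
    refine IsHom.neg (IsHom.sum fun Ψ _ => ?_)
    have h : rot D J Ψ Φ ≠ 0 → Ψ.isOdd = Φ.isOdd := by
      cases Φ <;> cases Ψ <;> simp [rot, Fld.isOdd]
    by_cases h0 : rot D J Ψ Φ = 0
    · rw [h0, zero_smul]; exact isHom_zero _
    · refine IsHom.smul ?_ _
      have := isHom_gen (.anti Ψ, α)
      rw [Bool.false_xor]
      change IsHom (!Φ.isOdd) _
      rw [← h h0]; exact this

lemma gaugeAct_totalD (J : 𝓘) (μ : Fin n) (x : 𝓐) :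
   𝓣 J (totalD μ x) = totalD μ (𝓣 J x) := by
  have := (isSDer_gaugeAct (D := D) J).comp_comm (isSDer_totalD μ) (fun z => by
    obtain ⟨Z, α⟩ := z
    rw [totalD_gen, gaugeAct, evol_gen, evol_gen]
    cases Z <;> simp [totalD_gen]) x
  simpa using this

lemma lie_C_zero (J : 𝓘) : 𝓠 (.inr J) 0 = 𝓣 J := by
  refine (isSDer_lie _ _).ext (isSDer_gaugeAct J) fun z => ?_
  obtain ⟨Z, α⟩ := z
  have h0' : ∀ μ, (0 : 𝓜) ≠ single μ 1 := by simp [eq_comm]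
  suffices h : 𝓠 (.inr J) 0 (gen (Z, 0)) = 𝓣 J (gen (Z, 0)) by
    have h1 := iterD_comm_of_comm (lie_zero_totalD (D := D) (L₀ := L₀) (.inr J)) α (gen (Z, 0))
    rwa [h, ← iterD_comm_of_comm (gaugeAct_totalD J), iterD_gen, zero_add] at h1
  cases Z with
  | fld Φ =>
    cases Φ with
    | e μ a => rw [lie_C_e]; simp
    | A μ a => rw [lie_C_A]; simp [h0']
    | yB m => rw [lie_C_yB]; simp
    | yF m => rw [lie_C_yF]; simp
    | xi μ => rw [lie_C_xi, gaugeAct_fld_xi]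
    | C I => rw [lie_C_C]; simp [h0']
  | anti Φ =>
    rw [lie_C_anti, if_pos rfl]
    have h3 : ∀ μ (Φ : 𝓕), dL (gJet (.inr J) 0) (dfld μ Φ : 𝓐) = 0 :=
        fun μ Φ => by simp [dL_gJet_fld, h0']
    have h2 : dL (gJet (.inr J) 0) (antiWorld Φ : 𝓐) = 0 := by
      cases Φ <;> simp [antiWorld, dL_gJet_mul, h3, dL_gJet_anti]
    rw [h2, add_zero]

/-! ### Lie derivatives along first and higher derivatives of the ghosts -/

lemma single_ne_of_two_le {γ : 𝓜} (h : 2 ≤ γ.degree) (μ : Fin n) :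
    γ ≠ single μ 1 := by rintro rfl; simp at h

lemma ne_zero_of_two_le {γ : 𝓜} (h : 2 ≤ γ.degree) : γ ≠ 0 := by rintro rfl; simp at h

/-- `x` has the Lie derivatives `w ρ σ` along `∂_ρ ξ^σ` and `v ρ J` along `∂_ρ C^J`, and vanishing
ones along higher derivatives of the ghosts. -/
structure HasLie (D : GaugeData n ι β φ) (L₀ : 𝓐) (x : 𝓐)
    (w : Fin n → Fin n → 𝓐) (v : Fin n → 𝓘 → 𝓐) : Prop where
  xi : ∀ ρ σ, lie D L₀ (.inl σ) (single ρ 1) x = w ρ σ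
  gh : ∀ ρ J, lie D L₀ (.inr J) (single ρ 1) x = v ρ J
  high : ∀ g (γ : 𝓜), 2 ≤ γ.degree → lie D L₀ g γ x = 0

lemma HasLie.add {w w' v v'} (hx : HasLie D L₀ x w v)
    (hy : HasLie D L₀ y w' v') : HasLie D L₀ (x + y) (fun ρ σ => w ρ σ + w' ρ σ)
      (fun ρ J => v ρ J + v' ρ J) where
  xi ρ σ := by rw [map_add, hx.xi, hy.xi]
  gh ρ σ := by rw [map_add, hx.gh, hy.gh]
  high g γ h := by rw [map_add, hx.high g γ h, hy.high g γ h, add_zero]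

lemma HasLie.sub {w w' v v'} (hx : HasLie D L₀ x w v)
    (hy : HasLie D L₀ y w' v') : HasLie D L₀ (x - y) (fun ρ σ => w ρ σ - w' ρ σ)
      (fun ρ J => v ρ J - v' ρ J) where
  xi ρ σ := by rw [map_sub, hx.xi, hy.xi]
  gh ρ σ := by rw [map_sub, hx.gh, hy.gh]
  high g γ h := by rw [map_sub, hx.high g γ h, hy.high g γ h, sub_zero]

lemma HasLie.sum {I : Type*} {s : Finset I} {x : I → 𝓐}
    {w : I → Fin n → Fin n → 𝓐} {v : I → Fin n → 𝓘 → 𝓐}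
    (hx : ∀ i ∈ s, HasLie D L₀ (x i) (w i) (v i)) : HasLie D L₀ (∑ i ∈ s, x i)
      (fun ρ σ => ∑ i ∈ s, w i ρ σ) (fun ρ J => ∑ i ∈ s, v i ρ J) where
  xi ρ σ := by rw [map_sum]; exact sum_ext fun i hi => (hx i hi).xi ρ σ
  gh ρ σ := by rw [map_sum]; exact sum_ext fun i hi => (hx i hi).gh ρ σ
  high g γ h := by rw [map_sum]; exact sum_eq_zero fun i hi => (hx i hi).high g γ h

lemma HasLie.mul {w w' v v'} (hx : HasLie D L₀ x w v)
    (hy : HasLie D L₀ y w' v') : HasLie D L₀ (x * y) (fun ρ σ => w ρ σ * y + x * w' ρ σ)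
      (fun ρ J => v ρ J * y + x * v' ρ J) where
  xi ρ σ := by rw [lie_mul, hx.xi, hy.xi]
  gh ρ σ := by rw [lie_mul, hx.gh, hy.gh]
  high g γ h := by rw [lie_mul, hx.high g γ h, hy.high g γ h, zero_mul, mul_zero, add_zero]

lemma HasLie.congr {w w' v v'} (hx : HasLie D L₀ x w v)
    (hw : ∀ ρ σ, w ρ σ = w' ρ σ) (hv : ∀ ρ J, v ρ J = v' ρ J) : HasLie D L₀ x w' v' where
  xi ρ σ := by rw [hx.xi, hw]
  gh ρ σ := by rw [hx.gh, hv]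
  high := hx.high

lemma hasLie_e (μ a : Fin n) : HasLie D L₀ (vb μ a)
    (fun ρ σ => if ρ = μ then vb σ a else 0) (fun _ _ => 0) where
  xi ρ σ := by rw [lie_xi_e]; simp [single_left_inj]
  gh ρ J := by rw [lie_C_e]; simp
  high g γ h := by
    rcases g with σ | J
    · rw [lie_xi_e]; simp [single_ne_of_two_le h, ne_zero_of_two_le h]
    · rw [lie_C_e]; simp [ne_zero_of_two_le h]

lemma hasLie_A (μ : Fin n) (i : ι) : HasLie D L₀ (fld (.A μ i))
    (fun ρ σ => if ρ = μ then fld (.A σ i) else 0)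
    (fun ρ J => if ρ = μ then (if J = .inl i then 1 else 0) else 0) where
  xi ρ σ := by rw [lie_xi_A]; simp [single_left_inj]
  gh ρ J := by rw [lie_C_A]; simp [single_left_inj]
  high g γ h := by
    rcases g with σ | J
    · rw [lie_xi_A]; simp [single_ne_of_two_le h, ne_zero_of_two_le h]
    · rw [lie_C_A]; simp [single_ne_of_two_le h, ne_zero_of_two_le h]

lemma hasLie_yB (m : β) : HasLie D L₀ (fld (.yB m)) (fun _ _ => 0) (fun _ _ => 0) where
  xi ρ σ := by rw [lie_xi_yB]; simp
  gh ρ J := by rw [lie_C_yB]; simp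
  high g γ h := by
    rcases g with σ | J
    · rw [lie_xi_yB]; simp [ne_zero_of_two_le h]
    · rw [lie_C_yB]; simp [ne_zero_of_two_le h]

lemma hasLie_yF (m : φ) : HasLie D L₀ (fld (.yF m)) (fun _ _ => 0) (fun _ _ => 0) where
  xi ρ σ := by rw [lie_xi_yF]; simp
  gh ρ J := by rw [lie_C_yF]; simp
  high g γ h := by
    rcases g with σ | J
    · rw [lie_xi_yF]; simp [ne_zero_of_two_le h]
    · rw [lie_C_yF]; simp [ne_zero_of_two_le h]

lemma hasLie_xi (μ : Fin n) : HasLie D L₀ (xi μ) (fun ρ σ => if σ = μ then -xi ρ else 0)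
    (fun _ _ => 0) where
  xi ρ σ := by rw [lie_xi_xi]; by_cases h : σ = μ <;> simp [single_left_inj, h]
  gh ρ J := by rw [lie_C_xi]
  high g γ h := by
    rcases g with σ | J
    · rw [lie_xi_xi]; simp [single_ne_of_two_le h, ne_zero_of_two_le h]
    · rw [lie_C_xi]

lemma hasLie_C (I : 𝓘) : HasLie D L₀ (gh I) (fun _ _ => 0)
    (fun ρ J => if J = I then -xi ρ else 0) where
  xi ρ σ := by rw [lie_xi_C]; simp
  gh ρ J := by rw [lie_C_C]; by_cases h : J = I <;> simp [single_left_inj, h]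
  high g γ h := by
    rcases g with σ | J
    · rw [lie_xi_C]; simp [ne_zero_of_two_le h]
    · rw [lie_C_C]; simp [single_ne_of_two_le h, ne_zero_of_two_le h]

/-- The action of `gl(n)` on the world indices of the antifields. -/
def antiGl (ρ σ : Fin n) : 𝓕 → 𝓐
  | .e ν a => if ν = σ then -anti (.e ρ a) else 0
  | .A ν i => if ν = σ then -anti (.A ρ i) else 0
  | .xi τ => if ρ = τ then anti (.xi σ) else 0
  | _ => 0

/-- The action of the derivatives of the gauge parameters on the antifields. -/
def antiShift (ρ : Fin n) (J : 𝓘) : 𝓕 → 𝓐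
  | .xi τ => if ρ = τ then anti (.C J) else 0
  | _ => 0

lemma dL_dfld_single (g : 𝓗) (ρ μ : Fin n) (Φ : 𝓕) :
    dL (gJet g (single ρ 1)) (dfld μ Φ : 𝓐) =
      if ghFld g = Φ then (if ρ = μ then 1 else 0) else 0 := by
  rw [dL_gJet_fld]; simp [single_left_inj]

lemma dL_dfld_high {γ : 𝓜} (h : 2 ≤ γ.degree) (g : 𝓗) (μ : Fin n)
    (Φ : 𝓕) : dL (gJet g γ) (dfld μ Φ : 𝓐) = 0 := by
  rw [dL_gJet_fld]; simp [single_ne_of_two_le h]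

lemma hasLie_anti (Φ : 𝓕) : HasLie D L₀ (anti Φ)
    (fun ρ σ => (if ρ = σ then anti Φ else 0) + antiGl ρ σ Φ) (fun ρ J => antiShift ρ J Φ) where
  xi ρ σ := by
    rw [lie_xi_anti]
    congr 1
    · simp [single_left_inj]
    · have h1 : ∀ μ ν, dL (gJet (.inl σ) (single ρ 1)) (dfld μ (.xi ν)) =
          if σ = ν then (if ρ = μ then 1 else 0) else (0 : 𝓐) := fun μ ν => by
        rw [dL_dfld_single]; simp [ghFld]
      have h2 : ∀ μ I, dL (gJet (.inl σ) (single ρ 1)) (dfld μ (.C I)) = (0 : 𝓐) := fun μ I => by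
        rw [dL_dfld_single]; simp [ghFld]
      cases Φ with
      | e ν a =>
        simp only [antiWorld, antiGl, map_neg, map_sum, dL_gJet_mul, h1, dL_gJet_anti]
        by_cases h : σ = ν
        · simp [h]
        · simp [h, Ne.symm h]
      | A ν a =>
        simp only [antiWorld, antiGl, map_neg, map_sum, dL_gJet_mul, h1, dL_gJet_anti]
        by_cases h : σ = ν
        · simp [h]
        · simp [h, Ne.symm h]
      | xi ν => simp [antiWorld, antiGl, dL_gJet_mul, h1, h2, dL_gJet_anti]
      | C I => simp [antiWorld, antiGl]
      | yB m => simp [antiWorld, antiGl]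
      | yF m => simp [antiWorld, antiGl]
  gh ρ J := by
    rw [lie_C_anti, if_neg (by simp), zero_add]
    have h1 : ∀ μ ν, dL (gJet (.inr J) (single ρ 1)) (dfld μ (.xi ν)) = (0 : 𝓐) := fun μ ν => by
      rw [dL_dfld_single]; simp [ghFld]
    have h2 : ∀ μ (x : 𝓘 → 𝓐), ∑ I, dL (gJet (.inr J) (single ρ 1)) (dfld μ (.C I)) * x I =
        if ρ = μ then x J else 0 := fun μ x => by
      simp only [dL_dfld_single, ite_mul, zero_mul]
      rw [sum_ite_ghFld_C]
      simp
    cases Φ with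
    | e ν a => simp [antiWorld, antiShift, dL_gJet_mul, h1, dL_gJet_anti]
    | A ν a => simp [antiWorld, antiShift, dL_gJet_mul, h1, dL_gJet_anti]
    | xi ν =>
      simp only [antiWorld, antiShift, map_add, map_sum, dL_gJet_mul, h1, dL_gJet_anti, mul_zero,
        add_zero, zero_mul, sum_const_zero, zero_add]
      exact h2 ν _
    | C I => simp [antiWorld, antiShift]
    | yB m => simp [antiWorld, antiShift]
    | yF m => simp [antiWorld, antiShift]
  high g γ h := by
    have h3 : dL (gJet g γ) (antiWorld Φ : 𝓐) = 0 := by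
      cases Φ <;> simp [antiWorld, dL_gJet_mul, dL_dfld_high h, dL_gJet_anti]
    rcases g with σ | J
    · rw [lie_xi_anti, h3, if_neg (ne_zero_of_two_le h), if_neg (single_ne_of_two_le h _)]; simp
    · rw [lie_C_anti, h3, if_neg (ne_zero_of_two_le h)]; simp

end Lie

local notation "𝓗" => GhIdx n ι
local notation "𝓠" => lie D L₀

section Frame

/-! ## The inverse vielbein -/

lemma smoothFun_ext {κ : Type*} [Fintype κ] {U : TopologicalSpace.Opens (κ → ℝ)}
    {f g : SmoothFun U} (h : ∀ x, f.1 x = g.1 x) : f = g := Subtype.ext (funext h)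

lemma frameMatrix_isUnit (x : GLp n) : IsUnit (frameMatrix n x.1).det :=
  (ne_of_gt (show 0 < (frameMatrix n x.1).det from x.2)).isUnit

lemma smoothFun_sum_apply {κ I : Type*} [Fintype κ] {U : TopologicalSpace.Opens (κ → ℝ)}
    (s : Finset I) (f : I → SmoothFun U) (x : U) : (∑ i ∈ s, f i).1 x = ∑ i ∈ s, (f i).1 x := by
  induction s using Finset.induction_on with
  | empty => rfl
  | insert a s ha ih => rw [sum_insert ha, sum_insert ha, ← ih]; rfl

lemma invFrameFun_mul (a b : Fin n) :
    ∑ μ, invFrameFun a μ * frameCoord (μ, b) = if a = b then 1 else 0 := by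
  refine smoothFun_ext fun x => ?_
  rw [smoothFun_sum_apply]
  have h := congrFun (congrFun (Matrix.nonsing_inv_mul _ (frameMatrix_isUnit x)) a) b
  rw [Matrix.mul_apply, Matrix.one_apply] at h
  refine Eq.trans h ?_
  split_ifs <;> rfl

lemma mul_invFrameFun (μ ν : Fin n) :
    ∑ a, frameCoord (μ, a) * invFrameFun a ν = if μ = ν then 1 else 0 := by
  refine smoothFun_ext fun x => ?_
  rw [smoothFun_sum_apply]
  have h := congrFun (congrFun (Matrix.mul_nonsing_inv _ (frameMatrix_isUnit x)) μ) ν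
  rw [Matrix.mul_apply, Matrix.one_apply] at h
  refine Eq.trans h ?_
  split_ifs <;> rfl

/-- The determinant of the vielbein. -/
def detFun (n : ℕ) : SmoothFun (GLp n) :=
  ⟨fun x => (frameMatrix n x).det, fun x => (frameMatrix n x).det,
    (contDiff_det _ (contDiff_frameMatrix n)).contDiffOn, fun _ => rfl⟩

lemma invDetFun_mul (n : ℕ) : invDetFun n * detFun n = 1 :=
  smoothFun_ext fun x => inv_mul_cancel₀ (frameMatrix_isUnit x).ne_zero

lemma pd_detFun (p : Fin n × Fin n) : pd p (detFun n) = detFun n * invFrameFun p.2 p.1 := by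
  refine smoothFun_ext fun x => ?_
  have hdiff : Differentiable ℝ fun x => (frameMatrix n x).det :=
    (contDiff_det _ (contDiff_frameMatrix n)).differentiable (by simp)
  rw [pd_apply_of_eqOn p (detFun n) (fun x => (frameMatrix n x).det) (fun _ => rfl) x,
    ← (hdiff x.1).lineDeriv_eq_fderiv]
  have h1 : ∀ t : ℝ, (frameMatrix n (x.1 + t • Pi.single p 1)).det =
      (frameMatrix n x.1).det + t * ((frameMatrix n x.1).updateRow p.1 (Pi.single p.2 1)).det := fun t => by
    have h2 : frameMatrix n (x.1 + t • Pi.single p 1) = (frameMatrix n x.1).updateRow p.1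
        ((frameMatrix n x.1) p.1 + t • Pi.single p.2 1) := by
      ext μ a
      by_cases h : μ = p.1
      · subst h
        by_cases h3 : a = p.2
        · subst h3; simp [frameMatrix]
        · simp [frameMatrix, Pi.single_apply, Prod.ext_iff, h3]
      · rw [Matrix.updateRow_ne h]
        simp [frameMatrix, Pi.single_apply, Prod.ext_iff, h]
    rw [h2, Matrix.det_updateRow_add, Matrix.det_updateRow_smul, Matrix.updateRow_eq_self]
  rw [lineDeriv]
  simp only [h1]
  have h3 : HasDerivAt (fun t : ℝ => (frameMatrix n x.1).det +
      t * ((frameMatrix n x.1).updateRow p.1 (Pi.single p.2 1)).det)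
      (1 * ((frameMatrix n x.1).updateRow p.1 (Pi.single p.2 1)).det) 0 :=
    ((hasDerivAt_id (0 : ℝ)).mul_const _).const_add _
  rw [h3.deriv, one_mul, ← Matrix.adjugate_apply]
  change _ = (frameMatrix n x.1).det * (frameMatrix n x.1)⁻¹ p.2 p.1
  rw [Matrix.inv_def, Matrix.smul_apply, Ring.inverse_eq_inv', smul_eq_mul, ← mul_assoc,
    mul_inv_cancel₀ (frameMatrix_isUnit x).ne_zero, one_mul]

lemma pd_invDetFun (p : Fin n × Fin n) :
    pd p (invDetFun n) = -(invDetFun n * invFrameFun p.2 p.1) := by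
  have h := congrArg (pd p) (invDetFun_mul n)
  rw [pd_mul, pd_one, pd_detFun] at h
  have h2 := congrArg (fun f => f * invDetFun n) h
  have h3 := invDetFun_mul n
  simp only [zero_mul] at h2
  linear_combination h2 + (-pd p (invDetFun n) - invDetFun n * invFrameFun p.2 p.1) * h3

lemma vb_eq (μ a : Fin n) : (vb μ a : 𝓐) = frameFun (frameCoord (μ, a)) := gen_frame (μ, a)

lemma sum_invFrame_vb (a b : Fin n) :
    ∑ μ, (invFrame a μ : 𝓐) * vb μ b = if a = b then 1 else 0 := by
  simp only [vb_eq, ← map_mul, ← map_sum, invFrameFun_mul]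
  split_ifs <;> simp

lemma sum_vb_invFrame (μ ν : Fin n) :
    ∑ a, (vb μ a : 𝓐) * invFrame a ν = if μ = ν then 1 else 0 := by
  simp only [vb_eq, ← map_mul, ← map_sum, mul_invFrameFun]
  split_ifs <;> simp

lemma vb_comm (μ a : Fin n) (x : 𝓐) : vb μ a * x = x * vb μ a := by
  rw [vb_eq, frameFun_comm]

/-- Conversion of a lower world index to a flat index and back. -/
lemma sum_vb_sum_invFrame (x : Fin n → 𝓐) (μ : Fin n) :
    ∑ a, vb μ a * ∑ ν, invFrame a ν * x ν = x μ := by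
  simp only [mul_sum]
  rw [sum_comm]
  simp only [← mul_assoc, ← sum_mul, sum_vb_invFrame]
  simp

lemma sum_invFrame_sum_vb (x : Fin n → 𝓐) (a : Fin n) :
    ∑ μ, invFrame a μ * ∑ b, vb μ b * x b = x a := by
  simp only [mul_sum]
  rw [sum_comm]
  simp only [← mul_assoc, ← sum_mul, sum_invFrame_vb]
  simp

lemma IsSDer.invFrame {E : 𝓛} (hE : IsSDer false E) (a ν : Fin n) : E (EYM.invFrame a ν) =
      -∑ μ, ∑ b, EYM.invFrame a μ * EYM.invFrame b ν * E (vb μ b) := by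
  have h : ∀ b, ∑ μ, (E (EYM.invFrame a μ) * vb μ b + EYM.invFrame a μ * E (vb μ b)) = 0 := fun b => by
    have h1 := congrArg E (sum_invFrame_vb (ι := ι) (β := β) (φ := φ) a b)
    rw [map_sum] at h1
    simp only [hE.mul, par_false] at h1
    rw [h1]
    split_ifs
    · exact hE.map_one
    · exact map_zero _
  have h2 : ∑ b, (∑ μ, (E (EYM.invFrame a μ) * vb μ b + EYM.invFrame a μ * E (vb μ b))) *
      EYM.invFrame b ν = 0 := sum_eq_zero fun b _ => by rw [h, zero_mul]
  simp only [sum_mul, add_mul, sum_add_distrib] at h2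
  rw [sum_comm] at h2
  simp only [mul_assoc, ← mul_sum, sum_vb_invFrame] at h2
  rw [eq_neg_iff_add_eq_zero, sum_comm]
  rw [← h2]
  congr 1
  · simp
  · refine sum_ext fun b _ => ?_
    refine sum_ext fun μ _ => ?_
    rw [mul_assoc, frameFun_comm (invFrameFun b ν)]

lemma IsSDer.invDet {ε : Bool} {E : 𝓛} (hE : IsSDer ε E) :
    E EYM.invDet = -∑ μ, ∑ a, EYM.invDet * EYM.invFrame a μ * E (vb μ a) := by
  rw [hE.frame, Fintype.sum_prod_type]
  simp only [← sum_neg_distrib]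
  refine sum_ext fun μ _ => sum_ext fun a _ => ?_
  rw [pd_invDetFun, map_neg, mul_neg, map_mul, ← map_mul, frameFun_comm]

end Frame

section Spin

/-! ## The spin connection -/

/-- Antisymmetric extension of a family indexed by pairs `a > b`. -/
def lor {M : Type*} [AddCommGroup M] (X : LPair n → M) (a b : Fin n) : M :=
  if h : b < a then X ⟨(a, b), h⟩ else if h : a < b then -X ⟨(b, a), h⟩ else 0

lemma lor_antisymm {M : Type*} [AddCommGroup M] (X : LPair n → M) (a b : Fin n) :
    lor X a b = -lor X b a := by
  unfold lor
  rcases lt_trichotomy a b with h | h | h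
  · simp [h, h.not_gt]
  · subst h; simp
  · simp [h, h.not_gt]

lemma sum_vec (hD : D.IsLie) {M : Type*} [AddCommGroup M] [Module ℝ M] (X : LPair n → M)
    (a b : Fin n) : ∑ p, D.vec (.inr p) a b • X p = eta n b b • lor X b a := by
  have h : ∀ p : LPair n, D.vec (.inr p) a b • X p = eta n b b •
      (if b = p.1.1 ∧ a = p.1.2 then X p else if b = p.1.2 ∧ a = p.1.1 then -X p else 0) := fun p => by
    rw [hD.vec_inr, mul_smul]
    split_ifs <;> simp
  simp only [h, ← smul_sum]
  congr 1
  unfold lor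
  split_ifs with h1 h2
  · rw [sum_eq_single ⟨(b, a), h1⟩]
    · simp
    · rintro ⟨⟨c, d⟩, hp⟩ _ hne
      have hp' : d < c := hp
      rw [if_neg, if_neg]
      · rintro ⟨rfl, rfl⟩; exact absurd h1 hp'.not_gt
      · rintro ⟨rfl, rfl⟩; exact hne rfl
    · simp
  · rw [sum_eq_single ⟨(a, b), h2⟩]
    · simp [h2.ne, h2.ne']
    · rintro ⟨⟨c, d⟩, hp⟩ _ hne
      have hp' : d < c := hp
      rw [if_neg, if_neg]
      · rintro ⟨rfl, rfl⟩; exact hne rfl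
      · rintro ⟨rfl, rfl⟩; exact absurd h2 hp'.not_gt
    · simp
  · refine sum_eq_zero fun p _ => ?_
    obtain ⟨⟨c, d⟩, hp⟩ := p
    have hp' : d < c := hp
    rw [if_neg, if_neg]
    · rintro ⟨rfl, rfl⟩; exact h2 hp'
    · rintro ⟨rfl, rfl⟩; exact h1 hp'

lemma eta_smul_inj {M : Type*} [AddCommGroup M] [Module ℝ M] (a : Fin n) {x y : M}
    (h : eta n a a • x = eta n a a • y) : x = y := by
  have := congrArg (fun z => eta n a a • z) h
  simpa only [smul_smul, eta_sq, one_smul] using this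

/-- An antisymmetric family whose contraction with the vielbein is symmetric vanishes. -/
lemma lor_eq_zero {X : Fin n → LPair n → 𝓐}
    (h : ∀ μ ν a, ∑ b, vb ν b * (eta n b b • lor (X μ) b a) =
      ∑ b, vb μ b * (eta n b b • lor (X ν) b a)) (μ : Fin n) (p : LPair n) : X μ p = 0 := by
  set Z : Fin n → Fin n → Fin n → 𝓐 := fun c d a =>
    ∑ μ, invFrame c μ * (eta n a a • eta n d d • lor (X μ) d a) with hZ
  have h1 : ∀ c d a, Z c d a = -Z c a d := fun c d a => by
    simp only [hZ, ← sum_neg_distrib]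
    refine sum_ext fun μ _ => ?_
    rw [lor_antisymm, smul_neg, smul_neg, mul_neg, smul_comm]
  have h2 : ∀ c d a, Z c d a = Z d c a := fun c d a => by
    have h3 : ∀ c d, Z c d a = eta n a a • ∑ μ, ∑ ν, invFrame c μ * (invFrame d ν *
        ∑ b, vb ν b * (eta n b b • lor (X μ) b a)) := fun c d => by
      simp only [hZ, smul_sum]
      refine sum_ext fun μ _ => ?_
      rw [← smul_sum, ← mul_sum, sum_invFrame_sum_vb, mul_smul_comm]
    rw [h3, h3, sum_comm]
    congr 1
    refine sum_ext fun ν _ => sum_ext fun μ _ => ?_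
    rw [h μ ν a, ← mul_assoc, ← mul_assoc, frameFun_comm]
  have h3 : ∀ c d a, Z c d a = 0 := fun c d a => by
    refine eq_zero_of_eq_neg ?_
    conv_lhs => rw [h2, h1, h2, h1, h2, h1]
    simp
  have h4 : ∀ μ d a, lor (X μ) d a = 0 := fun μ d a => by
    apply eta_smul_inj d
    apply eta_smul_inj a
    rw [← sum_vb_sum_invFrame (fun μ => eta n a a • eta n d d • lor (X μ) d a) μ]
    change ∑ c, vb μ c * Z c d a = _
    simp [h3]
  have h5 := h4 μ p.1.1 p.1.2
  unfold lor at h5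
  rwa [dif_pos p.2] at h5

/-- The connection, contracted with the vector representation and the vielbein. -/
def connVb (D : GaugeData n ι β φ) (μ ν a : Fin n) : 𝓐 :=
  ∑ p : LPair n, ∑ b, D.vec (.inr p) a b • (conn μ (.inr p) * vb ν b)

lemma contorsion_antisymm (μ ν ρ : Fin n) :
    anholonomy n ι β φ μ ν ρ = -anholonomy n ι β φ ν μ ρ := by
  unfold anholonomy
  simp only [← sum_neg_distrib]
  refine sum_ext fun a _ => sum_ext fun b _ => ?_
  rw [← smul_neg, ← mul_neg, ← smul_neg, neg_sub]

lemma spinConn_eq (μ a b : Fin n) : (spinConn μ a b : 𝓐) =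
    ∑ ν, ∑ ρ, (eta n a a * eta n b b) • (invFrame a ν * (invFrame b ρ *
    (anholonomy n ι β φ μ ν ρ - anholonomy n ι β φ ν ρ μ + anholonomy n ι β φ ρ μ ν))) := by
  unfold spinConn
  have h : ∀ a ν, (∑ c, eta n a c • invFrame c ν : 𝓐) = eta n a a • invFrame a ν := fun a ν => by
    rw [sum_eq_single a (fun c _ hc => by rw [eta_ne hc.symm, zero_smul]) (by simp)]
  simp only [h, smul_mul_assoc, mul_smul_comm, smul_smul, mul_assoc]
  simp only [mul_comm (eta n b b)]

lemma spinConn_antisymm (μ a b : Fin n) : (spinConn μ a b : 𝓐) = -spinConn μ b a := by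
  rw [spinConn_eq, spinConn_eq, sum_comm, ← sum_neg_distrib]
  refine sum_ext fun ρ _ => ?_
  rw [← sum_neg_distrib]
  refine sum_ext fun ν _ => ?_
  rw [mul_comm (eta n a a), ← smul_neg, ← mul_assoc, frameFun_comm (invFrameFun a ν), mul_assoc,
    ← mul_neg, ← mul_neg, contorsion_antisymm μ ν ρ, contorsion_antisymm ν ρ μ,
    contorsion_antisymm ρ μ ν]
  congr 3
  abel

lemma lor_conn (μ a b : Fin n) : lor (fun p => (conn μ (.inr p) : 𝓐)) a b = spinConn μ a b := by
  unfold lor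
  split_ifs with h1 h2
  · rfl
  · change -spinConn μ b a = _
    rw [spinConn_antisymm μ a b]
  · obtain rfl : a = b := le_antisymm (not_lt.1 h1) (not_lt.1 h2)
    exact (eq_zero_of_eq_neg (spinConn_antisymm μ a a)).symm

lemma sum_vec_vb (hD : D.IsLie) (X : LPair n → 𝓐) (ν a : Fin n) :
    ∑ p, ∑ b, D.vec (.inr p) a b • (X p * vb ν b) = ∑ b, vb ν b * (eta n b b • lor X b a) := by
  rw [sum_comm]
  refine sum_ext fun b _ => ?_
  rw [← sum_vec hD, mul_sum]
  refine sum_ext fun p _ => ?_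
  rw [mul_smul_comm, vb_comm]

lemma connVb_eq (hD : D.IsLie) (μ ν a : Fin n) : connVb D μ ν a = ∑ ρ, eta n a a • (invFrame a ρ *
    (anholonomy n ι β φ μ ν ρ - anholonomy n ι β φ ν ρ μ + anholonomy n ι β φ ρ μ ν)) := by
  unfold connVb
  rw [sum_vec_vb hD]
  simp only [lor_conn, spinConn_eq]
  have h : ∀ b, eta n b b • ∑ ν, ∑ ρ, (eta n b b * eta n a a) • ((invFrame b ν : 𝓐) * (invFrame a ρ *
      (anholonomy n ι β φ μ ν ρ - anholonomy n ι β φ ν ρ μ + anholonomy n ι β φ ρ μ ν))) =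
      ∑ ν, invFrame b ν * ∑ ρ, eta n a a • (invFrame a ρ *
      (anholonomy n ι β φ μ ν ρ - anholonomy n ι β φ ν ρ μ + anholonomy n ι β φ ρ μ ν)) := fun b => by
    simp only [smul_sum, mul_sum, smul_smul, ← mul_assoc, eta_sq, one_mul, mul_smul_comm]
  simp only [h]
  rw [sum_vb_sum_invFrame]

/-- The torsion of the spin connection vanishes. -/
lemma torsion (hD : D.IsLie) (μ ν a : Fin n) : (dfld μ (.e ν a) : 𝓐) - dfld ν (.e μ a) =
    connVb D μ ν a - connVb D ν μ a := by
  rw [connVb_eq hD, connVb_eq hD, ← sum_sub_distrib]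
  have h : ∀ ρ, anholonomy n ι β φ μ ν ρ - anholonomy n ι β φ ν ρ μ + anholonomy n ι β φ ρ μ ν -
      (anholonomy n ι β φ ν μ ρ - anholonomy n ι β φ μ ρ ν + anholonomy n ι β φ ρ ν μ) =
      ∑ c, vb ρ c * (eta n c c • (dfld μ (.e ν c) - dfld ν (.e μ c))) := fun ρ => by
    rw [contorsion_antisymm ν μ ρ, contorsion_antisymm ρ ν μ, contorsion_antisymm ρ μ ν]
    have : anholonomy n ι β φ μ ν ρ = (1 / 2 : ℝ) • ∑ c, vb ρ c * (eta n c c • (dfld μ (.e ν c) - dfld ν (.e μ c))) := by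
      rw [smul_sum]
      unfold anholonomy
      refine sum_ext fun a _ => ?_
      rw [sum_eq_single a (fun c _ hc => by rw [eta_ne hc.symm, zero_smul]) (by simp)]
      simp only [mul_smul_comm, smul_comm (eta n a a)]
    rw [this]
    module
  simp only [← smul_sub, ← mul_sub, h, ← smul_sum]
  rw [sum_invFrame_sum_vb, smul_smul, eta_sq, one_smul]

lemma conn_unique (hD : D.IsLie) {E : 𝓛} (hE : IsSDer false E) (W : Fin n → LPair n → 𝓐)
    (h : ∀ μ ν a, E (dfld μ (.e ν a)) - E (dfld ν (.e μ a)) =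
      (∑ p, ∑ b, D.vec (.inr p) a b • (W μ p * vb ν b + conn μ (.inr p) * E (vb ν b))) -
      ∑ p, ∑ b, D.vec (.inr p) a b • (W ν p * vb μ b + conn ν (.inr p) * E (vb μ b)))
    (μ : Fin n) (p : LPair n) : E (conn μ (.inr p)) = W μ p := by
  rw [← sub_eq_zero]
  refine lor_eq_zero (X := fun μ p => E (conn μ (.inr p)) - W μ p) (fun μ ν a => ?_) μ p
  rw [← sum_vec_vb hD, ← sum_vec_vb hD, ← sub_eq_zero]
  have h1 := congrArg E (torsion hD μ ν a)
  rw [map_sub, map_sub, h μ ν a] at h1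
  unfold connVb at h1
  simp only [map_sum, map_smul, hE.mul, par_false] at h1
  rw [← sub_eq_zero] at h1
  rw [← neg_eq_zero, ← h1]
  simp only [sub_mul, smul_sub, smul_add, sum_sub_distrib, sum_add_distrib]
  abel

end Spin

section ConnLie

/-! ## Transformation of the inverse vielbein and of the connection -/

lemma gaugeAct_mul (J : 𝓘) (x y : 𝓐) :
    𝓣 J (x * y) = 𝓣 J x * y + x * 𝓣 J y := (isSDer_gaugeAct J).mul x y

lemma gaugeAct_invFrame (J : 𝓘) (a ν : Fin n) :
    𝓣 J (invFrame a ν : 𝓐) = -∑ b, D.vec J b a • invFrame b ν := by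
  rw [(isSDer_gaugeAct J).invFrame, sum_comm]
  congr 1
  refine sum_ext fun b _ => ?_
  have h : ∀ μ, (invFrame a μ : 𝓐) * invFrame b ν * 𝓣 J (vb μ b) =
      ∑ c, D.vec J b c • (invFrame b ν * (invFrame a μ * vb μ c)) := fun μ => by
    rw [gaugeAct_fld_e, frameFun_comm (invFrameFun a μ), mul_assoc, mul_sum, mul_sum]
    simp only [mul_smul_comm]
  simp only [h]
  rw [sum_comm]
  simp only [← smul_sum, ← mul_sum, sum_invFrame_vb]
  simp

lemma GaugeData.IsLie.vec_diag (hD : D.IsLie) (J : 𝓘) (a : Fin n) : D.vec J a a = 0 := by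
  cases J with
  | inl i => exact hD.vec_inl _ _ _
  | inr p =>
    rw [hD.vec_inr, if_neg, if_neg, mul_zero]
    · rintro ⟨h1, h2⟩; exact p.2.ne (h1.symm.trans h2)
    · rintro ⟨h1, h2⟩; exact p.2.ne (h2.symm.trans h1)

lemma gaugeAct_invDet (hD : D.IsLie) (J : 𝓘) : 𝓣 J (invDet : 𝓐) = 0 := by
  rw [(isSDer_gaugeAct J).invDet, sum_comm, neg_eq_zero]
  refine sum_eq_zero fun a _ => ?_
  have h : ∀ μ, (invDet : 𝓐) * invFrame a μ * 𝓣 J (vb μ a) =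
      ∑ b, D.vec J a b • (invDet * (invFrame a μ * vb μ b)) := fun μ => by
    rw [gaugeAct_fld_e, mul_assoc, mul_sum, mul_sum]
    simp only [mul_smul_comm]
  simp only [h]
  rw [sum_comm]
  simp only [← smul_sum, ← mul_sum, sum_invFrame_vb]
  simp [hD.vec_diag]

variable [adm : Admissible D L₀]

lemma lie_frameFun_high (f : 𝓒) (g : 𝓗) (γ : 𝓜)
    (h : 2 ≤ γ.degree) : 𝓠 g γ (frameFun f) = 0 := by
  rw [(isSDer_lie g γ).frame]
  refine sum_eq_zero fun p _ => ?_
  rw [frameJet, (hasLie_e p.1 p.2).high g γ h, zero_mul]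

lemma lie_frameFun_gh (f : 𝓒) (ρ : Fin n) (J : 𝓘) :
    𝓠 (.inr J) (single ρ 1) (frameFun f) = 0 := by
  rw [(isSDer_lie _ _).frame]
  refine sum_eq_zero fun p _ => ?_
  rw [frameJet, (hasLie_e p.1 p.2).gh, zero_mul]

lemma hasLie_invFrame (a ν : Fin n) : HasLie D L₀ (invFrame a ν)
    (fun ρ σ => if σ = ν then -invFrame a ρ else 0) (fun _ _ => 0) where
  xi ρ σ := by
    rw [(isSDer_lie _ _).invFrame]
    simp only [(hasLie_e _ _).xi, mul_ite, mul_zero]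
    rw [sum_eq_single ρ (fun μ _ h => by simp [h.symm]) (by simp)]
    simp only [if_true]
    have h : ∀ b, (invFrame a ρ : 𝓐) * invFrame b ν * vb σ b =
        invFrame a ρ * (vb σ b * invFrame b ν) := fun b => by
      rw [mul_assoc, vb_comm σ b]
    simp only [h, ← mul_sum, sum_vb_invFrame]
    split_ifs <;> simp
  gh ρ J := lie_frameFun_gh _ _ _
  high g γ h := lie_frameFun_high _ _ _ h

lemma hasLie_invDet : HasLie D L₀ invDet
    (fun ρ σ => if ρ = σ then -invDet else 0) (fun _ _ => 0) where
  xi ρ σ := by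
    rw [(isSDer_lie _ _).invDet]
    simp only [(hasLie_e _ _).xi, mul_ite, mul_zero]
    rw [sum_eq_single ρ (fun μ _ h => by simp [h.symm]) (by simp)]
    simp only [if_true]
    have h : ∀ b, (invDet : 𝓐) * invFrame b ρ * vb σ b =
        invDet * (vb σ b * invFrame b ρ) := fun b => by
      rw [mul_assoc, vb_comm σ b]
    simp only [h, ← mul_sum, sum_vb_invFrame]
    by_cases h : ρ = σ
    · simp [h]
    · simp [h, Ne.symm h]
  gh ρ J := lie_frameFun_gh _ _ _
  high g γ h := lie_frameFun_high _ _ _ h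

lemma lie_xi_de (ρ σ μ ν a : Fin n) : 𝓠 (.inl σ) (single ρ 1) (dfld μ (.e ν a)) =
      (if ρ = ν then dfld μ (.e σ a) else 0) + if ρ = μ then dfld σ (.e ν a) else 0 := by
  rw [← totalD_fld, lie_single_totalD, (hasLie_e ν a).xi, lie_xi_zero, totalD_fld]
  congr 1
  split_ifs
  · rw [totalD_fld]
  · rw [map_zero]

lemma lie_xi_conn (ρ σ μ : Fin n) (p : LPair n) :
    𝓠 (.inl σ) (single ρ 1) (conn μ (.inr p)) = if ρ = μ then conn σ (.inr p) else 0 := by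
  refine conn_unique adm.isLie (isSDer_lie _ _)
    (fun μ p => if ρ = μ then conn σ (.inr p) else 0) (fun μ ν a => ?_) μ p
  simp only [lie_xi_de, (hasLie_e _ _).xi]
  have h1 : ∀ μ ν, (∑ p : LPair n, ∑ b, D.vec (.inr p) a b • ((if ρ = μ then conn σ (.inr p) else 0)
      * vb ν b + conn μ (.inr p) * (if ρ = ν then vb σ b else 0) : 𝓐)) =
      (if ρ = μ then connVb D σ ν a else 0) + if ρ = ν then connVb D μ σ a else 0 := fun μ ν => by
    unfold connVb
    split_ifs <;> simp [sum_add_distrib]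
  rw [h1, h1]
  have h2 := torsion adm.isLie μ σ a
  have h3 := torsion adm.isLie σ ν a
  have e : ∀ x y z w : 𝓐, x + y - (z + w) = (x - w) + (y - z) := fun x y z w => by
    abel
  have h4 : ∀ (p q : Prop) [Decidable p] [Decidable q] (x y z w : 𝓐), x - y = z - w →
    (if p then x else 0) - (if p then y else 0) = (if p then z else 0) - (if p then w else 0) := fun p q _ _ x y z w h => by
    split_ifs
    · exact h
    · rfl
  rw [e, h4 _ True _ _ _ _ h2, h4 _ True _ _ _ _ h3]
  abel

lemma lie_C_conn (ρ μ : Fin n) (J : 𝓘) (p : LPair n) :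
    𝓠 (.inr J) (single ρ 1) (conn μ (.inr p)) =
      if ρ = μ then (if J = .inr p then 1 else 0) else 0 := by
  refine conn_unique adm.isLie (isSDer_lie _ _)
    (fun μ p => if ρ = μ then (if J = .inr p then 1 else 0) else 0) (fun μ ν a => ?_) μ p
  have h0 : ∀ μ ν, 𝓠 (.inr J) (single ρ 1) (dfld μ (.e ν a)) =
      if ρ = μ then ∑ b, D.vec J a b • vb ν b else 0 := fun μ ν => by
    rw [← totalD_fld, lie_single_totalD, (hasLie_e ν a).gh, lie_C_zero, gaugeAct_fld_e, map_zero,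
      zero_add]
  have h1 : ∀ ν, (∑ p : LPair n, ∑ b, D.vec (.inr p) a b • ((if J = .inr p then 1 else 0)
      * vb ν b : 𝓐)) = ∑ b, D.vec J a b • vb ν b := fun ν => by
    cases J with
    | inl j => simp [adm.isLie.vec_inl]
    | inr q =>
      rw [sum_eq_single q (fun p _ h => by simp [h.symm]) (by simp)]
      simp
  have h3 : ∀ μ ν b (p : LPair n), ((if ρ = μ then (if J = .inr p then 1 else 0) else 0)
      * vb ν b : 𝓐) = if ρ = μ then (if J = .inr p then 1 else 0) * vb ν b else 0 :=
    fun μ ν b p => by split_ifs <;> simp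
  simp only [h0, (hasLie_e _ _).gh, mul_zero, add_zero, h3]
  have h2 : ∀ μ ν, (∑ p : LPair n, ∑ b, D.vec (.inr p) a b • (if ρ = μ then (if J = .inr p then 1 else 0)
      * vb ν b else 0: 𝓐)) = if ρ = μ then ∑ b, D.vec J a b • vb ν b else 0 := fun μ ν => by
    split_ifs
    · exact h1 ν
    · simp
  rw [← h2, ← h2]

lemma lie_de_high (g : 𝓗) {γ : 𝓜} (h : 2 ≤ γ.degree) (μ ν a : Fin n) :
    𝓠 g γ (dfld μ (.e ν a)) = if γ = single μ 1 + single ν 1 then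
      (match g with
        | .inl σ => vb σ a
        | .inr _ => 0) else 0 := by
  rw [← totalD_fld, lie_totalD, (hasLie_e ν a).high g γ h, map_zero, zero_add]
  by_cases h1 : γ μ = 0
  · rw [if_pos h1, if_neg]
    rintro rfl
    simp at h1
  · rw [if_neg h1]
    obtain ⟨γ', rfl⟩ := exists_eq_add_single h1
    rw [add_tsub_cancel_right]
    have hne : γ' ≠ 0 := by rintro rfl; simp at h
    have h2 : γ' + single μ 1 = single μ 1 + single ν 1 ↔
        γ' = single ν 1 := by rw [add_comm]; exact add_right_inj _
    simp only [h2]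
    cases g with
    | inl σ => rw [lie_xi_e, if_neg hne, zero_add]
    | inr J => rw [lie_C_e, if_neg hne]; simp

lemma lie_conn_high (g : 𝓗) {γ : 𝓜} (h : 2 ≤ γ.degree) (μ : Fin n)
    (p : LPair n) : 𝓠 g γ (conn μ (.inr p)) = 0 := by
  refine conn_unique adm.isLie (isSDer_lie _ _) (fun _ _ => 0) (fun μ ν a => ?_) μ p
  simp only [lie_de_high g h, (hasLie_e _ _).high g γ h]
  rw [add_comm]
  simp

lemma hasLie_conn (μ : Fin n) (I : 𝓘) : HasLie D L₀ (conn μ I)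
    (fun ρ σ => if ρ = μ then conn σ I else 0)
    (fun ρ J => if ρ = μ then (if J = I then 1 else 0) else 0) := by
  cases I with
  | inl i => exact hasLie_A μ i
  | inr p => exact ⟨fun ρ σ => lie_xi_conn ρ σ μ p, fun ρ J => lie_C_conn ρ μ J p,
      fun g γ h => lie_conn_high g h μ p⟩

lemma gaugeAct_conn (hD : D.IsLie) (J : 𝓘) (μ : Fin n) (I : 𝓘) :
    𝓣 J (conn μ I : 𝓐) = -∑ K, D.f J K I • conn μ K := by
  cases I with
  | inl i =>
    change 𝓣 J (fld (.A μ i)) = _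
    rw [gaugeAct_fld_A, Fintype.sum_sum_type]
    simp [hD.f_inr_inl, conn]
  | inr p =>
    refine conn_unique hD (isSDer_gaugeAct J) (fun μ p => -∑ K, D.f J K (.inr p) • conn μ K)
      (fun μ ν a => ?_) μ p
    have h0 : ∀ μ ν, 𝓣 J (dfld μ (.e ν a) : 𝓐) =
        ∑ b, D.vec J a b • dfld μ (.e ν b) := fun μ ν => by
      rw [← totalD_fld, gaugeAct_totalD, gaugeAct_fld_e, map_sum]
      simp only [map_smul, totalD_fld]
    have h1 : ∀ μ ν, (∑ p : LPair n, ∑ b, D.vec (.inr p) a b •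
        ((-∑ K, D.f J K (.inr p) • conn μ K) * vb ν b + conn μ (.inr p) * 𝓣 J (vb ν b)
          : 𝓐)) = ∑ b, D.vec J a b • connVb D μ ν b := fun μ ν => by
      have e0 : ∀ p b, (∑ K, D.f J K (.inr p) • conn μ K : 𝓐) * vb ν b =
          ∑ q : LPair n, D.f J (.inr q) (.inr p) • (conn μ (.inr q) * vb ν b) := fun p b => by
        rw [Fintype.sum_sum_type]
        simp [hD.f_inl_inr_right, sum_mul]
      simp only [neg_mul, e0, gaugeAct_fld_e, smul_add, sum_add_distrib, smul_neg,
        sum_neg_distrib, connVb, smul_sum, mul_sum, mul_smul_comm, smul_smul]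
      have e1 : (∑ p : LPair n, ∑ b, ∑ q : LPair n, (D.vec (.inr p) a b * D.f J (.inr q) (.inr p)) •
          (conn μ (.inr q) * vb ν b) : 𝓐) = ∑ q : LPair n, ∑ b,
            (∑ K, D.f J (.inr q) K * D.vec K a b) • (conn μ (.inr q) * vb ν b) := by
        have e4 : ∀ (q : LPair n) b, ∑ K, D.f J (.inr q) K * D.vec K a b =
            ∑ p : LPair n, D.vec (.inr p) a b * D.f J (.inr q) (.inr p) := fun q b => by
          rw [Fintype.sum_sum_type]
          simp only [hD.vec_inl, mul_zero, sum_const_zero, zero_add]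
          exact sum_ext fun p _ => mul_comm _ _
        simp only [e4, sum_smul]
        rw [sum_comm]
        conv_rhs => rw [sum_comm]
        refine sum_ext fun b _ => ?_
        rw [sum_comm]
      rw [e1]
      have e5 : ∀ (q : LPair n) b, ∑ K, D.f J (.inr q) K * D.vec K a b =
          ∑ c, (D.vec (.inr q) a c * D.vec J c b - D.vec J a c * D.vec (.inr q) c b) :=
        fun q b => hD.vec_rep J (.inr q) a b
      simp only [e5, sum_smul, sub_smul, sum_sub_distrib]
      have e2 : (∑ p : LPair n, ∑ b, ∑ c, (D.vec (.inr p) a b * D.vec J b c) •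
          (conn μ (.inr p) * vb ν c) : 𝓐) = ∑ q : LPair n, ∑ b, ∑ c,
            (D.vec (.inr q) a c * D.vec J c b) • (conn μ (.inr q) * vb ν b) :=
        sum_ext fun p _ => sum_comm
      have e3 : (∑ b, ∑ p : LPair n, ∑ c, (D.vec J a b * D.vec (.inr p) b c) •
          (conn μ (.inr p) * vb ν c) : 𝓐) = ∑ q : LPair n, ∑ b, ∑ c,
            (D.vec J a c * D.vec (.inr q) c b) • (conn μ (.inr q) * vb ν b) := by
        rw [sum_comm]
        exact sum_ext fun p _ => sum_comm
      rw [e2, e3]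
      abel
    rw [h0, h0, h1, h1, ← sum_sub_distrib, ← sum_sub_distrib]
    refine sum_ext fun b _ => ?_
    rw [← smul_sub, ← smul_sub, torsion hD]

end ConnLie

section Basic

/-! ## Local functions without ghosts -/

lemma invFrame_mem_ghostFree (a μ : Fin n) :
    (invFrame a μ : 𝓐) ∈ 𝓖 := frameFun_mem_jetAlg _ _

/-- The jet coordinates of the classical fields. -/
def classicalJets (n : ℕ) (ι β φ : Type*) : Set (Jet n ι β φ) :=
  {z | ∃ Φ, z.1 = .fld Φ ∧ Φ.IsClassical}

local notation "𝓚" => jetAlg (classicalJets n ι β φ)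

lemma jetAlg_mono {J J' : Set 𝓙} (h : J ⊆ J') : jetAlg J ≤ jetAlg J' :=
  adjoin_mono (Set.union_subset_union_right _ (Set.image_mono h))

lemma classicalJets_subset : classicalJets n ι β φ ⊆ ghostFree n ι β φ := by
  rintro z ⟨Φ, h, hΦ⟩ Ψ h'
  rw [h] at h'; cases h'; exact hΦ

lemma fld_mem_classical {Φ : 𝓕} (h : Φ.IsClassical) (α : 𝓜) :
    gen (.fld Φ, α) ∈ 𝓚 := gen_mem_jetAlg ⟨Φ, rfl, h⟩

lemma totalD_mem_classical (μ : Fin n)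
    (hx : x ∈ 𝓚) : totalD μ x ∈ 𝓚 :=
  (isSDer_totalD μ).mem_jetAlg (fun p => by
      rw [totalD_gen]
      exact gen_mem_jetAlg ⟨.e p.1 p.2, rfl, trivial⟩)
    (fun z hz => by rw [totalD_gen]; exact gen_mem_jetAlg hz) hx

lemma conn_mem_classical (μ : Fin n) (I : 𝓘) :
    (conn μ I : 𝓐) ∈ 𝓚 := by
  have h : ∀ μ ν ρ, anholonomy n ι β φ μ ν ρ ∈ 𝓚 := fun μ ν ρ =>
    sum_mem fun a _ => sum_mem fun b _ => Subalgebra.smul_mem _ (mul_mem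
      (fld_mem_classical (by trivial) _) (Subalgebra.smul_mem _ (sub_mem
        (fld_mem_classical (by trivial) _) (fld_mem_classical (by trivial) _)) _)) _
  cases I with
  | inl i => exact fld_mem_classical (by trivial) _
  | inr p =>
    change spinConn μ p.1.1 p.1.2 ∈ _
    rw [spinConn_eq]
    exact sum_mem fun ν _ => sum_mem fun ρ _ => Subalgebra.smul_mem _ (mul_mem
      (frameFun_mem_jetAlg _ _) (mul_mem (frameFun_mem_jetAlg _ _)
        (add_mem (sub_mem (h _ _ _) (h _ _ _)) (h _ _ _)))) _

lemma conn_mem_ghostFree (μ : Fin n) (I : 𝓘) : (conn μ I : 𝓐) ∈ 𝓖 :=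
  jetAlg_mono classicalJets_subset (conn_mem_classical μ I)

lemma curv_mem_classical (μ ν : Fin n) (I : 𝓘) : curv D μ ν I ∈ 𝓚 :=
  add_mem (sub_mem (totalD_mem_classical _ (conn_mem_classical _ _))
    (totalD_mem_classical _ (conn_mem_classical _ _))) (sum_mem fun _ _ => sum_mem fun _ _ =>
      Subalgebra.smul_mem _ (mul_mem (conn_mem_classical _ _) (conn_mem_classical _ _)) _)

lemma gaugeAct_gen_fld (I : 𝓘) (Φ : 𝓕) (α : 𝓜) :
    𝓣 I (gen (.fld Φ, α)) = ∑ Ψ, rot D I Φ Ψ • gen (.fld Ψ, α) := evol_gen _ _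

lemma gaugeAct_gen_anti (I : 𝓘) (Φ : 𝓕) (α : 𝓜) :
    𝓣 I (gen (.anti Φ, α)) = -∑ Ψ, rot D I Ψ Φ • gen (.anti Ψ, α) := evol_gen _ _

lemma rot_classical (I : 𝓘) {Φ Ψ : 𝓕} (h : rot D I Φ Ψ ≠ 0) : Φ.IsClassical ↔ Ψ.IsClassical := by
  cases Φ <;> cases Ψ <;> simp_all [rot, Fld.IsClassical]

lemma gaugeAct_mem_classical (I : 𝓘) (hx : x ∈ 𝓚) :
    𝓣 I x ∈ 𝓚 := by
  have key : ∀ (Φ : 𝓕) α, Φ.IsClassical →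
      𝓣 I (gen (.fld Φ, α)) ∈ 𝓚 := fun Φ α h => by
    rw [gaugeAct_gen_fld]
    refine sum_mem fun Ψ _ => ?_
    by_cases h0 : rot D I Φ Ψ = 0
    · rw [h0, zero_smul]; exact zero_mem _
    · exact Subalgebra.smul_mem _ (fld_mem_classical ((rot_classical I h0).1 h) _) _
  refine (isSDer_gaugeAct I).mem_jetAlg (fun p => key _ _ trivial) (fun z hz => ?_) hx
  obtain ⟨Z, α⟩ := z
  obtain ⟨Φ, h, hΦ⟩ := hz
  change Z = _ at h
  subst h
  exact key Φ α hΦ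

lemma gaugeAct_mem_ghostFree (I : 𝓘)
    (hx : x ∈ 𝓖) : 𝓣 I x ∈ 𝓖 := by
  have key : ∀ (Φ : 𝓕) α, Φ.IsClassical →
      𝓣 I (gen (.fld Φ, α)) ∈ 𝓖 := fun Φ α h =>
    jetAlg_mono classicalJets_subset (gaugeAct_mem_classical I (fld_mem_classical h α))
  refine (isSDer_gaugeAct I).mem_jetAlg (fun p => key _ _ trivial) (fun z hz => ?_) hx
  obtain ⟨Z, α⟩ := z
  cases Z with
  | fld Φ => exact key Φ α (hz Φ rfl)
  | anti Φ =>
    rw [gaugeAct_gen_anti]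
    exact neg_mem (sum_mem fun Ψ _ => Subalgebra.smul_mem _ (anti_mem_ghostFree _ _) _)

lemma dL_gJet_ghostFree (g : 𝓗) (γ : 𝓜)
    (hx : x ∈ 𝓖) : dL (gJet g γ) x = 0 :=
  dL_ghostFree (ghFld_not_classical g) γ hx

lemma covD_mem_ghostFree (a : Fin n)
    (hx : x ∈ 𝓖) : covD D a x ∈ 𝓖 :=
  sum_mem fun μ _ => mul_mem (frameFun_mem_jetAlg _ _) (sub_mem (totalD_mem_ghostFree μ hx)
    (sum_mem fun I _ => mul_mem (conn_mem_ghostFree _ _) (gaugeAct_mem_ghostFree I hx)))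

lemma covD_mem_classical (a : Fin n)
    (hx : x ∈ 𝓚) : covD D a x ∈ 𝓚 :=
  sum_mem fun μ _ => mul_mem (frameFun_mem_jetAlg _ _) (sub_mem (totalD_mem_classical μ hx)
    (sum_mem fun I _ => mul_mem (conn_mem_classical _ _) (gaugeAct_mem_classical I hx)))

lemma IsTensorSeed.mem_ghostFree {t : 𝓐} (ht : IsTensorSeed D t) :
    t ∈ 𝓖 := by
  cases ht with
  | matterB m => exact fld_mem_ghostFree (by trivial) _
  | matterF m => exact fld_mem_ghostFree (by trivial) _
  | curvature a b I =>
    exact jetAlg_mono classicalJets_subset (sum_mem fun μ _ => sum_mem fun ν _ => mul_mem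
      (mul_mem (frameFun_mem_jetAlg _ _) (frameFun_mem_jetAlg _ _)) (curv_mem_classical _ _ _))
  | antiB m => exact mul_mem (frameFun_mem_jetAlg _ _) (anti_mem_ghostFree _ _)
  | antiF m => exact mul_mem (frameFun_mem_jetAlg _ _) (anti_mem_ghostFree _ _)
  | antiE a b => exact mul_mem (frameFun_mem_jetAlg _ _) (sum_mem fun μ _ => mul_mem
      (fld_mem_ghostFree (by trivial) _) (anti_mem_ghostFree _ _))
  | antiA i a => exact mul_mem (frameFun_mem_jetAlg _ _) (sum_mem fun μ _ => mul_mem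
      (fld_mem_ghostFree (by trivial) _) (anti_mem_ghostFree _ _))
  | antiC I => exact mul_mem (frameFun_mem_jetAlg _ _) (anti_mem_ghostFree _ _)
  | antiXi a => exact mul_mem (frameFun_mem_jetAlg _ _) (sum_mem fun μ _ => mul_mem
      (frameFun_mem_jetAlg _ _) (sub_mem (anti_mem_ghostFree _ _) (sum_mem fun I _ => mul_mem
      (conn_mem_ghostFree _ _) (anti_mem_ghostFree _ _))))

/-! ## Basic elements -/

lemma dL_gaugeAct (I : 𝓘) (g : 𝓗) (γ : 𝓜) (x : 𝓐) :
    dL (gJet g γ) (𝓣 I x) = 𝓣 I (dL (gJet g γ) x) +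
      ∑ g', rot D I (ghFld g') (ghFld g) • dL (gJet g' γ) x := by
  have h1 : scomm true false (dL (gJet g γ)) (𝓣 I) =
      ∑ g', rot D I (ghFld g') (ghFld g) • dL (gJet g' γ) := by
    refine ((isSDer_dL_gJet g γ).scomm (isSDer_gaugeAct I)).ext
      (IsSDer.sum _ fun g' _ => (isSDer_dL_gJet g' γ).smul _) fun z => ?_
    obtain ⟨Z, α⟩ := z
    simp only [scomm_apply, sum_app, smul_app]
    cases Z with
    | anti Φ => simp [gaugeAct_gen_anti, dL_gJet_anti]
    | fld Φ =>
      have h2 : 𝓣 I (dL (gJet g γ) (gen (.fld Φ, α))) = 0 := by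
        rw [dL_gJet_fld]
        split_ifs
        · exact (isSDer_gaugeAct I).map_one
        · exact map_zero _
        · exact map_zero _
      rw [h2, smul_zero, sub_zero, gaugeAct_gen_fld, map_sum]
      simp only [map_smul, dL_gJet_fld]
      rw [sum_eq_single (ghFld g) (fun Ψ _ h => by rw [if_neg h.symm, smul_zero]) (by simp),
        if_pos rfl]
      by_cases h : ∃ g0, ghFld g0 = Φ
      · obtain ⟨g0, rfl⟩ := h
        rw [sum_eq_single g0 (fun g' _ h => by
          rw [if_neg fun e => h (ghFld_injective e), smul_zero]) (by simp), if_pos rfl]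
      · have h3 : rot D I Φ (ghFld g) = 0 := by
          by_contra h4
          have h5 := mt (rot_classical I h4).1 (ghFld_not_classical g)
          cases Φ with
          | xi σ => exact h ⟨.inl σ, rfl⟩
          | C J => exact h ⟨.inr J, rfl⟩
          | _ => exact h5 trivial
        rw [h3, zero_smul]
        refine (sum_eq_zero fun g' _ => ?_).symm
        rw [if_neg fun e => h ⟨g', e⟩, smul_zero]
  have h2 := LinearMap.congr_fun h1 x
  simp only [scomm_apply, sum_app, smul_app, Bool.and_false, sgn_false, one_smul] at h2
  rw [← h2]; abel

lemma degree_eq_one_or_two_le {γ : 𝓜} (h : γ ≠ 0) : (∃ ρ, γ = single ρ 1) ∨ 2 ≤ γ.degree := by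
  obtain ⟨μ, hμ⟩ : ∃ μ, γ μ ≠ 0 := by
    by_contra hc; push Not at hc; exact h (ext hc)
  obtain ⟨γ', rfl⟩ := exists_eq_add_single hμ
  by_cases h' : γ' = 0
  · left; exact ⟨μ, by rw [h', zero_add]⟩
  · right
    have : γ'.degree ≠ 0 := fun e => h' ((degree_eq_zero_iff γ').1 e)
    simp; omega

variable [adm : Admissible D L₀]

lemma HasLie.lie_eq_zero (hx : HasLie D L₀ x (fun _ _ => 0) (fun _ _ => 0))
    (g : 𝓗) {γ : 𝓜} (h : γ ≠ 0) : 𝓠 g γ x = 0 := by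
  rcases degree_eq_one_or_two_le h with ⟨ρ, rfl⟩ | h
  · rcases g with σ | J
    · exact hx.xi ρ σ
    · exact hx.gh ρ J
  · exact hx.high g γ h

variable (D L₀) in
/-- The local functions annihilated by the contractions and the Lie derivatives with respect to
the differentiated ghosts. -/
def basicAlg : Subalgebra ℝ 𝓐 where
  carrier := {x | ∀ g γ, γ ≠ 0 → dL (gJet g γ) x = 0 ∧ 𝓠 g γ x = 0}
  add_mem' hx hy g γ h := by
    rw [map_add, map_add, (hx g γ h).1, (hx g γ h).2, (hy g γ h).1, (hy g γ h).2]; simp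
  mul_mem' hx hy g γ h := by
    rw [dL_gJet_mul, lie_mul, (hx g γ h).1, (hx g γ h).2, (hy g γ h).1, (hy g γ h).2]; simp
  algebraMap_mem' r g γ h := by
    rw [algebraMap_eq_smul_one, map_smul, map_smul, (isSDer_dL_gJet g γ).map_one,
      (isSDer_lie g γ).map_one]; simp

lemma mem_basicAlg_of_ghostFree (hx : x ∈ 𝓖)
    (h : HasLie D L₀ x (fun _ _ => 0) (fun _ _ => 0)) : x ∈ basicAlg D L₀ := fun g _ hγ =>
  ⟨dL_gJet_ghostFree g _ hx, h.lie_eq_zero g hγ⟩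

lemma hasLie_of_mem_basicAlg (hx : x ∈ basicAlg D L₀) :
    HasLie D L₀ x (fun _ _ => 0) (fun _ _ => 0) where
  xi ρ σ := (hx _ _ (by simp)).2
  gh ρ J := (hx _ _ (by simp)).2
  high g γ h := (hx _ _ (ne_zero_of_two_le h)).2

lemma brst_mem_basicAlg (hx : x ∈ basicAlg D L₀) :
    𝓢 x ∈ basicAlg D L₀ := fun g γ h => by
  refine ⟨?_, ?_⟩
  · rw [← lie_eq (hx g γ h).1]; exact (hx g γ h).2
  · rw [lie_brst, (hx g γ h).2, map_zero]

lemma brst_gaugeAct (I : 𝓘) (x : 𝓐) :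
    𝓢 (𝓣 I x) = 𝓣 I (𝓢 x) := by
  rw [← lie_C_zero (L₀ := L₀), lie_brst]

lemma gaugeAct_mem_basicAlg (I : 𝓘) (hx : x ∈ basicAlg D L₀) :
    𝓣 I x ∈ basicAlg D L₀ := fun g γ h => by
  have h1 : ∀ {y : 𝓐}, y ∈ basicAlg D L₀ → dL (gJet g γ) (𝓣 I y) = 0 := by
    intro y hy
    rw [dL_gaugeAct, (hy g γ h).1, map_zero, zero_add]
    exact sum_eq_zero fun g' _ => by rw [(hy g' γ h).1, smul_zero]
  refine ⟨h1 hx, ?_⟩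
  rw [lie_eq (h1 hx), brst_gaugeAct]
  exact h1 (brst_mem_basicAlg hx)

lemma covD_mem_basicAlg (a : Fin n) (hx : x ∈ 𝓖)
    (hb : x ∈ basicAlg D L₀) : covD D a x ∈ basicAlg D L₀ := by
  have h1 : ∀ μ, HasLie D L₀ (totalD μ x) (fun ρ σ => if ρ = μ then totalD σ x else 0)
      (fun ρ J => if ρ = μ then 𝓣 J x else 0) := by
    refine fun μ => ⟨fun ρ σ => ?_, fun ρ J => ?_, fun g γ h => ?_⟩
    · rw [lie_single_totalD, (hb _ _ (by simp)).2, lie_xi_zero, map_zero, zero_add]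
    · rw [lie_single_totalD, (hb _ _ (by simp)).2, lie_C_zero, map_zero, zero_add]
    · rw [lie_totalD, (hb _ _ (ne_zero_of_two_le h)).2, map_zero, zero_add]
      split_ifs with h1
      · rfl
      · refine (hb _ _ ?_).2
        obtain ⟨γ', rfl⟩ := exists_eq_add_single h1
        rw [add_tsub_cancel_right]
        rintro rfl; simp at h
  have h2 : ∀ μ, HasLie D L₀ (totalD μ x - ∑ I, conn μ I * 𝓣 I x)
      (fun ρ σ => if ρ = μ then totalD σ x - ∑ I, conn σ I * 𝓣 I x else 0)
      (fun _ _ => 0) := fun μ => by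
    refine ((h1 μ).sub (HasLie.sum fun I _ => (hasLie_conn μ I).mul
      (hasLie_of_mem_basicAlg (gaugeAct_mem_basicAlg I hb)))).congr (fun ρ σ => ?_) (fun ρ J => ?_)
    · by_cases h : ρ = μ <;> simp [h]
    · by_cases h : ρ = μ <;> simp [h]
  refine mem_basicAlg_of_ghostFree (covD_mem_ghostFree a hx) ((HasLie.sum fun μ _ =>
    (hasLie_invFrame a μ).mul (h2 μ)).congr (fun ρ σ => ?_) fun ρ J => by simp)
  simp [sum_add_distrib]

lemma hasLie_curv (μ ν : Fin n) (I : 𝓘) : HasLie D L₀ (curv D μ ν I)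
    (fun ρ σ => (if ρ = μ then curv D σ ν I else 0) + if ρ = ν then curv D μ σ I else 0)
    (fun _ _ => 0) where
  xi ρ σ := by
    have h1 : ∀ μ ν, 𝓠 (.inl σ) (single ρ 1) (totalD μ (conn ν I)) =
        (if ρ = ν then totalD μ (conn σ I) else 0) + if ρ = μ then totalD σ (conn ν I) else 0 := fun μ ν => by
      rw [lie_single_totalD, (hasLie_conn ν I).xi, lie_xi_zero]
      congr 1
      split_ifs <;> simp
    unfold curv
    simp only [map_add, map_sub, map_sum, map_smul, lie_mul, h1, (hasLie_conn _ _).xi]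
    by_cases h2 : ρ = μ <;> by_cases h3 : ρ = ν <;>
      simp [h2, h3, sum_add_distrib]
    · subst h2; simp only [← h3, if_true]; abel
    · subst h2; simp only [if_neg h3]; abel
    · subst h3; simp only [if_neg h2]; abel
  gh ρ J := by
    have h1 : ∀ μ ν, 𝓠 (.inr J) (single ρ 1) (totalD μ (conn ν I)) =
        if ρ = μ then -∑ K, D.f J K I • conn ν K else 0 := fun μ ν => by
      rw [lie_single_totalD, (hasLie_conn ν I).gh, lie_C_zero, gaugeAct_conn adm.isLie]
      have : totalD μ (if ρ = ν then if J = I then 1 else 0 else 0 : 𝓐) = 0 := by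
        split_ifs <;> simp [totalD_one]
      rw [this, zero_add]
    have h2 : ∑ M, ∑ K, D.f M K I • ((if J = M then 1 else 0) * conn ν K : 𝓐) =
        ∑ K, D.f J K I • conn ν K := by
      rw [sum_eq_single J (fun M _ h => by simp [h.symm]) (by simp)]
      simp
    have h3 : ∑ M, ∑ K, D.f M K I • (conn μ M * (if J = K then 1 else 0) : 𝓐) =
        -∑ K, D.f J K I • conn μ K := by
      rw [← sum_neg_distrib]
      refine sum_ext fun M _ => ?_
      rw [sum_eq_single J (fun K _ h => by simp [h.symm]) (by simp), if_pos rfl, mul_one,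
        adm.isLie.antisymm, neg_smul]
    unfold curv
    simp only [map_add, map_sub, map_sum, map_smul, lie_mul, h1, (hasLie_conn _ _).gh, smul_add,
      sum_add_distrib]
    have h4 : ∀ (p q : Prop) [Decidable p] [Decidable q] (x : 𝓐),
        (if p then (if q then 1 else 0) else 0) * x = if p then (if q then 1 else 0) * x else 0 :=
      fun p q _ _ x => by split_ifs <;> simp
    have h5 : ∀ (p q : Prop) [Decidable p] [Decidable q] (x : 𝓐),
        x * (if p then (if q then 1 else 0) else 0) = if p then x * (if q then 1 else 0) else 0 :=
      fun p q _ _ x => by split_ifs <;> simp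
    have h6 : ∀ (p : Prop) [Decidable p] (F : 𝓘 → 𝓘 → 𝓐),
        ∑ M, ∑ K, D.f M K I • (if p then F M K else 0) =
          if p then ∑ M, ∑ K, D.f M K I • F M K else 0 := fun p _ F => by
      split_ifs <;> simp
    simp only [h4, h5, h6, h2, h3]
    split_ifs <;> abel
  high g γ h := by
    have h1 : ∀ μ ν, 𝓠 g γ (totalD μ (conn ν I)) = if γ = single μ 1 + single ν 1 then
      (match g with
        | .inl σ => conn σ I
        | .inr J => if J = I then 1 else 0) else 0 := fun μ ν => by
      rw [lie_totalD, (hasLie_conn ν I).high g γ h, map_zero, zero_add]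
      by_cases h1 : γ μ = 0
      · rw [if_pos h1, if_neg]
        rintro rfl
        simp at h1
      · rw [if_neg h1]
        obtain ⟨γ', rfl⟩ := exists_eq_add_single h1
        rw [add_tsub_cancel_right]
        have hne : γ' ≠ 0 := by rintro rfl; simp at h
        have h2 : γ' + single μ 1 = single μ 1 + single ν 1 ↔
            γ' = single ν 1 := by rw [add_comm]; exact add_right_inj _
        simp only [h2]
        rcases degree_eq_one_or_two_le hne with ⟨ρ, rfl⟩ | h3
        · cases g with
          | inl σ => rw [(hasLie_conn ν I).xi]; simp [single_left_inj]
          | inr J => rw [(hasLie_conn ν I).gh]; simp [single_left_inj]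
        · rw [(hasLie_conn ν I).high g γ' h3, if_neg (single_ne_of_two_le h3 ν)]
    unfold curv
    simp only [map_add, map_sub, map_sum, map_smul, lie_mul, h1, (hasLie_conn _ _).high g γ h]
    rw [add_comm (single μ 1)]
    simp

end Basic

local notation "𝓚" => jetAlg (classicalJets n ι β φ)

section Tensors

/-! ## Tensor fields are basic -/

/-- `ξ̂^a = ξ^μ e_μ^a`. -/
def xiHat (a : Fin n) : 𝓐 := ∑ μ, xi μ * vb μ a

/-- `Ĉ^I = C^I + ξ^μ A_μ^I`. -/
def ghHat (I : 𝓘) : 𝓐 := gh I + ∑ μ, xi μ * conn μ I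

section

variable [adm : Admissible D L₀]

lemma mem_basicAlg (hx : ∀ g γ, γ ≠ 0 → dL (gJet g γ) x = 0)
    (h : HasLie D L₀ x (fun _ _ => 0) (fun _ _ => 0)) : x ∈ basicAlg D L₀ := fun g γ hγ =>
  ⟨hx g γ hγ, h.lie_eq_zero g hγ⟩

lemma IsTensorSeed.mem_basicAlg {t : 𝓐} (ht : IsTensorSeed D t) : t ∈ basicAlg D L₀ := by
  refine mem_basicAlg_of_ghostFree ht.mem_ghostFree ?_
  cases ht with
  | matterB m => exact hasLie_yB m
  | matterF m => exact hasLie_yF m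
  | curvature a b I =>
    refine (HasLie.sum fun μ _ => HasLie.sum fun ν _ => ((hasLie_invFrame a μ).mul
      (hasLie_invFrame b ν)).mul (hasLie_curv μ ν I)).congr (fun ρ σ => ?_) (fun ρ J => by simp)
    simp only [add_mul, mul_add, ite_mul, mul_ite, zero_mul, mul_zero, sum_add_distrib,
      sum_ite_irrel, sum_const_zero, sum_ite_eq, mem_univ, if_true,
      neg_mul, mul_neg, sum_neg_distrib]
    abel
  | antiB m =>
    refine ((hasLie_invDet).mul (hasLie_anti (.yB m))).congr (fun ρ σ => ?_) (fun ρ J => ?_)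
    · simp only [antiGl]; split_ifs <;> simp
    · simp [antiShift]
  | antiF m =>
    refine ((hasLie_invDet).mul (hasLie_anti (.yF m))).congr (fun ρ σ => ?_) (fun ρ J => ?_)
    · simp only [antiGl]; split_ifs <;> simp
    · simp [antiShift]
  | antiC m =>
    refine ((hasLie_invDet).mul (hasLie_anti (.C m))).congr (fun ρ σ => ?_) (fun ρ J => ?_)
    · simp only [antiGl]; split_ifs <;> simp
    · simp [antiShift]
  | antiE a b =>
    refine ((hasLie_invDet).mul (HasLie.sum fun μ _ => (hasLie_e μ b).mul (hasLie_anti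
      (.e μ a)))).congr (fun ρ σ => ?_) (fun ρ J => ?_)
    · simp only [antiGl]
      by_cases h : ρ = σ <;> simp [h, mul_add, sum_add_distrib]
    · simp [antiShift]
  | antiA i a =>
    refine ((hasLie_invDet).mul (HasLie.sum fun μ _ => (hasLie_e μ a).mul (hasLie_anti
      (.A μ i)))).congr (fun ρ σ => ?_) (fun ρ J => ?_)
    · simp only [antiGl]
      by_cases h : ρ = σ <;> simp [h, mul_add, sum_add_distrib]
    · simp [antiShift]
  | antiXi a =>
    have hY : ∀ μ, HasLie D L₀ (anti (.xi μ) - ∑ I, conn μ I * anti (.C I))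
        (fun ρ σ => (if ρ = σ then anti (.xi μ) - ∑ I, conn μ I * anti (.C I) else 0) +
          if ρ = μ then anti (.xi σ) - ∑ I, conn σ I * anti (.C I) else 0) (fun _ _ => 0) := fun μ => by
      refine ((hasLie_anti (.xi μ)).sub (HasLie.sum fun I _ => (hasLie_conn μ I).mul
        (hasLie_anti (.C I)))).congr (fun ρ σ => ?_) (fun ρ J => ?_)
      · simp only [antiGl]
        by_cases h : ρ = σ <;> by_cases h2 : ρ = μ <;>
          simp [h, h2, sum_add_distrib]
        · subst h2; subst h; simp only [if_true]; abel
        · subst h; simp only [if_neg h2]; abel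
        · subst h2; simp only [if_neg h]; abel
      · simp only [antiShift]
        by_cases h : ρ = μ <;> simp [h]
    refine ((hasLie_invDet).mul (HasLie.sum fun μ _ => (hasLie_invFrame a μ).mul (hY μ))).congr
      (fun ρ σ => ?_) (fun ρ J => by simp)
    simp only [mul_add, ite_mul, mul_ite, zero_mul, mul_zero, sum_add_distrib,
      sum_ite_irrel, sum_const_zero, sum_ite_eq, mem_univ, if_true,
      neg_mul, mul_neg]
    split_ifs
    · abel
    · simp

lemma dL_xi_of_ne_zero (g : 𝓗) {γ : 𝓜} (h : γ ≠ 0) (Φ : 𝓕) :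
    dL (gJet g γ) (fld Φ) = 0 := by
  rw [dL_gJet_fld]; simp [h]

lemma xiHat_mem_basicAlg (a : Fin n) : xiHat a ∈ basicAlg D L₀ := by
  refine mem_basicAlg (fun g γ h => ?_) ((HasLie.sum fun μ _ => (hasLie_xi μ).mul
    (hasLie_e μ a)).congr (fun ρ σ => ?_) (fun ρ J => by simp))
  · rw [xiHat, map_sum]
    refine sum_eq_zero fun μ _ => ?_
    rw [dL_gJet_mul, dL_xi_of_ne_zero g h, dL_xi_of_ne_zero g h]; simp
  · simp [sum_add_distrib]

lemma ghHat_mem_basicAlg (I : 𝓘) : ghHat I ∈ basicAlg D L₀ := by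
  refine mem_basicAlg (fun g γ h => ?_) (((hasLie_C I).add (HasLie.sum fun μ _ => (hasLie_xi μ).mul
    (hasLie_conn μ I))).congr (fun ρ σ => ?_) (fun ρ J => ?_))
  · rw [ghHat, map_add, map_sum, dL_xi_of_ne_zero g h, zero_add]
    refine sum_eq_zero fun μ _ => ?_
    rw [dL_gJet_mul, dL_xi_of_ne_zero g h, dL_gJet_ghostFree g γ (conn_mem_ghostFree μ I)]; simp
  · simp [sum_add_distrib]
  · by_cases h : J = I <;> simp [h]

end

/-- The iterated covariant derivatives of the undifferentiated tensor fields. -/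
def IsTensor (D : GaugeData n ι β φ) (x : 𝓐) : Prop :=
  ∃ (l : List (Fin n)) (t : 𝓐), IsTensorSeed D t ∧ x = l.foldr (covD D) t

lemma tensorAlg_induction {p : 𝓐 → Prop} (ht : ∀ x, IsTensor D x → p x)
    (hx : ∀ a, p (xiHat a)) (hC : ∀ I, p (ghHat I)) (h1 : ∀ r : ℝ, p (algebraMap ℝ _ r))
    (hadd : ∀ x y, x ∈ tensorAlg D → y ∈ tensorAlg D → p x → p y → p (x + y))
    (hmul : ∀ x y, x ∈ tensorAlg D → y ∈ tensorAlg D → p x → p y → p (x * y))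
    (h : x ∈ tensorAlg D) : p x := by
  induction h using adjoin_induction with
  | mem x h =>
    rcases h with (h | ⟨a, rfl⟩) | ⟨I, rfl⟩
    · exact ht x h
    · exact hx a
    · exact hC I
  | algebraMap r => exact h1 r
  | add x y hx hy h h' => exact hadd x y hx hy h h'
  | mul x y hx hy h h' => exact hmul x y hx hy h h'

lemma IsTensor.mem (h : IsTensor D x) : x ∈ tensorAlg D :=
  subset_adjoin (Or.inl (Or.inl h))

lemma xiHat_mem (a : Fin n) : xiHat a ∈ tensorAlg D := subset_adjoin (Or.inl (Or.inr ⟨a, rfl⟩))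

lemma ghHat_mem (I : 𝓘) : ghHat I ∈ tensorAlg D := subset_adjoin (Or.inr ⟨I, rfl⟩)

lemma IsTensor.mem_ghostFree (h : IsTensor D x) : x ∈ 𝓖 := by
  obtain ⟨l, t, ht, rfl⟩ := h
  induction l with
  | nil => exact ht.mem_ghostFree
  | cons a l ih => exact covD_mem_ghostFree a ih

lemma IsTensor.mem_basicAlg [adm : Admissible D L₀] (h : IsTensor D x) :
    x ∈ basicAlg D L₀ := by
  obtain ⟨l, t, ht, rfl⟩ := h
  induction l with
  | nil => exact ht.mem_basicAlg
  | cons a l ih => exact covD_mem_basicAlg a (IsTensor.mem_ghostFree ⟨l, t, ht, rfl⟩) ih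

variable (D L₀) in
lemma tensorAlg_le_basicAlg [adm : Admissible D L₀] : tensorAlg D ≤ basicAlg D L₀ :=
  fun _ hx => tensorAlg_induction (p := fun x => x ∈ basicAlg D L₀) (fun _ h => h.mem_basicAlg)
    xiHat_mem_basicAlg ghHat_mem_basicAlg (fun r => Subalgebra.algebraMap_mem _ r)
    (fun _ _ _ _ h h' => add_mem h h') (fun _ _ _ _ h h' => mul_mem h h') hx

/-! ## The gauge algebra acts on tensor fields -/

lemma rot_rep (hD : D.IsLie) : IsRep D.f (rot D) := by
  intro I J Φ Χ
  rw [sum_fld]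
  cases Φ with
  | e μ a =>
    cases Χ with
    | e ν b =>
      by_cases h : μ = ν
      · subst h
        have := hD.vec_rep I J a b
        simpa [rot, sum_ite_irrel] using this
      · have h' : ∀ x, ¬(x = ν ∧ μ = x) := by rintro x ⟨rfl, rfl⟩; exact h rfl
        simp [rot, h, ← ite_and, h']
    | _ => simp [rot]
  | A μ a =>
    cases Χ with
    | A ν b =>
      by_cases h : μ = ν
      · subst h
        have := hD.coadj_rep_inl I J a b
        simpa [rot, sum_ite_irrel] using this
      · have h' : ∀ x, ¬(x = ν ∧ μ = x) := by rintro x ⟨rfl, rfl⟩; exact h rfl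
        simp [rot, h, sum_ite_irrel]
    | _ => simp [rot]
  | yB m =>
    cases Χ with
    | yB k => simpa [rot] using hD.repB_rep I J m k
    | _ => simp [rot]
  | yF m =>
    cases Χ with
    | yF k => simpa [rot] using hD.repF_rep I J m k
    | _ => simp [rot]
  | xi m => cases Χ <;> simp [rot]
  | C m =>
    cases Χ with
    | C k => simpa [rot] using hD.coadj_rep I J m k
    | _ => simp [rot]

lemma gaugeAct_comm (hD : D.IsLie) (I J : 𝓘) (x : 𝓐) :
    𝓣 I (𝓣 J x) - 𝓣 J (𝓣 I x) =
      ∑ K, D.f I J K • 𝓣 K x := by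
  have h1 : scomm false false (𝓣 I) (𝓣 J) = ∑ K, D.f I J K • 𝓣 K := by
    refine ((isSDer_gaugeAct I).scomm (isSDer_gaugeAct J)).ext
      (IsSDer.sum _ fun K _ => (isSDer_gaugeAct K).smul _) fun z => ?_
    obtain ⟨Z, α⟩ := z
    simp only [scomm_apply, sum_app, smul_app, Bool.and_false, sgn_false, one_smul]
    have h := rot_rep hD I J
    cases Z with
    | fld Φ =>
      have e1 : ∀ I J, 𝓣 I (𝓣 J (gen (.fld Φ, α))) =
          ∑ Χ, (∑ Ψ, rot D J Φ Ψ * rot D I Ψ Χ) • gen (.fld Χ, α) := fun I J => by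
        simp only [gaugeAct_gen_fld, map_sum, map_smul, smul_sum, smul_smul, sum_smul]
        rw [sum_comm]
      have e2 : ∑ K, D.f I J K • 𝓣 K (gen (.fld Φ, α)) =
          ∑ Χ, (∑ K, D.f I J K * rot D K Φ Χ) • gen (.fld Χ, α) := by
        simp only [gaugeAct_gen_fld, smul_sum, smul_smul, sum_smul]
        rw [sum_comm]
      rw [e1, e1, e2, ← sum_sub_distrib]
      exact sum_ext fun Χ _ => by rw [h Φ Χ, ← sub_smul, sum_sub_distrib]
    | anti Φ =>
      have e1 : ∀ I J, 𝓣 I (𝓣 J (gen (.anti Φ, α))) =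
          ∑ Χ, (∑ Ψ, rot D I Χ Ψ * rot D J Ψ Φ) • gen (.anti Χ, α) := fun I J => by
        simp only [gaugeAct_gen_anti, map_sum, map_smul, map_neg, smul_sum, smul_smul,
          smul_neg, sum_neg_distrib, neg_neg, sum_smul]
        rw [sum_comm]
        simp only [mul_comm]
      have e2 : ∑ K, D.f I J K • 𝓣 K (gen (.anti Φ, α)) =
          -∑ Χ, (∑ K, D.f I J K * rot D K Χ Φ) • gen (.anti Χ, α) := by
        simp only [gaugeAct_gen_anti, smul_sum, smul_smul, sum_smul, smul_neg, sum_neg_distrib]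
        rw [sum_comm]
      rw [e1, e1, e2, ← sum_sub_distrib, ← sum_neg_distrib]
      exact sum_ext fun Χ _ => by
        rw [h Χ Φ, ← sub_smul, sum_sub_distrib, ← neg_smul, neg_sub]
  have h2 := LinearMap.congr_fun h1 x
  simpa [scomm_apply] using h2

lemma gaugeAct_flat (J : 𝓘) (Y : Fin n → 𝓐) (a : Fin n) :
    𝓣 J (∑ μ, invFrame a μ * Y μ) = (∑ μ, invFrame a μ * 𝓣 J (Y μ)) -
      ∑ b, D.vec J b a • ∑ μ, invFrame b μ * Y μ := by
  rw [map_sum]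
  simp only [gaugeAct_mul, gaugeAct_invFrame, sum_add_distrib, neg_mul, sum_mul,
    sum_neg_distrib, smul_mul_assoc, smul_sum]
  rw [sum_comm]
  abel

lemma gaugeAct_sum_vb (J : 𝓘) (Y : Fin n → 𝓐) (a : Fin n) :
    𝓣 J (∑ μ, vb μ a * Y μ) = (∑ μ, vb μ a * 𝓣 J (Y μ)) +
      ∑ b, D.vec J a b • ∑ μ, vb μ b * Y μ := by
  rw [map_sum]
  simp only [gaugeAct_mul, gaugeAct_fld_e, sum_add_distrib, sum_mul, smul_mul_assoc, smul_sum]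
  rw [sum_comm]
  abel

lemma gaugeAct_curv (hD : D.IsLie) (J : 𝓘) (μ ν : Fin n) (I : 𝓘) :
    𝓣 J (curv D μ ν I) = -∑ K, D.f J K I • curv D μ ν K := by
  unfold curv
  simp only [map_add, map_sub, map_sum, map_smul, gaugeAct_mul, gaugeAct_totalD, gaugeAct_conn hD,
    map_neg, smul_add, smul_sub, sum_add_distrib, sum_sub_distrib, neg_mul, mul_neg,
    sum_mul, mul_sum, smul_mul_assoc, mul_smul_comm, smul_neg, sum_neg_distrib, smul_sum, smul_smul]
  set c : 𝓘 → 𝓘 → 𝓐 := fun M N => conn μ M * conn ν N with hc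
  have e1 : (∑ L, ∑ N, ∑ M, (D.f L N I * D.f J M L) • (conn μ M * conn ν N) : 𝓐) =
      ∑ M, ∑ N, (∑ L, D.f L N I * D.f J M L) • c M N := by
    simp only [sum_smul]
    rw [sum_comm]
    conv_rhs => rw [sum_comm]
    refine sum_ext fun N _ => ?_
    rw [sum_comm]
  have e2 : (∑ M, ∑ L, ∑ N, (D.f M L I * D.f J N L) • (conn μ M * conn ν N) : 𝓐) =
      ∑ M, ∑ N, (∑ L, D.f M L I * D.f J N L) • c M N := by
    simp only [sum_smul]
    refine sum_ext fun N _ => ?_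
    rw [sum_comm]
  have e3 : (∑ L, ∑ M, ∑ N, (D.f J L I * D.f M N L) • (conn μ M * conn ν N) : 𝓐) =
      ∑ M, ∑ N, (∑ L, D.f J L I * D.f M N L) • c M N := by
    simp only [sum_smul]
    rw [sum_comm]
    refine sum_ext fun N _ => ?_
    rw [sum_comm]
  rw [e1, e2, e3]
  have e4 : ∀ M N, ∑ L, D.f J L I * D.f M N L = (∑ L, D.f L N I * D.f J M L) +
      ∑ L, D.f M L I * D.f J N L := fun M N => by
    rw [← sub_eq_zero, ← sum_add_distrib, ← sum_sub_distrib, ← neg_eq_zero,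
      ← sum_neg_distrib, ← hD.jacobi J M N I]
    refine sum_ext fun L _ => ?_
    rw [hD.antisymm N J L, hD.antisymm J L, hD.antisymm M L]
    ring
  simp only [e4, add_smul, sum_add_distrib]
  abel

lemma covD_eq (a : Fin n) (x : 𝓐) :
    covD D a x = ∑ μ, invFrame a μ * (totalD μ x - ∑ I, conn μ I * 𝓣 I x) := rfl

lemma covD_add (a : Fin n) (x y : 𝓐) : covD D a (x + y) = covD D a x + covD D a y := by
  simp only [covD, map_add, mul_add, mul_sub, sum_add_distrib, sum_sub_distrib]
  abel

lemma covD_smul (a : Fin n) (r : ℝ) (x : 𝓐) : covD D a (r • x) = r • covD D a x := by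
  simp only [covD, map_smul, mul_smul_comm, smul_sum, mul_sub, smul_sub, sum_sub_distrib, mul_sum]

lemma gaugeAct_covD (hD : D.IsLie) (J : 𝓘) (a : Fin n) (x : 𝓐) :
    𝓣 J (covD D a x) = covD D a (𝓣 J x) - ∑ b, D.vec J b a • covD D b x := by
  rw [covD_eq, gaugeAct_flat]
  congr 1
  rw [covD_eq]
  refine sum_ext fun μ _ => ?_
  congr 1
  rw [map_sub, gaugeAct_totalD, map_sum]
  congr 1
  have h1 : ∀ I, 𝓣 J (𝓣 I x) = 𝓣 I (𝓣 J x) +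
      ∑ K, D.f J I K • 𝓣 K x := fun I => by rw [← gaugeAct_comm hD]; abel
  simp only [gaugeAct_mul, h1, gaugeAct_conn hD, mul_add, sum_add_distrib, mul_sum,
    neg_mul, sum_mul, sum_neg_distrib, smul_mul_assoc, mul_smul_comm]
  rw [sum_comm]
  abel

/-- The span of the tensor fields. -/
def tensorSpan (D : GaugeData n ι β φ) : Submodule ℝ 𝓐 := span ℝ {x | IsTensor D x}

lemma tensorSpan_le : tensorSpan D ≤ toSubmodule (tensorAlg D) :=
  Submodule.span_le.2 fun _ h => IsTensor.mem h

lemma covD_mem_tensorSpan (a : Fin n) (hx : x ∈ tensorSpan D) :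
    covD D a x ∈ tensorSpan D := by
  induction hx using span_induction with
  | mem x h =>
    obtain ⟨l, t, ht, rfl⟩ := h
    exact subset_span ⟨a :: l, t, ht, rfl⟩
  | zero =>
    have := covD_smul (D := D) a 0 0
    rw [zero_smul, zero_smul] at this
    rw [this]; exact zero_mem _
  | add x y _ _ h h' => rw [covD_add]; exact add_mem h h'
  | smul r x _ h => rw [covD_smul]; exact smul_mem _ _ h

lemma IsTensorSeed.mem_tensorSpan {t : 𝓐} (ht : IsTensorSeed D t) :
    t ∈ tensorSpan D := subset_span ⟨[], t, ht, rfl⟩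

lemma sum_mem_tensorSpan {T : Type*} [Fintype T] (r : T → ℝ) {y : T → 𝓐}
    (h : ∀ k, IsTensorSeed D (y k)) : ∑ k, r k • y k ∈ tensorSpan D :=
  sum_mem fun k _ => smul_mem _ _ (h k).mem_tensorSpan

lemma IsTensorSeed.gaugeAct_mem (hD : D.IsLie) (J : 𝓘) {t : 𝓐}
    (ht : IsTensorSeed D t) : 𝓣 J t ∈ tensorSpan D := by
  cases ht with
  | matterB m => rw [gaugeAct_fld_yB]; exact sum_mem_tensorSpan _ fun k => .matterB k
  | matterF m => rw [gaugeAct_fld_yF]; exact sum_mem_tensorSpan _ fun k => .matterF k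
  | curvature a b I =>
    simp only [mul_assoc, ← mul_sum]
    have h0 : ∀ a b I, ∑ μ, invFrame a μ * ∑ ν, invFrame b ν * curv D μ ν I ∈ tensorSpan D := fun a b I => by
      have := (IsTensorSeed.curvature (D := D) a b I).mem_tensorSpan
      simpa only [mul_assoc, ← mul_sum] using this
    rw [gaugeAct_flat]
    refine sub_mem ?_ (sum_mem fun c _ => smul_mem _ _ (h0 _ _ _))
    simp only [gaugeAct_flat, gaugeAct_curv hD, mul_sub, sum_sub_distrib]
    refine sub_mem ?_ ?_
    · have : (∑ μ, invFrame a μ * ∑ ν, invFrame b ν * -∑ K, D.f J K I • curv D μ ν K) =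
          -∑ K, D.f J K I • ∑ μ, invFrame a μ * ∑ ν, invFrame b ν * curv D μ ν K := by
        simp only [mul_sum, smul_sum, mul_neg, sum_neg_distrib, mul_smul_comm]
        congr 1
        rw [Finset.sum_comm' (t' := univ) (s' := fun _ => univ) (by simp)]
        conv_rhs => rw [sum_comm]
        rw [sum_comm]
        exact sum_ext fun μ _ => sum_comm
      rw [this]
      exact neg_mem (sum_mem fun c _ => smul_mem _ _ (h0 _ _ _))
    · have : (∑ μ, invFrame a μ * ∑ c, D.vec J c b • ∑ ν, invFrame c ν * curv D μ ν I) =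
          ∑ c, D.vec J c b • ∑ μ, invFrame a μ * ∑ ν, invFrame c ν * curv D μ ν I := by
        simp only [mul_sum, smul_sum, mul_smul_comm]
        rw [sum_comm]
      rw [this]
      exact sum_mem fun c _ => smul_mem _ _ (h0 _ _ _)
  | antiB m =>
    rw [gaugeAct_mul, gaugeAct_invDet hD, zero_mul, zero_add, gaugeAct_anti_yB, mul_neg, mul_sum]
    simp only [mul_smul_comm]
    exact neg_mem (sum_mem_tensorSpan _ fun k => .antiB k)
  | antiF m =>
    rw [gaugeAct_mul, gaugeAct_invDet hD, zero_mul, zero_add, gaugeAct_anti_yF, mul_neg, mul_sum]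
    simp only [mul_smul_comm]
    exact neg_mem (sum_mem_tensorSpan _ fun k => .antiF k)
  | antiC I =>
    rw [gaugeAct_mul, gaugeAct_invDet hD, zero_mul, zero_add, gaugeAct_anti_C, mul_sum]
    simp only [mul_smul_comm]
    exact sum_mem_tensorSpan _ fun k => .antiC k
  | antiE a b =>
    rw [gaugeAct_mul, gaugeAct_invDet hD, zero_mul, zero_add, gaugeAct_sum_vb, mul_add,
      mul_sum (univ : Finset (Fin n)) (fun c => D.vec J b c • _)]
    simp only [mul_smul_comm]
    refine add_mem ?_ (sum_mem_tensorSpan _ fun k => .antiE a k)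
    have : (invDet * ∑ μ, vb μ b * 𝓣 J (anti (.e μ a)) : 𝓐) =
        -∑ c, D.vec J c a • (invDet * ∑ μ, vb μ b * anti (.e μ c)) := by
      simp only [gaugeAct_anti_e, mul_sum, smul_sum, mul_neg, sum_neg_distrib, mul_smul_comm]
      rw [sum_comm]
    rw [this]
    exact neg_mem (sum_mem_tensorSpan _ fun k => .antiE k b)
  | antiA i a =>
    rw [gaugeAct_mul, gaugeAct_invDet hD, zero_mul, zero_add, gaugeAct_sum_vb, mul_add,
      mul_sum (univ : Finset (Fin n)) (fun c => D.vec J a c • _)]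
    simp only [mul_smul_comm]
    refine add_mem ?_ (sum_mem_tensorSpan _ fun k => .antiA i k)
    have : (invDet * ∑ μ, vb μ a * 𝓣 J (anti (.A μ i)) : 𝓐) =
        ∑ k, D.f J (.inl i) (.inl k) • (invDet * ∑ μ, vb μ a * anti (.A μ k)) := by
      simp only [gaugeAct_anti_A, mul_sum, smul_sum, mul_smul_comm]
      rw [sum_comm]
    rw [this]
    exact sum_mem_tensorSpan _ fun k => .antiA k a
  | antiXi a =>
    rw [gaugeAct_mul, gaugeAct_invDet hD, zero_mul, zero_add, gaugeAct_flat, mul_sub,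
      mul_sum (univ : Finset (Fin n)) (fun c => D.vec J c a • _)]
    simp only [mul_smul_comm]
    refine sub_mem ?_ (sum_mem_tensorSpan _ fun k => .antiXi k)
    have : ∀ μ, 𝓣 J (anti (.xi μ) - ∑ I, conn μ I * anti (.C I) : 𝓐) = 0 := fun μ => by
      simp only [map_sub, map_sum, gaugeAct_mul, gaugeAct_anti_xi, gaugeAct_anti_C,
        gaugeAct_conn hD, sum_add_distrib, neg_mul, sum_mul, mul_sum,
        smul_mul_assoc, mul_smul_comm, sum_neg_distrib]
      rw [sum_comm]
      abel
    simp only [this, mul_zero, sum_const_zero]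
    exact zero_mem _

lemma gaugeAct_mem_tensorSpan (hD : D.IsLie) (J : 𝓘)
    (hx : x ∈ tensorSpan D) : 𝓣 J x ∈ tensorSpan D := by
  refine map_mem_of_span _ ?_ hx
  rintro _ ⟨l, t, ht, rfl⟩
  induction l with
  | nil => exact ht.gaugeAct_mem hD J
  | cons a l ih =>
    change 𝓣 J (covD D a (l.foldr (covD D) t)) ∈ _
    rw [gaugeAct_covD hD]
    exact sub_mem (covD_mem_tensorSpan a ih) (sum_mem fun b _ => smul_mem _ _
      (subset_span ⟨b :: l, t, ht, rfl⟩))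

end Tensors

section GhostNumber

/-! ## The ghost number grading -/

variable (n ι β φ) in
/-- The ghost number operator. -/
def ghNumber : 𝓛 := evol fun z => (z.1.gh : ℝ) • gen z

lemma isSDer_ghNumber : IsSDer false (ghNumber n ι β φ) :=
  isSDer_evol fun z => by rw [Bool.false_xor]; exact (isHom_gen z).smul _

/-- Local functions of ghost number `k`. -/
def HasGh (k : ℤ) (x : 𝓐) : Prop := ghNumber n ι β φ x = (k : ℝ) • x

lemma hasGh_gen (z : 𝓙) : HasGh z.1.gh (gen z : 𝓐) := by
  rw [HasGh, ghNumber, evol_gen]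

lemma hasGh_frameFun (f : 𝓒) : HasGh 0 (frameFun f : 𝓐) := by
  rw [HasGh, isSDer_ghNumber.frame, Int.cast_zero, zero_smul]
  refine sum_eq_zero fun p _ => ?_
  rw [hasGh_gen (frameJet p)]
  change (((0 : ℤ) : ℝ) • _) * _ = _
  rw [Int.cast_zero, zero_smul, zero_mul]

lemma HasGh.mul {k l m : ℤ} (hx : HasGh k x) (hy : HasGh l y)
    (h : k + l = m := by rfl) : HasGh m (x * y) := by
  subst h
  unfold HasGh at *
  rw [isSDer_ghNumber.mul, hx, hy, par_false, smul_mul_assoc, mul_smul_comm, ← add_smul]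
  push_cast; rfl

lemma HasGh.add {k : ℤ} (hx : HasGh k x) (hy : HasGh k y) : HasGh k (x + y) := by
  unfold HasGh at *; rw [map_add, hx, hy, smul_add]

lemma HasGh.smul {k : ℤ} (hx : HasGh k x) (r : ℝ) : HasGh k (r • x) := by
  unfold HasGh at *; rw [map_smul, hx, smul_comm]

lemma HasGh.neg {k : ℤ} (hx : HasGh k x) : HasGh k (-x) := by
  unfold HasGh at *; rw [map_neg, hx, smul_neg]

lemma hasGh_zero (k : ℤ) : HasGh k (0 : 𝓐) := by
  unfold HasGh; rw [map_zero, smul_zero]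

lemma HasGh.sum {k : ℤ} {I : Type*} {s : Finset I} {x : I → 𝓐}
    (hx : ∀ i ∈ s, HasGh k (x i)) : HasGh k (∑ i ∈ s, x i) := by
  unfold HasGh at *
  rw [map_sum, smul_sum]
  exact sum_ext hx

lemma hasGh_one : HasGh 0 (1 : 𝓐) := by
  unfold HasGh; rw [isSDer_ghNumber.map_one]; simp

lemma HasGh.par {k : ℤ} (hx : HasGh k x) (ε : Bool) : HasGh k (par ε x) := by
  have := isSDer_ghNumber.par ε x
  rw [hx, map_smul] at this
  unfold HasGh
  rw [this]; simp

lemma HasGh.totalD {k : ℤ} (hx : HasGh k x) (μ : Fin n) : HasGh k (totalD μ x) := by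
  have h := (isSDer_ghNumber (n := n) (ι := ι) (β := β) (φ := φ)).comp_comm (isSDer_totalD μ) (fun z => by
    rw [totalD_gen, hasGh_gen, hasGh_gen, map_smul, totalD_gen]; simp) x
  unfold HasGh at *
  rw [hx, map_smul] at h
  simpa using h

lemma HasGh.iterD {k : ℤ} (hx : HasGh k x) (α : 𝓜) : HasGh k (iterD α x) := by
  induction α using multiIndex_induction with
  | h0 => rwa [iterD_zero]
  | h1 α μ h => rw [iterD_add_single]; exact h.totalD μ

lemma HasGh.dL {k l : ℤ} (hx : HasGh k x) (z : 𝓙)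
    (h : k - z.1.gh = l := by rfl) : HasGh l (dL z x) := by
  subst h
  have h1 := ((isSDer_ghNumber (n := n) (ι := ι) (β := β) (φ := φ)).scomm (isSDer_dL z)
    (ζ := z.1.isOdd) (Bool.false_xor _)).ext ((isSDer_dL z).smul (-(z.1.gh : ℝ))) (fun w => by
      rw [scomm_apply, smul_app, hasGh_gen, map_smul, dL_gen]
      split_ifs with h
      · subst h; rw [isSDer_ghNumber.map_one]; simp
      · simp)
  have h2 := LinearMap.congr_fun h1 x
  rw [scomm_apply, smul_app, hx, map_smul] at h2
  unfold HasGh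
  rw [Bool.false_and, sgn_false, one_smul, sub_eq_iff_eq_add] at h2
  rw [h2, ← add_smul]
  push_cast
  congr 1; ring

lemma HasGh.euler {k l : ℤ} (hx : HasGh k x) (Z : 𝓥)
    (h : k - Z.gh = l := by rfl) : HasGh l (euler Z x) := by
  rw [euler_eq, eulerL, adj_eq_sum Z x 1 (adj_finite Z x).toFinset (fun α hα => by
    by_contra h; exact hα (by simpa using h))]
  refine HasGh.par (HasGh.sum fun α _ => ?_) _
  rw [mul_one]
  exact ((hx.dL (Z, α) h).iterD α).smul _

lemma hasGh_fld (Φ : 𝓕) : HasGh Φ.gh (fld Φ : 𝓐) := hasGh_gen (.fld Φ, 0)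

lemma hasGh_anti (Φ : 𝓕) : HasGh (-Φ.gh - 1) (anti Φ : 𝓐) := hasGh_gen (.anti Φ, 0)

lemma hasGh_dfld (μ : Fin n) (Φ : 𝓕) : HasGh Φ.gh (dfld μ Φ : 𝓐) := hasGh_gen (.fld Φ, single μ 1)

variable (D) in
lemma hasGh_brstField (Φ : 𝓕) : HasGh (Φ.gh + 1) (brstField D Φ) := by
  rw [brstField_eq]
  refine (HasGh.sum fun ν _ => (hasGh_fld (.xi ν)).mul (hasGh_dfld ν Φ) (add_comm _ _)).add ?_
  cases Φ with
  | e μ a =>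
    exact (HasGh.sum fun ν _ => (hasGh_dfld μ (.xi ν)).mul (hasGh_fld (.e ν a))).add
      (HasGh.sum fun I _ => HasGh.sum fun b _ =>
        ((hasGh_fld (.C I)).mul (hasGh_fld (.e μ b))).smul _)
  | A μ i =>
    exact ((HasGh.sum fun ν _ => (hasGh_dfld μ (.xi ν)).mul (hasGh_fld (.A ν i))).add
      (hasGh_dfld μ (.C (.inl i)))).add (HasGh.sum fun j _ => HasGh.sum fun k _ =>
        ((hasGh_fld (.C (.inl j))).mul (hasGh_fld (.A μ k))).smul _)
  | yB m =>
    exact HasGh.sum fun I _ => HasGh.sum fun k _ =>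
      ((hasGh_fld (.C I)).mul (hasGh_fld (.yB k))).smul _
  | yF m =>
    exact HasGh.sum fun I _ => HasGh.sum fun k _ =>
      ((hasGh_fld (.C I)).mul (hasGh_fld (.yF k))).smul _
  | xi μ => exact hasGh_zero _
  | C K =>
    exact (HasGh.smul (HasGh.sum fun I _ => HasGh.sum fun k _ =>
      ((hasGh_fld (.C I)).mul (hasGh_fld (.C k))).smul _) _).neg

lemma hasGh_classical (hx : x ∈ 𝓚) : HasGh 0 x := by
  refine jetAlg_induction (p := HasGh 0) hasGh_frameFun (fun z hz => ?_)
    (fun x y _ _ h h' => h.add h') (fun x y _ _ h h' => h.mul h') hx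
  obtain ⟨Z, α⟩ := z
  obtain ⟨Φ, h, hΦ⟩ := hz
  change Z = _ at h
  subst h
  have h0 : Φ.gh = 0 := by cases Φ <;> first | rfl | exact hΦ.elim
  have := hasGh_gen (n := n) (ι := ι) (β := β) (φ := φ) (.fld Φ, α)
  rwa [show (Var.fld Φ).gh = 0 from h0] at this

variable [adm : Admissible D L₀]

lemma hasGh_master : HasGh 0 (masterDensity D L₀) := by
  have h : L₀ ∈ 𝓚 := by
    refine adjoin_mono (Set.union_subset_union_right _ ?_) adm.invariant.1
    rintro x ⟨Φ, α, hΦ, rfl⟩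
    exact ⟨_, ⟨Φ, rfl, hΦ⟩, rfl⟩
  rw [masterDensity, sub_eq_add_neg]
  exact (hasGh_classical h).add (HasGh.neg (HasGh.sum fun Φ _ =>
    (hasGh_brstField D Φ).mul (hasGh_anti Φ) (by ring)))

lemma hasGh_brstVar (Z : 𝓥) : HasGh (Z.gh + 1) (brstVar D L₀ Z) := by
  cases Z with
  | fld Φ => exact hasGh_brstField D Φ
  | anti Φ =>
    exact HasGh.euler hasGh_master (.fld Φ) (by change 0 - Φ.gh = -Φ.gh - 1 + 1; ring)

lemma HasGh.brst {k : ℤ} (hx : HasGh k x) : HasGh (k + 1) (𝓢 x) := by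
  have h1 := ((isSDer_ghNumber (n := n) (ι := ι) (β := β) (φ := φ)).scomm (isSDer_brst (D := D) adm.even)
    (ζ := true) rfl).ext (isSDer_brst (D := D) adm.even) (fun z => by
      have h := (hasGh_brstVar (D := D) (L₀ := L₀) z.1).iterD z.2
      rw [← brst_gen] at h
      rw [scomm_apply, h, hasGh_gen, map_smul]
      push_cast
      rw [add_smul, one_smul]
      simp)
  have h2 := LinearMap.congr_fun h1 x
  rw [scomm_apply, hx, map_smul, Bool.false_and, sgn_false, one_smul, sub_eq_iff_eq_add] at h2
  unfold HasGh
  rw [h2]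
  push_cast
  rw [add_smul, one_smul, add_comm]

end GhostNumber

section FieldBrst

/-! ## The BRST transformation of functions of the classical fields -/

variable [adm : Admissible D L₀]

lemma brst_mem_fieldJets (hx : x ∈ 𝓤) :
    𝓢 x ∈ 𝓤 :=
  have h (Φ α) : 𝓢 (gen (.fld Φ, α)) ∈ 𝓤 := by
    rw [brst_gen]; exact iterD_mem_fieldJets α (brstField_mem_fieldJets Φ)
  (isSDer_brst adm.even).mem_jetAlg (fun p => h _ _) (by rintro ⟨_, α⟩ ⟨Φ, rfl⟩; exact h Φ α) hx

/-- The BRST transformation of a function of the classical fields in terms of its Lie derivatives. -/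
lemma brst_of_hasLie (hx : x ∈ 𝓚) {w v}
    (h : HasLie D L₀ x w v) : 𝓢 x = (∑ σ, xi σ * totalD σ x) + (∑ J, gh J * 𝓣 J x) +
      (∑ ρ, ∑ σ, dfld ρ (.xi σ) * w ρ σ) + ∑ ρ, ∑ J, dfld ρ (.C J) * v ρ J := by
  have hl : ∀ g γ, dL (gJet g γ) (𝓢 x) = 𝓠 g γ x := fun g γ =>
    (lie_eq (dL_gJet_ghostFree g γ (jetAlg_mono classicalJets_subset hx))).symm
  have ha : ∀ (Φ : 𝓕) γ, dL (.anti Φ, γ) (𝓢 x) = 0 := fun Φ γ =>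
    (isSDer_dL _).eq_zero_of_jetAlg (fun p => dL_gen_of_ne fun e => by cases e)
      (fun z hz => dL_gen_of_ne fun e => by subst e; obtain ⟨Ψ, h⟩ := hz; cases h)
      (brst_mem_fieldJets (jetAlg_mono (fun z hz => hz.imp fun _ h => h.1) hx))
  have hg : ghNumber n ι β φ (𝓢 x) = 𝓢 x := by
    simpa [HasGh] using (hasGh_classical hx).brst (adm := adm)
  rw [← hg]
  let F : 𝓗 × Option (Fin n) → 𝓙 := fun q => gJet q.1 (match q.2 with
    | none => 0 | some ρ => single ρ 1)
  have hF : Injective F := by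
    rintro ⟨g, o⟩ ⟨g', o'⟩ h
    have h1 : ghFld g = (ghFld g' : 𝓕) := by injection congrArg Prod.fst h
    have h2 := congrArg Prod.snd h
    obtain rfl := ghFld_injective h1
    rcases o with - | ρ <;> rcases o' with - | ρ' <;> simp [F, eq_comm, single_left_inj] at h2 ⊢
    exact h2
  rw [ghNumber, evol_eq_sum _ _ (Finset.univ.image F)]
  · rw [sum_image fun _ _ _ _ h => hF h, Fintype.sum_prod_type, Fintype.sum_sum_type]
    have h1 : ∀ q, (((F q).1.gh : ℤ) : ℝ) • (gen (F q) : 𝓐) = gen (F q) := fun ⟨g, _⟩ => by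
      rcases g with μ | I <;> exact (congrArg (· • _) Int.cast_one).trans (one_smul ℝ _)
    simp only [h1, Fintype.sum_option]
    simp only [F, hl, h.xi, h.gh, lie_xi_zero, lie_C_zero, sum_add_distrib]
    rw [sum_comm (s := (univ : Finset (Fin n))) (f := fun ρ σ => dfld ρ (.xi σ) * w ρ σ),
      sum_comm (s := (univ : Finset (Fin n))) (f := fun ρ J => dfld ρ (.C J) * v ρ J)]
    change _ + _ + (_ + _) = _
    simp only [add_assoc]
    congr 1
    rw [add_left_comm]
    rfl
  · intro z hz
    obtain ⟨Φ | Φ, γ⟩ := z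
    · by_cases hΦ : Φ.IsClassical
      · rw [show (Var.fld Φ).gh = 0 by cases Φ <;> first | rfl | exact hΦ.elim, Int.cast_zero,
          zero_smul, zero_mul]
      obtain ⟨g, rfl⟩ : ∃ g, Φ = ghFld g := by
        cases Φ <;> first | exact (hΦ trivial).elim | exact ⟨.inl _, rfl⟩ | exact ⟨.inr _, rfl⟩
      refine (congrArg (_ * ·) ((hl g γ).trans (h.high g γ ?_))).trans (mul_zero _)
      by_contra h3
      refine hz (Finset.mem_image.2 ?_)
      by_cases h4 : γ = 0
      · exact ⟨(g, none), mem_univ _, by rw [h4]⟩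
      · obtain ⟨ρ, rfl⟩ := (degree_eq_one_or_two_le h4).resolve_right h3
        exact ⟨(g, some ρ), mem_univ _, rfl⟩
    · rw [ha, mul_zero]

/-- The undifferentiated tensor fields without antifields. -/
lemma brst_classical_basic (hx : x ∈ 𝓚)
    (h : x ∈ basicAlg D L₀) : 𝓢 x = (∑ a, xiHat a * covD D a x) +
      ∑ I, ghHat I * 𝓣 I x := by
  rw [brst_of_hasLie hx (hasLie_of_mem_basicAlg h)]
  simp only [mul_zero, sum_const_zero, add_zero]
  have h1 : ∑ a, xiHat a * covD D a x = ∑ μ, xi μ * (totalD μ x - ∑ I, conn μ I * 𝓣 I x) := by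
    simp only [xiHat, sum_mul, mul_assoc]
    rw [sum_comm]
    simp only [← mul_sum, covD_eq, sum_vb_sum_invFrame]
  have h2 : ∑ I, ghHat I * 𝓣 I x = (∑ I, gh I * 𝓣 I x) +
      ∑ μ, xi μ * ∑ I, conn μ I * 𝓣 I x := by
    simp only [ghHat, add_mul, sum_add_distrib, sum_mul, mul_sum, mul_assoc]
    rw [sum_comm]
  rw [h1, h2]
  simp only [mul_sub, sum_sub_distrib]
  abel

end FieldBrst

section Core

/-! ## Elements whose derivatives lie in a given subalgebra -/

/-- The elements whose derivatives up to order `k` lie in `H`. -/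
def jetCore (H : Subalgebra ℝ 𝓐) : ℕ → Subalgebra ℝ 𝓐
  | 0 => H
  | k + 1 =>
    { carrier := {x | x ∈ jetCore H k ∧ ∀ μ, totalD μ x ∈ jetCore H k}
      add_mem' := fun hx hy => ⟨add_mem hx.1 hy.1, fun μ => by
        rw [map_add]; exact add_mem (hx.2 μ) (hy.2 μ)⟩
      mul_mem' := fun hx hy => ⟨mul_mem hx.1 hy.1, fun μ => by
        rw [totalD_mul]; exact add_mem (mul_mem (hx.2 μ) hy.1) (mul_mem hx.1 (hy.2 μ))⟩
      algebraMap_mem' := fun r => ⟨Subalgebra.algebraMap_mem _ r, fun μ => by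
        rw [algebraMap_eq_smul_one, map_smul, totalD_one, smul_zero]; exact zero_mem _⟩ }

lemma mem_jetCore_succ {H : Subalgebra ℝ 𝓐} {k : ℕ} :
    x ∈ jetCore H (k + 1) ↔ x ∈ jetCore H k ∧ ∀ μ, totalD μ x ∈ jetCore H k := Iff.rfl

lemma mem_jetCore {H : Subalgebra ℝ 𝓐} {k : ℕ} :
    x ∈ jetCore H k ↔ ∀ α : 𝓜, α.degree ≤ k → iterD α x ∈ H := by
  induction k generalizing x with
  | zero =>
    constructor
    · intro h α hα
      rw [(degree_eq_zero_iff α).1 (by omega), iterD_zero]; exact h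
    · intro h; have := h 0 (by simp); rwa [iterD_zero] at this
  | succ k ih =>
    rw [mem_jetCore_succ]
    constructor
    · rintro ⟨h1, h2⟩ α hα
      by_cases h0 : α = 0
      · subst h0; exact ih.1 h1 0 (by simp)
      · obtain ⟨μ, hμ⟩ : ∃ μ, α μ ≠ 0 := by
          by_contra hc; push Not at hc; exact h0 (ext hc)
        obtain ⟨α', rfl⟩ := exists_eq_add_single hμ
        rw [iterD_add_single, ← iterD_totalD]
        refine ih.1 (h2 μ) α' ?_
        simp at hα; omega
    · intro h
      refine ⟨ih.2 fun α hα => h α (by omega), fun μ => ih.2 fun α hα => ?_⟩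
      rw [iterD_totalD, ← iterD_add_single]
      exact h _ (by simp; omega)

lemma jetCore_mono {H H' : Subalgebra ℝ 𝓐} (h : H ≤ H') (k : ℕ) :
    jetCore H k ≤ jetCore H' k := fun _ hx => mem_jetCore.2 fun α hα => h (mem_jetCore.1 hx α hα)

end Core

section Generation

/-! ## Parity of the tensor fields -/

lemma isHom_conn (μ : Fin n) (I : 𝓘) : IsHom false (conn μ I : 𝓐) := by
  have h : ∀ μ ν ρ, IsHom false (anholonomy n ι β φ μ ν ρ) := fun μ ν ρ =>
    IsHom.sum fun a _ => IsHom.sum fun b _ => ((isHom_vb ρ b).mul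
      (((isHom_dfld μ (.e ν a)).sub (isHom_dfld ν (.e μ a))).smul _) rfl).smul _
  cases I with
  | inl i => exact isHom_fld (.A μ i)
  | inr p =>
    change IsHom false (spinConn μ p.1.1 p.1.2)
    rw [spinConn_eq]
    exact IsHom.sum fun ν _ => IsHom.sum fun ρ _ => ((isHom_frameFun _).mul ((isHom_frameFun _).mul
      (((h _ _ _).sub (h _ _ _)).add (h _ _ _)) rfl) rfl).smul _

lemma isHom_curv (μ ν : Fin n) (I : 𝓘) : IsHom false (curv D μ ν I) :=
  (((isHom_conn ν I).totalD μ).sub ((isHom_conn μ I).totalD ν)).add (IsHom.sum fun J _ =>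
    IsHom.sum fun K _ => ((isHom_conn μ J).mul (isHom_conn ν K) rfl).smul _)

lemma IsHom.covD {η : Bool} (hx : IsHom η x) (a : Fin n) : IsHom η (covD D a x) :=
  IsHom.sum fun μ _ => (isHom_frameFun _).mul ((hx.totalD μ).sub (IsHom.sum fun I _ =>
    (isHom_conn μ I).mul ((isSDer_gaugeAct I).isHom hx) (by simp))) (by simp)

lemma IsTensorSeed.isHom {t : 𝓐} (ht : IsTensorSeed D t) : ∃ η, IsHom η t := by
  cases ht with
  | matterB m => exact ⟨_, isHom_fld _⟩
  | matterF m => exact ⟨_, isHom_fld _⟩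
  | curvature a b I => exact ⟨false, IsHom.sum fun μ _ => IsHom.sum fun ν _ =>
      ((isHom_frameFun _).mul (isHom_frameFun _) rfl).mul (isHom_curv μ ν I) rfl⟩
  | antiB m => exact ⟨_, (isHom_frameFun _).mul (isHom_anti _) rfl⟩
  | antiF m => exact ⟨_, (isHom_frameFun _).mul (isHom_anti _) rfl⟩
  | antiC m => exact ⟨_, (isHom_frameFun _).mul (isHom_anti _) rfl⟩
  | antiE a b => exact ⟨true, (isHom_frameFun _).mul (IsHom.sum fun μ _ =>
      (isHom_vb μ b).mul (isHom_anti (.e μ a)) rfl) rfl⟩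
  | antiA i a => exact ⟨true, (isHom_frameFun _).mul (IsHom.sum fun μ _ =>
      (isHom_vb μ a).mul (isHom_anti (.A μ i)) rfl) rfl⟩
  | antiXi a => exact ⟨false, (isHom_frameFun _).mul (IsHom.sum fun μ _ => (isHom_frameFun _).mul
      ((isHom_anti (.xi μ)).sub (IsHom.sum fun I _ => (isHom_conn μ I).mul (isHom_anti (.C I)) rfl))
        rfl) rfl⟩

lemma IsTensor.isHom (h : IsTensor D x) : ∃ η, IsHom η x := by
  obtain ⟨l, t, ht, rfl⟩ := h
  obtain ⟨η, h⟩ := ht.isHom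
  refine ⟨η, ?_⟩
  induction l with
  | nil => exact h
  | cons a l ih => exact ih.covD a

lemma parity_mem_tensorSpan (hx : x ∈ tensorSpan D) : parity x ∈ tensorSpan D :=
  map_mem_of_span parity (fun x h => by
    obtain ⟨η, hη⟩ := h.isHom
    exact hη ▸ smul_mem _ _ (subset_span h)) hx

/-- The tensor fields without antifields. -/
def fieldTensors (D : GaugeData n ι β φ) : Submodule ℝ 𝓐 :=
  tensorSpan D ⊓ toSubmodule 𝓚

lemma covD_mem_fieldTensors (a : Fin n) (hx : x ∈ fieldTensors D) :
    covD D a x ∈ fieldTensors D := ⟨covD_mem_tensorSpan a hx.1, covD_mem_classical a hx.2⟩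

lemma gaugeAct_mem_fieldTensors (hD : D.IsLie) (I : 𝓘)
    (hx : x ∈ fieldTensors D) : 𝓣 I x ∈ fieldTensors D :=
  ⟨gaugeAct_mem_tensorSpan hD I hx.1, gaugeAct_mem_classical I hx.2⟩

lemma totalD_eq_covD (μ : Fin n) (x : 𝓐) :
    totalD μ x = (∑ a, vb μ a * covD D a x) + ∑ I, conn μ I * 𝓣 I x := by
  simp only [covD_eq, sum_vb_sum_invFrame]
  abel

lemma curvature_mem_fieldTensors (a b : Fin n) (I : 𝓘) :
    (∑ μ, ∑ ν, invFrame a μ * invFrame b ν * curv D μ ν I) ∈ fieldTensors D :=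
  ⟨(IsTensorSeed.curvature a b I).mem_tensorSpan, Subalgebra.sum_mem _ fun _ _ =>
    Subalgebra.sum_mem _ fun _ _ => Subalgebra.mul_mem _ (Subalgebra.mul_mem _
      (frameFun_mem_jetAlg _ _) (frameFun_mem_jetAlg _ _)) (curv_mem_classical _ _ _)⟩

lemma curv_eq (μ ν : Fin n) (I : 𝓘) : curv D μ ν I = ∑ a, vb μ a * ∑ b, vb ν b *
    ∑ κ, ∑ τ, invFrame a κ * invFrame b τ * curv D κ τ I := by
  have h : ∀ a b, (∑ κ, ∑ τ, invFrame a κ * invFrame b τ * curv D κ τ I) =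
      ∑ τ, invFrame b τ * ∑ κ, invFrame a κ * curv D κ τ I := fun a b => by
    rw [sum_comm]
    refine sum_ext fun τ _ => ?_
    rw [mul_sum]
    refine sum_ext fun κ _ => ?_
    rw [frameFun_comm (invFrameFun a κ), mul_assoc]
  simp only [h, sum_vb_sum_invFrame]

/-! ## Generators adapted to the BRST differential -/

/-- The local functions of the fields which pair with the differentiated ghosts. -/
def potential : 𝓗 → 𝓜 → 𝓐
  | .inl ρ, γ => if h : 2 ≤ γ.degree ∧ ∃ ν, γ ν ≠ 0 then
      ∑ a, invFrame a ρ * iterD (γ - single h.2.choose 1) (vb h.2.choose a) else 0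
  | .inr I, γ => if h : ∃ ν, γ ν ≠ 0 then
      iterD (γ - single h.choose 1) (conn h.choose I) else 0

lemma exists_ne_zero {γ : 𝓜} (h : γ ≠ 0) : ∃ ν, γ ν ≠ 0 := by
  by_contra hc; push Not at hc; exact h (ext hc)

lemma potential_xi {γ : 𝓜} (h : 2 ≤ γ.degree) : ∃ ν γ', γ = γ' + single ν 1 ∧
    ∀ ρ, (potential (.inl ρ) γ : 𝓐) = ∑ a, invFrame a ρ * iterD γ' (vb ν a) := by
  have h2 : 2 ≤ γ.degree ∧ ∃ ν, γ ν ≠ 0 := ⟨h, exists_ne_zero (ne_zero_of_two_le h)⟩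
  refine ⟨h2.2.choose, γ - single h2.2.choose 1, ?_, fun ρ => ?_⟩
  · refine (tsub_add_cancel_of_le ?_).symm
    exact Finsupp.single_le_iff.2 (Nat.one_le_iff_ne_zero.2 h2.2.choose_spec)
  · rw [potential, dif_pos h2]

lemma potential_gh {γ : 𝓜} (h : γ ≠ 0) : ∃ ν γ', γ = γ' + single ν 1 ∧
    ∀ I, (potential (.inr I) γ : 𝓐) = iterD γ' (conn ν I) := by
  have h2 := exists_ne_zero h
  refine ⟨h2.choose, γ - single h2.choose 1, ?_, fun ρ => ?_⟩
  · refine (tsub_add_cancel_of_le ?_).symm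
    exact Finsupp.single_le_iff.2 (Nat.one_le_iff_ne_zero.2 h2.choose_spec)
  · rw [potential, dif_pos h2]

lemma potential_xi_low (ρ : Fin n) {γ : 𝓜} (h : ¬ 2 ≤ γ.degree) :
    (potential (.inl ρ) γ : 𝓐) = 0 := by
  rw [potential, dif_neg fun h2 => h h2.1]

lemma potential_gh_zero (I : 𝓘) : (potential (.inr I) 0 : 𝓐) = 0 := by
  rw [potential, dif_neg (by simp)]

lemma isHom_potential (g : 𝓗) (γ : 𝓜) : IsHom false (potential g γ : 𝓐) := by
  cases g with
  | inl ρ =>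
    by_cases h : 2 ≤ γ.degree
    · obtain ⟨ν, γ', -, h⟩ := potential_xi (ι := ι) (β := β) (φ := φ) h
      rw [h]
      exact IsHom.sum fun a _ => (isHom_frameFun _).mul ((isHom_vb ν a).iterD _) rfl
    · rw [potential_xi_low ρ h]; exact isHom_zero _
  | inr I =>
    by_cases h : γ = 0
    · rw [h, potential_gh_zero]; exact isHom_zero _
    · obtain ⟨ν, γ', -, h⟩ := potential_gh (ι := ι) (β := β) (φ := φ) h
      rw [h]; exact (isHom_conn ν I).iterD _

variable (D L₀) in
/-- The set of generators: functions of the vielbein, `s e`, the potentials and their BRST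
transformations, and the elements of `tensorAlg`. -/
def adaptedGen : Set 𝓐 :=
  Set.range frameFun ∪ Set.range (fun p : Fin n × Fin n => 𝓢 (vb p.1 p.2)) ∪
    (Set.range (fun c : 𝓗 × 𝓜 => potential c.1 c.2) ∪
    Set.range (fun c : 𝓗 × 𝓜 => 𝓢 (potential c.1 c.2)) ∪ tensorAlg D)

variable (D L₀) in
/-- The algebra generated by `adaptedGen`. -/
def adaptedAlg : Subalgebra ℝ 𝓐 := adjoin ℝ (adaptedGen D L₀)

lemma frameFun_mem_adapted (f : 𝓒) : frameFun f ∈ adaptedAlg D L₀ :=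
  subset_adjoin (Or.inl (Or.inl ⟨f, rfl⟩))

lemma brst_vb_mem_adapted (μ a : Fin n) : 𝓢 (vb μ a) ∈ adaptedAlg D L₀ :=
  subset_adjoin (Or.inl (Or.inr ⟨(μ, a), rfl⟩))

lemma potential_mem_adapted (g : 𝓗) (γ : 𝓜) : potential g γ ∈ adaptedAlg D L₀ :=
  subset_adjoin (Or.inr (Or.inl (Or.inl ⟨(g, γ), rfl⟩)))

lemma brst_potential_mem_adapted (g : 𝓗) (γ : 𝓜) :
    𝓢 (potential g γ) ∈ adaptedAlg D L₀ :=
  subset_adjoin (Or.inr (Or.inl (Or.inr ⟨(g, γ), rfl⟩)))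

lemma tensorAlg_le_adapted : tensorAlg D ≤ adaptedAlg D L₀ :=
  fun _ h => subset_adjoin (Or.inr (Or.inr h))

variable [adm : Admissible D L₀]

variable (D L₀) in
/-- The elements of `adaptedAlg` with BRST transformation in `adaptedAlg`. -/
def closedAlg : Subalgebra ℝ 𝓐 where
  carrier := {x | x ∈ adaptedAlg D L₀ ∧ parity x ∈ adaptedAlg D L₀ ∧ 𝓢 x ∈ adaptedAlg D L₀}
  add_mem' hx hy := ⟨add_mem hx.1 hy.1, by rw [map_add]; exact add_mem hx.2.1 hy.2.1,
    by rw [map_add]; exact add_mem hx.2.2 hy.2.2⟩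
  mul_mem' hx hy := ⟨mul_mem hx.1 hy.1, by rw [parity_mul]; exact mul_mem hx.2.1 hy.2.1,
    by rw [(isSDer_brst adm.even).mul]; exact add_mem (mul_mem hx.2.2 hy.1) (mul_mem hx.2.1 hy.2.2)⟩
  algebraMap_mem' r := by
    rw [algebraMap_eq_smul_one]
    refine ⟨Subalgebra.smul_mem _ (one_mem _) _, ?_, ?_⟩
    · rw [map_smul, parity_one]; exact Subalgebra.smul_mem _ (one_mem _) _
    · rw [map_smul, (isSDer_brst adm.even).map_one, smul_zero]; exact zero_mem _

lemma closedAlg_le : closedAlg D L₀ ≤ adaptedAlg D L₀ := fun _ h => h.1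

lemma frameFun_mem_closed (f : 𝓒) : frameFun f ∈ closedAlg D L₀ :=
  ⟨frameFun_mem_adapted f, by rw [parity_frameFun]; exact frameFun_mem_adapted f, by
    rw [(isSDer_brst adm.even).frame]
    exact sum_mem fun p _ => mul_mem (brst_vb_mem_adapted p.1 p.2) (frameFun_mem_adapted _)⟩

lemma potential_mem_closed (g : 𝓗) (γ : 𝓜) : potential g γ ∈ closedAlg D L₀ :=
  ⟨potential_mem_adapted g γ, by
    rw [isHom_potential g γ]; exact Subalgebra.smul_mem _ (potential_mem_adapted g γ) _,
    brst_potential_mem_adapted g γ⟩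

lemma fieldTensors_mem_closed (hx : x ∈ fieldTensors D) : x ∈ closedAlg D L₀ := by
  refine ⟨tensorAlg_le_adapted (tensorSpan_le hx.1), tensorAlg_le_adapted (tensorSpan_le
    (parity_mem_tensorSpan hx.1)), tensorAlg_le_adapted ?_⟩
  rw [brst_classical_basic hx.2 (tensorAlg_le_basicAlg D L₀ (tensorSpan_le hx.1))]
  exact add_mem (sum_mem fun a _ => mul_mem (xiHat_mem a) (tensorSpan_le (covD_mem_tensorSpan a hx.1)))
    (sum_mem fun I _ => mul_mem (ghHat_mem I) (tensorSpan_le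
      (gaugeAct_mem_tensorSpan adm.isLie I hx.1)))

lemma curv_mem_of {H : Subalgebra ℝ 𝓐} (he : ∀ μ a, vb μ a ∈ H)
    (hT : ∀ x ∈ fieldTensors D, x ∈ H) (μ ν : Fin n) (I : 𝓘) : curv D μ ν I ∈ H := by
  rw [curv_eq]
  exact sum_mem fun a _ => mul_mem (he _ _) (sum_mem fun b _ => mul_mem (he _ _)
    (hT _ (curvature_mem_fieldTensors a b I)))

lemma classical_mem_jetCore (k : ℕ) : (∀ f, frameFun f ∈ jetCore (closedAlg D L₀) k) ∧
    (∀ μ I, conn μ I ∈ jetCore (closedAlg D L₀) k) ∧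
    ∀ x ∈ fieldTensors D, x ∈ jetCore (closedAlg D L₀) k := by
  induction k with
  | zero =>
    refine ⟨frameFun_mem_closed, fun μ I => ?_, fun x hx => fieldTensors_mem_closed hx⟩
    obtain ⟨ν, γ', h1, h2⟩ := potential_gh (n := n) (ι := ι) (β := β) (φ := φ)
      (γ := single μ 1) (by simp)
    have h3 : γ' = 0 := by
      have := congrArg degree h1
      simp at this
      exact (degree_eq_zero_iff _).1 this
    subst h3
    rw [zero_add, single_left_inj one_ne_zero] at h1
    subst h1
    have := potential_mem_closed (D := D) (L₀ := L₀) (.inr I) (single μ 1)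
    rwa [h2, iterD_zero] at this
  | succ k ih =>
    obtain ⟨hf, hc, hT⟩ := ih
    have he : ∀ μ a, vb μ a ∈ jetCore (closedAlg D L₀) k := fun μ a => by rw [vb_eq]; exact hf _
    have hf0 : ∀ f, frameFun f ∈ closedAlg D L₀ := frameFun_mem_closed
    have key : ∀ (x : Fin n → 𝓐), (∀ ν, x ν ∈ jetCore (closedAlg D L₀) k) →
        (∀ μ ν, totalD μ (x ν) - totalD ν (x μ) ∈ jetCore (closedAlg D L₀) k) →
        (∀ γ : 𝓜, 2 ≤ γ.degree → ∃ ν γ', γ = γ' + single ν 1 ∧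
          iterD γ' (x ν) ∈ closedAlg D L₀) → ∀ ν, x ν ∈ jetCore (closedAlg D L₀) (k + 1) := fun x h1 h2 h3 ν => by
      refine mem_jetCore.2 fun α hα => ?_
      rcases Nat.lt_or_ge k α.degree with h4 | h4
      · obtain ⟨ν0, γ', h5, h6⟩ := h3 (α + single ν 1) (by simp; omega)
        by_cases h7 : ν0 = ν
        · subst h7; rwa [← add_right_cancel h5] at h6
        · have h8 : α ν0 ≠ 0 := by
            have := DFunLike.congr_fun h5 ν0
            simp [Ne.symm h7] at this
            omega
          obtain ⟨α', rfl⟩ := exists_eq_add_single h8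
          have h9 : γ' = α' + single ν 1 := by
            rw [add_right_comm] at h5
            exact (add_right_cancel h5).symm
          subst h9
          rw [iterD_add_single, ← iterD_totalD] at h6 ⊢
          have h10 : totalD ν0 (x ν) = totalD ν (x ν0) + (totalD ν0 (x ν) - totalD ν (x ν0)) := by
            abel
          rw [h10, map_add]
          refine add_mem h6 (mem_jetCore.1 (h2 ν0 ν) α' ?_)
          simp at hα; omega
      · exact mem_jetCore.1 (h1 ν) α h4
    have he' : ∀ ν a, vb ν a ∈ jetCore (closedAlg D L₀) (k + 1) := fun ν a => by
      refine key (fun ν => vb ν a) (fun ν => he ν a) (fun μ ν => ?_) (fun γ hγ => ?_) ν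
      · have hv : ∀ μ ν, connVb D μ ν a ∈ jetCore (closedAlg D L₀) k := fun μ ν =>
          sum_mem fun p _ => sum_mem fun b _ => Subalgebra.smul_mem _ (mul_mem (hc _ _) (he _ _)) _
        rw [totalD_fld, totalD_fld, torsion adm.isLie]
        exact sub_mem (hv _ _) (hv _ _)
      · obtain ⟨ν, γ', h1, h2⟩ := potential_xi (n := n) (ι := ι) (β := β) (φ := φ) hγ
        refine ⟨ν, γ', h1, ?_⟩
        have h3 : (iterD γ' (vb ν a) : 𝓐) = ∑ ρ, vb ρ a * potential (.inl ρ) γ := by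
          simp only [h2, mul_sum]
          rw [sum_comm]
          have h4 : ∀ b ρ, (vb ρ a * (invFrame b ρ * iterD γ' (vb ν b)) : 𝓐) =
              invFrame b ρ * vb ρ a * iterD γ' (vb ν b) := fun b ρ => by
            rw [← mul_assoc, vb_comm]
          simp only [h4, ← sum_mul, sum_invFrame_vb]
          simp
        rw [h3]
        exact sum_mem fun ρ _ => mul_mem (by rw [vb_eq]; exact hf0 _) (potential_mem_closed _ _)
    refine ⟨fun f => mem_jetCore_succ.2 ⟨hf f, fun μ => ?_⟩, fun μ I => ?_,
      fun x hx => mem_jetCore_succ.2 ⟨hT x hx, fun μ => ?_⟩⟩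
    · rw [(isSDer_totalD μ).frame]
      exact sum_mem fun p _ => mul_mem ((mem_jetCore_succ.1 (he' p.1 p.2)).2 μ) (hf _)
    · refine key (fun μ => conn μ I) (fun μ => hc μ I) (fun μ ν => ?_) (fun γ hγ => ?_) μ
      · have h1 : totalD μ (conn ν I) - totalD ν (conn μ I) = curv D μ ν I -
            ∑ J, ∑ K, D.f J K I • (conn μ J * conn ν K) := by unfold curv; abel
        rw [h1]
        exact sub_mem (curv_mem_of he hT μ ν I) (sum_mem fun J _ => sum_mem fun K _ =>
          Subalgebra.smul_mem _ (mul_mem (hc _ _) (hc _ _)) _)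
      · obtain ⟨ν, γ', h1, h2⟩ := potential_gh (n := n) (ι := ι) (β := β) (φ := φ)
          (ne_zero_of_two_le hγ)
        exact ⟨ν, γ', h1, by rw [← h2]; exact potential_mem_closed _ _⟩
    · rw [totalD_eq_covD (D := D)]
      exact add_mem (sum_mem fun a _ => mul_mem (he _ _) (hT _ (covD_mem_fieldTensors a hx)))
        (sum_mem fun I _ => mul_mem (hc _ _) (hT _ (gaugeAct_mem_fieldTensors adm.isLie I hx)))

lemma vb_mem_jetCore (k : ℕ) (μ a : Fin n) : vb μ a ∈ jetCore (closedAlg D L₀) k := by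
  rw [vb_eq]; exact (classical_mem_jetCore k).1 _

lemma brst_mem_jetCore {k : ℕ} (hx : x ∈ jetCore (closedAlg D L₀) k) :
    𝓢 x ∈ jetCore (adaptedAlg D L₀) k := mem_jetCore.2 fun α hα => by
  rw [← iterD_comm_of_comm (brst_totalD adm.even)]
  exact (mem_jetCore.1 hx α hα).2.2

lemma xi_eq (μ : Fin n) : (xi μ : 𝓐) = ∑ a, xiHat a * invFrame a μ := by
  simp only [xiHat, sum_mul, mul_assoc]
  rw [sum_comm]
  simp only [← mul_sum, sum_vb_invFrame]
  simp

lemma gh_eq (I : 𝓘) : (gh I : 𝓐) = ghHat I - ∑ μ, xi μ * conn μ I := by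
  rw [ghHat]; abel

lemma ghosts_mem_jetCore (k : ℕ) : (∀ μ, xi μ ∈ jetCore (adaptedAlg D L₀) k) ∧
    ∀ I, gh I ∈ jetCore (adaptedAlg D L₀) k := by
  have hle := jetCore_mono (closedAlg_le (D := D) (L₀ := L₀))
  induction k with
  | zero =>
    have h1 : ∀ μ, xi μ ∈ adaptedAlg D L₀ := fun μ => by
      rw [xi_eq]
      exact sum_mem fun a _ => mul_mem (tensorAlg_le_adapted (xiHat_mem a)) (frameFun_mem_adapted _)
    refine ⟨h1, fun I => ?_⟩
    rw [gh_eq]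
    exact sub_mem (tensorAlg_le_adapted (ghHat_mem I)) (sum_mem fun μ _ => mul_mem (h1 μ)
      (hle 0 ((classical_mem_jetCore 0).2.1 μ I)))
  | succ k ih =>
    obtain ⟨hx, hC⟩ := ih
    have hv := fun μ a => hle k (vb_mem_jetCore k μ a)
    have hc := fun μ I => hle k ((classical_mem_jetCore (D := D) (L₀ := L₀) k).2.1 μ I)
    have hdx : ∀ μ ρ, dfld μ (.xi ρ) ∈ jetCore (adaptedAlg D L₀) k := fun μ ρ => by
      have h1 : dfld μ (.xi ρ) = ∑ a, (𝓢 (vb μ a) - (∑ ν, xi ν * dfld ν (.e μ a)) -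
          ∑ I, ∑ b, D.vec I a b • (gh I * vb μ b)) * invFrame a ρ := by
        have h2 : ∀ a, 𝓢 (vb μ a) - (∑ ν, xi ν * dfld ν (.e μ a)) -
          (∑ I, ∑ b, D.vec I a b • (gh I * vb μ b)) = ∑ ν, dfld μ (.xi ν) * vb ν a := fun a => by
          rw [brst_fld]
          unfold brstField
          dsimp only
          abel
        simp only [h2, sum_mul, mul_assoc]
        rw [sum_comm]
        simp only [← mul_sum, sum_vb_invFrame]
        simp
      rw [h1]
      refine sum_mem fun a _ => mul_mem (sub_mem (sub_mem (brst_mem_jetCore (vb_mem_jetCore k μ a))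
        (sum_mem fun ν _ => mul_mem (hx ν) ?_)) (sum_mem fun I _ => sum_mem fun b _ =>
          Subalgebra.smul_mem _ (mul_mem (hC I) (hv _ _)) _)) (hle k ((classical_mem_jetCore k).1 _))
      rw [← totalD_fld]
      exact (mem_jetCore_succ.1 (hle (k + 1) (vb_mem_jetCore (k + 1) μ a))).2 ν
    refine ⟨fun μ => mem_jetCore_succ.2 ⟨hx μ, fun ν => by rw [totalD_fld]; exact hdx ν μ⟩,
      fun I => mem_jetCore_succ.2 ⟨hC I, fun μ => ?_⟩⟩
    have h1 := brst_of_hasLie (L₀ := L₀) (conn_mem_classical μ I) (hasLie_conn (D := D) μ I)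
    have h2 : totalD μ (gh I) = 𝓢 (conn μ I) - (∑ σ, xi σ * totalD σ (conn μ I)) -
        (∑ J, gh J * 𝓣 J (conn μ I)) - ∑ σ, dfld μ (.xi σ) * conn σ I := by
      rw [h1, totalD_fld]
      simp only [mul_ite, mul_zero, mul_one, sum_ite_irrel, sum_const_zero,
        sum_ite_eq', mem_univ, if_true]
      abel
    rw [h2]
    refine sub_mem (sub_mem (sub_mem (brst_mem_jetCore ((classical_mem_jetCore k).2.1 μ I))
      (sum_mem fun σ _ => mul_mem (hx σ) ?_)) (sum_mem fun J _ => mul_mem (hC J) ?_))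
      (sum_mem fun σ _ => mul_mem (hdx μ σ) (hc σ I))
    · exact (mem_jetCore_succ.1 (hle (k + 1) ((classical_mem_jetCore (k + 1)).2.1 μ I))).2 σ
    · rw [gaugeAct_conn adm.isLie]
      exact neg_mem (sum_mem fun K _ => Subalgebra.smul_mem _ (hc _ _) _)

lemma tensors_mem_jetCore (k : ℕ) : ∀ x ∈ tensorSpan D, x ∈ jetCore (adaptedAlg D L₀) k := by
  have hle := jetCore_mono (closedAlg_le (D := D) (L₀ := L₀))
  induction k with
  | zero => exact fun x hx => tensorAlg_le_adapted (tensorSpan_le hx)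
  | succ k ih =>
    refine fun x hx => mem_jetCore_succ.2 ⟨ih x hx, fun μ => ?_⟩
    rw [totalD_eq_covD (D := D)]
    exact add_mem (sum_mem fun a _ => mul_mem (hle k (vb_mem_jetCore k μ a))
        (ih _ (covD_mem_tensorSpan a hx)))
      (sum_mem fun I _ => mul_mem (hle k ((classical_mem_jetCore k).2.1 μ I))
        (ih _ (gaugeAct_mem_tensorSpan adm.isLie I hx)))

lemma detFun_mul_invDet (x : 𝓐) : frameFun (detFun n) * (invDet * x) = x := by
  rw [← mul_assoc, ← map_mul, mul_comm (detFun n), invDetFun_mul, map_one, one_mul]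

lemma fld_mem_jetCore (k : ℕ) (Φ : 𝓕) : fld Φ ∈ jetCore (adaptedAlg D L₀) k := by
  have hle := jetCore_mono (closedAlg_le (D := D) (L₀ := L₀)) k
  cases Φ with
  | e μ a => exact hle (vb_mem_jetCore k μ a)
  | A μ i => exact hle ((classical_mem_jetCore k).2.1 μ (.inl i))
  | yB m => exact tensors_mem_jetCore k _ (IsTensorSeed.matterB m).mem_tensorSpan
  | yF m => exact tensors_mem_jetCore k _ (IsTensorSeed.matterF m).mem_tensorSpan
  | xi μ => exact (ghosts_mem_jetCore k).1 μ
  | C I => exact (ghosts_mem_jetCore k).2 I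

lemma anti_mem_jetCore (k : ℕ) (Φ : 𝓕) : anti Φ ∈ jetCore (adaptedAlg D L₀) k := by
  have hle := jetCore_mono (closedAlg_le (D := D) (L₀ := L₀)) k
  have hf := fun f => hle ((classical_mem_jetCore (D := D) (L₀ := L₀) k).1 f)
  have hs : ∀ {x : 𝓐}, IsTensorSeed D (invDet * x) →
      x ∈ jetCore (adaptedAlg D L₀) k := fun {x} h => by
    rw [← detFun_mul_invDet x]
    exact mul_mem (hf _) (tensors_mem_jetCore k _ h.mem_tensorSpan)
  have hC : ∀ I, anti (.C I) ∈ jetCore (adaptedAlg D L₀) k := fun I => hs (.antiC I)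
  have hlow : ∀ (x : Fin n → 𝓐),
      (∀ a, ∑ μ, vb μ a * x μ ∈ jetCore (adaptedAlg D L₀) k) → ∀ μ, x μ ∈ jetCore (adaptedAlg D L₀) k := fun x hx μ => by
    have : x μ = ∑ a, invFrame a μ * ∑ ν, vb ν a * x ν := by
      simp only [mul_sum]
      rw [sum_comm]
      have h4 : ∀ b ρ, (invFrame b μ * (vb ρ b * x ρ) : 𝓐) =
          vb ρ b * invFrame b μ * x ρ := fun b ρ => by
        rw [← mul_assoc, vb_comm]
      simp only [h4, ← sum_mul, sum_vb_invFrame]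
      simp
    rw [this]
    exact sum_mem fun a _ => mul_mem (hf _) (hx a)
  cases Φ with
  | e μ a => exact hlow (fun μ => anti (.e μ a)) (fun b => hs (.antiE a b)) μ
  | A μ i => exact hlow (fun μ => anti (.A μ i)) (fun b => hs (.antiA i b)) μ
  | yB m => exact hs (.antiB m)
  | yF m => exact hs (.antiF m)
  | xi μ =>
    have h1 : anti (.xi μ) = (∑ a, vb μ a * ∑ ν, invFrame a ν * (anti (.xi ν) -
        ∑ I, conn ν I * anti (.C I))) + ∑ I, conn μ I * (anti (.C I) : 𝓐) := by
      rw [sum_vb_sum_invFrame (fun ν => anti (.xi ν) - ∑ I, conn ν I * anti (.C I))]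
      abel
    rw [h1]
    exact add_mem (sum_mem fun a _ => mul_mem (hle (vb_mem_jetCore k μ a)) (hs (.antiXi a)))
      (sum_mem fun I _ => mul_mem (hle ((classical_mem_jetCore k).2.1 μ I)) (hC I))
  | C I => exact hC I

variable (D L₀) in
lemma adaptedAlg_eq_top : adaptedAlg D L₀ = ⊤ := by
  refine eq_top_iff.2 fun x _ => ?_
  induction x using LocalFun.induction with
  | hf f => exact frameFun_mem_adapted f
  | hadd x y hx hy => exact add_mem (hx trivial) (hy trivial)
  | hg z x hx =>
    refine mul_mem ?_ (hx trivial)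
    obtain ⟨Z, α⟩ := z
    have h : ∀ Z : 𝓥, ∀ k, gen (Z, 0) ∈ jetCore (adaptedAlg D L₀) k := fun Z k => by
      cases Z with
      | fld Φ => exact fld_mem_jetCore k Φ
      | anti Φ => exact anti_mem_jetCore k Φ
    have := mem_jetCore.1 (h Z α.degree) α le_rfl
    rwa [iterD_gen, zero_add] at this

end Generation

section Homotopy

/-! ## The contracting homotopy for the differentiated ghosts -/

/-- Weight of a ghost jet coordinate. -/
def ghWt (c : 𝓗 × 𝓜) : ℕ := match c.1 with
  | .inl _ => 2 * c.2.degree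
  | .inr _ => 2 * c.2.degree + 1

variable (D L₀) in
/-- The values of the homotopy on the ghost jet coordinates. -/
def homotopyCoeff (c : 𝓗 × 𝓜) : 𝓐 :=
  potential c.1 c.2 - ∑ᶠ c' : 𝓗 × 𝓜, if _ : ghWt c' < ghWt c then
    homotopyCoeff c' * 𝓠 c'.1 c'.2 (potential c.1 c.2) else 0
termination_by ghWt c

lemma potential_mem_ghostFree (g : 𝓗) (γ : 𝓜) :
    (potential g γ : 𝓐) ∈ 𝓖 := by
  cases g with
  | inl ρ =>
    by_cases h : 2 ≤ γ.degree
    · obtain ⟨ν, γ', -, h⟩ := potential_xi (ι := ι) (β := β) (φ := φ) h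
      rw [h]
      exact sum_mem fun a _ => mul_mem (invFrame_mem_ghostFree _ _)
        (iterD_mem_ghostFree _ (fld_mem_ghostFree (by trivial) _))
    · rw [potential_xi_low ρ h]; exact zero_mem _
  | inr I =>
    by_cases h : γ = 0
    · rw [h, potential_gh_zero]; exact zero_mem _
    · obtain ⟨ν, γ', -, h⟩ := potential_gh (ι := ι) (β := β) (φ := φ) h
      rw [h]; exact iterD_mem_ghostFree _ (conn_mem_ghostFree _ _)

lemma homotopyCoeff_of_potential_eq_zero {c : 𝓗 × 𝓜}
    (h : (potential c.1 c.2 : 𝓐) = 0) : homotopyCoeff D L₀ c = 0 := by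
  rw [homotopyCoeff, h]
  simp

lemma homotopyCoeff_xi_low (ρ : Fin n) {γ : 𝓜} (h : ¬ 2 ≤ γ.degree) :
    homotopyCoeff D L₀ (.inl ρ, γ) = 0 := homotopyCoeff_of_potential_eq_zero (potential_xi_low ρ h)

lemma homotopyCoeff_zero (g : 𝓗) : homotopyCoeff D L₀ (g, 0) = 0 := by
  cases g with
  | inl ρ => exact homotopyCoeff_xi_low ρ (by simp)
  | inr I => exact homotopyCoeff_of_potential_eq_zero (potential_gh_zero I)

variable (D L₀) in
/-- The contracting homotopy. -/
def ghHomotopy : 𝓛 := evol fun z => match z with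
  | (.fld (.xi σ), γ) => homotopyCoeff D L₀ (.inl σ, γ)
  | (.fld (.C J), γ) => homotopyCoeff D L₀ (.inr J, γ)
  | _ => 0

lemma ghHomotopy_apply (x : 𝓐) : ghHomotopy D L₀ x =
    ∑ᶠ c : 𝓗 × 𝓜, homotopyCoeff D L₀ c * dL (gJet c.1 c.2) x := by
  let F : 𝓗 × 𝓜 → 𝓙 := fun c => gJet c.1 c.2
  have hF : Injective F := by
    rintro ⟨g, γ⟩ ⟨g', γ'⟩ h
    have h1 : ghFld g = (ghFld g' : 𝓕) := by injection congrArg Prod.fst h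
    have h2 := congrArg Prod.snd h
    obtain rfl := ghFld_injective h1
    exact Prod.ext rfl h2
  rw [ghHomotopy, evol_apply]
  set Q : 𝓙 → 𝓐 := fun z => match z with
    | (.fld (.xi σ), γ) => homotopyCoeff D L₀ (.inl σ, γ)
    | (.fld (.C J), γ) => homotopyCoeff D L₀ (.inr J, γ)
    | _ => 0 with hQ
  have h1 : ∀ c, homotopyCoeff D L₀ c * dL (gJet c.1 c.2) x = Q (F c) * dL (F c) x := by
    rintro ⟨g | g, γ⟩ <;> rfl
  rw [finsum_congr h1, ← finsum_mem_range (f := fun z => Q z * dL z x) hF, finsum_mem_def]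
  refine finsum_congr fun z => ?_
  by_cases hz : z ∈ Set.range F
  · rw [Set.indicator_of_mem hz]
  · rw [Set.indicator_of_notMem hz]
    have : Q z = 0 := by
      obtain ⟨Z, γ⟩ := z
      cases Z with
      | anti Φ => rfl
      | fld Φ =>
        cases Φ with
        | xi σ => exact (hz ⟨(.inl σ, γ), rfl⟩).elim
        | C σ => exact (hz ⟨(.inr σ, γ), rfl⟩).elim
        | _ => rfl
    exact (mul_eq_zero_of_left this _).symm ▸ rfl

variable [adm : Admissible D L₀]

lemma isHom_homotopyCoeff (c : 𝓗 × 𝓜) : IsHom false (homotopyCoeff D L₀ c) := by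
  induction h : ghWt c using Nat.strong_induction_on generalizing c with
  | _ k ih =>
    subst h
    rw [homotopyCoeff]
    refine (isHom_potential _ _).sub (finsum_induction (IsHom false) (isHom_zero _)
      (fun _ _ h h' => h.add h') fun c' => ?_)
    split_ifs with h
    · exact (ih _ h c' rfl).mul ((isSDer_lie _ _).isHom (isHom_potential _ _)) rfl
    · exact isHom_zero _

lemma isSDer_ghHomotopy : IsSDer true (ghHomotopy D L₀) := isSDer_evol fun z => by
  obtain ⟨Z, γ⟩ := z
  cases Z with
  | anti Φ => exact isHom_zero _
  | fld Φ =>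
    cases Φ with
    | xi σ => exact isHom_homotopyCoeff _
    | C σ => exact isHom_homotopyCoeff _
    | _ => exact isHom_zero _

lemma lie_iterD_high {g : 𝓗} {k : ℕ}
    (hx : ∀ δ : 𝓜, k < δ.degree → 𝓠 g δ x = 0) (α γ : 𝓜)
    (h : α.degree + k < γ.degree) : 𝓠 g γ (iterD α x) = 0 := by
  induction α using multiIndex_induction generalizing γ with
  | h0 => rw [iterD_zero]; exact hx γ (by simpa using h)
  | h1 α μ ih =>
    have h2 : α.degree + k + 1 < γ.degree := by simp at h; omega
    rw [iterD_add_single, lie_totalD, ih γ (by omega), map_zero, zero_add]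
    split_ifs with h1
    · rfl
    · obtain ⟨γ', rfl⟩ := exists_eq_add_single h1
      rw [add_tsub_cancel_right]
      exact ih γ' (by simp at h2; omega)

lemma lie_iterD_top {g : 𝓗} {k : ℕ}
    (hx : ∀ δ : 𝓜, k < δ.degree → 𝓠 g δ x = 0) (α γ : 𝓜)
    (h : γ.degree = α.degree + k) : 𝓠 g γ (iterD α x) =
      if α ≤ γ then 𝓠 g (γ - α) x else 0 := by
  induction α using multiIndex_induction generalizing γ with
  | h0 => rw [iterD_zero]; simp
  | h1 α μ ih =>
    have h2 : γ.degree = α.degree + k + 1 := by simp at h; omega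
    rw [iterD_add_single, lie_totalD, lie_iterD_high hx α γ (by omega), map_zero, zero_add]
    by_cases h1 : γ μ = 0
    · rw [if_pos h1, if_neg]
      intro h3
      have := h3 μ
      simp [h1] at this
    · rw [if_neg h1]
      obtain ⟨γ', rfl⟩ := exists_eq_add_single h1
      rw [add_tsub_cancel_right, ih γ' (by simp at h2; omega)]
      simp only [add_le_add_iff_right, add_tsub_add_eq_tsub_right]

lemma eq_add_single_of_sub {γ γ' : 𝓜} {ν : Fin n} (h : γ' ≤ γ)
    (h2 : γ - γ' = single ν 1) : γ = γ' + single ν 1 := by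
  rw [← h2, add_tsub_cancel_of_le h]

lemma lie_potential_xi (ρ : Fin n) {γ γ' : 𝓜} (h : 2 ≤ γ.degree)
    (h2 : γ.degree ≤ γ'.degree) (g : 𝓗) :
    𝓠 g γ' (potential (.inl ρ) γ) = if (g, γ') = (.inl ρ, γ) then 1 else 0 := by
  obtain ⟨ν, γ0, h3, h4⟩ := potential_xi (ι := ι) (β := β) (φ := φ) h
  have hd : γ.degree = γ0.degree + 1 := by rw [h3]; simp
  simp only [h4, map_sum, lie_mul, lie_frameFun_high _ g γ' (h.trans h2), zero_mul, zero_add]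
  rcases g with σ | J
  · have hk : ∀ a (δ : 𝓜), 1 < δ.degree → 𝓠 (.inl σ) δ (vb ν a) = 0 :=
      fun a δ hδ => (hasLie_e ν a).high _ _ hδ
    rcases h2.lt_or_eq with h5 | h5
    · rw [if_neg (by rintro h; cases h; omega)]
      exact sum_eq_zero fun a _ => by rw [lie_iterD_high (hk a) _ _ (by omega), mul_zero]
    · have h6 : ∀ a, 𝓠 (.inl σ) γ' (iterD γ0 (vb ν a)) = if γ' = γ then vb σ a else 0 := fun a => by
        rw [lie_iterD_top (hk a) _ _ (by omega)]
        by_cases h7 : γ0 ≤ γ'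
        · rw [if_pos h7]
          have h8 : γ' - γ0 ≠ 0 := by
            intro h9
            have := add_tsub_cancel_of_le h7
            rw [h9, add_zero] at this
            rw [← this] at h5; omega
          rw [lie_xi_e, if_neg h8, zero_add]
          refine if_congr ⟨fun h9 => ?_, fun h9 => ?_⟩ rfl rfl
          · rw [h3]; exact eq_add_single_of_sub h7 h9
          · rw [h9, h3, add_tsub_cancel_left]
        · rw [if_neg h7, if_neg]
          rintro rfl; exact h7 (h3 ▸ le_self_add)
      simp only [h6]
      by_cases h7 : γ' = γ
      · simp only [h7, if_true, Prod.mk.injEq, Sum.inl.injEq, and_true]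
        have h8 : ∀ a, (invFrame a ρ : 𝓐) * vb σ a = vb σ a * invFrame a ρ :=
          fun a => (vb_comm _ _ _).symm
        simp only [h8, sum_vb_invFrame]
      · simp [h7]
  · have hk : ∀ a (δ : 𝓜), 0 < δ.degree → 𝓠 (.inr J) δ (vb ν a) = 0 := fun a δ hδ => by
      rw [lie_C_e, if_neg]
      rintro rfl; simp at hδ
    rw [if_neg (by rintro h; cases h)]
    exact sum_eq_zero fun a _ => by rw [lie_iterD_high (hk a) _ _ (by omega), mul_zero]

lemma lie_potential_gh (I : 𝓘) {γ γ' : 𝓜} (h : γ ≠ 0) (g : 𝓗)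
    (h2 : ghWt (.inr I, γ) ≤ ghWt (g, γ')) :
    𝓠 g γ' (potential (.inr I) γ) = if (g, γ') = (.inr I, γ) then 1 else 0 := by
  obtain ⟨ν, γ0, h3, h4⟩ := potential_gh (ι := ι) (β := β) (φ := φ) h
  have hd : γ.degree = γ0.degree + 1 := by rw [h3]; simp
  rw [h4]
  have hk : ∀ g (δ : 𝓜), 1 < δ.degree → 𝓠 g δ (conn ν I) = 0 :=
      fun g δ hδ => (hasLie_conn ν I).high _ _ hδ
  rcases g with σ | J
  · rw [if_neg (by rintro h; cases h)]
    exact lie_iterD_high (hk _) _ _ (by simp [ghWt] at h2; omega)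
  · have h2' : γ.degree ≤ γ'.degree := by simp [ghWt] at h2; omega
    rcases h2'.lt_or_eq with h5 | h5
    · rw [if_neg (by rintro h; cases h; omega)]
      exact lie_iterD_high (hk _) _ _ (by omega)
    · rw [lie_iterD_top (hk _) _ _ (by omega)]
      by_cases h7 : γ0 ≤ γ'
      · rw [if_pos h7]
        have h8 : (γ' - γ0).degree = 1 := by
          have := congrArg degree (add_tsub_cancel_of_le h7)
          simp at this; omega
        rcases degree_eq_one_or_two_le (γ := γ' - γ0) (by intro h; simp [h] at h8) with ⟨ρ, h9⟩ | h9
        · rw [h9, (hasLie_conn ν I).gh, ← ite_and]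
          refine if_congr ⟨?_, ?_⟩ rfl rfl
          · rintro ⟨rfl, rfl⟩
            rw [h3, eq_add_single_of_sub h7 h9]
          · intro h10
            obtain ⟨h11, h12⟩ := Prod.mk.inj h10
            refine ⟨?_, Sum.inr.inj h11⟩
            rw [h12, h3, add_tsub_cancel_left, single_left_inj one_ne_zero] at h9
            exact h9.symm
        · omega
      · rw [if_neg h7, if_neg]
        intro h; cases h; exact h7 (h3 ▸ le_self_add)

lemma ghHomotopy_ghostFree (hx : x ∈ 𝓖) :
    ghHomotopy D L₀ x = 0 := by
  rw [ghHomotopy_apply]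
  simp [dL_gJet_ghostFree _ _ hx]

lemma ghHomotopy_basic (hx : x ∈ basicAlg D L₀) : ghHomotopy D L₀ x = 0 := by
  rw [ghHomotopy_apply]
  refine finsum_eq_zero_of_forall_eq_zero fun c => ?_
  by_cases h : c.2 = 0
  · rw [show c = (c.1, 0) from Prod.ext rfl h, homotopyCoeff_zero, zero_mul]
  · rw [(hx c.1 c.2 h).1, mul_zero]

lemma ghHomotopy_brst (hx : x ∈ 𝓖) :
    ghHomotopy D L₀ (𝓢 x) = ∑ᶠ c : 𝓗 × 𝓜,
      homotopyCoeff D L₀ c * 𝓠 c.1 c.2 x := by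
  rw [ghHomotopy_apply]
  refine finsum_congr fun c => ?_
  rw [lie_eq (dL_gJet_ghostFree _ _ hx)]

lemma ghHomotopy_brst_vb (μ a : Fin n) : ghHomotopy D L₀ (𝓢 (vb μ a)) = 0 := by
  rw [ghHomotopy_brst (fld_mem_ghostFree (by trivial) _)]
  refine finsum_eq_zero_of_forall_eq_zero fun c => ?_
  obtain ⟨g, γ⟩ := c
  by_cases h : 2 ≤ γ.degree
  · rw [(hasLie_e μ a).high _ _ h, mul_zero]
  · rcases g with σ | J
    · rw [homotopyCoeff_xi_low σ h, zero_mul]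
    · classical
      rw [lie_C_e]
      split_ifs with h2
      · obtain rfl : γ = 0 := h2
        rw [homotopyCoeff_zero, zero_mul]
      · rw [mul_zero]

lemma ghHomotopy_brst_potential (c : 𝓗 × 𝓜) :
    ghHomotopy D L₀ (𝓢 (potential c.1 c.2)) = potential c.1 c.2 := by
  by_cases h0 : (potential c.1 c.2 : 𝓐) = 0
  · rw [h0, map_zero, map_zero]
  have key : ∀ c' : 𝓗 × 𝓜, ghWt c ≤ ghWt c' →
      𝓠 c'.1 c'.2 (potential c.1 c.2) = if c' = c then 1 else 0 := by
    rintro ⟨g', γ'⟩ h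
    obtain ⟨g, γ⟩ := c
    rcases g with ρ | I
    · have h2 : 2 ≤ γ.degree := by by_contra h; exact h0 (potential_xi_low ρ h)
      refine lie_potential_xi ρ h2 ?_ g'
      change γ.degree ≤ γ'.degree
      rcases g' with σ | J
      · change 2 * γ.degree ≤ 2 * γ'.degree at h; omega
      · change 2 * γ.degree ≤ 2 * γ'.degree + 1 at h; omega
    · have h2 : γ ≠ 0 := by rintro rfl; exact h0 (potential_gh_zero I)
      exact lie_potential_gh I h2 g' h
  have hfin : (support fun c' : 𝓗 × 𝓜 =>
      𝓠 c'.1 c'.2 (potential c.1 c.2)).Finite := by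
    have h1 := (dL_finite (𝓢 (potential c.1 c.2))).preimage
      (f := fun c' : 𝓗 × 𝓜 => (gJet c'.1 c'.2 : 𝓙)) (by
        rintro ⟨g, γ⟩ - ⟨g', γ'⟩ - h
        have h1 : ghFld g = (ghFld g' : 𝓕) := by injection congrArg Prod.fst h
        have h2 := congrArg Prod.snd h
        obtain rfl := ghFld_injective h1
        exact Prod.ext rfl h2)
    refine h1.subset fun c' hc' => ?_
    change dL _ _ ≠ 0
    rwa [← lie_eq (dL_gJet_ghostFree _ _ (potential_mem_ghostFree _ _))]
  rw [ghHomotopy_brst (potential_mem_ghostFree _ _)]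
  have h1 : ∀ c', homotopyCoeff D L₀ c' * 𝓠 c'.1 c'.2 (potential c.1 c.2) =
      (if _ : ghWt c' < ghWt c then homotopyCoeff D L₀ c' * 𝓠 c'.1 c'.2 (potential c.1 c.2)
        else 0) + if c' = c then homotopyCoeff D L₀ c else 0 := fun c' => by
    by_cases h : ghWt c' < ghWt c
    · rw [dif_pos h, if_neg (by rintro rfl; omega), add_zero]
    · rw [dif_neg h, key c' (by omega), zero_add]
      split_ifs with h2
      · rw [h2, mul_one]
      · rw [mul_zero]
  rw [finsum_congr h1, finsum_add_distrib, finsum_eq_single (fun c' => if c' = c then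
    homotopyCoeff D L₀ c else 0) c (fun c' h => if_neg h), if_pos rfl]
  · have e : homotopyCoeff D L₀ c = potential c.1 c.2 - ∑ᶠ c' : 𝓗 × 𝓜,
        if _ : ghWt c' < ghWt c then
          homotopyCoeff D L₀ c' * 𝓠 c'.1 c'.2 (potential c.1 c.2) else 0 := by
      rw [homotopyCoeff]
    rw [e]; abel
  · refine hfin.subset fun c' h h2 => h ?_
    dsimp only at h2 ⊢
    split_ifs
    · rw [h2, mul_zero]
    · rfl
  · refine (Set.finite_singleton c).subset fun c' h => ?_
    by_contra h2
    exact h (if_neg h2)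

end Homotopy

section Reduction

/-! ## Reduction of the cohomology to frame forms and tensors -/

variable (D L₀) in
/-- The subalgebra generated by functions of the vielbein, the `s e_μ^a` and `tensorAlg`. -/
def frameTensorAlg : Subalgebra ℝ 𝓐 := adjoin ℝ
  (Set.range frameFun ∪ Set.range (fun p : Fin n × Fin n => 𝓢 (vb p.1 p.2)) ∪ tensorAlg D)

variable (D L₀) in
/-- The derivation counting potentials and their BRST transformations. -/
def potentialCount : 𝓛 := scomm true true 𝓢 (ghHomotopy D L₀)

lemma potentialCount_apply (x : 𝓐) : potentialCount D L₀ x =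
    𝓢 (ghHomotopy D L₀ x) + ghHomotopy D L₀ (𝓢 x) := by
  rw [potentialCount, scomm_apply]; simp

variable (D L₀) in
/-- The span of the eigenvectors of `potentialCount` with positive eigenvalues. -/
def potentialSpan : Submodule ℝ 𝓐 := span ℝ {x | ∃ k : ℕ, potentialCount D L₀ x = ((k : ℝ) + 1) • x}

variable [adm : Admissible D L₀]

lemma isSDer_potentialCount : IsSDer false (potentialCount D L₀) :=
  (isSDer_brst adm.even).scomm isSDer_ghHomotopy

lemma potentialCount_mul (x y : 𝓐) : potentialCount D L₀ (x * y) =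
    potentialCount D L₀ x * y + x * potentialCount D L₀ y := isSDer_potentialCount.mul x y

lemma brst_brst (x : 𝓐) : 𝓢 (𝓢 x) = 0 := brst_sq adm.isLie adm.invariant x

lemma potentialCount_brst (x : 𝓐) :
    potentialCount D L₀ (𝓢 x) = 𝓢 (potentialCount D L₀ x) := by
  rw [potentialCount_apply, potentialCount_apply, brst_brst, map_zero, add_zero, map_add, brst_brst,
    zero_add]

lemma potentialCount_frameFun (f : 𝓒) : potentialCount D L₀ (frameFun f) = 0 := by
  rw [isSDer_potentialCount.frame]
  refine sum_eq_zero fun p _ => ?_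
  rw [potentialCount_apply]
  change (𝓢 (ghHomotopy D L₀ (vb p.1 p.2)) +
    ghHomotopy D L₀ (𝓢 (vb p.1 p.2))) * _ = 0
  rw [ghHomotopy_ghostFree (fld_mem_ghostFree (by trivial) _), ghHomotopy_brst_vb,
    map_zero, zero_add, zero_mul]

lemma potentialCount_brst_vb (μ a : Fin n) : potentialCount D L₀ (𝓢 (vb μ a)) = 0 := by
  rw [potentialCount_brst, potentialCount_apply,
    ghHomotopy_ghostFree (fld_mem_ghostFree (by trivial) _), ghHomotopy_brst_vb,
    map_zero, zero_add, map_zero]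

lemma potentialCount_basic (hx : x ∈ basicAlg D L₀) : potentialCount D L₀ x = 0 := by
  rw [potentialCount_apply, ghHomotopy_basic hx, ghHomotopy_basic (brst_mem_basicAlg hx), map_zero,
    zero_add]

lemma potentialCount_potential (c : 𝓗 × 𝓜) :
    potentialCount D L₀ (potential c.1 c.2) = potential c.1 c.2 := by
  rw [potentialCount_apply, ghHomotopy_ghostFree (potential_mem_ghostFree _ _), map_zero, zero_add,
    ghHomotopy_brst_potential]

lemma potentialCount_frameTensor (hx : x ∈ frameTensorAlg D L₀) :
    potentialCount D L₀ x = 0 := by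
  induction hx using adjoin_induction with
  | mem x h =>
    rcases h with (⟨f, rfl⟩ | ⟨p, rfl⟩) | h
    · exact potentialCount_frameFun f
    · exact potentialCount_brst_vb _ _
    · exact potentialCount_basic (tensorAlg_le_basicAlg D L₀ h)
  | algebraMap r => rw [← AlgHom.commutes frameFun r]; exact potentialCount_frameFun _
  | add x y _ _ hx hy => rw [map_add, hx, hy, add_zero]
  | mul x y _ _ hx hy => rw [potentialCount_mul, hx, hy, zero_mul, mul_zero, add_zero]

lemma frameTensor_mul_mem_potentialSpan (hx : potentialCount D L₀ x = 0)
    (hy : y ∈ potentialSpan D L₀) : x * y ∈ potentialSpan D L₀ ∧ y * x ∈ potentialSpan D L₀ := by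
  induction hy using span_induction with
  | mem y h =>
    obtain ⟨k, h⟩ := h
    exact ⟨subset_span ⟨k, by rw [potentialCount_mul, hx, h]; simp⟩,
      subset_span ⟨k, by rw [potentialCount_mul, hx, h]; simp⟩⟩
  | zero => simp
  | add y z _ _ hy hz => rw [mul_add, add_mul]; exact ⟨add_mem hy.1 hz.1, add_mem hy.2 hz.2⟩
  | smul r y _ hy =>
    rw [mul_smul_comm, smul_mul_assoc]
    exact ⟨smul_mem _ _ hy.1, smul_mem _ _ hy.2⟩

lemma potentialSpan_mul_le : potentialSpan D L₀ * potentialSpan D L₀ ≤ potentialSpan D L₀ := by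
  rw [potentialSpan, Submodule.span_mul_span]
  refine span_mono ?_
  rintro _ ⟨x, ⟨k, hx⟩, y, ⟨l, hy⟩, rfl⟩
  refine ⟨k + l + 1, ?_⟩
  dsimp only
  rw [potentialCount_mul, hx, hy, smul_mul_assoc, mul_smul_comm, ← add_smul]
  congr 1
  push_cast
  ring

lemma exists_reduction (x : 𝓐) :
    ∃ y ∈ frameTensorAlg D L₀, ∃ z ∈ potentialSpan D L₀, x = y + z := by
  have hx : x ∈ adaptedAlg D L₀ := by rw [adaptedAlg_eq_top]; trivial
  induction hx using adjoin_induction with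
  | mem x h =>
    rcases h with h | ((⟨c, rfl⟩ | ⟨c, rfl⟩) | h)
    · exact ⟨x, subset_adjoin (Or.inl h), 0, zero_mem _, (add_zero _).symm⟩
    · exact ⟨0, zero_mem _, _, subset_span ⟨0, by
        rw [potentialCount_potential]; simp⟩, (zero_add _).symm⟩
    · exact ⟨0, zero_mem _, _, subset_span ⟨0, by
        rw [potentialCount_brst, potentialCount_potential]; simp⟩, (zero_add _).symm⟩
    · exact ⟨x, subset_adjoin (Or.inr h), 0, zero_mem _, (add_zero _).symm⟩
  | algebraMap r => exact ⟨_, algebraMap_mem _ r, 0, zero_mem _, (add_zero _).symm⟩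
  | add x x' _ _ hx hx' =>
    obtain ⟨y, hy, z, hz, rfl⟩ := hx
    obtain ⟨y', hy', z', hz', rfl⟩ := hx'
    exact ⟨_, add_mem hy hy', _, add_mem hz hz', by abel⟩
  | mul x x' _ _ hx hx' =>
    obtain ⟨y, hy, z, hz, rfl⟩ := hx
    obtain ⟨y', hy', z', hz', rfl⟩ := hx'
    refine ⟨_, mul_mem hy hy', y * z' + z * y' + z * z', add_mem (add_mem
      (frameTensor_mul_mem_potentialSpan (potentialCount_frameTensor hy) hz').1
      (frameTensor_mul_mem_potentialSpan (potentialCount_frameTensor hy') hz).2)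
      (potentialSpan_mul_le (mul_mem_mul hz hz')), ?_⟩
    rw [add_mul, mul_add, mul_add]; abel

lemma eq_zero_of_mem_potentialSpan (hx : x ∈ potentialSpan D L₀)
    (h : potentialCount D L₀ x = 0) : x = 0 := by
  let T : End ℝ 𝓐 := potentialCount D L₀
  have h1 := Module.End.eigenspaces_iSupIndep T 0
  have h2 : x ∈ T.eigenspace 0 := by
    rw [Module.End.mem_eigenspace_iff, zero_smul]; exact h
  have h3 : potentialSpan D L₀ ≤ ⨆ r, ⨆ (_ : r ≠ 0), T.eigenspace r := by
    refine Submodule.span_le.2 ?_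
    rintro y ⟨k, hy⟩
    refine mem_iSup_of_mem ((k : ℝ) + 1) (mem_iSup_of_mem (by positivity) ?_)
    exact Module.End.mem_eigenspace_iff.2 hy
  exact (Submodule.disjoint_def.1 h1) x h2 (h3 hx)

lemma exists_potentialCount_eq (hx : x ∈ potentialSpan D L₀) :
    ∃ y ∈ potentialSpan D L₀, potentialCount D L₀ y = x := by
  refine map_mem_of_span (S := (potentialSpan D L₀).map (potentialCount D L₀)) .id ?_ hx
  rintro x ⟨k, h⟩
  refine ⟨((k : ℝ) + 1)⁻¹ • x, smul_mem _ _ (subset_span ⟨k, h⟩), ?_⟩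
  rw [map_smul, h, smul_smul, inv_mul_cancel₀ (by positivity), one_smul, id_apply]

lemma brst_mem_potentialSpan (hx : x ∈ potentialSpan D L₀) :
    𝓢 x ∈ potentialSpan D L₀ := by
  have h : potentialSpan D L₀ ≤ (potentialSpan D L₀).comap 𝓢 := by
    refine Submodule.span_le.2 ?_
    rintro y ⟨k, hy⟩
    exact subset_span ⟨k, by rw [potentialCount_brst, hy, map_smul]⟩
  exact h hx

variable (D L₀) in
/-- Every cocycle is cohomologous to one in `frameTensorAlg`. -/
lemma exists_frameTensor_cocycle (hx : 𝓢 x = 0) :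
    ∃ y ∈ frameTensorAlg D L₀, 𝓢 y = 0 ∧ ∃ b, x = y + 𝓢 b := by
  obtain ⟨y, hy, z, hz, rfl⟩ := exists_reduction (D := D) (L₀ := L₀) x
  have h1 : 𝓢 z = 0 := by
    refine eq_zero_of_mem_potentialSpan (brst_mem_potentialSpan hz) ?_
    have h2 := congrArg (potentialCount D L₀) hx
    rwa [map_add, map_add, map_zero, potentialCount_brst y, potentialCount_frameTensor hy, map_zero,
      zero_add] at h2
  rw [map_add, h1, add_zero] at hx
  obtain ⟨w, hw, rfl⟩ := exists_potentialCount_eq hz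
  have h2 : 𝓢 w = 0 := by
    refine eq_zero_of_mem_potentialSpan (brst_mem_potentialSpan hw) ?_
    rw [potentialCount_brst, h1]
  refine ⟨y, hy, hx, ghHomotopy D L₀ w, ?_⟩
  rw [potentialCount_apply, h2, map_zero, add_zero]

variable (D L₀) in
lemma basicAlg_le_frameTensorAlg : basicAlg D L₀ ≤ frameTensorAlg D L₀ := fun x hx => by
  obtain ⟨y, hy, z, hz, rfl⟩ := exists_reduction (D := D) (L₀ := L₀) x
  have h := potentialCount_basic hx
  rw [map_add, potentialCount_frameTensor hy, zero_add] at h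
  rwa [eq_zero_of_mem_potentialSpan hz h, add_zero]

end Reduction

section Connected

open Matrix

variable {m : Type*} [Fintype m] [DecidableEq m]

/-- The matrices of positive determinant. -/
abbrev posDet (m : Type*) [Fintype m] [DecidableEq m] : Set (Matrix m m ℝ) := {M | 0 < M.det}

lemma joinedIn_posDet_mul {A B : Matrix m m ℝ} (hA : JoinedIn (posDet m) A 1)
    (hB : JoinedIn (posDet m) B 1) : JoinedIn (posDet m) (A * B) 1 := by
  have h := hA.mul hB
  rw [mul_one] at h
  refine h.mono ?_
  rintro _ ⟨X, hX, Y, hY, rfl⟩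
  simp only [Set.mem_ofPred_eq] at hX hY ⊢
  rw [det_mul]
  exact mul_pos hX hY

lemma joinedIn_posDet_transvection {i j : m} (hij : i ≠ j) (c : ℝ) :
    JoinedIn (posDet m) (transvection i j c) 1 := by
  refine JoinedIn.symm (JoinedIn.ofLine (f := fun t : ℝ => transvection i j (t * c)) ?_ ?_ ?_ ?_)
  · refine Continuous.continuousOn (continuous_matrix fun a b => ?_)
    simp only [transvection, Matrix.add_apply, Matrix.single_apply]
    split_ifs <;> fun_prop
  · simp
  · simp
  · rintro _ ⟨t, -, rfl⟩
    simp [det_transvection_of_ne i j hij]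

lemma diagonal_mul_transvections {i j : m} (hij : i ≠ j) {c : ℝ} (hc : c ≠ 0) :
    diagonal (fun k ↦ if k = i then c else if k = j then c⁻¹ else 1) =
      transvection i j c * transvection j i (-c⁻¹) * transvection i j c *
      (transvection i j (-1) * transvection j i 1 * transvection i j (-1)) := by
  have h : diagonal (fun k ↦ if k = i then c else if k = j then c⁻¹ else 1) =
      1 + Matrix.single i i (c - 1) + Matrix.single j j (c⁻¹ - 1) := by
    ext a b
    simp only [Matrix.diagonal_apply, Matrix.add_apply, Matrix.one_apply, Matrix.single_apply]
    by_cases hab : a = b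
    · subst hab
      by_cases h1 : a = i
      · subst h1; simp [hij.symm]
      · by_cases h2 : a = j
        · subst h2; simp [h1, Ne.symm h1]
        · simp [h1, h2, Ne.symm h1, Ne.symm h2]
    · have : ¬ (i = a ∧ i = b) := fun h => hab (h.1.symm.trans h.2)
      have h' : ¬ (j = a ∧ j = b) := fun h => hab (h.1.symm.trans h.2)
      simp [hab, this, h']
  rw [h]
  simp only [transvection, mul_add, add_mul, mul_one, one_mul, Matrix.single_mul_single_same,
    Matrix.single_mul_single_of_ne _ _ _ _ hij, Matrix.single_mul_single_of_ne _ _ _ _ hij.symm,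
    mul_inv_cancel₀ hc, inv_mul_cancel₀ hc, mul_neg, neg_mul,
    add_zero, neg_neg]
  ext a b
  simp only [Matrix.add_apply, Matrix.single_apply, Matrix.one_apply]
  split_ifs <;> ring

lemma joinedIn_posDet_sl (M : SpecialLinearGroup m ℝ) : JoinedIn (posDet m) M.1 1 := by
  rcases subsingleton_or_nontrivial m with hs | hs
  · have : M.1 = 1 := by
      ext i j
      obtain rfl := Subsingleton.elim i j
      rw [← det_eq_elem_of_subsingleton M.1 i, M.2]; simp
    rw [this]
    exact JoinedIn.refl (by simp)
  refine SpecialLinearGroup.diagonal_transvection_induction' (fun M => JoinedIn (posDet m) M.1 1) M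
    (fun i j hij c hc => ?_) (fun i j hij c => joinedIn_posDet_transvection hij c)
    fun A B hA hB => joinedIn_posDet_mul hA hB
  change JoinedIn _ (diagonal _) 1
  rw [diagonal_mul_transvections hij hc]
  have h := fun c => joinedIn_posDet_transvection hij c
  have h' := fun c => joinedIn_posDet_transvection hij.symm c
  exact joinedIn_posDet_mul (joinedIn_posDet_mul (joinedIn_posDet_mul (h _) (h' _)) (h _))
    (joinedIn_posDet_mul (joinedIn_posDet_mul (h _) (h' _)) (h _))

lemma joinedIn_posDet {M : Matrix m m ℝ} (hM : 0 < M.det) : JoinedIn (posDet m) M 1 := by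
  rcases isEmpty_or_nonempty m with h | h
  · rw [Subsingleton.elim M 1]; exact JoinedIn.refl (by simp)
  have hk : (Fintype.card m : ℝ) ≠ 0 := Nat.cast_ne_zero.2 Fintype.card_ne_zero
  set r : ℝ := M.det ^ (-(Fintype.card m : ℝ)⁻¹) with hr
  have hr0 : 0 < r := Real.rpow_pos_of_pos hM _
  have h1 : (r • M).det = 1 := by
    rw [det_smul, hr, ← Real.rpow_natCast, ← Real.rpow_mul hM.le, neg_mul, inv_mul_cancel₀ hk,
      Real.rpow_neg_one, inv_mul_cancel₀ hM.ne']
  refine JoinedIn.trans ?_ (joinedIn_posDet_sl ⟨r • M, h1⟩)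
  refine JoinedIn.ofLine (f := fun t : ℝ => ((1 - t) + t * r) • M) ?_ ?_ ?_ ?_
  · exact Continuous.continuousOn (by fun_prop)
  · simp
  · simp
  · rintro _ ⟨t, ⟨ht0, ht1⟩, rfl⟩
    simp only [Set.mem_ofPred_eq]
    rw [det_smul]
    have : 0 < (1 - t) + t * r := by
      rcases ht0.eq_or_lt with rfl | h
      · simp
      · have := mul_pos h hr0; linarith
    positivity

lemma isPreconnected_GLp (n : ℕ) : IsPreconnected (GLp n : Set (Fin n × Fin n → ℝ)) := by
  have h1 : IsPathConnected (posDet (Fin n)) := ⟨1, by simp, fun _ hy => (joinedIn_posDet hy).symm⟩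
  have h2 := h1.isConnected.isPreconnected.image
    (fun (M : Matrix (Fin n) (Fin n) ℝ) (p : Fin n × Fin n) => M p.1 p.2) (by fun_prop)
  convert h2
  ext x
  constructor
  · exact fun hx => ⟨frameMatrix n x, hx, rfl⟩
  · rintro ⟨M, hM, rfl⟩; exact hM

end Connected

section LinearSystem

variable {κ : Type*} [Fintype κ] [DecidableEq κ] {U : TopologicalSpace.Opens (κ → ℝ)}

lemma fderiv_extendZero (f : SmoothFun U) (x : U) (v : κ → ℝ) :
    fderiv ℝ (extendZero f.1) x v = ∑ i, v i * (pd i f).1 x := by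
  conv_lhs => rw [← Finset.univ_sum_single v, map_sum]
  refine sum_ext fun i _ => ?_
  have : (Pi.single i (v i) : κ → ℝ) = v i • Pi.single i 1 := by
    rw [← Pi.single_smul, smul_eq_mul, mul_one]
  rw [this, map_smul, smul_eq_mul]
  rfl

lemma continuousOn_extendZero (f : SmoothFun U) : ContinuousOn (extendZero f.1) U :=
  (smoothFun_contDiffOn f).continuousOn

/-- A solution of a linear first order system vanishing at a point vanishes nearby. -/
lemma eventually_eq_zero_of_linear_system {J : Type*} [Fintype J] (y : J → SmoothFun U)
    (a : κ → J → J → SmoothFun U) (h : ∀ i j, pd i (y j) = ∑ k, a i j k * y k) (x₀ : U)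
    (h0 : ∀ j, (y j).1 x₀ = 0) : ∀ᶠ x in nhds (x₀ : κ → ℝ), ∀ j, extendZero (y j).1 x = 0 := by
  obtain ⟨r, hr, hrU⟩ := Metric.nhds_basis_closedBall.mem_iff.1 (U.isOpen.mem_nhds x₀.2)
  obtain ⟨C, hC0, hC⟩ : ∃ C : ℝ, 0 ≤ C ∧ ∀ i j k, ∀ x ∈ Metric.closedBall (x₀ : κ → ℝ) r,
      |extendZero (a i j k).1 x| ≤ C := by
    have h1 : ∀ q : κ × J × J, ∃ C, ∀ x ∈ Metric.closedBall (x₀ : κ → ℝ) r,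
        |extendZero (a q.1 q.2.1 q.2.2).1 x| ≤ C := fun q => by
      obtain ⟨C, hC⟩ := (isCompact_closedBall (x₀ : κ → ℝ) r).exists_bound_of_continuousOn
        ((continuousOn_extendZero (a q.1 q.2.1 q.2.2)).mono hrU)
      exact ⟨C, hC⟩
    choose C hC using h1
    refine ⟨∑ q, |C q|, Finset.sum_nonneg fun _ _ => abs_nonneg _, fun i j k x hx => ?_⟩
    exact ((hC (i, j, k) x hx).trans (le_abs_self _)).trans
      (Finset.single_le_sum (f := fun q => |C q|) (fun _ _ => abs_nonneg _) (mem_univ _))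
  filter_upwards [Metric.closedBall_mem_nhds (x₀ : κ → ℝ) hr] with x hx
  have hseg : ∀ t ∈ Icc (0 : ℝ) 1, (x₀ : κ → ℝ) + t • (x - x₀) ∈ Metric.closedBall (x₀ : κ → ℝ) r := fun t ht => by
    exact (convex_closedBall _ _).add_smul_sub_mem (Metric.mem_closedBall_self hr.le) hx ht
  let γ : ℝ → κ → ℝ := fun t => (x₀ : κ → ℝ) + t • (x - x₀)
  let Y : ℝ → J → ℝ := fun t j => extendZero (y j).1 (γ t)
  let Y' : ℝ → J → ℝ := fun t j => fderiv ℝ (extendZero (y j).1) (γ t) (x - x₀)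
  have hγ : ∀ t, HasDerivAt γ (x - x₀) t := fun t => by
    have := ((hasDerivAt_id t).smul_const (x - (x₀ : κ → ℝ))).const_add (x₀ : κ → ℝ)
    rwa [one_smul] at this
  have hY : ∀ t ∈ Icc (0 : ℝ) 1, HasDerivAt Y (Y' t) t := fun t ht => by
    rw [hasDerivAt_pi]
    intro j
    exact ((smoothFun_differentiableAt (y j) ⟨γ t, hrU (hseg t ht)⟩).hasFDerivAt).comp_hasDerivAt t
      (hγ t)
  have hb : ∀ t ∈ Set.Ico (0 : ℝ) 1, ‖Y' t‖ ≤
      ((Fintype.card κ * (‖x - x₀‖ * (Fintype.card J * C))) : ℝ) * ‖Y t‖ := fun t ht => by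
    have htU := hrU (hseg t ⟨ht.1, ht.2.le⟩)
    refine (pi_norm_le_iff_of_nonneg (by positivity)).2 fun j => ?_
    have e : Y' t j = ∑ i, (x - x₀) i * ∑ k, extendZero (a i j k).1 (γ t) * Y t k := by
      change fderiv ℝ (extendZero (y j).1) ((⟨γ t, htU⟩ : U) : κ → ℝ) (x - x₀) = _
      rw [fderiv_extendZero]
      refine sum_ext fun i _ => ?_
      rw [h]
      congr 1
      have e1 : (∑ k, a i j k * y k).1 (⟨γ t, htU⟩ : U) =
          ∑ k, (a i j k).1 ⟨γ t, htU⟩ * (y k).1 ⟨γ t, htU⟩ := by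
        rw [AddSubmonoidClass.coe_finsetSum, Finset.sum_apply]; rfl
      rw [e1]
      refine sum_ext fun k _ => ?_
      rw [← extendZero_apply (a i j k).1, ← extendZero_apply (y k).1]
    rw [e]
    have h2 : ∀ i, ‖(x - x₀) i * ∑ k, extendZero (a i j k).1 (γ t) * Y t k‖ ≤
        ‖x - x₀‖ * (Fintype.card J * C) * ‖Y t‖ := fun i => by
      rw [norm_mul, mul_assoc]
      refine mul_le_mul (norm_le_pi_norm (x - (x₀ : κ → ℝ)) i) ?_ (norm_nonneg _) (norm_nonneg _)
      calc ‖∑ k, extendZero (a i j k).1 (γ t) * Y t k‖ ≤ ∑ _k : J, C * ‖Y t‖ := by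
            refine norm_sum_le_of_le _ fun k _ => ?_
            rw [norm_mul]
            exact mul_le_mul (hC i j k _ (hseg t ⟨ht.1, ht.2.le⟩)) (norm_le_pi_norm (Y t) k)
              (norm_nonneg _) hC0
        _ = Fintype.card J * C * ‖Y t‖ := by
            rw [sum_const, card_univ, nsmul_eq_mul, mul_assoc]
    calc ‖∑ i, (x - x₀) i * ∑ k, extendZero (a i j k).1 (γ t) * Y t k‖
        ≤ ∑ _i : κ, ‖x - x₀‖ * (Fintype.card J * C) * ‖Y t‖ := norm_sum_le_of_le _ fun i _ => h2 i
      _ = _ := by rw [sum_const, card_univ, nsmul_eq_mul]; ring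
  have h3 := eq_zero_of_abs_deriv_le_mul_abs_self_of_eq_zero_right (f := Y) (f' := Y')
    (fun t ht => (hY t ht).continuousAt.continuousWithinAt)
    (fun t ht => (hY t ⟨ht.1, ht.2.le⟩).hasDerivWithinAt) (by
      funext j
      change extendZero (y j).1 (γ 0) = 0
      have : γ 0 = x₀ := by simp [γ]
      rw [this, extendZero_apply, h0]) hb 1 ⟨zero_le_one, le_rfl⟩
  intro j
  have h4 := congrFun h3 j
  have : γ 1 = x := by simp [γ]
  change extendZero (y j).1 (γ 1) = 0 at h4
  rwa [this] at h4

/-- A solution of a linear first order system on a connected domain vanishing at a point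
vanishes. -/
lemma eq_zero_of_linear_system (hU : IsPreconnected (U : Set (κ → ℝ))) {J : Type*} [Fintype J]
    (y : J → SmoothFun U) (a : κ → J → J → SmoothFun U)
    (h : ∀ i j, pd i (y j) = ∑ k, a i j k * y k) (x₀ : U) (h0 : ∀ j, (y j).1 x₀ = 0) (j : J) :
    y j = 0 := by
  have : PreconnectedSpace U := isPreconnected_iff_preconnectedSpace.1 hU
  have hc : IsClopen {x : U | ∀ j, (y j).1 x = 0} := by
    constructor
    · simp only [Set.ofPred_forall]
      refine isClosed_iInter fun j => isClosed_eq ?_ continuous_const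
      have := continuousOn_iff_continuous_domRestrict.1 (continuousOn_extendZero (y j))
      refine this.congr fun x => ?_
      exact extendZero_apply (y j).1 x
    · rw [isOpen_iff_mem_nhds]
      intro x hx
      have h1 := (continuous_subtype_val (p := fun x => x ∈ U)).continuousAt.eventually
        (eventually_eq_zero_of_linear_system y a h x hx)
      filter_upwards [h1] with z hz j
      rw [← extendZero_apply (y j).1 z]
      exact hz j
  rcases isClopen_iff.1 hc with h1 | h1
  · exact (Set.notMem_empty x₀ (h1 ▸ (h0 : x₀ ∈ {x : U | ∀ j, (y j).1 x = 0}))).elim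
  · refine Subtype.ext (funext fun x => ?_)
    have : x ∈ {x : U | ∀ j, (y j).1 x = 0} := h1 ▸ Set.mem_univ x
    exact this j

end LinearSystem

section Coefficients

variable (n ι β φ)

/-- Polynomials in the jet coordinates other than the vielbein. -/
abbrev ConstFun : Type _ := MvPolynomial 𝓙₀ ℝ ⊗[ℝ] Grassmann 𝓙₁

variable {n ι β φ}

/-- The inclusion of the local functions with constant coefficients. -/
def inclConst : ConstFun n ι β φ →ₐ[ℝ] 𝓐 := Algebra.TensorProduct.map
    (Algebra.TensorProduct.includeRight :
      MvPolynomial 𝓙₀ ℝ →ₐ[ℝ] 𝓒 ⊗[ℝ] MvPolynomial 𝓙₀ ℝ)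
    (AlgHom.id ℝ (Grassmann 𝓙₁))

/-- Local functions are constant coefficient ones with coefficients in `C^∞(GL⁺(n))`. -/
def coeffEquiv : 𝓐 →ₗ[ℝ] 𝓒 ⊗[ℝ] ConstFun n ι β φ :=
  (TensorProduct.assoc ℝ 𝓒 (MvPolynomial 𝓙₀ ℝ)
    (Grassmann 𝓙₁)).toLinearMap

lemma coeffEquiv_mul (f : 𝓒) (w : ConstFun n ι β φ) :
    coeffEquiv (frameFun f * inclConst w) = f ⊗ₜ w := by
  induction w using induction_on with
  | zero => simp
  | add x y hx hy => rw [map_add, mul_add, map_add, hx, hy, tmul_add]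
  | tmul p v =>
    have : frameFun f * inclConst (p ⊗ₜ[ℝ] v) = EvenFun.mk f p ⊗ₜ[ℝ] v := by
      change (EvenFun.mk f 1 ⊗ₜ[ℝ] (1 : Grassmann 𝓙₁)) * (EvenFun.mk 1 p ⊗ₜ[ℝ] v) = _
      rw [tmul_mul_tmul, EvenFun.mk_mul, one_mul, one_mul, mul_one]
    rw [this]
    rfl

variable (n ι β φ) in
/-- The jet coordinates other than the undifferentiated vielbein. -/
def nonFrame : Set 𝓙 := {z | frameIdx z = none}

variable (n ι β φ) in
/-- The subalgebra of local functions with constant coefficients. -/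
def constAlg : Subalgebra ℝ 𝓐 := adjoin ℝ (gen '' nonFrame n ι β φ)

lemma constAlg_le_range : constAlg n ι β φ ≤ inclConst.range := by
  refine Algebra.adjoin_le ?_
  rintro _ ⟨z, hz, rfl⟩
  by_cases h : z.1.isOdd = true
  · exact ⟨1 ⊗ₜ ggen ⟨z, h⟩, by rw [gen_odd h]; rfl⟩
  · exact ⟨MvPolynomial.X ⟨z, by simpa using h, hz⟩ ⊗ₜ 1, by
      rw [gen_even ⟨by simpa using h, hz⟩]; rfl⟩

lemma coeff_eq_zero {V W J : Type*} [AddCommGroup V] [Module ℝ V] [AddCommGroup W] [Module ℝ W]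
    [Fintype J] (w : J → W) (hw : LinearIndependent ℝ w) (g : J → V)
    (h : ∑ j, g j ⊗ₜ[ℝ] w j = 0) (j : J) : g j = 0 := by
  obtain ⟨Φ, hΦ⟩ := LinearMap.exists_leftInverse_of_injective (linearCombination ℝ w)
    (LinearMap.ker_eq_bot.2 hw)
  have hΦ' : ∀ k, Φ (w k) = single k 1 := fun k => by
    have := LinearMap.congr_fun hΦ (single k 1)
    simpa using this
  have h1 := congrArg ((TensorProduct.rid ℝ V).toLinearMap ∘ₗ
    map LinearMap.id (Finsupp.lapply j ∘ₗ Φ)) h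
  simpa [hΦ', single_apply] using h1

lemma frameFun_coeff_eq_zero {J : Type*} [Fintype J] (b : J → 𝓐)
    (hb : LinearIndependent ℝ b) (hc : ∀ j, b j ∈ constAlg n ι β φ) (g : J → 𝓒)
    (h : ∑ j, frameFun (g j) * b j = 0) (j : J) : g j = 0 := by
  choose w hw using fun j => constAlg_le_range (hc j)
  have hwi : LinearIndependent ℝ w := by
    refine LinearIndependent.of_comp (inclConst (n := n) (ι := ι) (β := β) (φ := φ)).toLinearMap ?_
    have : (inclConst (n := n) (ι := ι) (β := β) (φ := φ)).toLinearMap ∘ w = b := funext hw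
    rw [this]; exact hb
  refine coeff_eq_zero w hwi g ?_ j
  have h1 := congrArg coeffEquiv h
  rw [map_sum, map_zero] at h1
  rw [← h1]
  refine sum_ext fun j _ => ?_
  rw [← hw j]
  exact (coeffEquiv_mul (g j) (w j)).symm

end Coefficients

section GlAction

/-- The span of the jet coordinates of order `k`. -/
def jetSpan (n : ℕ) (ι β φ : Type*) [Fintype ι] [Fintype β] [Fintype φ] :
    ℕ → Submodule ℝ (LocalFun n ι β φ)
  | 0 => span ℝ (Set.range fun Z : Var n ι β φ => gen (Z, 0))
  | k + 1 => ⨆ μ, (jetSpan n ι β φ k).map (totalD μ)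

lemma jetSpan_fg (k : ℕ) : (jetSpan n ι β φ k).FG := by
  induction k with
  | zero => exact fg_span (Set.finite_range _)
  | succ k ih => exact Submodule.fg_iSup _ fun μ => ih.map _

lemma gen_mem_jetSpan (Z : 𝓥) (α : 𝓜) : gen (Z, α) ∈ jetSpan n ι β φ α.degree := by
  induction α using multiIndex_induction with
  | h0 => rw [map_zero]; exact subset_span ⟨Z, rfl⟩
  | h1 α μ ih =>
    rw [map_add, degree_single]
    refine mem_iSup_of_mem μ ⟨_, ih, ?_⟩
    rw [totalD_gen]

lemma jetSpan_le (k : ℕ) : jetSpan n ι β φ k ≤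
    span ℝ {x | ∃ (Z : 𝓥) (α : 𝓜), α.degree = k ∧ x = gen (Z, α)} := by
  induction k with
  | zero =>
    refine span_mono ?_
    rintro _ ⟨Z, rfl⟩
    exact ⟨Z, 0, by simp, rfl⟩
  | succ k ih =>
    refine iSup_le fun μ => Submodule.map_le_iff_le_comap.2 (ih.trans (Submodule.span_le.2 ?_))
    rintro _ ⟨Z, α, rfl, rfl⟩
    refine subset_span ⟨Z, α + single μ 1, by simp, ?_⟩
    rw [totalD_gen]

lemma gen_mem_constAlg {z : 𝓙} (hz : frameIdx z = none) : gen z ∈ constAlg n ι β φ :=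
  subset_adjoin ⟨z, hz, rfl⟩

lemma frameIdx_of_ne {Z : 𝓥} {α : 𝓜} (h : α ≠ 0) : frameIdx (Z, α) = none := by
  cases Z with
  | anti Φ => rfl
  | fld Φ => cases Φ <;> simp [frameIdx, h]

lemma jetSpan_le_constAlg {k : ℕ} (hk : k ≠ 0) :
    jetSpan n ι β φ k ≤ toSubmodule (constAlg n ι β φ) := by
  refine (jetSpan_le k).trans (Submodule.span_le.2 ?_)
  rintro _ ⟨Z, α, rfl, rfl⟩
  exact gen_mem_constAlg (frameIdx_of_ne fun h => hk (by simp [h]))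

/-- The span of the undifferentiated fields and antifields other than the vielbein. -/
def undiffSpan (n : ℕ) (ι β φ : Type*) [Fintype ι] [Fintype β] [Fintype φ] :
    Submodule ℝ (LocalFun n ι β φ) :=
  span ℝ (gen '' {z : Jet n ι β φ | z.2 = 0 ∧ frameIdx z = none})

lemma undiffSpan_fg : (undiffSpan n ι β φ).FG := by
  refine fg_span (Set.Finite.image _ ?_)
  refine (Set.finite_range fun Z : 𝓥 => ((Z, 0) : 𝓙)).subset ?_
  rintro ⟨Z, α⟩ ⟨h, -⟩
  exact ⟨Z, by rw [← h]⟩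

lemma undiffSpan_le_constAlg : undiffSpan n ι β φ ≤ toSubmodule (constAlg n ι β φ) := by
  refine Submodule.span_le.2 ?_
  rintro _ ⟨z, ⟨-, hz⟩, rfl⟩
  exact gen_mem_constAlg hz

lemma gen_mem_undiffSpan {Z : 𝓥} (h : frameIdx (Z, (0 : 𝓜)) = none) :
    gen (Z, 0) ∈ undiffSpan n ι β φ := subset_span ⟨(Z, 0), ⟨rfl, h⟩, rfl⟩

variable [adm : Admissible D L₀]

variable (D L₀) in
/-- The action of the generator of `gl(n)`. -/
abbrev glAct (ρ σ : Fin n) : 𝓛 := 𝓠 (.inl σ) (single ρ 1)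

lemma glAct_gen (ρ σ : Fin n) (Z : 𝓥) :
    (frameIdx (Z, (0 : 𝓜)) = none → glAct D L₀ ρ σ (gen (Z, 0)) ∈ undiffSpan n ι β φ) ∧
    glAct D L₀ ρ σ (gen (Z, 0)) ∈ jetSpan n ι β φ 0 := by
  have hle : undiffSpan n ι β φ ≤ jetSpan n ι β φ 0 := by
    refine span_mono ?_
    rintro _ ⟨⟨Z, α⟩, ⟨h, -⟩, rfl⟩
    obtain rfl : α = 0 := h
    exact ⟨Z, rfl⟩
  have key : ∀ {x : 𝓐}, x ∈ undiffSpan n ι β φ →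
    (frameIdx (Z, (0 : 𝓜)) = none → x ∈ undiffSpan n ι β φ) ∧ x ∈ jetSpan n ι β φ 0 :=
    fun h => ⟨fun _ => h, hle h⟩
  cases Z with
  | anti Φ =>
    refine key ?_
    have ha : ∀ Ψ : 𝓕, anti Ψ ∈ undiffSpan n ι β φ := fun Ψ => gen_mem_undiffSpan rfl
    rw [(hasLie_anti Φ).xi]
    refine add_mem ?_ ?_
    · split_ifs
      exacts [ha _, zero_mem _]
    · cases Φ <;> simp only [antiGl]
      all_goals try split_ifs
      all_goals first | exact zero_mem _ | exact ha _ | exact neg_mem (ha _)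
  | fld Φ =>
    cases Φ with
    | e μ a =>
      refine ⟨fun h => by simp [frameIdx] at h, ?_⟩
      rw [(hasLie_e μ a).xi]
      split_ifs
      exacts [subset_span ⟨_, rfl⟩, zero_mem _]
    | A μ i =>
      refine key ?_
      rw [(hasLie_A μ i).xi]
      split_ifs
      exacts [gen_mem_undiffSpan rfl, zero_mem _]
    | yB m => refine key ?_; rw [(hasLie_yB m).xi]; exact zero_mem _
    | yF m => refine key ?_; rw [(hasLie_yF m).xi]; exact zero_mem _
    | xi μ =>
      refine key ?_
      rw [(hasLie_xi μ).xi]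
      split_ifs
      exacts [neg_mem (gen_mem_undiffSpan rfl), zero_mem _]
    | C I => refine key ?_; rw [(hasLie_C I).xi]; exact zero_mem _

lemma glAct_undiffSpan (ρ σ : Fin n) (hx : x ∈ undiffSpan n ι β φ) :
    glAct D L₀ ρ σ x ∈ undiffSpan n ι β φ := by
  have : undiffSpan n ι β φ ≤ (undiffSpan n ι β φ).comap (glAct D L₀ ρ σ) := by
    refine Submodule.span_le.2 ?_
    rintro _ ⟨⟨Z, α⟩, ⟨h, h'⟩, rfl⟩
    obtain rfl : α = 0 := h
    exact (glAct_gen ρ σ Z).1 h'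
  exact this hx

lemma glAct_jetSpan (k : ℕ) (ρ σ : Fin n) (hx : x ∈ jetSpan n ι β φ k) :
    glAct D L₀ ρ σ x ∈ jetSpan n ι β φ k := by
  induction k generalizing x with
  | zero =>
    have : jetSpan n ι β φ 0 ≤ (jetSpan n ι β φ 0).comap (glAct D L₀ ρ σ) := by
      refine Submodule.span_le.2 ?_
      rintro _ ⟨Z, rfl⟩
      exact (glAct_gen ρ σ Z).2
    exact this hx
  | succ k ih =>
    have : jetSpan n ι β φ (k + 1) ≤ (jetSpan n ι β φ (k + 1)).comap (glAct D L₀ ρ σ) := by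
      refine iSup_le fun μ => ?_
      rintro _ ⟨y, hy, rfl⟩
      rw [mem_comap, glAct, lie_single_totalD, lie_xi_zero]
      refine add_mem (mem_iSup_of_mem μ ⟨_, ih hy, rfl⟩) ?_
      split_ifs
      · exact mem_iSup_of_mem σ ⟨_, hy, rfl⟩
      · exact zero_mem _
    exact this hx

variable (D L₀) in
/-- Finite-dimensional `gl(n)`-stable spaces of local functions with constant coefficients. -/
structure IsGlStable (S : Submodule ℝ 𝓐) : Prop where
  fg : S.FG
  le : S ≤ toSubmodule (constAlg n ι β φ)
  act : ∀ ρ σ, ∀ x ∈ S, glAct D L₀ ρ σ x ∈ S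

lemma IsGlStable.sup {S T : Submodule ℝ 𝓐} (hS : IsGlStable D L₀ S)
    (hT : IsGlStable D L₀ T) : IsGlStable D L₀ (S ⊔ T) where
  fg := hS.fg.sup hT.fg
  le := sup_le hS.le hT.le
  act ρ σ x hx := by
    obtain ⟨y, hy, z, hz, rfl⟩ := Submodule.mem_sup.1 hx
    rw [map_add]
    exact add_mem (mem_sup_left (hS.act ρ σ y hy)) (mem_sup_right (hT.act ρ σ z hz))

lemma IsGlStable.mul {S T : Submodule ℝ 𝓐} (hS : IsGlStable D L₀ S)
    (hT : IsGlStable D L₀ T) : IsGlStable D L₀ (S * T) where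
  fg := hS.fg.mul hT.fg
  le := Submodule.mul_le.2 fun x hx y hy => (constAlg n ι β φ).mul_mem (hS.le hx) (hT.le hy)
  act ρ σ x hx := by
    have : S * T ≤ (S * T).comap (glAct D L₀ ρ σ) := Submodule.mul_le.2 fun x hx y hy => by
      rw [mem_comap, glAct, lie_mul]
      exact add_mem (mul_mem_mul (hS.act ρ σ x hx) hy) (mul_mem_mul hx (hT.act ρ σ y hy))
    exact this hx

lemma isGlStable_one : IsGlStable D L₀ (1 : Submodule ℝ 𝓐) where
  fg := by rw [one_eq_span]; exact fg_span (Set.finite_singleton _)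
  le := by
    rw [one_eq_span]
    exact Submodule.span_le.2 (Set.singleton_subset_iff.2 (constAlg n ι β φ).one_mem)
  act ρ σ x hx := by
    obtain ⟨r, rfl⟩ := hx
    change glAct D L₀ ρ σ (r • 1) ∈ _
    rw [map_smul, glAct, (isSDer_lie _ _).map_one, smul_zero]
    exact zero_mem _

lemma exists_isGlStable_gen {z : 𝓙} (hz : frameIdx z = none) :
    ∃ S, IsGlStable D L₀ S ∧ gen z ∈ S := by
  obtain ⟨Z, α⟩ := z
  by_cases h : α = 0
  · subst h
    exact ⟨undiffSpan n ι β φ, ⟨undiffSpan_fg, undiffSpan_le_constAlg,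
      fun ρ σ x hx => glAct_undiffSpan ρ σ hx⟩, gen_mem_undiffSpan hz⟩
  · exact ⟨jetSpan n ι β φ α.degree, ⟨jetSpan_fg _, jetSpan_le_constAlg (by simpa [degree_eq_zero_iff] using h),
      fun ρ σ x hx => glAct_jetSpan _ ρ σ hx⟩, gen_mem_jetSpan Z α⟩

/-- Combinations of elements of `S` with coefficients that are functions of the vielbein in `c`. -/
def coeffSpan (c : Submodule ℝ 𝓒) (S : Submodule ℝ 𝓐) :
    Submodule ℝ 𝓐 := c.map (frameFun (n := n) (ι := ι) (β := β) (φ := φ)).toLinearMap * S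

lemma coeffSpan_mono {c : Submodule ℝ 𝓒} {S T : Submodule ℝ 𝓐}
    (h : S ≤ T) : coeffSpan c S ≤ coeffSpan c T := mul_le_mul' le_rfl h

lemma exists_isGlStable (x : 𝓐) : ∃ S, IsGlStable D L₀ S ∧ x ∈ coeffSpan ⊤ S := by
  induction x using LocalFun.induction with
  | hf f =>
    refine ⟨1, isGlStable_one, ?_⟩
    rw [coeffSpan, mul_one]
    exact ⟨f, trivial, rfl⟩
  | hadd x y hx hy =>
    obtain ⟨S, hS, hx⟩ := hx
    obtain ⟨T, hT, hy⟩ := hy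
    exact ⟨S ⊔ T, hS.sup hT, add_mem (coeffSpan_mono le_sup_left hx)
      (coeffSpan_mono le_sup_right hy)⟩
  | hg z x hx =>
    obtain ⟨S, hS, hx⟩ := hx
    cases h : frameIdx z with
    | none =>
      obtain ⟨T, hT, hz⟩ := exists_isGlStable_gen (D := D) (L₀ := L₀) h
      refine ⟨T * S, hT.mul hS, ?_⟩
      have : coeffSpan ⊤ S ≤ (coeffSpan ⊤ (T * S)).comap (mulLeft ℝ (gen z)) := by
        refine Submodule.mul_le.2 ?_
        rintro _ ⟨f, -, rfl⟩ y hy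
        change gen z * (frameFun f * y) ∈ coeffSpan ⊤ (T * S)
        rw [← mul_assoc, ← frameFun_comm, mul_assoc]
        exact mul_mem_mul ⟨f, trivial, rfl⟩ (mul_mem_mul hz hy)
      exact this hx
    | some p =>
      refine ⟨S, hS, ?_⟩
      obtain rfl := eq_frameJet h
      rw [gen_frame]
      have : coeffSpan ⊤ S ≤ (coeffSpan ⊤ S).comap (mulLeft ℝ (frameFun (frameCoord p) : 𝓐)) := by
        refine Submodule.mul_le.2 ?_
        rintro _ ⟨f, -, rfl⟩ y hy
        change frameFun (frameCoord p) * (frameFun f * y) ∈ coeffSpan ⊤ S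
        rw [← mul_assoc, ← map_mul]
        exact mul_mem_mul ⟨_, trivial, rfl⟩ hy
      exact this hx

lemma glAct_frameFun (ρ σ : Fin n) (f : 𝓒) : glAct D L₀ ρ σ (frameFun f) =
    frameFun (∑ a, frameCoord (σ, a) * pd (ρ, a) f) := by
  rw [glAct, (isSDer_lie _ _).frame, Fintype.sum_prod_type, map_sum]
  have : ∀ μ a, 𝓠 (.inl σ) (single ρ 1) (gen (frameJet (μ, a))) =
      if ρ = μ then vb σ a else 0 := fun μ a => (hasLie_e μ a).xi ρ σ
  simp only [this, ite_mul, zero_mul, map_mul]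
  rw [sum_comm]
  simp only [sum_ite_eq, mem_univ, if_true, vb_eq]

/-- The functions on `GL⁺(n)` vanishing at `h`. -/
def vanishing (h : GLp n) : Submodule ℝ 𝓒 where
  carrier := {f | f.1 h = 0}
  add_mem' {f g} hf hg := by
    change f.1 h + g.1 h = 0
    rw [show f.1 h = 0 from hf, show g.1 h = 0 from hg, add_zero]
  zero_mem' := rfl
  smul_mem' r f hf := by
    change r • f.1 h = 0
    rw [show f.1 h = 0 from hf, smul_zero]

lemma eq_zero_of_mem_coeffSpan {S : Submodule ℝ 𝓐} (hS : IsGlStable D L₀ S)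
    {h : GLp n} (hy : y ∈ coeffSpan (vanishing h) S)
    (hinv : ∀ ρ σ, glAct D L₀ ρ σ y = 0) : y = 0 := by
  have : Module.Finite ℝ S := Module.Finite.iff_fg.2 hS.fg
  let b := Module.finBasis ℝ S
  obtain ⟨g, hg, rfl⟩ : ∃ g : Fin (finrank ℝ S) → 𝓒,
      (∀ j, g j ∈ vanishing h) ∧ y = ∑ j, frameFun (g j) * (b j : 𝓐) := by
    clear hinv
    induction hy using Submodule.mul_induction_on' with
    | mem_mul_mem _ hm w hw =>
      obtain ⟨f, hf, rfl⟩ := hm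
      refine ⟨fun j => b.repr ⟨w, hw⟩ j • f, fun j => smul_mem _ _ hf, ?_⟩
      have e := congrArg Subtype.val (b.sum_repr ⟨w, hw⟩)
      rw [AddSubmonoidClass.coe_finsetSum] at e
      change frameFun f * w = _
      change _ = w at e
      conv_lhs => rw [← e]
      rw [mul_sum]
      refine sum_ext fun j _ => ?_
      rw [map_smul, smul_mul_assoc]
      exact mul_smul_comm _ _ _
    | add x _ y _ hx hy =>
      obtain ⟨g, hg, rfl⟩ := hx
      obtain ⟨g', hg', rfl⟩ := hy
      refine ⟨g + g', fun j => add_mem (hg j) (hg' j), ?_⟩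
      simp [add_mul, sum_add_distrib]
  let c : Fin n → Fin n → Fin (finrank ℝ S) → Fin (finrank ℝ S) → ℝ :=
    fun ρ σ j k => b.repr ⟨glAct D L₀ ρ σ (b j), hS.act ρ σ _ (b j).2⟩ k
  have hc : ∀ ρ σ j, glAct D L₀ ρ σ (b j) = ∑ k, c ρ σ j k • (b k : 𝓐) := fun ρ σ j => by
    have e := congrArg Subtype.val (b.sum_repr ⟨glAct D L₀ ρ σ (b j), hS.act ρ σ _ (b j).2⟩)
    rw [AddSubmonoidClass.coe_finsetSum] at e
    exact e.symm
  have hbi : LinearIndependent ℝ fun j => (b j : 𝓐) :=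
    b.linearIndependent.map' S.subtype (ker_subtype S)
  have h1 : ∀ ρ σ k, ∑ a, frameCoord (σ, a) * pd (ρ, a) (g k) + ∑ j, c ρ σ j k • g j = 0 := fun ρ σ k => by
    refine frameFun_coeff_eq_zero _ hbi (fun j => hS.le (b j).2) (fun k =>
      ∑ a, frameCoord (σ, a) * pd (ρ, a) (g k) + ∑ j, c ρ σ j k • g j) ?_ k
    have e := hinv ρ σ
    simp only [map_sum, glAct, lie_mul] at e
    rw [sum_add_distrib] at e
    simp only [map_add, add_mul, sum_add_distrib]
    rw [← e]
    congr 1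
    · refine sum_ext fun j _ => ?_
      congr 1
      exact (glAct_frameFun ρ σ (g j)).symm
    · simp only [map_sum, map_smul, sum_mul, smul_mul_assoc]
      rw [sum_comm]
      refine sum_ext fun j _ => ?_
      rw [show 𝓠 (.inl σ) (single ρ 1) (b j : 𝓐) = _ from hc ρ σ j, mul_sum]
      refine sum_ext fun k _ => ?_
      rw [mul_smul_comm]
  have h2 : ∀ (p : Fin n × Fin n) k, pd p (g k) =
      ∑ j, (-∑ σ, c p.1 σ j k • invFrameFun p.2 σ) * g j := by
    rintro ⟨ρ, a⟩ k
    have e1 : pd (ρ, a) (g k) =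
        ∑ σ, invFrameFun a σ * ∑ b, frameCoord (σ, b) * pd (ρ, b) (g k) := by
      simp only [mul_sum]
      rw [sum_comm]
      simp only [← mul_assoc, ← sum_mul, invFrameFun_mul]
      simp
    rw [e1]
    have e2 : ∀ σ, ∑ b, frameCoord (σ, b) * pd (ρ, b) (g k) = -∑ j, c ρ σ j k • g j := fun σ =>
      eq_neg_of_add_eq_zero_left (h1 ρ σ k)
    simp only [e2, neg_mul, sum_mul, sum_neg_distrib, mul_neg, mul_sum,
      smul_mul_assoc, mul_smul_comm]
    rw [sum_comm]
  have h3 : ∀ j, g j = 0 := fun j => eq_zero_of_linear_system (isPreconnected_GLp n) g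
    (fun p k j => -∑ σ, c p.1 σ j k • invFrameFun p.2 σ) h2 h hg j
  exact sum_eq_zero fun j _ => by rw [h3, map_zero, zero_mul]

variable (D L₀) in
/-- A `gl(n)`-invariant local function whose coefficients vanish at a point is zero. -/
lemma eq_zero_of_invariant {I : Type*} (s : Finset I) (f : I → SmoothFun (GLp n))
    (x : I → LocalFun n ι β φ) (h : GLp n) (hf : ∀ i ∈ s, (f i).1 h = 0)
    (hinv : ∀ ρ σ, glAct D L₀ ρ σ (∑ i ∈ s, frameFun (f i) * x i) = 0) :
    ∑ i ∈ s, frameFun (f i) * x i = 0 := by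
  suffices h1 : ∀ t ⊆ s, ∃ S, IsGlStable D L₀ S ∧
      ∑ i ∈ t, frameFun (f i) * x i ∈ coeffSpan (vanishing h) S by
    obtain ⟨S, hS, hs⟩ := h1 s subset_rfl
    exact eq_zero_of_mem_coeffSpan hS hs hinv
  intro t
  induction t using Finset.induction_on with
  | empty => exact fun _ => ⟨1, isGlStable_one, by simp⟩
  | insert i t hi ih =>
    intro ht
    obtain ⟨S, hS, hs⟩ := ih ((Finset.subset_insert i t).trans ht)
    obtain ⟨T, hT, hx⟩ := exists_isGlStable (D := D) (L₀ := L₀) (x i)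
    refine ⟨T ⊔ S, hT.sup hS, ?_⟩
    rw [sum_insert hi]
    refine add_mem ?_ (coeffSpan_mono le_sup_right hs)
    have : coeffSpan ⊤ T ≤ (coeffSpan (vanishing h) T).comap
        (mulLeft ℝ (frameFun (f i) : LocalFun n ι β φ)) := by
      refine Submodule.mul_le.2 ?_
      rintro _ ⟨g, -, rfl⟩ y hy
      change frameFun (f i) * (frameFun g * y) ∈ coeffSpan (vanishing h) T
      rw [← mul_assoc, ← map_mul]
      refine mul_mem_mul ⟨_, ?_, rfl⟩ hy
      change (f i).1 h * g.1 h = 0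
      rw [hf i (ht (mem_insert_self i t)), zero_mul]
    exact coeffSpan_mono le_sup_left (this hx)

end GlAction

section Graded

variable {V W : Type*} [AddCommGroup V] [Module ℝ V] [AddCommGroup W] [Module ℝ W]

/-- A grading of `V` by eigenspaces of `T`. -/
structure IsGrading (T : V →ₗ[ℝ] V) (A : ℤ → Submodule ℝ V) : Prop where
  eigen : ∀ k, ∀ x ∈ A k, T x = (k : ℝ) • x
  top : ∀ x, x ∈ ⨆ k, A k

lemma IsGrading.iSupIndep {T : V →ₗ[ℝ] V} {A : ℤ → Submodule ℝ V} (h : IsGrading T A) :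
    iSupIndep A := by
  refine ((Module.End.eigenspaces_iSupIndep T).comp
    (f := fun k : ℤ => (k : ℝ)) Int.cast_injective).mono fun k x hx => ?_
  exact Module.End.mem_eigenspace_iff.2 (h.eigen k x hx)

lemma IsGrading.isInternal {T : V →ₗ[ℝ] V} {A : ℤ → Submodule ℝ V} (h : IsGrading T A) :
    DirectSum.IsInternal A := DirectSum.isInternal_submodule_of_iSupIndep_of_iSup_eq_top h.iSupIndep
    (eq_top_iff.2 fun x _ => h.top x)

/-- The projection onto the homogeneous component. -/
def IsGrading.proj {T : V →ₗ[ℝ] V} {A : ℤ → Submodule ℝ V} (h : IsGrading T A) (k : ℤ) : V →ₗ[ℝ] V :=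
  (A k).subtype ∘ₗ DirectSum.component ℝ ℤ (fun k => A k) k ∘ₗ
    (LinearEquiv.ofBijective (DirectSum.coeLinearMap A) h.isInternal).symm.toLinearMap

variable {T : V →ₗ[ℝ] V} {A : ℤ → Submodule ℝ V}

lemma IsGrading.proj_mem (h : IsGrading T A) (k : ℤ) (x : V) : h.proj k x ∈ A k := Subtype.mem _

lemma IsGrading.symm_apply (h : IsGrading T A) {k : ℤ} {x : V} (hx : x ∈ A k) :
    (LinearEquiv.ofBijective (DirectSum.coeLinearMap A) h.isInternal).symm x =
      DirectSum.lof ℝ ℤ (fun k => A k) k ⟨x, hx⟩ := by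
  rw [LinearEquiv.symm_apply_eq]
  exact (DirectSum.coeLinearMap_lof A k ⟨x, hx⟩).symm

lemma IsGrading.proj_of_mem (h : IsGrading T A) {k : ℤ} {x : V} (hx : x ∈ A k) : h.proj k x = x := by
  change ((DirectSum.component ℝ ℤ (fun k => A k) k
    ((LinearEquiv.ofBijective (DirectSum.coeLinearMap A) h.isInternal).symm x) : A k) : V) = x
  rw [h.symm_apply hx, DirectSum.component.lof_self]

lemma IsGrading.proj_of_ne (h : IsGrading T A) {k l : ℤ} (hkl : l ≠ k) {x : V} (hx : x ∈ A l) : h.proj k x = 0 := by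
  change ((DirectSum.component ℝ ℤ (fun k => A k) k
    ((LinearEquiv.ofBijective (DirectSum.coeLinearMap A) h.isInternal).symm x) : A k) : V) = 0
  rw [h.symm_apply hx, DirectSum.component.of, dif_neg hkl]
  rfl

lemma IsGrading.induction (h : IsGrading T A) {p : V → Prop} (hm : ∀ k, ∀ x ∈ A k, p x) (h0 : p 0)
    (hadd : ∀ x y, p x → p y → p (x + y)) (x : V) : p x :=
  Submodule.iSup_induction A (motive := p) (h.top x) hm h0 hadd

lemma IsGrading.exists_sum (h : IsGrading T A) (x : V) : ∃ s : Finset ℤ, x = ∑ k ∈ s, h.proj k x := by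
  obtain ⟨f, hf, hx⟩ := (Submodule.mem_iSup_iff_exists_finsupp A x).1 (h.top x)
  refine ⟨f.support, ?_⟩
  have h1 : ∀ k ∈ f.support, h.proj k x = f k := fun k hk => by
    rw [← hx, map_finsuppSum, Finsupp.sum, sum_eq_single k]
    · exact h.proj_of_mem (hf k)
    · exact fun l _ hl => h.proj_of_ne hl (hf l)
    · exact fun h' => (h' hk).elim
  rw [sum_ext h1]
  exact hx.symm

lemma IsGrading.mem_of_eigen (h : IsGrading T A) {k : ℤ} {x : V} (hx : T x = (k : ℝ) • x) : x ∈ A k := by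
  have h1 : ∀ (l : ℤ) (y : V), T (h.proj l y) = h.proj l (T y) := fun l y => by
    induction y using h.induction with
    | hm m y hy =>
      by_cases hl : m = l
      · subst hl
        rw [h.proj_of_mem hy, h.eigen _ _ hy, map_smul, h.proj_of_mem hy]
      · rw [h.proj_of_ne hl hy, h.eigen _ _ hy, map_smul, h.proj_of_ne hl hy, map_zero, smul_zero]
    | h0 => simp
    | hadd y z hy hz => simp only [map_add, hy, hz]
  obtain ⟨s, hs⟩ := h.exists_sum x
  rw [hs]
  refine sum_mem fun l _ => ?_
  by_cases hl : l = k
  · exact hl ▸ h.proj_mem l x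
  · have h2 := h1 l x
    rw [hx, map_smul, h.eigen l _ (h.proj_mem l x), ← sub_eq_zero, ← sub_smul] at h2
    rcases smul_eq_zero.1 h2 with h3 | h3
    · exact (hl (by exact_mod_cast sub_eq_zero.1 h3)).elim
    · rw [h3]; exact zero_mem _

lemma IsGrading.mem_iff (h : IsGrading T A) {k : ℤ} {x : V} : x ∈ A k ↔ T x = (k : ℝ) • x :=
  ⟨h.eigen k x, h.mem_of_eigen⟩

lemma IsGrading.proj_map (h : IsGrading T A) {T' : W →ₗ[ℝ] W} {A' : ℤ → Submodule ℝ W} (h' : IsGrading T' A')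
    {S : V →ₗ[ℝ] W} {c : ℤ} (hS : ∀ k, ∀ x ∈ A k, S x ∈ A' (k + c)) (k : ℤ) (x : V) :
    h'.proj (k + c) (S x) = S (h.proj k x) := by
  induction x using h.induction with
  | hm l x hx =>
    by_cases hl : l = k
    · subst hl
      rw [h.proj_of_mem hx, h'.proj_of_mem (hS _ _ hx)]
    · rw [h.proj_of_ne hl hx, h'.proj_of_ne (fun h => hl (add_right_cancel h)) (hS _ _ hx), map_zero]
  | h0 => simp
  | hadd y z hy hz => simp only [map_add, hy, hz]

end Graded

section FormGrading

variable {κ : Type*} [Fintype κ] [DecidableEq κ] {U : TopologicalSpace.Opens (κ → ℝ)}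

/-- The derivation of the Grassmann algebra counting the generators. -/
def Grassmann.count (κ : Type*) [Fintype κ] : Grassmann κ →ₗ[ℝ] Grassmann κ :=
  ∑ i, mulLeft ℝ (ggen i) ∘ₗ gdL i

lemma Grassmann.count_apply (x : Grassmann κ) : Grassmann.count κ x = ∑ i, ggen i * gdL i x := by
  simp [Grassmann.count, sum_app]

lemma Grassmann.lin_eq_sum (v : κ →₀ ℝ) : lin v = ∑ i, v i • ggen i := by
  conv_lhs => rw [← Finsupp.univ_sum_single v, map_sum]
  refine sum_ext fun i _ => ?_
  rw [ggen, ← map_smul, Finsupp.smul_single, smul_eq_mul, mul_one]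

lemma Grassmann.gen_mul_lin (i : κ) (v : κ →₀ ℝ) :
    (ggen i * lin v : Grassmann κ) = -(lin v * ggen i) :=
  eq_neg_of_add_eq_zero_left (lin_add_mul_swap _ _)

lemma Grassmann.count_lin_mul (v : κ →₀ ℝ) (x : Grassmann κ) :
    Grassmann.count κ (lin v * x) = lin v * x + lin v * Grassmann.count κ x := by
  have e : lin v * x = ∑ i, v i • (ggen i * x) := by
    conv_lhs => rw [Grassmann.lin_eq_sum v]
    simp only [sum_mul, smul_mul_assoc]
  simp only [Grassmann.count_apply, dL_lin_mul, mul_sub,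
    mul_smul_comm, ← mul_assoc, Grassmann.gen_mul_lin, mul_sum, neg_mul,
    sub_neg_eq_add]
  rw [e, sum_add_distrib]

lemma Grassmann.dL_gen_mul (i j : κ) (x : Grassmann κ) : gdL i (ggen j * x) =
    (if i = j then x else 0) - ggen j * gdL i x := by
  rw [ggen, dL_lin_mul]
  by_cases h : i = j
  · subst h; simp
  · simp [h]

lemma Grassmann.count_dL (i : κ) (x : Grassmann κ) :
    Grassmann.count κ (gdL i x) = gdL i (Grassmann.count κ x) - gdL i x := by
  simp only [Grassmann.count_apply, map_sum, Grassmann.dL_gen_mul, sum_sub_distrib]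
  rw [sum_ite_eq]
  simp only [mem_univ, if_true]
  simp only [dL_comm i, mul_neg, sum_neg_distrib]
  abel

lemma Grassmann.count_algebraMap (r : ℝ) : Grassmann.count κ (algebraMap ℝ _ r) = 0 := by
  simp [Grassmann.count_apply, dL_algebraMap]

lemma Grassmann.deg_induction {C : ℕ → Grassmann κ → Prop}
    (h0 : ∀ r, C 0 (algebraMap ℝ _ r)) (hadd : ∀ k x y, C k x → C k y → C k (x + y))
    (hmul : ∀ k v x, C k x → C (k + 1) (lin v * x)) {k : ℕ} {x : Grassmann κ}
    (hx : x ∈ Grassmann.deg κ k) : C k x := by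
  refine Submodule.pow_induction_on_left' (R := ℝ) (A := ExteriorAlgebra ℝ (κ →₀ ℝ))
    (range (ExteriorAlgebra.ι ℝ)) (C := fun n x _ => C n x) h0
    (fun x y i _ _ hx hy => hadd i x y hx hy) ?_ hx
  rintro _ ⟨v, rfl⟩ i x _ h
  exact hmul i v x h

lemma Grassmann.count_deg {k : ℕ} {x : Grassmann κ} (hx : x ∈ Grassmann.deg κ k) :
    Grassmann.count κ x = (k : ℝ) • x := by
  refine Grassmann.deg_induction (C := fun k x => Grassmann.count κ x = (k : ℝ) • x)
    (fun r => ?_) (fun k x y hx hy => ?_) (fun k v x hx => ?_) hx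
  · rw [Grassmann.count_algebraMap]; simp
  · rw [map_add, hx, hy, smul_add]
  · rw [Grassmann.count_lin_mul, hx, mul_smul_comm]; push_cast; rw [add_smul, one_smul, add_comm]

lemma Grassmann.parity_deg {k : ℕ} {x : Grassmann κ} (hx : x ∈ Grassmann.deg κ k) :
    gpar x = (-1 : ℝ) ^ k • x := by
  refine Grassmann.deg_induction (C := fun k x => gpar x = (-1 : ℝ) ^ k • x)
    (fun r => ?_) (fun k x y hx hy => ?_) (fun k v x hx => ?_) hx
  · rw [AlgHom.commutes]; simp
  · rw [map_add, hx, hy, smul_add]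
  · rw [map_mul, parity_lin, hx, mul_smul_comm, pow_succ]; simp

lemma Grassmann.mem_iSup_deg (x : Grassmann κ) : x ∈ ⨆ k, Grassmann.deg κ k := by
  have h := CliffordAlgebra.iSup_ι_range_eq_top (Q := (0 : QuadraticForm ℝ (κ →₀ ℝ)))
  have h2 : x ∈ (⊤ : Submodule ℝ (CliffordAlgebra (0 : QuadraticForm ℝ (κ →₀ ℝ)))) := trivial
  rw [← h] at h2
  exact h2

lemma Grassmann.deg_eq_bot {k : ℕ} (hk : Fintype.card κ < k) : Grassmann.deg κ k = ⊥ := by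
  change ⋀[ℝ]^k (κ →₀ ℝ) = ⊥
  have h := exteriorPower.finrank_eq (R := ℝ) (M := κ →₀ ℝ) (n := k)
  rw [Module.finrank_finsupp_self, Nat.choose_eq_zero_of_lt hk] at h
  exact Submodule.finrank_eq_zero.1 h

lemma Grassmann.lin_mul_mem_deg (v : κ →₀ ℝ) {k : ℕ} {x : Grassmann κ}
    (hx : x ∈ Grassmann.deg κ k) : lin v * x ∈ Grassmann.deg κ (k + 1) := by
  have h : (range (ExteriorAlgebra.ι ℝ (M := κ →₀ ℝ))) ^ (k + 1) =
    range (ExteriorAlgebra.ι ℝ (M := κ →₀ ℝ)) *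
      range (ExteriorAlgebra.ι ℝ (M := κ →₀ ℝ)) ^ k := pow_succ' _ _
  change _ ∈ (range (ExteriorAlgebra.ι ℝ (M := κ →₀ ℝ))) ^ (k + 1)
  rw [h]
  exact mul_mem_mul ⟨v, rfl⟩ hx

/-- The contraction of forms with a coordinate vector field. -/
def contract (i : κ) : Form U →ₗ[ℝ] Form U := map LinearMap.id (gdL i)

/-- Left multiplication with a coordinate differential. -/
def wedge (i : κ) : Form U →ₗ[ℝ] Form U := map LinearMap.id (mulLeft ℝ (ggen i))

variable (U) in
/-- The degree operator on forms. -/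
def formCount : Form U →ₗ[ℝ] Form U := map LinearMap.id (Grassmann.count κ)

lemma formCount_eq (w : Form U) : formCount U w = ∑ i, wedge i (contract i w) := by
  induction w using induction_on with
  | zero => simp
  | add x y hx hy => simp only [map_add, hx, hy, sum_add_distrib]
  | tmul f v =>
    simp only [formCount, wedge, contract, map_tmul, Grassmann.count_apply,
      mulLeft_apply, TensorProduct.tmul_sum, id_apply]

lemma formCount_contract (i : κ) (w : Form U) :
    formCount U (contract i w) = contract i (formCount U w) - contract i w := by
  induction w using induction_on with
  | zero => simp
  | add x y hx hy => simp only [map_add, hx, hy]; abel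
  | tmul f v =>
    simp only [formCount, contract, map_tmul, Grassmann.count_dL, TensorProduct.tmul_sub, id_apply]

lemma formCount_extD (w : Form U) : formCount U (extD w) = extD (formCount U w) + extD w := by
  induction w using induction_on with
  | zero => simp
  | add x y hx hy => simp only [map_add, hx, hy]; abel
  | tmul f v =>
    simp only [formCount, extD, sum_app, map_sum, map_tmul,
      mulLeft_apply, id_apply, ← sum_add_distrib]
    refine sum_ext fun i _ => ?_
    rw [ggen, Grassmann.count_lin_mul, tmul_add, add_comm]

lemma isGrading_form : IsGrading (formCount U) (formDeg U) where
  eigen k w hw := by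
    refine LinearMap.eqOn_span (g := (k : ℝ) • LinearMap.id) ?_ hw
    rintro _ ⟨f, l, rfl, v, hv, rfl⟩
    change f ⊗ₜ[ℝ] Grassmann.count κ v = ((l : ℤ) : ℝ) • f ⊗ₜ[ℝ] v
    rw [Grassmann.count_deg hv, tmul_smul, Int.cast_natCast]
  top w := by
    induction w using induction_on with
    | zero => exact zero_mem _
    | add x y hx hy => exact add_mem hx hy
    | tmul f v =>
      have hv := Grassmann.mem_iSup_deg v
      induction hv using Submodule.iSup_induction' with
      | mem k v hv =>
        exact mem_iSup_of_mem (k : ℤ) (subset_span ⟨f, k, rfl, v, hv, rfl⟩)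
      | zero => rw [tmul_zero]; exact zero_mem _
      | add x y _ _ hx hy => rw [tmul_add]; exact add_mem hx hy

lemma extD_mem_formDeg (p : ℤ) : ∀ w ∈ formDeg U p, extD w ∈ formDeg U (p + 1) := fun w hw =>
  isGrading_form.mem_of_eigen (by
    rw [formCount_extD, isGrading_form.eigen p w hw, map_smul]; push_cast; rw [add_smul, one_smul])

lemma contract_mem_formDeg (i : κ) (p : ℤ) {w : Form U} (hw : w ∈ formDeg U p) :
    contract i w ∈ formDeg U (p - 1) := isGrading_form.mem_of_eigen (by
    rw [formCount_contract, isGrading_form.eigen p w hw, map_smul]; push_cast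
    rw [sub_smul, one_smul])

lemma formDeg_neg {p : ℤ} (hp : p < 0) : formDeg U p = ⊥ := by
  refine (Submodule.span_eq_bot).2 ?_
  rintro x ⟨f, k, hk, -⟩
  omega

lemma mem_formDeg_zero {w : Form U} (hw : w ∈ formDeg U 0) : ∃ f, w = f ⊗ₜ 1 := by
  induction hw using span_induction with
  | mem x hx =>
    obtain ⟨f, k, hk, v, hv, rfl⟩ := hx
    obtain rfl : k = 0 := by exact_mod_cast hk
    obtain ⟨r, rfl⟩ : ∃ r : ℝ, v = algebraMap ℝ _ r := by
      have : v ∈ (1 : Submodule ℝ (ExteriorAlgebra ℝ (κ →₀ ℝ))) := by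
        have h2 : v ∈ range (ExteriorAlgebra.ι ℝ (M := κ →₀ ℝ)) ^ 0 := hv
        rwa [pow_zero] at h2
      obtain ⟨r, hr⟩ := this
      refine ⟨r, hr.symm.trans ?_⟩
      exact (algebraMap_eq_smul_one (A := ExteriorAlgebra ℝ (κ →₀ ℝ)) r).symm
    exact ⟨r • f, by rw [algebraMap_eq_smul_one, TensorProduct.smul_tmul]⟩
  | zero => exact ⟨0, by rw [zero_tmul]⟩
  | add x y _ _ hx hy =>
    obtain ⟨f, rfl⟩ := hx
    obtain ⟨g, rfl⟩ := hy
    exact ⟨f + g, by rw [add_tmul]⟩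
  | smul r x _ hx =>
    obtain ⟨f, rfl⟩ := hx
    exact ⟨r • f, rfl⟩

lemma formSign_formSign (w : Form U) : formSign (formSign w) = w := by
  induction w using induction_on with
  | zero => simp
  | add x y hx hy => simp only [map_add, hx, hy]
  | tmul f v => exact congrArg (f ⊗ₜ[ℝ] ·) (Grassmann.parity_parity v)

lemma formSign_extD (w : Form U) : formSign (extD w) = -extD (formSign w) := by
  induction w using induction_on with
  | zero => simp
  | add x y hx hy => simp only [map_add, hx, hy]; abel
  | tmul f v =>
    simp only [extD, formSign, sum_app, map_sum, map_tmul,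
      mulLeft_apply, id_apply, ← sum_neg_distrib, AlgHom.toLinearMap_apply, map_mul]
    refine sum_ext fun i _ => ?_
    rw [ggen, parity_lin, neg_mul, tmul_neg]

lemma formSign_of_mem {p : ℤ} {w : Form U} (hw : w ∈ formDeg U p) :
    formSign w ∈ formDeg U p ∧ (formSign w = w ∨ formSign w = -w) := by
  have : formSign w = (-1 : ℝ) ^ p • w := by
    refine LinearMap.eqOn_span (g := (-1 : ℝ) ^ p • LinearMap.id) ?_ hw
    rintro _ ⟨f, k, rfl, v, hv, rfl⟩
    change f ⊗ₜ[ℝ] gpar v = (-1 : ℝ) ^ _ • f ⊗ₜ[ℝ] v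
    rw [Grassmann.parity_deg hv, tmul_smul, zpow_natCast]
  refine ⟨this ▸ smul_mem _ _ hw, ?_⟩
  rw [this]
  rcases Int.even_or_odd p with h | h
  · rw [h.neg_one_zpow, one_smul]; exact Or.inl rfl
  · rw [h.neg_one_zpow, neg_smul, one_smul]; exact Or.inr rfl

/-- The homogeneous components of a form. -/
def formProj (p : ℤ) : Form U →ₗ[ℝ] Form U := isGrading_form.proj p

lemma formProj_mem (p : ℤ) (w : Form U) : formProj p w ∈ formDeg U p := isGrading_form.proj_mem p w

lemma formProj_of_mem {p : ℤ} {w : Form U} (hw : w ∈ formDeg U p) : formProj p w = w :=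
  isGrading_form.proj_of_mem hw

lemma formProj_extD (p : ℤ) (w : Form U) : formProj (p + 1) (extD w) = extD (formProj p w) :=
  IsGrading.proj_map (S := extD (U := U)) (c := 1) isGrading_form isGrading_form extD_mem_formDeg p w

/-- An exact form of degree `p` has a primitive of degree `p - 1`. -/
lemma IsExact.exists_mem {p : ℤ} {w : Form U} (hw : w ∈ formDeg U p) (h : IsExact w) :
    ∃ v ∈ formDeg U (p - 1), extD v = w := by
  obtain ⟨v, rfl⟩ := h
  refine ⟨formProj (p - 1) v, formProj_mem _ _, ?_⟩
  rw [← formProj_extD, sub_add_cancel, formProj_of_mem hw]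

end FormGrading

open EYM.Grassmann (count_apply deg_induction count_lin_mul dL_gen_mul lin_mul_mem_deg lin_eq_sum
  gen_mul_lin count_dL count_algebraMap count_deg parity_deg mem_iSup_deg deg_eq_bot)

section FrameForms

variable (D) in
/-- The substitution `θ ↦ s e` in the Grassmann algebra. -/
def substGrassmann : Grassmann (Fin n × Fin n) →ₐ[ℝ] 𝓐 :=
  Grassmann.lift (brstFrame D) (brstFrame_sq D)

lemma substFrame_tmul (f : 𝓒) (v : Grassmann (Fin n × Fin n)) :
    substFrame D (f ⊗ₜ v) = frameFun f * substGrassmann D v :=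
  Algebra.TensorProduct.lift_tmul _ _ _ _ _

lemma substGrassmann_lin (v : Fin n × Fin n →₀ ℝ) :
    substGrassmann D (lin v) = brstFrame D v := ExteriorAlgebra.lift_ι_apply ℝ _ _ v

lemma brstFrame_eq (v : Fin n × Fin n →₀ ℝ) :
    brstFrame D v = ∑ p, v p • 𝓢 (vb p.1 p.2) := by
  rw [brstFrame, linearCombination_apply, Finsupp.sum_fintype _ _ (by simp)]
  simp only [brst_fld]

lemma substGrassmann_gen (p : Fin n × Fin n) :
    substGrassmann D (ggen p) = 𝓢 (vb p.1 p.2) := by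
  rw [ggen, substGrassmann_lin, brstFrame_eq (L₀ := L₀)]
  simp [single_apply]

section Instances

variable [adm : Admissible D L₀]

lemma isHom_brst_vb (p : Fin n × Fin n) : IsHom true (𝓢 (vb p.1 p.2)) :=
  (isSDer_brst adm.even).isHom (isHom_vb _ _)

lemma parity_substGrassmann (L₀ : 𝓐) [Admissible D L₀] (v : Grassmann (Fin n × Fin n)) :
    parity (substGrassmann D v) = substGrassmann D (gpar v) := by
  induction v using Grassmann.induction with
  | h0 r =>
    rw [AlgHom.commutes, AlgHom.commutes, AlgHom.commutes, algebraMap_eq_smul_one, map_smul,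
      parity_one]
  | hadd x y hx hy => simp only [map_add, hx, hy]
  | hmul x v hx =>
    rw [map_mul, parity_mul, hx, map_mul, map_mul, parity_lin, map_neg,
      substGrassmann_lin, brstFrame_eq (L₀ := L₀)]
    congr 1
    rw [map_sum, ← sum_neg_distrib]
    refine sum_ext fun p _ => ?_
    rw [map_smul, isHom_brst_vb p, sgn_true, neg_one_smul, smul_neg]

lemma parity_substFrame (L₀ : 𝓐) [Admissible D L₀] (w : Form (GLp n)) :
    parity (substFrame D w) = substFrame D (formSign w) := by
  induction w using induction_on with
  | zero => simp
  | add x y hx hy => simp only [map_add, hx, hy]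
  | tmul f v =>
    change _ = substFrame D (f ⊗ₜ gpar v)
    rw [substFrame_tmul, substFrame_tmul, parity_mul, parity_frameFun, parity_substGrassmann L₀]

lemma brst_substGrassmann (v : Grassmann (Fin n × Fin n)) :
    𝓢 (substGrassmann D v) = 0 := by
  induction v using Grassmann.induction with
  | h0 r =>
    rw [AlgHom.commutes, algebraMap_eq_smul_one, map_smul, (isSDer_brst adm.even).map_one,
      smul_zero]
  | hadd x y hx hy => rw [map_add, map_add, hx, hy, add_zero]
  | hmul x v hx =>
    rw [map_mul, (isSDer_brst adm.even).mul, hx, substGrassmann_lin, brstFrame_eq (L₀ := L₀), map_sum]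
    simp [brst_brst]

/-- The substitution `e ↦ e, de ↦ se` intertwines the exterior derivative with `s`. -/
lemma brst_substFrame (w : Form (GLp n)) :
    𝓢 (substFrame D w) = substFrame D (extD w) := by
  induction w using induction_on with
  | zero => simp
  | add x y hx hy => simp only [map_add, hx, hy]
  | tmul f v =>
    rw [substFrame_tmul, (isSDer_brst adm.even).mul, brst_substGrassmann, mul_zero, add_zero,
      (isSDer_brst adm.even).frame]
    simp only [extD, sum_app, map_sum, map_tmul, sum_mul,
      mulLeft_apply, substFrame_tmul, map_mul, substGrassmann_gen (L₀ := L₀)]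
    refine sum_ext fun p _ => ?_
    rw [← mul_assoc, frameFun_comm]

variable (D L₀) in
/-- The odd derivation dual to `s e_μ^a`. -/
def frameContract (p : Fin n × Fin n) : 𝓛 :=
  ∑ ν, mulLeft ℝ (invFrame p.2 ν) ∘ₗ dL (gJet (.inl ν) (single p.1 1))

lemma frameContract_apply (p : Fin n × Fin n) (x : 𝓐) : frameContract p x =
    ∑ ν, invFrame p.2 ν * dL (gJet (.inl ν) (single p.1 1)) x := by
  simp [frameContract, sum_app]

lemma isSDer_frameContract (p : Fin n × Fin n) : IsSDer true (frameContract p : 𝓛) :=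
  IsSDer.sum _ fun ν _ => (isSDer_dL_gJet _ _).lmul (isHom_frameFun _)

lemma frameContract_ghostFree (p : Fin n × Fin n)
    (hx : x ∈ 𝓖) : frameContract p x = 0 := by
  rw [frameContract_apply]
  exact sum_eq_zero fun ν _ => by rw [dL_gJet_ghostFree _ _ hx, mul_zero]

lemma frameContract_basic (p : Fin n × Fin n) (hx : x ∈ basicAlg D L₀) :
    frameContract p x = 0 := by
  rw [frameContract_apply]
  exact sum_eq_zero fun ν _ => by rw [(hx _ _ (by simp)).1, mul_zero]

lemma frameContract_brst_vb (p q : Fin n × Fin n) :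
    frameContract p (𝓢 (vb q.1 q.2)) = if p = q then 1 else 0 := by
  obtain ⟨μ, a⟩ := p
  obtain ⟨ρ, b⟩ := q
  rw [frameContract_apply]
  have h : ∀ ν, dL (gJet (.inl ν) (single μ 1)) (𝓢 (vb ρ b)) =
      if μ = ρ then vb ν b else 0 := fun ν => by
    rw [← lie_eq (dL_gJet_ghostFree _ _ (fld_mem_ghostFree (by trivial) _))]
    exact (hasLie_e ρ b).xi μ ν
  simp only [h, mul_ite, mul_zero, Prod.mk.injEq]
  by_cases h1 : μ = ρ
  · simp only [h1, if_true, true_and]; exact sum_invFrame_vb a b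
  · simp [h1]

lemma frameContract_substGrassmann (L₀ : 𝓐) [Admissible D L₀] (p : Fin n × Fin n) (v : Grassmann (Fin n × Fin n)) :
    frameContract p (substGrassmann D v) = substGrassmann D (gdL p v) := by
  induction v using Grassmann.induction with
  | h0 r =>
    rw [dL_algebraMap, map_zero, AlgHom.commutes, algebraMap_eq_smul_one, map_smul,
      (isSDer_frameContract p).map_one, smul_zero]
  | hadd x y hx hy => simp only [map_add, hx, hy]
  | hmul x v hx =>
    have h : frameContract p (substGrassmann D (lin v)) = v p • 1 := by
      rw [substGrassmann_lin, brstFrame_eq (L₀ := L₀), map_sum, sum_eq_single p]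
      · rw [map_smul, frameContract_brst_vb, if_pos rfl]
      · intro q _ hq; rw [map_smul, frameContract_brst_vb, if_neg hq.symm, smul_zero]
      · simp
    rw [map_mul, (isSDer_frameContract p).mul, h, hx, par_true, parity_substGrassmann L₀,
      parity_lin, dL_lin_mul, map_sub, map_smul, map_mul, map_neg, smul_mul_assoc,
      one_mul, neg_mul, sub_eq_add_neg]

lemma frameContract_substFrame (L₀ : 𝓐) [Admissible D L₀] (p : Fin n × Fin n) (w : Form (GLp n)) :
    frameContract p (substFrame D w) = substFrame D (contract p w) := by
  induction w using induction_on with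
  | zero => simp
  | add x y hx hy => simp only [map_add, hx, hy]
  | tmul f v =>
    change _ = substFrame D (f ⊗ₜ gdL p v)
    rw [substFrame_tmul, substFrame_tmul, (isSDer_frameContract p).mul, par_frameFun,
      frameContract_ghostFree p (frameFun_mem_jetAlg _ f), zero_mul, zero_add,
      frameContract_substGrassmann L₀]

lemma frameContract_mul_basic (p : Fin n × Fin n) (w : Form (GLp n)) {t : 𝓐}
    (ht : t ∈ basicAlg D L₀) :
    frameContract p (substFrame D w * t) = substFrame D (contract p w) * t := by
  rw [(isSDer_frameContract p).mul, frameContract_basic p ht, mul_zero, add_zero,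
    frameContract_substFrame L₀]

lemma frameFun_tensor_independent {J : Type*} (t : J → 𝓐)
    (ht : LinearIndependent ℝ t) (hb : ∀ j, t j ∈ basicAlg D L₀) (s : Finset J)
    (f : J → 𝓒) (h : ∑ j ∈ s, frameFun (f j) * t j = 0) : ∀ j ∈ s, f j = 0 := by
  intro j hj
  refine smoothFun_ext fun x => ?_
  have h1 : ∑ j ∈ s, frameFun (f j - algebraMap ℝ _ ((f j).1 x)) * t j =
      -∑ j ∈ s, (f j).1 x • t j := by
    simp only [map_sub, sub_mul, sum_sub_distrib, h, zero_sub, AlgHom.commutes, ← smul_def]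
  have h2 := eq_zero_of_invariant D L₀ s (fun j => f j - algebraMap ℝ _ ((f j).1 x)) t x
    (fun j _ => by
      change (f j).1 x - (f j).1 x = 0
      exact sub_self _) (fun ρ σ => by
      rw [h1, map_neg, map_sum, neg_eq_zero]
      exact sum_eq_zero fun j _ => by rw [map_smul, (hb j _ _ (by simp)).2, smul_zero])
  rw [h1, neg_eq_zero] at h2
  exact linearIndependent_iff'.1 ht s _ h2 j hj

/-- The forms annihilated by `N` contractions. -/
def lowDeg (κ : Type*) [Fintype κ] [DecidableEq κ] (U : TopologicalSpace.Opens (κ → ℝ)) :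
    ℕ → Submodule ℝ (Form U)
  | 0 => ⊥
  | N + 1 => ⨅ i, (lowDeg κ U N).comap (contract i)

lemma mem_lowDeg_succ {κ : Type*} [Fintype κ] [DecidableEq κ]
    {U : TopologicalSpace.Opens (κ → ℝ)} {N : ℕ} {w : Form U} :
    w ∈ lowDeg κ U (N + 1) ↔ ∀ i, contract i w ∈ lowDeg κ U N := by
  simp [lowDeg, Submodule.mem_iInf]

lemma lowDeg_mono {κ : Type*} [Fintype κ] [DecidableEq κ]
    {U : TopologicalSpace.Opens (κ → ℝ)} : Monotone (lowDeg κ U) :=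
  monotone_nat_of_le_succ fun N => by
    induction N with
    | zero => exact bot_le
    | succ N ih => exact fun w hw => mem_lowDeg_succ.2 fun i => ih (mem_lowDeg_succ.1 hw i)

lemma formDeg_le_lowDeg {κ : Type*} [Fintype κ] [DecidableEq κ]
    {U : TopologicalSpace.Opens (κ → ℝ)} (k : ℕ) (p : ℤ) (hp : p < k) :
    formDeg U p ≤ lowDeg κ U k := by
  induction k generalizing p with
  | zero => rw [formDeg_neg (by exact_mod_cast hp)]; exact bot_le
  | succ k ih =>
    exact fun w hw => mem_lowDeg_succ.2 fun i =>
      ih (p - 1) (by push_cast at hp; omega) (contract_mem_formDeg i p hw)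

lemma exists_mem_lowDeg {κ : Type*} [Fintype κ] [DecidableEq κ]
    {U : TopologicalSpace.Opens (κ → ℝ)} (w : Form U) : ∃ N, w ∈ lowDeg κ U N := by
  refine IsGrading.induction (isGrading_form (U := U)) (p := fun w => ∃ N, w ∈ lowDeg κ U N)
    (fun k x hx => ⟨(k + 1).toNat, formDeg_le_lowDeg _ k (by omega) hx⟩) ⟨0, zero_mem _⟩ ?_ w
  rintro x y ⟨N, hx⟩ ⟨K, hy⟩
  exact ⟨max N K, add_mem (lowDeg_mono (le_max_left _ _) hx) (lowDeg_mono (le_max_right _ _) hy)⟩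

lemma mem_formDeg_zero_of_contract {κ : Type*} [Fintype κ] [DecidableEq κ]
    {U : TopologicalSpace.Opens (κ → ℝ)} {w : Form U} (h : ∀ i, contract i w = 0) :
    ∃ f, w = f ⊗ₜ 1 := mem_formDeg_zero (isGrading_form.mem_of_eigen (by
    rw [formCount_eq, sum_eq_zero fun i _ => by rw [h i, map_zero]]
    simp))

/-- Linearly independent basic functions are independent over forms in `e, se`. -/
lemma substFrame_tensor_independent {J : Type*} (t : J → 𝓐)
    (ht : LinearIndependent ℝ t) (hb : ∀ j, t j ∈ basicAlg D L₀) (s : Finset J)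
    (w : J → Form (GLp n)) (h : ∑ j ∈ s, substFrame D (w j) * t j = 0) : ∀ j ∈ s, w j = 0 := by
  have main : ∀ (N : ℕ) (w : J → Form (GLp n)), (∀ j ∈ s, w j ∈ lowDeg _ (GLp n) N) →
      ∑ j ∈ s, substFrame D (w j) * t j = 0 → ∀ j ∈ s, w j = 0 := fun N => by
    induction N with
    | zero => exact fun w hw _ j hj => hw j hj
    | succ N ih =>
      intro w hw h
      have h1 : ∀ j ∈ s, ∀ p, contract p (w j) = 0 := fun j hj p => by
        refine ih (fun j => contract p (w j)) (fun j hj => mem_lowDeg_succ.1 (hw j hj) p) ?_ j hj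
        have h2 := congrArg (frameContract p) h
        rw [map_sum, map_zero] at h2
        rw [← h2]
        exact sum_ext fun j _ => (frameContract_mul_basic p _ (hb j)).symm
      choose! f hf using fun j hj => mem_formDeg_zero_of_contract (h1 j hj)
      have h1 : ∑ j ∈ s, frameFun (f j) * t j = 0 := by
        rw [← h]
        refine sum_ext fun j hj => ?_
        rw [hf j hj, substFrame_tmul, map_one, mul_one]
      intro j hj
      rw [hf j hj, frameFun_tensor_independent t ht hb s f h1 j hj, zero_tmul]
  choose N hN using fun j => exists_mem_lowDeg (w j)
  exact main (s.sup N) w (fun j hj => lowDeg_mono (Finset.le_sup hj) (hN j)) h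

end Instances
end FrameForms

section Kuenneth

variable {V T J M : Type*} [AddCommGroup V] [Module ℝ V] [AddCommGroup T] [Module ℝ T]

/-- A contraction onto representatives of the cohomology. -/
lemma IsCohomologyBasis.exists_homotopy {δ : T →ₗ[ℝ] T} {c : J → T}
    (hc : IsCohomologyBasis δ ⊤ c) (hδ : ∀ x, δ (δ x) = 0) :
    ∃ (R : T →ₗ[ℝ] J →₀ ℝ) (h : T →ₗ[ℝ] T), (∀ x, R (δ x) = 0) ∧
      ∀ x, x = linearCombination ℝ c (R x) + δ (h x) + h (δ x) := by
  obtain ⟨g₀, hg₀⟩ := δ.rangeRestrict.exists_rightInverse_of_surjective δ.range_rangeRestrict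
  obtain ⟨π, hπ⟩ := (range δ).subtype.exists_leftInverse_of_injective (ker_subtype _)
  let g : T →ₗ[ℝ] T := g₀ ∘ₗ π
  have hg : ∀ x, δ (g (δ x)) = δ x := fun x => by
    have h1 : π (δ x) = δ.rangeRestrict x := LinearMap.congr_fun hπ (δ.rangeRestrict x)
    change δ (g₀ (π (δ x))) = _
    rw [h1]
    exact congrArg Subtype.val (LinearMap.congr_fun hg₀ (δ.rangeRestrict x))
  let L : (J →₀ ℝ) × T →ₗ[ℝ] T := (linearCombination ℝ c).coprod δ
  have hL : ∀ y, δ (L y) = 0 := fun y => by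
    change δ (linearCombination ℝ c y.1 + δ y.2) = 0
    rw [map_add, hδ, add_zero, linearCombination_apply, map_finsuppSum]
    exact sum_eq_zero fun j _ => by
      change δ (y.1 j • c j) = 0
      rw [map_smul, (hc.1 j).2, smul_zero]
  let L' : (J →₀ ℝ) × T →ₗ[ℝ] ker δ := L.codRestrict _ hL
  have hL' : range L' = ⊤ := by
    refine LinearMap.range_eq_top.2 fun z => ?_
    obtain ⟨r, b, -, hb⟩ := hc.2.1 z.1 trivial z.2
    exact ⟨(r, b), Subtype.ext hb.symm⟩
  obtain ⟨s, hs⟩ := L'.exists_rightInverse_of_surjective hL'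
  let p : T →ₗ[ℝ] ker δ := (LinearMap.id - g ∘ₗ δ).codRestrict _ fun x => by
    change δ (x - g (δ x)) = 0
    rw [map_sub, hg, sub_self]
  let R : T →ₗ[ℝ] J →₀ ℝ := LinearMap.fst ℝ _ _ ∘ₗ s ∘ₗ p
  have h1 : ∀ x, x - g (δ x) = linearCombination ℝ c (R x) + δ (s (p x)).2 := fun x =>
    (congrArg Subtype.val (LinearMap.congr_fun hs (p x))).symm
  have hR : ∀ x, R (δ x) = 0 := fun x => by
    refine hc.2.2 _ ⟨x - (s (p (δ x))).2, trivial, ?_⟩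
    have h2 := h1 (δ x)
    rw [hδ, map_zero, sub_zero] at h2
    rw [map_sub]
    exact eq_sub_of_add_eq h2.symm
  refine ⟨R, g ∘ₗ (LinearMap.id - linearCombination ℝ c ∘ₗ R - g ∘ₗ δ), hR, fun x => ?_⟩
  change x = linearCombination ℝ c (R x) + δ (g (x - linearCombination ℝ c (R x) - g (δ x))) +
    g (δ x - linearCombination ℝ c (R (δ x)) - g (δ (δ x)))
  have h2 : x - linearCombination ℝ c (R x) - g (δ x) = δ (s (p x)).2 := by
    rw [sub_right_comm, h1]; abel
  rw [h2, hg, ← h2, hR, hδ, map_zero, map_zero, sub_zero, sub_zero]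
  abel

/-- The operator `d ⊗ 1 + σ ⊗ δ`. -/
def tensorDiff (d σ : V →ₗ[ℝ] V) (δ : T →ₗ[ℝ] T) : V ⊗[ℝ] T →ₗ[ℝ] V ⊗[ℝ] T :=
  map d LinearMap.id + map σ δ

lemma tensorDiff_tmul (d σ : V →ₗ[ℝ] V) (δ : T →ₗ[ℝ] T) (v : V) (t : T) :
    tensorDiff d σ δ (v ⊗ₜ t) = d v ⊗ₜ t + σ v ⊗ₜ δ t := rfl

/-- The Künneth theorem: cocycles of `d ⊗ 1 + σ ⊗ δ`. -/
lemma kuenneth {d σ : V →ₗ[ℝ] V} {δ : T →ₗ[ℝ] T} {α : M → V} {c : J → T}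
    (hα : IsCohomologyBasis d ⊤ α) (hc : IsCohomologyBasis δ ⊤ c)
    (hδ : ∀ x, δ (δ x) = 0) (hσ : ∀ v, σ (σ v) = v) (hσd : ∀ v, σ (d v) = -d (σ v)) {u : V ⊗[ℝ] T}
    (hu : tensorDiff d σ δ u = 0) : u ∈ span ℝ (Set.range fun q : M × J => α q.1 ⊗ₜ[ℝ] c q.2) ⊔
      range (tensorDiff d σ δ) := by
  obtain ⟨R, h, hR, hh⟩ := hc.exists_homotopy hδ
  set D := tensorDiff d σ δ with hD
  have hDt : ∀ v t, D (v ⊗ₜ t) = d v ⊗ₜ t + σ v ⊗ₜ δ t := tensorDiff_tmul d σ δ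
  have h1 : ∀ u : V ⊗[ℝ] T, u = map LinearMap.id (linearCombination ℝ c ∘ₗ R) u +
      D (map σ h u) + map σ h (D u) := fun u => by
    induction u using induction_on with
    | zero => simp
    | add x y hx hy =>
      conv_lhs => rw [hx, hy]
      simp only [map_add]; abel
    | tmul v t =>
      rw [hDt, map_add, map_tmul, map_tmul, map_tmul,
        map_tmul, hDt, hσ, hσd, TensorProduct.neg_tmul, comp_apply, id_apply]
      conv_lhs => rw [hh t, tmul_add, tmul_add]
      abel
  have h2 := h1 u
  rw [hu, map_zero, add_zero] at h2
  rw [h2]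
  refine add_mem ?_ (mem_sup_right ⟨_, rfl⟩)
  have h3 : map d R u = 0 := by
    have e : ∀ u : V ⊗[ℝ] T, map d R u = map LinearMap.id R (D u) := fun u => by
      induction u using induction_on with
      | zero => simp
      | add x y hx hy => simp only [map_add, hx, hy]
      | tmul v t => rw [hDt, map_add]; simp [hR]
    rw [e, hu, map_zero]
  let eqv : V ⊗[ℝ] (J →₀ ℝ) ≃ₗ[ℝ] J →₀ V := TensorProduct.finsuppScalarRight ℝ ℝ V J
  set w : J →₀ V := eqv (map LinearMap.id R u) with hw
  have h4 : ∀ j, d (w j) = 0 := fun j => by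
    have e : ∀ u : V ⊗[ℝ] T, d (eqv (map LinearMap.id R u) j) = eqv (map d R u) j := fun u => by
      induction u using induction_on with
      | zero => simp
      | add x y hx hy => simp only [map_add, Finsupp.add_apply, hx, hy]
      | tmul v t => simp [eqv]
    rw [hw, e, h3]; simp
  have h5 : map LinearMap.id (linearCombination ℝ c ∘ₗ R) u = w.sum fun j v => v ⊗ₜ c j := by
    have e : ∀ x : V ⊗[ℝ] (J →₀ ℝ), map LinearMap.id (linearCombination ℝ c) x =
        (eqv x).sum fun j v => v ⊗ₜ c j := fun x => by
      induction x using induction_on with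
      | zero => simp
      | add x y hx hy =>
        rw [map_add, map_add, hx, hy, Finsupp.sum_add_index'] <;> simp [add_tmul]
      | tmul v r =>
        induction r using induction_linear with
        | zero => simp
        | add x y hx hy =>
          rw [tmul_add, map_add, map_add, hx, hy, Finsupp.sum_add_index'] <;> simp [add_tmul]
        | single j r =>
          have : eqv (v ⊗ₜ single j r) = single j (r • v) := by
            simp [eqv, TensorProduct.finsuppScalarRight_apply_tmul]
          rw [this, Finsupp.sum_single_index (zero_tmul _ _), map_tmul,
            Finsupp.linearCombination_single, id_apply, tmul_smul, smul_tmul']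
    rw [← LinearMap.id_comp (LinearMap.id : V →ₗ[ℝ] V), TensorProduct.map_comp, comp_apply, e]
  rw [h5]
  refine sum_mem fun j _ => ?_
  obtain ⟨r, b, -, hb⟩ := hα.2.1 (w j) trivial (h4 j)
  have h6 : w j ⊗ₜ c j = (r.sum fun m x => x • (α m ⊗ₜ[ℝ] c j)) + D (b ⊗ₜ c j) := by
    conv_lhs => rw [hb]
    rw [add_tmul, hDt, (hc.1 j).2, tmul_zero, add_zero,
      linearCombination_apply, Finsupp.sum, Finsupp.sum, TensorProduct.sum_tmul]
    simp only [smul_tmul']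
  dsimp only
  rw [h6]
  exact add_mem (mem_sup_left (sum_mem fun m _ => smul_mem _ _
    (subset_span ⟨(m, j), rfl⟩))) (mem_sup_right ⟨_, rfl⟩)

end Kuenneth

section FrameTensors

variable (D) in
/-- The multiplication of frame forms and tensors. -/
def frameTensor : Form (GLp n) ⊗[ℝ] tensorAlg D →ₗ[ℝ] 𝓐 :=
  TensorProduct.lift (((LinearMap.mul ℝ 𝓐).compl₂
    (tensorAlg D).val.toLinearMap).comp (substFrame D).toLinearMap)

lemma frameTensor_tmul (w : Form (GLp n)) (t : tensorAlg D) :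
    frameTensor D (w ⊗ₜ t) = substFrame D w * t := rfl

lemma IsHom.mul_substFrame (L₀ : 𝓐) [Admissible D L₀] {η : Bool}
    (hx : IsHom η x) (w : Form (GLp n)) :
    ∃ w', x * substFrame D w = substFrame D w' * x := by
  rw [hx.comm]
  cases η
  · exact ⟨w, rfl⟩
  · exact ⟨formSign w, by rw [par_true, parity_substFrame L₀]⟩

lemma mul_mem_range_frameTensor (L₀ : 𝓐) [Admissible D L₀]
    (h : (∃ v, x = substFrame D v) ∨ (x ∈ tensorAlg D ∧ ∃ η, IsHom η x))
    (hy : y ∈ range (frameTensor D)) : x * y ∈ range (frameTensor D) := by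
  obtain ⟨u, rfl⟩ := hy
  induction u using induction_on with
  | zero => simp
  | add a b ha hb => rw [map_add, mul_add]; exact add_mem ha hb
  | tmul w t =>
    rw [frameTensor_tmul, ← mul_assoc]
    rcases h with ⟨v, rfl⟩ | ⟨hx, η, hη⟩
    · exact ⟨(v * w) ⊗ₜ t, by rw [frameTensor_tmul, map_mul]⟩
    · obtain ⟨w', hw'⟩ := hη.mul_substFrame (D := D) L₀ w
      exact ⟨w' ⊗ₜ (⟨x, hx⟩ * t), by rw [frameTensor_tmul, hw', mul_assoc]; rfl⟩

variable (D L₀) in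
lemma frameTensorAlg_le [adm : Admissible D L₀] :
    toSubmodule (frameTensorAlg D L₀) ≤ range (frameTensor D) := by
  have key : ∀ x ∈ frameTensorAlg D L₀, ∀ y ∈ range (frameTensor D),
      x * y ∈ range (frameTensor D) := fun x hx => by
    induction hx using adjoin_induction with
    | mem x hx =>
      intro y hy
      rcases hx with (⟨f, rfl⟩ | ⟨p, rfl⟩) | hx
      · exact mul_mem_range_frameTensor L₀ (Or.inl ⟨f ⊗ₜ 1, by
          rw [substFrame_tmul, map_one, mul_one]⟩) hy
      · exact mul_mem_range_frameTensor L₀ (Or.inl ⟨1 ⊗ₜ ggen p, by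
          rw [substFrame_tmul, map_one, one_mul, substGrassmann_gen]⟩) hy
      · revert y
        refine tensorAlg_induction (p := fun x => ∀ y ∈ range (frameTensor D),
          x * y ∈ range (frameTensor D)) (fun x h y hy => ?_) (fun a y hy => ?_)
          (fun I y hy => ?_) (fun r y hy => ?_) (fun x x' _ _ hx hx' y hy => ?_)
          (fun x x' _ _ hx hx' y hy => ?_) hx
        · exact mul_mem_range_frameTensor L₀ (Or.inr ⟨h.mem, h.isHom⟩) hy
        · exact mul_mem_range_frameTensor L₀ (Or.inr ⟨xiHat_mem a, true,
            IsHom.sum fun μ _ => (isHom_xi μ).mul (isHom_vb μ a)⟩) hy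
        · exact mul_mem_range_frameTensor L₀ (Or.inr ⟨ghHat_mem I, true,
            (isHom_gh I).add (IsHom.sum fun μ _ => (isHom_xi μ).mul (isHom_conn μ I))⟩) hy
        · rw [← smul_def]; exact smul_mem _ _ hy
        · rw [add_mul]; exact add_mem (hx y hy) (hx' y hy)
        · rw [mul_assoc]; exact hx _ (hx' y hy)
    | algebraMap r => intro y hy; rw [← smul_def]; exact smul_mem _ _ hy
    | add x x' _ _ hx hx' => intro y hy; rw [add_mul]; exact add_mem (hx y hy) (hx' y hy)
    | mul x x' _ _ hx hx' => intro y hy; rw [mul_assoc]; exact hx _ (hx' y hy)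
  intro x hx
  rw [← mul_one x]
  exact key x hx 1 ⟨1 ⊗ₜ 1, by rw [frameTensor_tmul, map_one, one_mul]; rfl⟩

lemma exists_frameTensor_eq (u : Form (GLp n) ⊗[ℝ] tensorAlg D) :
    ∃ w : Module.Basis.ofVectorSpaceIndex ℝ (tensorAlg D) →₀ Form (GLp n),
      u = ∑ j ∈ w.support, w j ⊗ₜ Module.Basis.ofVectorSpace ℝ (tensorAlg D) j := by
  obtain ⟨w, h⟩ := TensorProduct.eq_repr_basis_right (Module.Basis.ofVectorSpace ℝ (tensorAlg D)) u
  exact ⟨w, h.symm⟩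

variable [adm : Admissible D L₀]

lemma linearIndependent_tensorBasis : LinearIndependent ℝ
    fun j => ((Module.Basis.ofVectorSpace ℝ (tensorAlg D) j : tensorAlg D) : 𝓐) :=
  (Module.Basis.ofVectorSpace ℝ (tensorAlg D)).linearIndependent.map'
    (toSubmodule (tensorAlg D)).subtype (ker_subtype _)

lemma frameTensor_injective (L₀ : 𝓐) [Admissible D L₀]
    {u : Form (GLp n) ⊗[ℝ] tensorAlg D} (hu : frameTensor D u = 0) : u = 0 := by
  obtain ⟨w, rfl⟩ := exists_frameTensor_eq u
  rw [map_sum] at hu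
  have := substFrame_tensor_independent (L₀ := L₀) _ linearIndependent_tensorBasis
    (fun j => tensorAlg_le_basicAlg D L₀ (Subtype.mem _)) w.support w hu
  exact sum_eq_zero fun j hj => by rw [this j hj, zero_tmul]

/-- Basic local functions are tensors. -/
lemma basicAlg_le_tensorAlg : basicAlg D L₀ ≤ tensorAlg D := by
  intro x hx
  obtain ⟨u, rfl⟩ := frameTensorAlg_le D L₀ (basicAlg_le_frameTensorAlg D L₀ hx)
  obtain ⟨w, rfl⟩ := exists_frameTensor_eq u
  set t := fun j => ((Module.Basis.ofVectorSpace ℝ (tensorAlg D) j : tensorAlg D) : 𝓐)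
  have ht : ∀ j, t j ∈ basicAlg D L₀ := fun j => tensorAlg_le_basicAlg D L₀ (Subtype.mem _)
  have e : frameTensor D (∑ j ∈ w.support, w j ⊗ₜ Module.Basis.ofVectorSpace ℝ (tensorAlg D) j) =
      ∑ j ∈ w.support, substFrame D (w j) * t j := map_sum _ _ _
  rw [e] at hx ⊢
  have h1 : ∀ p, ∀ j ∈ w.support, contract p (w j) = 0 := fun p => by
    refine substFrame_tensor_independent (L₀ := L₀) t linearIndependent_tensorBasis ht _ _ ?_
    have h2 := frameContract_basic p hx
    rw [map_sum] at h2
    rw [← h2]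
    exact sum_ext fun j _ => (frameContract_mul_basic p _ (ht j)).symm
  choose! f hf using fun j hj => mem_formDeg_zero_of_contract fun p => h1 p j hj
  have h2 : ∑ j ∈ w.support, substFrame D (w j) * t j = ∑ j ∈ w.support, frameFun (f j) * t j :=
    sum_ext fun j hj => by rw [hf j hj, substFrame_tmul, map_one, mul_one]
  rw [h2] at hx ⊢
  let h₀ : GLp n := ⟨fun p => if p.1 = p.2 then 1 else 0, by
    change 0 < (frameMatrix n _).det
    have : frameMatrix n (fun p => if p.1 = p.2 then 1 else 0) = 1 := by
      ext i j; simp [frameMatrix, Matrix.one_apply]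
    rw [this, Matrix.det_one]; exact one_pos⟩
  have h3 : ∑ j ∈ w.support, frameFun (f j - algebraMap ℝ _ ((f j).1 h₀)) * t j =
      ∑ j ∈ w.support, frameFun (f j) * t j - ∑ j ∈ w.support, (f j).1 h₀ • t j := by
    simp only [map_sub, sub_mul, sum_sub_distrib, AlgHom.commutes, ← smul_def]
  have h4 := eq_zero_of_invariant D L₀ w.support (fun j => f j - algebraMap ℝ _ ((f j).1 h₀)) t h₀
    (fun j _ => by
      change (f j).1 h₀ - (f j).1 h₀ = 0
      exact sub_self _) (fun ρ σ => by
      rw [h3, map_sub, (hx _ _ (by simp)).2, map_sum, zero_sub, neg_eq_zero]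
      exact sum_eq_zero fun j _ => by rw [map_smul, (ht j _ _ (by simp)).2, smul_zero])
  rw [h3, sub_eq_zero] at h4
  rw [h4]
  exact sum_mem fun j _ => Subalgebra.smul_mem _ (Subtype.mem _) _

lemma brst_mem_tensorAlg (hx : x ∈ tensorAlg D) : 𝓢 x ∈ tensorAlg D :=
  basicAlg_le_tensorAlg (L₀ := L₀) (brst_mem_basicAlg (tensorAlg_le_basicAlg D L₀ hx))

/-- Representatives of the BRST cohomology of local functions. -/
lemma brst_cocycle {M B : Type*} {α : M → Form (GLp n)}
    (hα : IsCohomologyBasis (extD (U := GLp n)) ⊤ α) {P : B → 𝓐}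
    (hP : IsCohomologyBasis 𝓢 (toSubmodule (tensorAlg D)) P)
    (hx : 𝓢 x = 0) :
    x ∈ span ℝ (Set.range fun q : M × B => substFrame D (α q.1) * P q.2) ⊔ range 𝓢 := by
  obtain ⟨y, hy, hsy, b, rfl⟩ := exists_frameTensor_cocycle D L₀ hx
  refine add_mem ?_ (mem_sup_right ⟨b, rfl⟩)
  obtain ⟨u, rfl⟩ := frameTensorAlg_le D L₀ hy
  let δ : tensorAlg D →ₗ[ℝ] tensorAlg D :=
    ((𝓢).comp (tensorAlg D).val.toLinearMap).codRestrict
      (toSubmodule (tensorAlg D)) fun x => brst_mem_tensorAlg x.2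
  let c : B → tensorAlg D := fun A => ⟨P A, (hP.1 A).1⟩
  have hlc : ∀ r : B →₀ ℝ, ((linearCombination ℝ c r : tensorAlg D) : 𝓐) =
      linearCombination ℝ P r := fun r => by
    exact LinearMap.map_finsupp_linearCombination (tensorAlg D).val.toLinearMap r
  have hc : IsCohomologyBasis δ ⊤ c := by
    refine ⟨fun j => ⟨trivial, Subtype.ext (hP.1 j).2⟩, fun z _ hz => ?_, fun r ⟨b, _, hb⟩ => ?_⟩
    · obtain ⟨r, b, hb, h⟩ := hP.2.1 z z.2 (congrArg Subtype.val hz)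
      refine ⟨r, ⟨b, hb⟩, trivial, Subtype.ext ?_⟩
      rw [h, ← hlc]; rfl
    · refine hP.2.2 r ⟨b, b.2, ?_⟩
      rw [← hlc, hb]; rfl
  have hcomm : ∀ u, 𝓢 (frameTensor D u) = frameTensor D (tensorDiff extD formSign δ u) := fun u => by
    induction u using induction_on with
    | zero => simp
    | add x y hx hy => simp only [map_add, hx, hy]
    | tmul w t =>
      rw [frameTensor_tmul, (isSDer_brst adm.even).mul, brst_substFrame, par_true,
        parity_substFrame L₀]
      rw [tensorDiff_tmul, map_add]
      rfl
  have hu := kuenneth (u := u) hα hc (fun x => Subtype.ext (brst_brst _)) formSign_formSign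
    formSign_extD (frameTensor_injective L₀ (by rw [← hcomm, hsy]))
  obtain ⟨v, hv, v', ⟨v₀, rfl⟩, rfl⟩ := Submodule.mem_sup.1 hu
  rw [map_add, ← hcomm]
  refine add_mem (mem_sup_left ?_) (mem_sup_right ⟨_, rfl⟩)
  refine (map_span_le (frameTensor D) _ _).2 ?_ ⟨v, hv, rfl⟩
  rintro _ ⟨q, rfl⟩
  exact subset_span ⟨q, rfl⟩

end FrameTensors

section GhostCohomology

variable [adm : Admissible D L₀]

lemma hasGh_list (l : List 𝓙) : HasGh (l.map fun z => z.1.gh).sum ((l.map gen).prod : 𝓐) := by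
  induction l with
  | nil => exact hasGh_one
  | cons z l ih => exact (hasGh_gen z).mul ih rfl

lemma isGrading_ghost : IsGrading (ghNumber n ι β φ) (ghostDeg n ι β φ) where
  eigen k x hx := by
    refine LinearMap.eqOn_span (g := (k : ℝ) • LinearMap.id) ?_ hx
    rintro _ ⟨f, l, rfl, rfl⟩
    exact (hasGh_frameFun f).mul (hasGh_list l) (zero_add _)
  top x := by
    have hx : x ∈ (⊤ : Submodule ℝ 𝓐) := trivial
    rw [← span_monomials] at hx
    refine Submodule.span_le.2 ?_ hx
    rintro _ ⟨f, l, rfl⟩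
    exact mem_iSup_of_mem _ (subset_span ⟨f, l, rfl, rfl⟩)

lemma hasGh_iff {k : ℤ} : HasGh k x ↔ x ∈ ghostDeg n ι β φ k :=
  isGrading_ghost.mem_iff.symm

lemma brst_mem_ghostDeg (k : ℤ) : ∀ x ∈ ghostDeg n ι β φ k, 𝓢 x ∈ ghostDeg n ι β φ (k + 1) :=
  fun _ hx => hasGh_iff.1 (hasGh_iff.2 hx).brst

lemma hasGh_substGrassmann {k : ℕ} {v : Grassmann (Fin n × Fin n)} (hv : v ∈ Grassmann.deg _ k) :
    HasGh k (substGrassmann D v) := by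
  refine deg_induction (C := fun k v => HasGh (k : ℤ) (substGrassmann D v)) (fun r => ?_)
    (fun k x y hx hy => ?_) (fun k v x hx => ?_) hv
  · rw [AlgHom.commutes, algebraMap_eq_smul_one]; exact hasGh_one.smul r
  · rw [map_add]; exact hx.add hy
  · rw [map_mul, substGrassmann_lin, brstFrame, linearCombination_apply]
    exact HasGh.mul (HasGh.sum fun p _ => (hasGh_brstField D (.e p.1 p.2)).smul _) hx
      (by change (0 : ℤ) + 1 + k = _; push_cast; ring)

variable (D) in
lemma hasGh_substFrame {k : ℤ} {w : Form (GLp n)} (hw : w ∈ formDeg (GLp n) k) :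
    HasGh k (substFrame D w) := by
  refine LinearMap.eqOn_span (f := ghNumber n ι β φ ∘ₗ (substFrame D).toLinearMap)
    (g := (k : ℝ) • (substFrame D).toLinearMap) ?_ hw
  rintro _ ⟨f, l, rfl, v, hv, rfl⟩
  change HasGh (l : ℤ) (substFrame D (f ⊗ₜ v))
  rw [substFrame_tmul]
  exact (hasGh_frameFun f).mul (hasGh_substGrassmann hv) (zero_add _)

/-- Representatives of the BRST cohomology of local functions of ghost number `g`. -/
lemma brst_cocycle_ghostDeg {M B : Type*} {α : M → Form (GLp n)} {k : M → ℕ}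
    (hk : ∀ m, α m ∈ formDeg (GLp n) (k m))
    (hα : IsCohomologyBasis (extD (U := GLp n)) ⊤ α) {P : B → 𝓐} {gP : B → ℤ}
    (hgP : ∀ A, P A ∈ ghostDeg n ι β φ (gP A))
    (hP : IsCohomologyBasis 𝓢 (toSubmodule (tensorAlg D)) P)
    {g : ℤ} (hg : x ∈ ghostDeg n ι β φ g) (hx : 𝓢 x = 0) :
    x ∈ span ℝ ((fun q : M × B => substFrame D (α q.1) * P q.2) ''
        {q | (k q.1 : ℤ) + gP q.2 = g}) ⊔ (ghostDeg n ι β φ (g - 1)).map 𝓢 := by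
  obtain ⟨y, hy, _, ⟨b, rfl⟩, rfl⟩ := Submodule.mem_sup.1 (brst_cocycle hα hP hx)
  have h1 := isGrading_ghost.proj_of_mem hg
  have h2 := IsGrading.proj_map (S := 𝓢) (c := 1) isGrading_ghost isGrading_ghost
    brst_mem_ghostDeg (g - 1) b
  rw [sub_add_cancel] at h2
  rw [map_add, h2] at h1
  rw [← h1]
  refine add_mem (mem_sup_left ?_) (mem_sup_right ⟨_, isGrading_ghost.proj_mem _ _, rfl⟩)
  refine (map_span_le (isGrading_ghost.proj g) _ _).2 ?_ ⟨y, hy, rfl⟩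
  rintro _ ⟨q, rfl⟩
  have h3 : substFrame D (α q.1) * P q.2 ∈ ghostDeg n ι β φ ((k q.1 : ℤ) + gP q.2) :=
    hasGh_iff.1 ((hasGh_substFrame D (hk q.1)).mul (hasGh_iff.2 (hgP q.2)))
  by_cases hq : (k q.1 : ℤ) + gP q.2 = g
  · subst hq
    rw [isGrading_ghost.proj_of_mem h3]
    exact subset_span ⟨q, rfl, rfl⟩
  · rw [isGrading_ghost.proj_of_ne hq h3]
    exact zero_mem _

end GhostCohomology

section Volume

/-! ## Exactness of volume forms -/

variable {κ : Type*} [Fintype κ] [DecidableEq κ]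

open scoped Convolution in
/-- Averages of a smooth function over a coordinate are smooth. -/
lemma contDiff_average (i : κ) {f : (κ → ℝ) → ℝ} (hf : ContDiff ℝ ∞ f) :
    ContDiff ℝ ∞ fun x => ∫ t in (0 : ℝ)..1, f (update x i (t * x i)) := by
  let χ : ContDiffBump (0 : ℝ) := ⟨2, 3, by norm_num, by norm_num⟩
  let g : (κ → ℝ) → ℝ → ℝ := fun x s => χ s * f (update x i (-s * x i))
  let u : ℝ → ℝ := Set.indicator (Ioc 0 1) 1
  have hu : MeasureTheory.LocallyIntegrable u MeasureTheory.volume := by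
    refine MeasureTheory.Integrable.locallyIntegrable ?_
    exact (MeasureTheory.integrable_indicator_iff measurableSet_Ioc).2
      (MeasureTheory.integrableOn_const (by simp))
  have hg : ContDiff ℝ ∞ (fun q : (κ → ℝ) × ℝ => g q.1 q.2) := by
    refine (χ.contDiff.comp contDiff_snd).mul (hf.comp (contDiff_pi.2 fun j => ?_))
    by_cases hj : j = i
    · subst hj
      simp only [update_self]
      fun_prop
    · simp only [Function.update_of_ne hj]
      fun_prop
  have h := MeasureTheory.contDiffOn_convolution_right_with_param_comp (n := ⊤) (μ := MeasureTheory.volume)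
    (ContinuousLinearMap.mul ℝ ℝ) (s := Set.univ) (v := fun _ : κ → ℝ => (0 : ℝ)) contDiffOn_const
    (g := g) isOpen_univ (isCompact_closedBall (0 : ℝ) 3)
    (fun p x _ hx => by
      have : χ x = 0 := χ.zero_of_le_dist (not_le.1 hx).le
      simp only [g, this, zero_mul]) hu hg.contDiffOn
  rw [contDiffOn_univ] at h
  convert h using 2 with x
  rw [MeasureTheory.convolution_def, intervalIntegral.integral_of_le zero_le_one,
    ← MeasureTheory.integral_indicator measurableSet_Ioc]
  refine MeasureTheory.integral_congr_ae (Filter.Eventually.of_forall fun t => ?_)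
  dsimp only
  by_cases ht : t ∈ Ioc (0 : ℝ) 1
  · have h1 : χ (-t) = 1 := χ.one_of_mem_closedBall (by
      rw [mem_closedBall_zero_iff, norm_neg, Real.norm_of_nonneg ht.1.le]
      exact ht.2.trans (by norm_num))
    simp only [g, u, zero_sub, neg_neg, Set.indicator_of_mem ht, h1, ContinuousLinearMap.mul_apply',
      Pi.one_apply, one_mul]
  · simp only [u, Set.indicator_of_notMem ht, map_zero, zero_apply]

/-- Smooth functions on a coordinate space have antiderivatives in each coordinate. -/
lemma exists_pd_eq (i : κ) (f : SmoothFun (⊤ : TopologicalSpace.Opens (κ → ℝ))) :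
    ∃ F, pd i F = f := by
  set g := extendZero f.1
  have hg : ContDiff ℝ ∞ g := contDiffOn_univ.1 (smoothFun_contDiffOn f)
  let G : (κ → ℝ) → ℝ := fun x => x i * ∫ t in (0 : ℝ)..1, g (update x i (t * x i))
  have hG : ContDiff ℝ ∞ G := (contDiff_apply ℝ ℝ i).mul (contDiff_average i hg)
  have hG' : ∀ x, G x = ∫ t in (0 : ℝ)..x i, g (update x i t) := fun x => by
    have := intervalIntegral.smul_integral_comp_mul_right (a := 0) (b := 1)
      (fun t => g (update x i t)) (x i)
    rw [zero_mul, one_mul] at this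
    exact this
  refine ⟨⟨fun x => G x, G, hG.contDiffOn, fun _ => rfl⟩, smoothFun_ext fun x => ?_⟩
  rw [pd_apply_of_eqOn i _ G fun _ => rfl]
  have h1 : HasDerivAt (fun t : ℝ => G (update x.1 i t))
      (fderiv ℝ G x.1 (Pi.single i 1)) (x.1 i) := by
    have h2 := (hG.differentiable (by simp) (update x.1 i (x.1 i))).hasFDerivAt.comp_hasDerivAt
      (x.1 i) (hasDerivAt_update x.1 i (x.1 i))
    rw [update_eq_self] at h2
    exact h2
  have h2 : HasDerivAt (fun t : ℝ => G (update x.1 i t)) (g x.1) (x.1 i) := by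
    simp only [hG', update_self, Function.update_idem]
    have hc : Continuous fun t : ℝ => g (update x.1 i t) :=
      hg.continuous.comp (continuous_const.update i continuous_id)
    have := hc.integral_hasStrictDerivAt 0 (x.1 i)
    rw [update_eq_self] at this
    exact this.hasDerivAt
  rw [h1.unique h2]
  exact extendZero_apply f.1 x

/-- Forms of top degree are exact. -/
lemma isExact_of_top (i : κ) {w : Form (⊤ : TopologicalSpace.Opens (κ → ℝ))}
    (hw : w ∈ formDeg _ (Fintype.card κ)) : IsExact w := by
  change w ∈ range (extD (U := (⊤ : TopologicalSpace.Opens (κ → ℝ))))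
  refine Submodule.span_le.2 ?_ hw
  rintro _ ⟨f, k, hk, v, hv, rfl⟩
  obtain rfl : k = Fintype.card κ := by exact_mod_cast hk
  obtain ⟨F, rfl⟩ := exists_pd_eq i f
  have h : ∀ j, ggen j * gdL i v = if i = j then v else 0 := fun j => by
    have h1 : ggen j * v = 0 := by
      have := lin_mul_mem_deg (single j 1) hv
      rw [deg_eq_bot (Nat.lt_succ_self _)] at this
      exact this
    have h2 := dL_gen_mul i j v
    rw [h1, map_zero] at h2
    exact (sub_eq_zero.1 h2.symm).symm
  refine ⟨F ⊗ₜ gdL i v, ?_⟩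
  simp only [extD, sum_app, map_tmul, mulLeft_apply, h]
  rw [sum_eq_single i]
  · rw [if_pos rfl]
  · intro j _ hj; rw [if_neg hj.symm, tmul_zero]
  · simp

end Volume

section TensorSums

variable {V W Q : Type*} [AddCommGroup V] [Module ℝ V] [AddCommGroup W] [Module ℝ W]

lemma tmul_coeff_eq_zero {s : Finset V} (hs : LinearIndependent ℝ fun v : s => v.1) {y : V → W}
    (h : ∑ v ∈ s, v ⊗ₜ[ℝ] y v = 0) {v : V} (hv : v ∈ s) : y v = 0 := by
  have h1 := congrArg (TensorProduct.comm ℝ V W) h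
  rw [map_sum, map_zero, ← Finset.sum_coe_sort] at h1
  exact coeff_eq_zero (fun v : s => v.1) hs (fun v => y v.1) h1 ⟨v, hv⟩

lemma exists_sum_of_mem_map₂ {F : Submodule ℝ V} {G : Submodule ℝ W} {x : V ⊗[ℝ] W}
    (hx : x ∈ map₂ (TensorProduct.mk ℝ V W) F G) :
    ∃ (s : Finset V) (c : V → W), (∀ v ∈ s, v ∈ F ∧ c v ∈ G) ∧
      (LinearIndependent ℝ fun v : s => v.1) ∧ x = ∑ v ∈ s, v ⊗ₜ c v := by
  let b := Module.Basis.ofVectorSpace ℝ F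
  have hb : LinearIndependent ℝ fun j => (b j : V) :=
    b.linearIndependent.map' F.subtype (ker_subtype _)
  have hinj : Injective fun j => (b j : V) := hb.injective
  let Φ : (Module.Basis.ofVectorSpaceIndex ℝ F →₀ G) →ₗ[ℝ] V ⊗[ℝ] W :=
    lsum ℝ fun j => TensorProduct.mk ℝ V W (b j) ∘ₗ G.subtype
  have hΦ : map₂ (TensorProduct.mk ℝ V W) F G ≤ range Φ := by
    refine Submodule.map₂_le.2 fun m hm y hy => ?_
    have h1 : m = ∑ j ∈ (b.repr ⟨m, hm⟩).support, b.repr ⟨m, hm⟩ j • (b j : V) := by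
      have := congrArg F.subtype (b.linearCombination_repr ⟨m, hm⟩)
      rw [linearCombination_apply, Finsupp.sum, map_sum] at this
      exact this.symm
    rw [h1, map_sum, sum_app]
    refine sum_mem fun j _ => ⟨single j (b.repr ⟨m, hm⟩ j • ⟨y, hy⟩), ?_⟩
    rw [lsum_single, comp_apply, map_smul, map_smul, map_smul]
    rfl
  obtain ⟨c, rfl⟩ := hΦ hx
  refine ⟨c.support.image fun j => (b j : V), fun v => if h : ∃ j, (b j : V) = v then c h.choose else 0,
    fun v hv => ?_, ?_, ?_⟩
  · obtain ⟨j, -, rfl⟩ := Finset.mem_image.1 hv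
    refine ⟨(b j).2, ?_⟩
    dsimp only
    rw [dif_pos ⟨j, rfl⟩]
    exact Subtype.mem _
  · refine hb.linearIndepOn_id.mono ?_
    intro v hv
    obtain ⟨j, -, rfl⟩ := Finset.mem_image.1 hv
    exact ⟨j, rfl⟩
  · rw [sum_image fun _ _ _ _ h => hinj h, lsum_apply, Finsupp.sum]
    refine sum_ext fun j _ => ?_
    have h : ∃ k, (b k : V) = b j := ⟨j, rfl⟩
    dsimp only
    rw [dif_pos h, show h.choose = j from hinj h.choose_spec]
    rfl

lemma exists_sum_of_mem_map₂_span {F : Submodule ℝ V} {e : Q → W} {T : Set Q} {x : V ⊗[ℝ] W}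
    (hx : x ∈ map₂ (TensorProduct.mk ℝ V W) F (span ℝ (e '' T))) :
    ∃ (S : Finset Q) (w : Q → V), (∀ q ∈ S, w q ∈ F ∧ q ∈ T) ∧ x = ∑ q ∈ S, w q ⊗ₜ e q := by
  let Φ : (T →₀ F) →ₗ[ℝ] V ⊗[ℝ] W :=
    lsum ℝ fun q => (TensorProduct.mk ℝ V W).flip (e q) ∘ₗ F.subtype
  have hΦ : map₂ (TensorProduct.mk ℝ V W) F (span ℝ (e '' T)) ≤
      range Φ := by
    refine Submodule.map₂_le.2 fun m hm y hy => map_mem_of_span _ ?_ hy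
    rintro _ ⟨q, hq, rfl⟩
    exact ⟨single ⟨q, hq⟩ ⟨m, hm⟩, lsum_single _ _ _ _⟩
  obtain ⟨c, rfl⟩ := hΦ hx
  refine ⟨c.support.map (Function.Embedding.subtype _), fun q => if h : q ∈ T then c ⟨q, h⟩ else 0,
    fun q hq => ?_, ?_⟩
  · obtain ⟨j, -, rfl⟩ := Finset.mem_map.1 hq
    refine ⟨?_, j.2⟩
    dsimp only
    rw [dif_pos (show (Function.Embedding.subtype _) j ∈ T from j.2)]
    exact Subtype.mem _
  · rw [sum_map, lsum_apply, Finsupp.sum]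
    refine sum_ext fun j _ => ?_
    dsimp only
    rw [dif_pos (show (Function.Embedding.subtype _) j ∈ T from j.2)]
    rfl

end TensorSums

section TrivialDescent

/-! ## Solutions generating a trivial descent -/

lemma tmul_mem_bideg {g p : ℤ} {w : Form (spacetime n)}
    (hw : w ∈ formDeg (spacetime n) p) (hx : x ∈ ghostDeg n ι β φ g) :
    w ⊗ₜ[ℝ] x ∈ bideg n ι β φ g p := apply_mem_map₂ _ hw hx

lemma sForm_tmul (w : Form (spacetime n)) (x : 𝓐) :
    sForm D L₀ (w ⊗ₜ x) = formSign w ⊗ₜ 𝓢 x := rfl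

lemma dForm_tmul (w : Form (spacetime n)) (x : 𝓐) : dForm (w ⊗ₜ[ℝ] x) =
    extD w ⊗ₜ x + ∑ μ, ((1 : SmoothFun (spacetime n)) ⊗ₜ[ℝ] ggen μ * w) ⊗ₜ totalD μ x := by
  rw [dForm, add_app, sum_app]
  rfl

lemma gen_mul_mem_formDeg (μ : Fin n) {p : ℤ} {w : Form (spacetime n)}
    (hw : w ∈ formDeg (spacetime n) (p - 1)) :
    (1 : SmoothFun (spacetime n)) ⊗ₜ[ℝ] ggen μ * w ∈ formDeg (spacetime n) p := by
  refine map_mem_of_span (mulLeft ℝ _) ?_ hw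
  rintro _ ⟨f, k, hk, v, hv, rfl⟩
  rw [mulLeft_apply, tmul_mul_tmul, one_mul]
  exact subset_span ⟨f, k + 1, by push_cast; omega, _, lin_mul_mem_deg _ hv, rfl⟩

variable [adm : Admissible D L₀]

/-- Total derivatives of cocycles are exact. -/
lemma totalD_eq_brst (hx : 𝓢 x = 0) (μ : Fin n) :
    totalD μ x = 𝓢 (dL (gJet (.inl μ) 0) x) := by
  have h := lie_apply (D := D) (L₀ := L₀) (.inl μ) 0 x
  rwa [hx, map_zero, add_zero, lie_xi_zero] at h

lemma brst_representative {M B : Type*} {α : M → Form (GLp n)}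
    (hα : IsCohomologyBasis (extD (U := GLp n)) ⊤ α) {P : B → 𝓐}
    (hP : IsCohomologyBasis 𝓢 (toSubmodule (tensorAlg D)) P) (q : M × B) :
    𝓢 (substFrame D (α q.1) * P q.2) = 0 := by
  rw [(isSDer_brst adm.even).mul, brst_substFrame, (hα.1 q.1).2, (hP.1 q.2).2, map_zero, zero_mul,
    mul_zero, add_zero]

/-- An exact form times a cocycle is a trivial solution. -/
lemma exact_tmul_trivial {g p : ℤ} {w : Form (spacetime n)} (hw : w ∈ formDeg (spacetime n) p)
    (he : IsExact w) (hg : x ∈ ghostDeg n ι β φ g) (hx : 𝓢 x = 0) :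
    IsTrivialSolution D L₀ g p (w ⊗ₜ[ℝ] x) := by
  obtain ⟨v, hv, rfl⟩ := IsExact.exists_mem hw he
  refine ⟨-∑ μ, formSign ((1 : SmoothFun (spacetime n)) ⊗ₜ[ℝ] ggen μ * v) ⊗ₜ[ℝ]
    dL (gJet (.inl μ) 0) x, neg_mem (sum_mem fun μ _ => tmul_mem_bideg
      (formSign_of_mem (gen_mul_mem_formDeg μ hv)).1 (hasGh_iff.1 ((hasGh_iff.2 hg).dL _))),
    v ⊗ₜ x, tmul_mem_bideg hv hg, ?_⟩
  rw [map_neg, map_sum, dForm_tmul]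
  simp only [sForm_tmul, formSign_formSign, ← totalD_eq_brst hx]
  abel

lemma IsTrivialSolution.add {g p : ℤ} {x y : LocalForm n ι β φ} (hx : IsTrivialSolution D L₀ g p x)
    (hy : IsTrivialSolution D L₀ g p y) : IsTrivialSolution D L₀ g p (x + y) := by
  obtain ⟨b, hb, c, hc, rfl⟩ := hx
  obtain ⟨b', hb', c', hc', rfl⟩ := hy
  exact ⟨_, add_mem hb hb', _, add_mem hc hc', by rw [map_add, map_add]; abel⟩

lemma IsTrivialSolution.sum {g p : ℤ} {I : Type*} {s : Finset I} {x : I → LocalForm n ι β φ}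
    (hx : ∀ i ∈ s, IsTrivialSolution D L₀ g p (x i)) : IsTrivialSolution D L₀ g p (∑ i ∈ s, x i) := by
  induction s using Finset.induction_on with
  | empty => exact ⟨0, zero_mem _, 0, zero_mem _, by
    rw [LinearMap.map_zero, LinearMap.map_zero, sum_empty, add_zero]⟩
  | insert i s hi ih =>
    rw [sum_insert hi]
    exact (hx i (mem_insert_self i s)).add (ih fun j hj => hx j (Finset.mem_insert_of_mem hj))

variable {M B : Type*} {α : M → Form (GLp n)} {k : M → ℕ} {P : B → LocalFun n ι β φ} {gP : B → ℤ}

/-- The Künneth form of the local forms annihilated by `s`. -/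
lemma sForm_cocycle (hk : ∀ m, α m ∈ formDeg (GLp n) (k m))
    (hα : IsCohomologyBasis (extD (U := GLp n)) ⊤ α) (hgP : ∀ A, P A ∈ ghostDeg n ι β φ (gP A))
    (hP : IsCohomologyBasis 𝓢 (toSubmodule (tensorAlg D)) P)
    {g p : ℤ} {a : LocalForm n ι β φ} (ha : a ∈ bideg n ι β φ g p) (hs : sForm D L₀ a = 0) :
    ∃ (S : Finset (M × B)) (w : M × B → Form (spacetime n)),
      (∀ q ∈ S, w q ∈ formDeg (spacetime n) p ∧ (k q.1 : ℤ) + gP q.2 = g) ∧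
      ∃ b ∈ bideg n ι β φ (g - 1) p,
        a = ∑ q ∈ S, w q ⊗ₜ[ℝ] (substFrame D (α q.1) * P q.2) + sForm D L₀ b := by
  obtain ⟨s, c, hc, hli, rfl⟩ := exists_sum_of_mem_map₂ ha
  have h1 : ∀ v ∈ s, 𝓢 (c v) = 0 := fun v hv => by
    refine tmul_coeff_eq_zero (y := fun v => 𝓢 (c v)) hli ?_ hv
    have h2 := congrArg (map formSign LinearMap.id) hs
    rw [LinearMap.map_zero, map_sum, map_sum] at h2
    rw [← h2]
    refine sum_ext fun v _ => ?_
    rw [sForm_tmul, map_tmul, formSign_formSign, id_apply]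
  have h2 : ∑ v ∈ s, v ⊗ₜ c v ∈ map₂ (TensorProduct.mk ℝ _ _) (formDeg (spacetime n) p)
      (span ℝ ((fun q : M × B => substFrame D (α q.1) * P q.2) ''
        {q | (k q.1 : ℤ) + gP q.2 = g})) ⊔ (bideg n ι β φ (g - 1) p).map (sForm D L₀) := by
    refine sum_mem fun v hv => ?_
    obtain ⟨y, hy, _, ⟨b, hb, rfl⟩, hyb⟩ := Submodule.mem_sup.1
      (brst_cocycle_ghostDeg hk hα hgP hP (hc v hv).2 (h1 v hv))
    rw [← hyb, tmul_add]
    refine add_mem (mem_sup_left (apply_mem_map₂ _ (hc v hv).1 hy)) (mem_sup_right ⟨formSign v ⊗ₜ b,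
        tmul_mem_bideg (formSign_of_mem (hc v hv).1).1 hb, ?_⟩)
    rw [sForm_tmul, formSign_formSign]
  obtain ⟨y, hy, _, ⟨b, hb, rfl⟩, hyb⟩ := Submodule.mem_sup.1 h2
  obtain ⟨S, w, hw, rfl⟩ := exists_sum_of_mem_map₂_span hy
  exact ⟨S, w, hw, b, hb, hyb.symm⟩

/-- The Künneth form with non-exact coefficients, up to trivial solutions. -/
lemma exists_nonExact_form (hk : ∀ m, α m ∈ formDeg (GLp n) (k m))
    (hα : IsCohomologyBasis (extD (U := GLp n)) ⊤ α) (hgP : ∀ A, P A ∈ ghostDeg n ι β φ (gP A))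
    (hP : IsCohomologyBasis 𝓢 (toSubmodule (tensorAlg D)) P)
    {g p : ℤ} {a : LocalForm n ι β φ} (hnt : ¬ IsTrivialSolution D L₀ g p a)
    (htd : HasTrivialDescent D L₀ g p a) :
    ∃ (S : Finset (M × B)) (w : M × B → Form (spacetime n)), S.Nonempty ∧
      (∀ q ∈ S, w q ∈ formDeg (spacetime n) p ∧ ¬ IsExact (w q) ∧ (k q.1 : ℤ) + gP q.2 = g) ∧
      ∃ b ∈ bideg n ι β φ (g - 1) p, ∃ c ∈ bideg n ι β φ g (p - 1),
        a = ∑ q ∈ S, w q ⊗ₜ[ℝ] (substFrame D (α q.1) * P q.2) + sForm D L₀ b + dForm c := by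
  obtain ⟨a₀, ha₀, hs, ht⟩ := htd
  obtain ⟨S, w, hw, b, hb, hab⟩ := sForm_cocycle hk hα hgP hP ha₀ hs
  have h1 : IsTrivialSolution D L₀ g p
      (∑ q ∈ S with IsExact (w q), w q ⊗ₜ[ℝ] (substFrame D (α q.1) * P q.2)) := by
    refine IsTrivialSolution.sum fun q hq => ?_
    obtain ⟨hqS, hqe⟩ := Finset.mem_filter.1 hq
    refine exact_tmul_trivial (hw q hqS).1 hqe ?_ (brst_representative hα hP q)
    rw [← (hw q hqS).2]
    exact hasGh_iff.1 ((hasGh_substFrame D (hk q.1)).mul (hasGh_iff.2 (hgP q.2)))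
  have h2 : IsTrivialSolution D L₀ g p (sForm D L₀ b) :=
    ⟨b, hb, 0, zero_mem _, by rw [LinearMap.map_zero, add_zero]⟩
  have h3 : a = ∑ q ∈ S with ¬ IsExact (w q), w q ⊗ₜ[ℝ] (substFrame D (α q.1) * P q.2) +
      ((a - a₀) + ∑ q ∈ S with IsExact (w q), w q ⊗ₜ[ℝ] (substFrame D (α q.1) * P q.2) +
        sForm D L₀ b) := by
    have h4 := Finset.sum_filter_add_sum_filter_not S (fun q => IsExact (w q))
      fun q => w q ⊗ₜ[ℝ] (substFrame D (α q.1) * P q.2)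
    rw [← h4] at hab
    rw [hab]
    abel
  have h5 := (ht.add h1).add h2
  refine ⟨S.filter fun q => ¬ IsExact (w q), w, ?_, fun q hq => ?_, ?_⟩
  · by_contra hne
    rw [Finset.not_nonempty_iff_eq_empty] at hne
    rw [hne, sum_empty, zero_add] at h3
    exact hnt (h3 ▸ h5)
  · obtain ⟨hqS, hqe⟩ := Finset.mem_filter.1 hq
    exact ⟨(hw q hqS).1, hqe, (hw q hqS).2⟩
  · obtain ⟨b', hb', c', hc', h6⟩ := h5
    exact ⟨b', hb', c', hc', by rw [h6] at h3; rw [add_assoc]; exact h3⟩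

end TrivialDescent

end EYM

attribute [-instance] EYM.ringLocalFun EYM.algebraLocalFun EYM.addCommGroupLocalFun EYM.moduleLocalFun
  EYM.semiringLocalFun EYM.addCommMonoidLocalFun EYM.nonAssocRingLocalFun
  EYM.nonAssocSemiringLocalFun

theorem theorem6p2 {n : ℕ} (hn : 2 < n) {ι β φ : Type*} [Fintype ι] [Fintype β] [Fintype φ]
    -- the Yang–Mills algebra and the bosonic and fermionic matter multiplets
    {𝔤 : Type*} [LieRing 𝔤] [LieAlgebra ℝ 𝔤] (X : Module.Basis ι ℝ 𝔤)
    {WB : Type*} [AddCommGroup WB] [Module ℝ WB] [LieRingModule (𝔤 × Lorentz n) WB]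
    [LieModule ℝ (𝔤 × Lorentz n) WB] (yB : Module.Basis β ℝ WB)
    {WF : Type*} [AddCommGroup WF] [Module ℝ WF] [LieRingModule (𝔤 × Lorentz n) WF]
    [LieModule ℝ (𝔤 × Lorentz n) WF] (yF : Module.Basis φ ℝ WF)
    (D : GaugeData n ι β φ) (hD : D = GaugeData.ofLie n X yB yF)
    -- the classical Lagrangian
    (L₀ : LocalFun n ι β φ) (hL : IsInvariantLagrangian D L₀)
    -- closed forms representing a homogeneous basis of the de Rham cohomology of `GL⁺(n)`
    {M : Type*} (α : M → Form (GLp n)) (k : M → ℕ) (hk : ∀ m, α m ∈ formDeg (GLp n) (k m))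
    (hα : IsCohomologyBasis (extD (U := GLp n)) ⊤ α)
    -- local functions representing a homogeneous basis of the BRST cohomology of `𝒜₂`
    {B : Type*} (P : B → LocalFun n ι β φ) (gP : B → ℤ)
    (hgP : ∀ A, P A ∈ ghostDeg n ι β φ (gP A))
    (hP : IsCohomologyBasis (brst D L₀) (Subalgebra.toSubmodule (tensorAlg D)) P) :
    -- non-trivial solutions generating a trivial descent
    (∀ (g p : ℤ) (a : LocalForm n ι β φ), IsWZSolution D L₀ g p a →
      ¬ IsTrivialSolution D L₀ g p a → HasTrivialDescent D L₀ g p a →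
      -- each `s`-closed representative has the Künneth form
      (∀ a₀ ∈ bideg n ι β φ g p, sForm D L₀ a₀ = 0 → IsTrivialSolution D L₀ g p (a - a₀) →
        ∃ (S : Finset (M × B)) (w : M × B → Form (spacetime n)),
          (∀ q ∈ S, w q ∈ formDeg (spacetime n) p ∧ (k q.1 : ℤ) + gP q.2 = g) ∧
          ∃ b ∈ bideg n ι β φ (g - 1) p,
            a₀ = ∑ q ∈ S, w q ⊗ₜ[ℝ] (substFrame D (α q.1) * P q.2) + sForm D L₀ b) ∧
      -- up to trivial solutions, the coefficient forms can all be taken non-exact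
      (∃ (S : Finset (M × B)) (w : M × B → Form (spacetime n)), S.Nonempty ∧
          (∀ q ∈ S, w q ∈ formDeg (spacetime n) p ∧ ¬ IsExact (w q) ∧
            (k q.1 : ℤ) + gP q.2 = g) ∧
          ∃ b ∈ bideg n ι β φ (g - 1) p, ∃ c ∈ bideg n ι β φ g (p - 1),
            a = ∑ q ∈ S, w q ⊗ₜ[ℝ] (substFrame D (α q.1) * P q.2)
              + sForm D L₀ b + dForm c)) ∧
    -- non-trivial volume forms always generate a non-trivial descent
    (∀ (g : ℤ) (a : LocalForm n ι β φ), IsWZSolution D L₀ g n a →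
      ¬ IsTrivialSolution D L₀ g n a → ¬ HasTrivialDescent D L₀ g n a) := by
  have : Admissible D L₀ := ⟨hD ▸ isLie_ofLie X yB yF, hL⟩
  refine ⟨fun g p a _ hnt htd => ⟨fun a₀ ha₀ hs _ => sForm_cocycle hk hα hgP hP ha₀ hs,
    exists_nonExact_form hk hα hgP hP hnt htd⟩, fun g a _ hnt htd => ?_⟩
  obtain ⟨S, w, ⟨q, hq⟩, hw, -⟩ := exists_nonExact_form hk hα hgP hP hnt htd
  exact (hw q hq).2.1 (isExact_of_top ⟨0, by omega⟩ (by rw [Fintype.card_fin]; exact (hw q hq).1))
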